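/- Let $L_1,L_2,T>0$, $D=(0,L_1)\times(0,L_2)$, $H=L^2(D;\mathbb C)$ with norm $\|\cdot\|$, $V=H_0^1(D;\mathbb C)$ with dual $V^*$, and let $\|\cdot\|_p$ be the norm of $L^p(D;\mathbb C)$. Let $\alpha,\beta,\sigma\in\mathbb R$, $\gamma>0$, $\lambda_1,\lambda_2\in\mathbb C^2$, and set $$Au=(1+i\alpha)\Delta u,\qquad Bu=-(1-i\beta)|u|^{2\sigma}u+\gamma u+\lambda_1\cdot\nabla(|u|^2u)+(\lambda_2\cdot\nabla u)|u|^2 .$$ Let $\mathcal Z$ be a locally compact Polish space with its Borel $\sigma$-field, $\nu$ a $\sigma$-finite measure on $\mathcal Z$ that is finite on compact sets, and $g:\mathcal Z\to\mathbb C$ a measurable function with $\int_{\mathcal Z}|g|^2\,d\nu<\infty$ which satisfies the exponential integrability condition: there is $\delta>0$ such that $\int_E e^{\delta|g(z)|^2}\nu(dz)<\infty$ for every Borel set $E\subset\mathcal Z$ with $\nu(E)<\infty$. Let $l(r)=r\log r-r+1$ for $r\ge 0$ (with $l(0)=1$), and for $N\in\mathbb N$ let $S^N$ be the set of measurable $\varphi:[0,T]\times\mathcal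 Z\to[0,\infty)$ with $\int_0^T\int_{\mathcal Z}l(\varphi(s,z))\,\nu(dz)\,ds\le N$; put $\mathbb S=\bigcup_{N\ge1}S^N$. **Proposition 3.1.** Suppose $\sigma>2$ and $0<|\beta|<\sqrt{2\sigma+1}/\sigma$, and let $u(0)\in V$. Then for every $\varphi\in\mathbb S$ the skeleton equation $$u^\varphi(t)=u(0)+\int_0^tAu^\varphi(s)\,ds+\int_0^tBu^\varphi(s)\,ds+\int_0^t\int_{\mathcal Z}u^\varphi(s)\,g(z)\,(\varphi(s,z)-1)\,\nu(dz)\,ds,\qquad t\in[0,T],$$ understood as an identity in $V^*$, has a unique solution $u^\varphi\in C([0,T],H)\cap L^2([0,T],V)\cap L^{2\sigma+2}([0,T],L^{2\sigma+2}(D))$. Moreover, for every $N\in\mathbb N$ there is $C_N>0$ such that $$\sup_{\varphi\in S^N}\Big(\sup_{s\in[0,T]}\|u^\varphi(s)\|^2+\int_0^T\|\nabla u^\varphi(s)\|^2\,ds+\int_0^T\|u^\varphi(s)\|_{2\sigma+2}^{2\sigma+2}\,ds\Big)\le C_N .$$ -/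

import Mathlib

open MeasureTheory Set
open scoped ENNReal NNReal ComplexConjugate

noncomputable section

namespace SGGLE

/-! ### The function spaces on the rectangle -/

/-- The open rectangle `D = (0, L₁) × (0, L₂)`. -/
def rect (L₁ L₂ : ℝ) : Set (ℝ × ℝ) := Ioo 0 L₁ ×ˢ Ioo 0 L₂

/-- Lebesgue measure on the rectangle. -/
abbrev rectMeasure (L₁ L₂ : ℝ) : Measure (ℝ × ℝ) := volume.restrict (rect L₁ L₂)

/-- `H = L²(D)`, complex-valued. -/
abbrev H (L₁ L₂ : ℝ) : Type := Lp ℂ 2 (rectMeasure L₁ L₂)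

/-- Test functions on `D`: smooth, with compact support inside `D`. -/
def IsTestFunction (L₁ L₂ : ℝ) (f : ℝ × ℝ → ℂ) : Prop :=
  ContDiff ℝ ((⊤ : ℕ∞) : WithTop ℕ∞) f ∧ HasCompactSupport f ∧ tsupport f ⊆ rect L₁ L₂

/-- `V = H₀¹(D)`: the closure in the `H¹` norm of the test functions. A member is stored as the
triple `(f, ∂₁ f, ∂₂ f)` of elements of `L²(D)`, so that
`‖w‖² = ‖f‖² + ‖∂₁ f‖² + ‖∂₂ f‖²`. -/
def V (L₁ L₂ : ℝ) : Submodule ℂ (PiLp 2 (fun _ : Fin 3 => H L₁ L₂)) :=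
  (Submodule.span ℂ {w | ∃ f : ℝ × ℝ → ℂ, IsTestFunction L₁ L₂ f ∧
    (w 0 =ᵐ[rectMeasure L₁ L₂] f) ∧
    (w 1 =ᵐ[rectMeasure L₁ L₂] fun x => fderiv ℝ f x (1, 0)) ∧
    (w 2 =ᵐ[rectMeasure L₁ L₂] fun x => fderiv ℝ f x (0, 1))}).topologicalClosure

variable {L₁ L₂ : ℝ}

/-- The inclusion of `V` in `H`. -/
def toH (w : V L₁ L₂) : H L₁ L₂ := w.1 0

/-- The weak derivative in the first variable. -/
def d₁ (w : V L₁ L₂) : H L₁ L₂ := w.1 1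

/-- The weak derivative in the second variable. -/
def d₂ (w : V L₁ L₂) : H L₁ L₂ := w.1 2

/-! ### The operators, as functionals on `V`

All pairings are `(X, v) ↦ ∫_D X(x) conj(v(x)) dx`. Since `D` is a bounded planar domain, members
of `V` lie in every `L^p(D)` with `p < ∞`, so each integrand below is integrable. -/

/-- `⟨A w, v⟩` for `A w = (1 + iα) Δ w`. -/
def pairA (α : ℝ) (w v : V L₁ L₂) : ℂ :=
  -(1 + Complex.I * α) * ∫ x in rect L₁ L₂, (d₁ w x * conj (d₁ v x) + d₂ w x * conj (d₂ v x))

/-- `⟨F(w), v⟩` for `F(w) = λ₁ · ∇(|w|² w) + (λ₂ · ∇w) |w|²`; the derivative in the first term is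
the distributional one. -/
def pairF (lam₁ lam₂ : ℂ × ℂ) (w v : V L₁ L₂) : ℂ :=
  -(∫ x in rect L₁ L₂, ((‖toH w x‖ : ℂ) ^ 2 * toH w x) *
      (lam₁.1 * conj (d₁ v x) + lam₁.2 * conj (d₂ v x)))
  + ∫ x in rect L₁ L₂, (lam₂.1 * d₁ w x + lam₂.2 * d₂ w x) * (‖toH w x‖ : ℂ) ^ 2 *
      conj (toH v x)

/-- `⟨B w, v⟩` for `B w = -(1 - iβ) |w|^{2σ} w + γ w + F(w)`. -/
def pairB (σ β γ : ℝ) (lam₁ lam₂ : ℂ × ℂ) (w v : V L₁ L₂) : ℂ :=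
  -(1 - Complex.I * β) *
      (∫ x in rect L₁ L₂, ((‖toH w x‖ ^ (2 * σ) : ℝ) : ℂ) * toH w x * conj (toH v x))
  + γ * (∫ x in rect L₁ L₂, toH w x * conj (toH v x))
  + pairF lam₁ lam₂ w v

/-! ### Controls -/

/-- `l(r) = r log r - r + 1`, with `l(0) = 1`. -/
def ell (r : ℝ≥0) : ℝ := r * Real.log r - r + 1

/-- The cost `L_T(φ) = ∫_{[0,T] × Z} l(φ) dt ν(dz)`, in `[0, ∞]` (note `l ≥ 0`). -/
def cost {Z : Type*} [MeasurableSpace Z] (ν : Measure Z) (T : ℝ) (φ : ℝ → Z → ℝ≥0) : ℝ≥0∞ :=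
  ∫⁻ p, ENNReal.ofReal (ell (φ p.1 p.2)) ∂((volume.restrict (Icc 0 T)).prod ν)

/-- The sublevel set `S^N` of controls. Only the values of a control on `[0,T] × Z` matter. -/
def S {Z : Type*} [MeasurableSpace Z] (ν : Measure Z) (T : ℝ) (N : ℕ) : Set (ℝ → Z → ℝ≥0) :=
  {φ | Measurable (Function.uncurry φ) ∧ cost ν T φ ≤ N}

/-- The set `𝕊 = ⋃_{N ≥ 1} S^N` of all controls. -/
def Controls {Z : Type*} [MeasurableSpace Z] (ν : Measure Z) (T : ℝ) : Set (ℝ → Z → ℝ≥0) :=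
  ⋃ (N : ℕ) (_ : 1 ≤ N), S ν T N

/-- The exponential integrability condition on the jump coefficient. -/
def ExpIntegrable {Z : Type*} [MeasurableSpace Z] (ν : Measure Z) (g : Z → ℂ) : Prop :=
  ∃ δ : ℝ, 0 < δ ∧ ∀ E : Set Z, MeasurableSet E → ν E < ∞ →
    ∫⁻ z in E, ENNReal.ofReal (Real.exp (δ * ‖g z‖ ^ 2)) ∂ν < ∞

/-! ### The skeleton equation -/

/-- `∫_0^T ‖u(s)‖_{L^p(D)}^p ds` for `p = 2σ + 2`, in `[0, ∞]`. -/
def lpEnergy (σ T : ℝ) (u : ℝ → H L₁ L₂) : ℝ≥0∞ :=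
  ∫⁻ s in Icc 0 T,
    eLpNorm (u s) (ENNReal.ofReal (2 * σ + 2)) (rectMeasure L₁ L₂) ^ (2 * σ + 2)

/-- `u ∈ C([0,T], H) ∩ L²([0,T], V) ∩ L^{2σ+2}([0,T], L^{2σ+2}(D))` solves the skeleton equation
`u(t) = u(0) + ∫_0^t A u ds + ∫_0^t B u ds + ∫_0^t ∫_Z u(s) g(z) (φ(s,z) - 1) ν(dz) ds`
on `[0,T]`, as an identity in the dual of `V`. Here `w` is the `V`-valued version of `u`. The
values of `u` and `w` outside `[0,T]` are irrelevant. -/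
structure IsSolution {Z : Type*} [MeasurableSpace Z] (ν : Measure Z) (g : Z → ℂ)
    (T σ α β γ : ℝ) (lam₁ lam₂ : ℂ × ℂ) (u₀ : V L₁ L₂) (φ : ℝ → Z → ℝ≥0)
    (u : ℝ → H L₁ L₂) (w : ℝ → V L₁ L₂) : Prop where
  continuousOn : ContinuousOn u (Icc 0 T)
  memLp_V : MemLp w 2 (volume.restrict (Icc 0 T))
  version : ∀ᵐ s ∂(volume.restrict (Icc 0 T)), toH (w s) = u s
  lpEnergy_lt_top : lpEnergy σ T u < ∞
  integrable_drift : ∀ v : V L₁ L₂, IntervalIntegrable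
    (fun s => pairA α (w s) v + pairB σ β γ lam₁ lam₂ (w s) v) volume 0 T
  integrable_jump : ∀ v : V L₁ L₂, Integrable
    (fun p : ℝ × Z => (∫ x in rect L₁ L₂, u p.1 x * conj (toH v x)) *
      (g p.2 * (((φ p.1 p.2 : ℝ) - 1 : ℝ) : ℂ)))
    ((volume.restrict (Icc 0 T)).prod ν)
  equation : ∀ t ∈ Icc 0 T, ∀ v : V L₁ L₂,
    ∫ x in rect L₁ L₂, u t x * conj (toH v x) =
      (∫ x in rect L₁ L₂, toH u₀ x * conj (toH v x))
      + (∫ s in (0 : ℝ)..t, (pairA α (w s) v + pairB σ β γ lam₁ lam₂ (w s) v))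
      + ∫ s in (0 : ℝ)..t, ∫ z, (∫ x in rect L₁ L₂, u s x * conj (toH v x)) *
          (g z * (((φ s z : ℝ) - 1 : ℝ) : ℂ)) ∂ν

/-- `sup_{[0,T]} ‖u(s)‖² + ∫_0^T ‖∇u(s)‖² ds + ∫_0^T ‖u(s)‖_{2σ+2}^{2σ+2} ds`, in `[0, ∞]`. -/
def energy (σ T : ℝ) (u : ℝ → H L₁ L₂) (w : ℝ → V L₁ L₂) : ℝ≥0∞ :=
  (⨆ s ∈ Icc 0 T, ‖u s‖ₑ ^ 2)
  + (∫⁻ s in Icc 0 T, (‖d₁ (w s)‖ₑ ^ 2 + ‖d₂ (w s)‖ₑ ^ 2))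
  + lpEnergy σ T u

end SGGLE

end

noncomputable section

namespace SGGLE

open Filter Topology
open scoped InnerProductSpace

/-! ### Absolutely continuous functions and integrating factors -/

/-! The jump term is linear in the unknown: it multiplies `u(s)` by the scalar rate `h(s) = ∫ g
(φ(s,·) - 1) dν`. Young's inequality for the cost together with the exponential integrability of `g`
shows that `h` is integrable on `[0,T]`, with a norm bounded uniformly over `S^N`
(`exists_jumpKernel_bound`). With `Θ` the primitive of `h`, the function `exp(-Θ) u` therefore
solves an equation without jumps. In it the power nonlinearity carries the factor `A₁ = exp(2σ Re
Θ)` and the convective term the factor `A₂ = exp(2 Re Θ)`, both continuous and bounded above and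
away from zero in terms of `N` (`G_exp_smul`, `coeffs_exp`). Everything is proved for this
transformed equation, whose drift is `G`, and transported back.

The condition on `β` says that the real derivative of `(1 - iβ)|z|^{2σ} z` is elliptic, with
constant `ellip σ β > 0` times `|z|^{2σ}` (`le_re_powMulDeriv`). This is used twice. Integrated
along segments, it makes the nonlinearity strongly monotone with weight `|w|^{2σ} + |w'|^{2σ}`.
Since `σ > 2`, this absorbs the weights of order four produced by the cubic convective terms, and
one obtains local monotonicity of `G` in which the only further factor is `1 + ‖∇w'‖⁴`, a quantity
of the second argument alone (`exists_local_monotone`). Tested against the Laplacian, ellipticity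
gives an `H¹` estimate by the same absorption (`exists_re_G_laplace_le`).

Existence uses the Galerkin scheme in the product sine functions. The `H¹` estimate bounds the
approximations in `V` and their Laplacians in `L²(0,T;H)`; the initial value has to lie in `V` for
this. Local monotonicity then compares two approximations directly. The only error is the drift of
the coarser one on the high modes of the finer one, which the Laplacian bound makes small. The
scheme is thus Cauchy in `C(H)` and in `L²(V)`, and its limit is a solution bounded in `V`
(`exists_strongSolution`). No compactness argument is needed.

Uniqueness is of weak-strong type. Any solution in the energy class is compared with the strong one,
placed in the second slot of the local monotonicity inequality, and Grönwall's lemma applies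
(`IsEnergySolution.eq_strong`). This requires the energy identity in `L²(V) ∩ L^p(L^p)`, `p = 2σ +
2`, which is obtained by averaging the weak equation over small time translations
(`Dominated.energy_identity`). The same identity with coercivity, which is local monotonicity
against zero, gives the uniform energy bound (`exists_energy_bound`). -/

lemma absolutelyContinuousOnInterval_of_dist_le {X Y : Type*} [PseudoMetricSpace X]
    [PseudoMetricSpace Y] {F : ℝ → X} {N : ℝ → Y} {a b C : ℝ}
    (hN : AbsolutelyContinuousOnInterval N a b)
    (h : ∀ x ∈ uIcc a b, ∀ y ∈ uIcc a b, dist (F x) (F y) ≤ C * dist (N x) (N y)) :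
    AbsolutelyContinuousOnInterval F a b := by
  unfold AbsolutelyContinuousOnInterval at *
  refine squeeze_zero' (Eventually.of_forall fun t => Finset.sum_nonneg fun i _ => dist_nonneg)
    ?_ (by simpa using hN.const_mul C)
  refine eventually_inf_principal.2 (Eventually.of_forall fun E hE => ?_)
  rw [Finset.mul_sum]
  exact Finset.sum_le_sum fun i hi => h _ (hE.1 i hi).1 _ (hE.1 i hi).2

lemma absolutelyContinuousOnInterval_integral {f : ℝ → ℂ} {a b c : ℝ}
    (hf : IntervalIntegrable f volume a b) (hc : c ∈ uIcc a b) :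
    AbsolutelyContinuousOnInterval (fun x => ∫ v in c..x, f v) a b := by
  refine absolutelyContinuousOnInterval_of_dist_le (C := 1)
    (hf.norm.absolutelyContinuousOnInterval_intervalIntegral hc) fun x hx y hy => ?_
  have hi : ∀ {u v}, u ∈ uIcc a b → v ∈ uIcc a b → IntervalIntegrable f volume u v :=
    fun hu hv => hf.mono_set (uIcc_subset_uIcc hu hv)
  rw [one_mul, dist_eq_norm, Real.dist_eq, intervalIntegral.integral_interval_sub_left
    (hi hc hx) (hi hc hy), intervalIntegral.integral_interval_sub_left
    (hi hc hx).norm (hi hc hy).norm]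
  exact intervalIntegral.norm_integral_le_abs_integral_norm

lemma AbsolutelyContinuousOnInterval.cexp {f : ℝ → ℂ} {a b : ℝ}
    (hf : AbsolutelyContinuousOnInterval f a b) :
    AbsolutelyContinuousOnInterval (fun x => Complex.exp (f x)) a b := by
  obtain ⟨R, hR⟩ := hf.exists_bound
  refine absolutelyContinuousOnInterval_of_dist_le (C := Real.exp R) hf fun x hx y hy => ?_
  rw [dist_eq_norm, dist_eq_norm]
  refine (convex_closedBall (0 : ℂ) R).norm_image_sub_le_of_norm_deriv_le
    (fun z _ => Complex.differentiableAt_exp) (fun z hz => ?_) ?_ ?_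
  · rw [Complex.deriv_exp, Complex.norm_exp]
    exact Real.exp_le_exp.2 ((Complex.re_le_norm z).trans (by simpa using hz))
  · simpa using hR y hy
  · simpa using hR x hx

/-- Variation of constants with an integrable coefficient. -/
lemma exp_integral_mul_eq {T : ℝ} (hT : 0 ≤ T) {h q Y : ℝ → ℂ} {Y₀ : ℂ}
    (hh : IntervalIntegrable h volume 0 T) (hq : IntervalIntegrable q volume 0 T)
    (hY : ∀ t ∈ Icc 0 T, Y t = Y₀ + ∫ s in (0 : ℝ)..t, q s) {t : ℝ} (ht : t ∈ Icc 0 T) :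
    Complex.exp (∫ s in (0 : ℝ)..t, h s) * Y t = Y₀ + ∫ s in (0 : ℝ)..t,
      Complex.exp (∫ r in (0 : ℝ)..s, h r) * (q s + h s * Y s) := by
  have h0 : (0 : ℝ) ∈ uIcc 0 T := left_mem_uIcc
  have hI : uIcc 0 T = Icc 0 T := uIcc_of_le hT
  set E : ℝ → ℂ := fun s => Complex.exp (∫ r in (0 : ℝ)..s, h r) with hE
  set Q : ℝ → ℂ := fun s => Y₀ + ∫ r in (0 : ℝ)..s, q r with hQ
  have acE : AbsolutelyContinuousOnInterval E 0 T :=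
    AbsolutelyContinuousOnInterval.cexp (absolutelyContinuousOnInterval_integral hh h0)
  have acQ : AbsolutelyContinuousOnInterval Q 0 T := by
    refine absolutelyContinuousOnInterval_of_dist_le (C := 1)
      (absolutelyContinuousOnInterval_integral hq h0) fun x _ y _ => ?_
    simp [hQ]
  have hqE : IntervalIntegrable (fun s => E s * (q s + h s * Q s)) volume 0 T :=
    (hq.add (hh.mul_continuousOn acQ.continuousOn)).continuousOn_mul acE.continuousOn
  have acR := absolutelyContinuousOnInterval_integral hqE h0
  -- The coefficients are only integrable, so the product rule holds almost everywhere. Absolute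
  -- continuity of the difference of the two sides is what allows a vanishing derivative almost
  -- everywhere to force it to be constant.
  have acD : AbsolutelyContinuousOnInterval
      (fun s => E s * Q s - ∫ r in (0 : ℝ)..s, E r * (q r + h r * Q r)) 0 T :=
    (acE.smul acQ).sub acR
  obtain ⟨C, hC⟩ := acD.const_of_ae_hasDerivAt_zero <| by
    filter_upwards [hh.ae_hasDerivAt_integral, hq.ae_hasDerivAt_integral,
      hqE.ae_hasDerivAt_integral] with x h1 h2 h3 hx
    have e1 := (h1 hx 0 h0).cexp
    have e2 := (h2 hx 0 h0).const_add Y₀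
    have e3 := (e1.mul e2).sub (h3 hx 0 h0)
    convert! e3 using 1
    simp only [hE, hQ]
    ring
  have c0 : C = Y₀ := by rw [← hC 0 h0]; simp [hE, hQ]
  have ct := hC t (hI ▸ ht)
  rw [c0, sub_eq_iff_eq_add] at ct
  rw [hY t ht]
  change E t * Q t = _
  rw [ct]
  congr 1
  refine intervalIntegral.integral_congr fun s hs => ?_
  have : s ∈ Icc 0 T := by
    rw [uIcc_of_le ht.1] at hs
    exact ⟨hs.1, hs.2.trans ht.2⟩
  simp only [hY s this, hQ, hE]

/-! ### Integral Grönwall inequality -/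

/-- `Y` need not be differentiable, but its majorant `c + K ∫ Y` is, from the right, with derivative
`K Y`, which is at most `K` times the majorant. The differential Grönwall inequality is applied to
the majorant. -/
lemma le_mul_exp_of_le_add_integral {T c K : ℝ} {Y : ℝ → ℝ} (hK : 0 ≤ K)
    (hY : ContinuousOn Y (Icc 0 T))
    (h : ∀ t ∈ Icc 0 T, Y t ≤ c + K * ∫ s in (0 : ℝ)..t, Y s) {t : ℝ} (ht : t ∈ Icc 0 T) :
    Y t ≤ c * Real.exp (K * t) := by
  have hT : 0 ≤ T := ht.1.trans ht.2
  have hint : IntervalIntegrable Y volume 0 T :=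
    (by rwa [uIcc_of_le hT] : ContinuousOn Y (uIcc 0 T)).intervalIntegrable
  have hcont : ContinuousOn (fun s => c + K * ∫ r in (0 : ℝ)..s, Y r) (Icc 0 T) := by
    have := intervalIntegral.continuousOn_primitive_interval' hint left_mem_uIcc
    rw [uIcc_of_le hT] at this
    exact (this.const_mul K).const_add c
  have key := le_gronwallBound_of_liminf_deriv_right_le (f' := fun s => K * Y s) (δ := c) (K := K)
    (ε := 0) hcont (fun x hx r hr => ?_) (by simp)
    (fun x hx => by simpa using mul_le_mul_of_nonneg_left (h x ⟨hx.1, hx.2.le⟩) hK) t ht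
  · rw [gronwallBound_ε0, sub_zero] at key
    exact (h t ht).trans key
  · have hd : HasDerivWithinAt (fun s => ∫ r in (0 : ℝ)..s, Y r) (Y x) (Ici x) x := by
      refine intervalIntegral.integral_hasDerivWithinAt_right (t := Ioi x)
        (hint.mono_set (by
          rw [uIcc_of_le hT, uIcc_of_le hx.1]; exact Icc_subset_Icc_right hx.2.le)) ?_ ?_
      · refine ⟨Ioc x T, ?_, ?_⟩
        · exact Ioc_mem_nhdsGT hx.2
        · exact (hY.mono fun s hs => ⟨hx.1.trans hs.1.le, hs.2⟩).aestronglyMeasurable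
            measurableSet_Ioc
      · exact (hY x ⟨hx.1, hx.2.le⟩).mono_of_mem_nhdsWithin
          (mem_of_superset (Ioc_mem_nhdsGT hx.2) fun s hs => ⟨hx.1.trans hs.1.le, hs.2⟩)
    have := ((hd.const_mul K).const_add c).liminf_right_slope_le hr
    simpa [slope, smul_eq_mul] using this

/-! ### Global solutions of dissipative ordinary differential equations -/

/-- A vector field on a Hilbert space which is continuous in time, Lipschitz on balls and satisfies
a one-sided linear growth bound has global solutions. -/
theorem exists_global_solution {E : Type*} [NormedAddCommGroup E] [InnerProductSpace ℂ E]
    [NormedSpace ℝ E] [IsScalarTower ℝ ℂ E]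
    [CompleteSpace E] {T K : ℝ} (hT : 0 ≤ T) (hK : 0 ≤ K) (X : ℝ → E → E)
    (hc : ∀ x, ContinuousOn (fun t => X t x) (Icc 0 T))
    (hL : ∀ R : ℝ, ∃ L : ℝ, 0 ≤ L ∧ ∀ t ∈ Icc 0 T, ∀ x y : E, ‖x‖ ≤ R → ‖y‖ ≤ R →
      ‖X t x - X t y‖ ≤ L * ‖x - y‖)
    (hX : ∀ t ∈ Icc 0 T, ∀ x, (⟪x, X t x⟫_ℂ).re ≤ K * ‖x‖ ^ 2) (x₀ : E) :
    ∃ y : ℝ → E, y 0 = x₀ ∧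
      ∀ t ∈ Icc 0 T, HasDerivWithinAt y (X t (y t)) (Icc 0 T) t := by
  -- A radius above the a priori bound for the solution; the `1` only makes it positive. The field
  -- is multiplied by a cut-off `χ` that is one on the ball of radius `R` and zero off the ball of
  -- radius `2R`. As `0 ≤ χ ≤ 1` and `0 ≤ K`, the one-sided growth bound survives, so the truncated
  -- solution stays where `χ = 1` and solves the original equation.
  set R : ℝ := ‖x₀‖ * Real.exp (K * T) + 1 with hR
  have hR0 : 0 < R := by positivity
  obtain ⟨L, hL0, hL⟩ := hL (2 * R)
  obtain ⟨B₀, hB₀⟩ := isCompact_Icc.exists_bound_of_continuousOn (hc 0)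
  set B : ℝ := |B₀| + L * (2 * R) with hB
  have hBnn : 0 ≤ B := by positivity
  have hbd : ∀ t ∈ Icc 0 T, ∀ x : E, ‖x‖ ≤ 2 * R → ‖X t x‖ ≤ B := fun t ht x hx => by
    have h1 := hL t ht x 0 hx (by simpa using hR0.le)
    have h2 := hB₀ t ht
    calc ‖X t x‖ ≤ ‖X t 0‖ + ‖X t x - X t 0‖ := by
          simpa using norm_add_le (X t 0) (X t x - X t 0)
      _ ≤ |B₀| + L * (2 * R) := by
        rw [sub_zero] at h1
        exact add_le_add (h2.trans (le_abs_self _)) (h1.trans (by gcongr))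
  let χ : E → ℝ := fun x => max 0 (min 1 (2 - ‖x‖ / R))
  have χ0 : ∀ x, 0 ≤ χ x := fun x => le_max_left _ _
  have χ1 : ∀ x, χ x ≤ 1 := fun x => max_le zero_le_one (min_le_left _ _)
  have χout : ∀ x, 2 * R ≤ ‖x‖ → χ x = 0 := fun x hx => by
    refine max_eq_left ((min_le_right _ _).trans ?_)
    rw [sub_nonpos, le_div_iff₀ hR0]; exact hx
  have χin : ∀ x, ‖x‖ ≤ R → χ x = 1 := fun x hx => by
    have : ‖x‖ / R ≤ 1 := (div_le_one hR0).2 hx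
    simp only [χ]
    rw [min_eq_left (by linarith), max_eq_right zero_le_one]
  have χlip : ∀ x y, |χ x - χ y| ≤ R⁻¹ * ‖x - y‖ := fun x y => by
    have h1 : |χ x - χ y| ≤ |(2 - ‖x‖ / R) - (2 - ‖y‖ / R)| :=
      (abs_max_sub_max_le_max _ _ _ _).trans (by
        rw [sub_self, abs_zero]
        refine max_le (abs_nonneg _) ((abs_min_sub_min_le_max _ _ _ _).trans ?_)
        simp)
    refine h1.trans ?_
    rw [show (2 - ‖x‖ / R) - (2 - ‖y‖ / R) = R⁻¹ * (‖y‖ - ‖x‖) by field_simp; ring, abs_mul,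
      abs_of_pos (inv_pos.2 hR0), abs_sub_comm]
    gcongr
    exact abs_norm_sub_norm_le x y
  let F : ℝ → E → E := fun t x => ((χ x : ℝ) : ℂ) • X t x
  have Flip : ∀ t ∈ Icc 0 T, ∀ x y, ‖F t x - F t y‖ ≤ (L + R⁻¹ * B) * ‖x - y‖ := by
    intro t ht
    have main : ∀ x y : E, ‖x‖ ≤ 2 * R → ‖F t x - F t y‖ ≤ (L + R⁻¹ * B) * ‖x - y‖ := by
      intro x y hx
      rcases le_total ‖y‖ (2 * R) with hy | hy
      · have : F t x - F t y = ((χ y : ℝ) : ℂ) • (X t x - X t y)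
            + ((χ x - χ y : ℝ) : ℂ) • X t x := by
          simp only [F]; push_cast; module
        rw [this]
        refine (norm_add_le _ _).trans ?_
        rw [norm_smul, norm_smul, Complex.norm_real, Complex.norm_real, Real.norm_eq_abs,
          Real.norm_eq_abs, abs_of_nonneg (χ0 y), add_mul]
        refine add_le_add ?_ ?_
        · calc χ y * ‖X t x - X t y‖ ≤ 1 * (L * ‖x - y‖) := by
                gcongr
                · exact χ1 y
                · exact hL t ht x y hx hy
            _ = _ := one_mul _
        · calc |χ x - χ y| * ‖X t x‖ ≤ (R⁻¹ * ‖x - y‖) * B := by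
                gcongr
                · exact χlip x y
                · exact hbd t ht x hx
            _ = _ := by ring
      · have hz : F t y = 0 := by
          simp only [F, χout y hy, Complex.ofReal_zero, zero_smul]
        have hx' : F t x = ((χ x - χ y : ℝ) : ℂ) • X t x := by
          simp only [F, χout y hy, sub_zero]
        rw [hz, sub_zero, hx', norm_smul, Complex.norm_real, Real.norm_eq_abs]
        calc |χ x - χ y| * ‖X t x‖ ≤ (R⁻¹ * ‖x - y‖) * B := by
              gcongr
              · exact χlip x y
              · exact hbd t ht x hx
          _ ≤ _ := by rw [add_mul]; nlinarith [mul_nonneg hL0 (norm_nonneg (x - y))]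
    intro x y
    rcases le_total ‖x‖ (2 * R) with hx | hx
    · exact main x y hx
    · rcases le_total ‖y‖ (2 * R) with hy | hy
      · rw [norm_sub_rev, norm_sub_rev x y]; exact main y x hy
      · simp only [F, χout x hx, χout y hy, Complex.ofReal_zero, zero_smul, sub_self, norm_zero]
        positivity
  have Fbd : ∀ t ∈ Icc 0 T, ∀ x, ‖F t x‖ ≤ B := by
    intro t ht x
    rcases le_total ‖x‖ (2 * R) with hx | hx
    · simp only [F, norm_smul, Complex.norm_real, Real.norm_eq_abs, abs_of_nonneg (χ0 x)]
      calc χ x * ‖X t x‖ ≤ 1 * B := by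
            gcongr
            · exact χ1 x
            · exact hbd t ht x hx
        _ = B := one_mul B
    · simpa only [F, χout x hx, Complex.ofReal_zero, zero_smul, norm_zero] using hBnn
  have hLnn : 0 ≤ L + R⁻¹ * B := by positivity
  -- The truncated field is globally Lipschitz and bounded by `B`, so a trajectory moves by at most
  -- `B * T` and the whole interval is covered in one application.
  have hPL : IsPicardLindelof F (tmin := 0) (tmax := T) ⟨0, left_mem_Icc.2 hT⟩ x₀
      (B * T).toNNReal 0 B.toNNReal (L + R⁻¹ * B).toNNReal := by
    refine ⟨fun t ht => ?_, fun x _ => ?_, fun t ht x _ => ?_, ?_⟩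
    · refine LipschitzOnWith.of_dist_le_mul fun x _ y _ => ?_
      rw [dist_eq_norm, dist_eq_norm, Real.coe_toNNReal _ hLnn]
      exact Flip t ht x y
    · exact (hc x).const_smul _
    · rw [Real.coe_toNNReal _ hBnn]; exact Fbd t ht x
    · rw [Real.coe_toNNReal _ hBnn, Real.coe_toNNReal _ (by positivity)]
      simp [hT]
  obtain ⟨y, hy0, hy⟩ := hPL.exists_eq_forall_mem_Icc_hasDerivWithinAt₀
  refine ⟨y, hy0, fun t ht => ?_⟩
  have hyc : ContinuousOn y (Icc 0 T) := fun s hs => (hy s hs).continuousWithinAt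
  have hbound : ∀ s ∈ Icc 0 T, ‖y s‖ ^ 2 ≤ ‖x₀‖ ^ 2 * Real.exp (2 * K * s) := by
    have key := le_gronwallBound_of_liminf_deriv_right_le
      (f := fun s => ‖y s‖ ^ 2) (f' := fun s => 2 * (⟪y s, F s (y s)⟫_ℂ).re)
      (δ := ‖x₀‖ ^ 2) (K := 2 * K) (ε := 0) (hyc.norm.pow 2) (fun x hx r hr => ?_)
      (by simp only [← hy0]; exact le_rfl) (fun x hx => ?_)
    · intro s hs
      simpa [gronwallBound_ε0] using key s hs
    · have hd : HasDerivWithinAt y (F x (y x)) (Ici x) x :=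
        (hy x ⟨hx.1, hx.2.le⟩).mono_of_mem_nhdsWithin
          (mem_of_superset (Icc_mem_nhdsGE hx.2) (Icc_subset_Icc_left hx.1))
      have hd2 : HasDerivWithinAt (fun s => ‖y s‖ ^ 2) (2 * (⟪y x, F x (y x)⟫_ℂ).re) (Ici x) x := by
        have h1 := (hd.inner ℂ hd)
        have h2 := (Complex.reCLM.hasFDerivAt (x := ⟪y x, y x⟫_ℂ)).comp_hasDerivWithinAt x h1
        have e : (fun s => ‖y s‖ ^ 2) = ⇑Complex.reCLM ∘ fun t => ⟪y t, y t⟫_ℂ := by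
          funext s
          simp only [Function.comp, Complex.reCLM_apply]
          exact norm_sq_eq_re_inner (𝕜 := ℂ) (y s)
        rw [e]
        convert! h2 using 1
        simp only [Complex.reCLM_apply, Complex.add_re]
        rw [← inner_conj_symm (F x (y x)) (y x), Complex.conj_re]
        ring
      have := hd2.liminf_right_slope_le hr
      simpa [slope, smul_eq_mul] using this
    · have h1 : (⟪y x, F x (y x)⟫_ℂ).re = χ (y x) * (⟪y x, X x (y x)⟫_ℂ).re := by
        simp only [F, inner_smul_right, Complex.re_ofReal_mul]
      have h2 := hX x ⟨hx.1, hx.2.le⟩ (y x)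
      rw [h1, add_zero]
      have h3 : χ (y x) * (⟪y x, X x (y x)⟫_ℂ).re ≤ χ (y x) * (K * ‖y x‖ ^ 2) :=
        mul_le_mul_of_nonneg_left h2 (χ0 _)
      have h4 : χ (y x) * (K * ‖y x‖ ^ 2) ≤ 1 * (K * ‖y x‖ ^ 2) :=
        mul_le_mul_of_nonneg_right (χ1 _) (by positivity)
      linarith
  have hyR : ‖y t‖ ≤ R := by
    have h1 := hbound t ht
    have h2 : ‖x₀‖ ^ 2 * Real.exp (2 * K * t) ≤ (‖x₀‖ * Real.exp (K * T)) ^ 2 := by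
      rw [mul_pow, ← Real.exp_nat_mul]
      refine mul_le_mul_of_nonneg_left (Real.exp_le_exp.2 ?_) (by positivity)
      push_cast
      nlinarith [mul_le_mul_of_nonneg_left ht.2 hK]
    have h3 := abs_le_of_sq_le_sq' (h1.trans h2) (by positivity)
    linarith [h3.2]
  have := hy t ht
  simpa only [F, χin _ hyR, Complex.ofReal_one, one_smul] using this

end SGGLE

namespace SGGLE

open Filter Topology
open scoped InnerProductSpace

/-! ### Pointwise inequalities for the power nonlinearity -/

/-- The map `z ↦ |z|^{2σ} z`. -/
def powMul (σ : ℝ) (z : ℂ) : ℂ := ((‖z‖ ^ (2 * σ) : ℝ) : ℂ) * z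

/-- The real derivative of `powMul σ`. -/
def powMulDeriv (σ : ℝ) (z : ℂ) : ℂ →L[ℝ] ℂ :=
  (‖z‖ ^ (2 * σ)) • ContinuousLinearMap.id ℝ ℂ +
    (2 * σ * ‖z‖ ^ (2 * σ - 2)) •
      (Complex.reCLM.comp (ContinuousLinearMap.mul ℝ ℂ (conj z))).smulRight z

lemma powMulDeriv_apply (σ : ℝ) (z h : ℂ) :
    powMulDeriv σ z h = ((‖z‖ ^ (2 * σ) : ℝ) : ℂ) * h +
      ((2 * σ * ‖z‖ ^ (2 * σ - 2) * (conj z * h).re : ℝ) : ℂ) * z := by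
  simp only [powMulDeriv, add_apply, smul_apply,
    ContinuousLinearMap.id_apply, ContinuousLinearMap.smulRight_apply,
    ContinuousLinearMap.comp_apply, ContinuousLinearMap.mul_apply', Complex.reCLM_apply,
    Complex.real_smul]
  push_cast
  ring

lemma norm_rpow_two_mul (σ : ℝ) (z : ℂ) : ‖z‖ ^ (2 * σ) = (‖z‖ ^ 2) ^ σ := by
  rw [Real.rpow_mul (norm_nonneg z), Real.rpow_two]

lemma norm_powMul {σ : ℝ} (hσ : 0 ≤ σ) (z : ℂ) : ‖powMul σ z‖ = ‖z‖ ^ (2 * σ + 1) := by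
  rw [powMul, norm_mul, Complex.norm_real, Real.norm_of_nonneg (by positivity),
    Real.rpow_add_one' (norm_nonneg z) (by linarith)]

lemma powMul_zero (σ : ℝ) : powMul σ 0 = 0 := by simp [powMul]

lemma contDiff_powMul {σ : ℝ} (hσ : 1 ≤ σ) : ContDiff ℝ 1 (powMul σ) := by
  have h1 : ContDiff ℝ 1 fun z : ℂ => (‖z‖ ^ 2) ^ σ :=
    (contDiff_norm_sq ℝ).rpow_const_of_le (by simpa using hσ)
  have : powMul σ = fun z => (((‖z‖ ^ 2) ^ σ : ℝ) : ℂ) * z := by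
    funext z; rw [powMul, norm_rpow_two_mul]
  rw [this]
  exact (Complex.ofRealCLM.contDiff.comp h1).mul contDiff_id

lemma hasFDerivAt_powMul {σ : ℝ} (hσ : 1 ≤ σ) (z : ℂ) :
    HasFDerivAt (powMul σ) (powMulDeriv σ z) z := by
  have h0 : HasFDerivAt (fun z : ℂ => ‖z‖ ^ 2) (2 • innerSL ℝ z) z :=
    (hasStrictFDerivAt_norm_sq z).hasFDerivAt
  have h1 := h0.rpow_const (p := σ) (Or.inr hσ)
  have h2 := (Complex.ofRealCLM.hasFDerivAt.comp z h1).mul (hasFDerivAt_id (𝕜 := ℝ) z)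
  have e : powMul σ = (⇑Complex.ofRealCLM ∘ fun z : ℂ => (‖z‖ ^ 2) ^ σ) * id := by
    funext z; simp [powMul, norm_rpow_two_mul]
  rw [e]
  convert! h2 using 1
  ext h
  have h3 : ‖z‖ ^ (2 * σ - 2) = (‖z‖ ^ 2) ^ (σ - 1) := by
    rw [← norm_rpow_two_mul]; congr 1; ring
  simp only [powMulDeriv_apply]
  simp [h3, norm_rpow_two_mul, Complex.inner]
  ring

lemma norm_rpow_two_mul_eq {σ : ℝ} (hσ : 1 < σ) (z : ℂ) :
    ‖z‖ ^ (2 * σ) = ‖z‖ ^ (2 * σ - 2) * ‖z‖ ^ 2 := by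
  rw [← Real.rpow_two, ← Real.rpow_add' (norm_nonneg z) (by linarith)]
  congr 1; ring

lemma norm_powMulDeriv_apply_le {σ : ℝ} (hσ : 1 < σ) (z h : ℂ) :
    ‖powMulDeriv σ z h‖ ≤ (2 * σ + 1) * ‖z‖ ^ (2 * σ) * ‖h‖ := by
  rw [powMulDeriv_apply]
  refine (norm_add_le _ _).trans ?_
  rw [norm_mul, norm_mul, Complex.norm_real, Complex.norm_real, Real.norm_of_nonneg (by positivity),
    Real.norm_eq_abs, abs_mul, abs_of_nonneg (by positivity)]
  have h1 : |(conj z * h).re| ≤ ‖z‖ * ‖h‖ := by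
    refine (Complex.abs_re_le_norm _).trans ?_
    rw [norm_mul, RCLike.norm_conj]
  have h2 : 2 * σ * ‖z‖ ^ (2 * σ - 2) * |(conj z * h).re| * ‖z‖
      ≤ 2 * σ * ‖z‖ ^ (2 * σ - 2) * (‖z‖ * ‖h‖) * ‖z‖ := by gcongr
  rw [norm_rpow_two_mul_eq hσ]
  nlinarith

/-- After multiplication by `conj z`, everything depends on the two real numbers `re` and `im` of
`conj z * h`, and the pairing is a quadratic form in them. -/
lemma re_powMulDeriv_mul_conj {σ : ℝ} (hσ : 1 < σ) (β : ℝ) (z h : ℂ) :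
    ((1 - Complex.I * β) * powMulDeriv σ z h * conj h).re =
      ‖z‖ ^ (2 * σ - 2) * ((conj z * h).re ^ 2 + (conj z * h).im ^ 2
        + 2 * σ * (conj z * h).re * ((conj z * h).re - β * (conj z * h).im)) := by
  rw [powMulDeriv_apply, norm_rpow_two_mul_eq hσ, ← Complex.normSq_eq_norm_sq]
  simp [Complex.normSq_apply]
  ring

lemma normSq_conj_mul (z h : ℂ) :
    (conj z * h).re ^ 2 + (conj z * h).im ^ 2 = ‖z‖ ^ 2 * ‖h‖ ^ 2 := by
  rw [← Complex.normSq_eq_norm_sq, ← Complex.normSq_eq_norm_sq]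
  simp [Complex.normSq_apply]
  ring

/-- The ellipticity constant of the power nonlinearity. -/
def ellip (σ β : ℝ) : ℝ := 1 + σ - σ * Real.sqrt (1 + β ^ 2)

/-- Positivity means `σ √(1 + β²) < 1 + σ`; squared, this is `σ² β² < 2σ + 1`, which is the
assumption on `β`. -/
lemma ellip_pos {σ β : ℝ} (hσ : 0 < σ) (hβ : |β| < Real.sqrt (2 * σ + 1) / σ) :
    0 < ellip σ β := by
  rw [lt_div_iff₀ hσ] at hβ
  have h1 : β ^ 2 * σ ^ 2 < 2 * σ + 1 := by
    have := (Real.lt_sqrt (by positivity)).1 hβ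
    rwa [mul_pow, sq_abs] at this
  have h2 : Real.sqrt (1 + β ^ 2) < (1 + σ) / σ := by
    rw [Real.sqrt_lt' (by positivity), div_pow, lt_div_iff₀ (by positivity)]
    nlinarith
  rw [lt_div_iff₀ hσ] at h2
  rw [ellip]; linarith

/-- `ellip σ β` is the smaller eigenvalue of the quadratic form of `re_powMulDeriv_mul_conj`. What
is left after subtracting it is `σ` times a degenerate form, which becomes a perfect square when
multiplied by `√(1 + β²) + 1`. -/
lemma le_re_powMulDeriv {σ : ℝ} (hσ : 1 < σ) (β : ℝ) (z h : ℂ) :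
    ellip σ β * (‖z‖ ^ (2 * σ) * ‖h‖ ^ 2) ≤
      ((1 - Complex.I * β) * powMulDeriv σ z h * conj h).re := by
  rw [re_powMulDeriv_mul_conj hσ, norm_rpow_two_mul_eq hσ, mul_assoc _ (‖z‖ ^ 2),
    ← normSq_conj_mul]
  set p := (conj z * h).re
  set q := (conj z * h).im
  set s := Real.sqrt (1 + β ^ 2) with hs
  have hs2 : s ^ 2 = 1 + β ^ 2 := Real.sq_sqrt (by positivity)
  have hs0 : 0 ≤ s := Real.sqrt_nonneg _
  have key : 0 ≤ (s + 1) * p ^ 2 + (s - 1) * q ^ 2 - 2 * β * p * q := by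
    have : 0 ≤ (s + 1) * ((s + 1) * p ^ 2 + (s - 1) * q ^ 2 - 2 * β * p * q) := by
      have e : (s + 1) * ((s + 1) * p ^ 2 + (s - 1) * q ^ 2 - 2 * β * p * q)
        = ((s + 1) * p - β * q) ^ 2 := by linear_combination q ^ 2 * hs2
      rw [e]; positivity
    exact nonneg_of_mul_nonneg_right this (by positivity)
  have h2 : ellip σ β * (p ^ 2 + q ^ 2) ≤ p ^ 2 + q ^ 2 + 2 * σ * p * (p - β * q) := by
    rw [ellip, ← hs]
    nlinarith [mul_nonneg (by linarith : (0 : ℝ) ≤ σ) key]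
  calc _ = ‖z‖ ^ (2 * σ - 2) * (ellip σ β * (p ^ 2 + q ^ 2)) := by ring
    _ ≤ _ := mul_le_mul_of_nonneg_left h2 (by positivity)

lemma re_powMulDeriv_le {σ : ℝ} (hσ : 1 < σ) (z h : ℂ) :
    (powMulDeriv σ z h * conj h).re ≤ (2 * σ + 1) * (‖z‖ ^ (2 * σ) * ‖h‖ ^ 2) := by
  refine (Complex.re_le_norm _).trans ?_
  rw [norm_mul, RCLike.norm_conj]
  have := mul_le_mul_of_nonneg_right (norm_powMulDeriv_apply_le hσ z h) (norm_nonneg h)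
  linarith

lemma norm_powMul_sub_le {σ : ℝ} (hσ : 1 < σ) (a b : ℂ) :
    ‖powMul σ a - powMul σ b‖ ≤
      (2 * σ + 1) * (‖a‖ ^ (2 * σ) + ‖b‖ ^ (2 * σ)) * ‖a - b‖ := by
  set R := max ‖a‖ ‖b‖
  have hR : 0 ≤ R := (norm_nonneg a).trans (le_max_left _ _)
  have h1 : ‖powMul σ a - powMul σ b‖ ≤ (2 * σ + 1) * R ^ (2 * σ) * ‖a - b‖ := by
    refine (convex_closedBall (0 : ℂ) R).norm_image_sub_le_of_norm_hasFDerivWithin_le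
      (f' := powMulDeriv σ)
      (fun z _ => (hasFDerivAt_powMul hσ.le z).hasFDerivWithinAt) (fun z hz => ?_) ?_ ?_
    · refine ContinuousLinearMap.opNorm_le_bound _ (by positivity) fun h =>
        (norm_powMulDeriv_apply_le hσ z h).trans ?_
      gcongr
      simpa using hz
    · simp [R]
    · simp [R]
  refine h1.trans ?_
  gcongr
  rcases max_choice ‖a‖ ‖b‖ with h | h <;> simp only [R, h]
  · exact le_add_of_nonneg_right (by positivity)
  · exact le_add_of_nonneg_left (by positivity)

/-- An exact identity: twice the pairing is the weighted square plus the product of the differences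
of `‖·‖^{2σ}` and `‖·‖²`. Both are increasing in the modulus, so the product is nonnegative. -/
lemma re_powMul_sub_ge {σ : ℝ} (hσ : 1 < σ) (a b : ℂ) :
    (‖a‖ ^ (2 * σ) + ‖b‖ ^ (2 * σ)) * ‖a - b‖ ^ 2 ≤
      2 * ((powMul σ a - powMul σ b) * conj (a - b)).re := by
  have h1 : 2 * ((powMul σ a - powMul σ b) * conj (a - b)).re =
      (‖a‖ ^ (2 * σ) + ‖b‖ ^ (2 * σ)) * ‖a - b‖ ^ 2
        + (‖a‖ ^ (2 * σ) - ‖b‖ ^ (2 * σ)) * (‖a‖ ^ 2 - ‖b‖ ^ 2) := by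
    simp only [powMul]
    rw [← Complex.normSq_eq_norm_sq, ← Complex.normSq_eq_norm_sq, ← Complex.normSq_eq_norm_sq]
    simp [Complex.normSq_apply]
    ring
  have h2 : 0 ≤ (‖a‖ ^ (2 * σ) - ‖b‖ ^ (2 * σ)) * (‖a‖ ^ 2 - ‖b‖ ^ 2) := by
    rcases le_total ‖a‖ ‖b‖ with h | h
    · refine mul_nonneg_of_nonpos_of_nonpos (sub_nonpos.2 ?_) (sub_nonpos.2 ?_) <;> gcongr
    · refine mul_nonneg (sub_nonneg.2 ?_) (sub_nonneg.2 ?_) <;> gcongr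
  linarith

/-- Strong monotonicity of `(1 - iβ) |z|^{2σ} z`. -/
lemma re_mul_powMul_sub_ge {σ : ℝ} (hσ : 1 < σ) {β : ℝ} (hc : 0 ≤ ellip σ β) (a b : ℂ) :
    ellip σ β / (2 * (2 * σ + 1)) * ((‖a‖ ^ (2 * σ) + ‖b‖ ^ (2 * σ)) * ‖a - b‖ ^ 2) ≤
      ((1 - Complex.I * β) * (powMul σ a - powMul σ b) * conj (a - b)).re := by
  set c' := ellip σ β / (2 * σ + 1) with hc'
  set h := a - b with hh
  let m : ℂ →L[ℝ] ℝ := Complex.reCLM.comp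
    ((ContinuousLinearMap.mul ℝ ℂ).flip ((1 - Complex.I * β) * conj h))
  let n : ℂ →L[ℝ] ℝ := Complex.reCLM.comp ((ContinuousLinearMap.mul ℝ ℂ).flip (conj h))
  -- Ellipticity along the segment from `b` to `a` produces weights at intermediate points, while
  -- weights at the end points are wanted. Subtracting `c'` times the pairing without the factor `1
  -- - iβ` keeps `F` monotone, because that pairing is bounded above by `2σ + 1` times the same
  -- intermediate weight. For the subtracted pairing `re_powMul_sub_ge` supplies the weights at the
  -- end points.
  let F : ℝ → ℝ := fun t => m (powMul σ (b + t * h)) - c' * n (powMul σ (b + t * h))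
  have hd : ∀ t : ℝ, HasDerivAt F (m (powMulDeriv σ (b + t * h) h)
      - c' * n (powMulDeriv σ (b + t * h) h)) t := fun t => by
    have h1 : HasDerivAt (fun t : ℝ => b + t * h) h t := by
      simpa using ((Complex.ofRealCLM.hasDerivAt (x := t)).mul_const h).const_add b
    have h2 := (hasFDerivAt_powMul hσ.le (b + t * h)).comp_hasDerivAt t h1
    exact (m.hasFDerivAt.comp_hasDerivAt t h2).sub
      ((n.hasFDerivAt.comp_hasDerivAt t h2).const_mul c')
  have hmono : Monotone F := by
    refine monotone_of_deriv_nonneg (fun t => (hd t).differentiableAt) fun t => ?_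
    rw [(hd t).deriv]
    have e1 : m (powMulDeriv σ (b + t * h) h) =
        ((1 - Complex.I * β) * powMulDeriv σ (b + t * h) h * conj h).re := by
      simp only [m, ContinuousLinearMap.comp_apply, ContinuousLinearMap.flip_apply,
        ContinuousLinearMap.mul_apply', Complex.reCLM_apply]
      congr 1; ring
    have e2 : n (powMulDeriv σ (b + t * h) h) =
        (powMulDeriv σ (b + t * h) h * conj h).re := by
      simp [n]; ring
    rw [e1, e2, sub_nonneg]
    refine le_trans ?_ (le_re_powMulDeriv hσ β _ h)
    calc c' * (powMulDeriv σ (b + t * h) h * conj h).re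
        ≤ c' * ((2 * σ + 1) * (‖b + t * h‖ ^ (2 * σ) * ‖h‖ ^ 2)) :=
          mul_le_mul_of_nonneg_left (re_powMulDeriv_le hσ _ h) (by positivity)
      _ = _ := by rw [hc']; field_simp
  have key := hmono (zero_le_one (α := ℝ))
  have e0 : b + ((0 : ℝ) : ℂ) * h = b := by simp
  have e1 : b + ((1 : ℝ) : ℂ) * h = a := by simp [hh]
  simp only [F, e0, e1] at key
  have k1 : m (powMul σ a) - m (powMul σ b) =
      ((1 - Complex.I * β) * (powMul σ a - powMul σ b) * conj h).re := by
    rw [← map_sub]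
    simp only [m, ContinuousLinearMap.comp_apply, ContinuousLinearMap.flip_apply,
      ContinuousLinearMap.mul_apply', Complex.reCLM_apply]
    congr 1; ring
  have k2 : n (powMul σ a) - n (powMul σ b) = ((powMul σ a - powMul σ b) * conj h).re := by
    rw [← map_sub]; simp [n]; ring
  rw [← k1]
  have k3 := re_powMul_sub_ge hσ a b
  rw [← hh, ← k2] at k3
  have k4 := mul_le_mul_of_nonneg_left k3 (by positivity : 0 ≤ c' / 2)
  have k5 : ellip σ β / (2 * (2 * σ + 1)) = c' / 2 := by rw [hc']; field_simp
  rw [k5]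
  linarith

lemma norm_cubic_sub_le (a b : ℂ) :
    ‖(‖a‖ : ℂ) ^ 2 * a - (‖b‖ : ℂ) ^ 2 * b‖ ≤ 2 * (‖a‖ ^ 2 + ‖b‖ ^ 2) * ‖a - b‖ := by
  have e : (‖a‖ : ℂ) ^ 2 * a - (‖b‖ : ℂ) ^ 2 * b =
      (‖a‖ : ℂ) ^ 2 * (a - b) + (((‖a‖ - ‖b‖) * (‖a‖ + ‖b‖) : ℝ) : ℂ) * b := by
    push_cast; ring
  rw [e]
  refine (norm_add_le _ _).trans ?_
  rw [norm_mul, norm_mul, norm_pow, Complex.norm_real, Complex.norm_real, norm_norm,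
    Real.norm_eq_abs, abs_mul, abs_of_nonneg (by positivity : 0 ≤ ‖a‖ + ‖b‖)]
  have := mul_le_mul_of_nonneg_right (abs_norm_sub_norm_le a b)
    (by positivity : 0 ≤ (‖a‖ + ‖b‖) * ‖b‖)
  nlinarith [mul_nonneg (norm_nonneg (a - b)) (sq_nonneg (‖a‖ - ‖b‖)),
    mul_nonneg (norm_nonneg (a - b)) (sq_nonneg ‖a‖),
    mul_nonneg (norm_nonneg (a - b)) (sq_nonneg ‖b‖)]

lemma abs_sq_norm_sub_le (a b : ℂ) :
    ‖(‖a‖ : ℂ) ^ 2 - (‖b‖ : ℂ) ^ 2‖ ≤ (‖a‖ + ‖b‖) * ‖a - b‖ := by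
  have e : (‖a‖ : ℂ) ^ 2 - (‖b‖ : ℂ) ^ 2 = (((‖a‖ - ‖b‖) * (‖a‖ + ‖b‖) : ℝ) : ℂ) := by
    push_cast; ring
  rw [e, Complex.norm_real, Real.norm_eq_abs, abs_mul,
    abs_of_nonneg (by positivity : 0 ≤ ‖a‖ + ‖b‖), mul_comm]
  gcongr
  exact abs_norm_sub_norm_le a b

/-! ### Young-type inequalities for powers -/

lemma exists_rpow_le_add {r s : ℝ} (hr : 0 < r) (hrs : r < s) {η : ℝ} (hη : 0 < η) :
    ∃ C : ℝ, 0 ≤ C ∧ ∀ x : ℝ, 0 ≤ x → x ^ r ≤ η * x ^ s + C := by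
  have hR := (tendsto_rpow_neg_atTop (sub_pos.2 hrs)).eventually (gt_mem_nhds hη)
  obtain ⟨R, hR, hR1⟩ := (hR.and (eventually_gt_atTop 0)).exists
  refine ⟨R ^ r, by positivity, fun x hx => ?_⟩
  rcases le_total x R with h | h
  · exact (Real.rpow_le_rpow hx h hr.le).trans (le_add_of_nonneg_left (by positivity))
  · have hx0 : 0 < x := hR1.trans_le h
    have h1 : x ^ r = x ^ (-(s - r)) * x ^ s := by
      rw [← Real.rpow_add hx0]; congr 1; ring
    have h2 : x ^ (-(s - r)) ≤ R ^ (-(s - r)) :=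
      Real.rpow_le_rpow_of_nonpos hR1 h (by linarith)
    rw [h1]
    have := mul_le_mul_of_nonneg_right (h2.trans hR.le) (by positivity : 0 ≤ x ^ s)
    linarith [Real.rpow_nonneg hR1.le r]

/-- Young's inequality by splitting at `y = η x`: each side of the split is bounded by one of the
two terms. -/
lemma exists_rpow_mul_le_add {p : ℝ} (hp : 1 < p) {η : ℝ} (hη : 0 < η) :
    ∃ C : ℝ, 0 ≤ C ∧ ∀ x y : ℝ, 0 ≤ x → 0 ≤ y → x ^ (p - 1) * y ≤ η * x ^ p + C * y ^ p := by
  refine ⟨(η⁻¹) ^ (p - 1), by positivity, fun x y hx hy => ?_⟩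
  have hp' : ∀ z : ℝ, 0 ≤ z → z ^ p = z ^ (p - 1) * z := fun z hz => by
    rw [← Real.rpow_add_one' hz (by linarith)]; congr 1; ring
  rcases le_total y (η * x) with h | h
  · calc x ^ (p - 1) * y ≤ x ^ (p - 1) * (η * x) := by gcongr
      _ = η * x ^ p := by rw [hp' x hx]; ring
      _ ≤ _ := le_add_of_nonneg_right (by positivity)
  · have h1 : x ≤ η⁻¹ * y := by rw [inv_mul_eq_div, le_div_iff₀ hη]; linarith
    calc x ^ (p - 1) * y ≤ (η⁻¹ * y) ^ (p - 1) * y := by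
          gcongr
      _ = (η⁻¹) ^ (p - 1) * y ^ p := by
        rw [Real.mul_rpow (by positivity) hy, hp' y hy]; ring
      _ ≤ _ := le_add_of_nonneg_left (by positivity)

end SGGLE

namespace SGGLE

open Filter Topology
open scoped InnerProductSpace

/-! ### Basic facts on the rectangle and on `V` -/

variable {L₁ L₂ : ℝ}

lemma isOpen_rect (L₁ L₂ : ℝ) : IsOpen (rect L₁ L₂) := isOpen_Ioo.prod isOpen_Ioo

lemma measurableSet_rect (L₁ L₂ : ℝ) : MeasurableSet (rect L₁ L₂) :=
  (isOpen_rect L₁ L₂).measurableSet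

lemma rect_subset_Icc (L₁ L₂ : ℝ) : rect L₁ L₂ ⊆ Icc (0, 0) (L₁, L₂) := by
  rintro ⟨x, y⟩ ⟨hx, hy⟩
  exact ⟨⟨hx.1.le, hy.1.le⟩, ⟨hx.2.le, hy.2.le⟩⟩

instance (L₁ L₂ : ℝ) : IsFiniteMeasure (rectMeasure L₁ L₂) := by
  refine ⟨?_⟩
  rw [Measure.restrict_apply_univ]
  exact (measure_mono (rect_subset_Icc L₁ L₂)).trans_lt isCompact_Icc.measure_lt_top

/-- The components of the triple stored in a member of `V`, as continuous linear maps. -/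
def compL (i : Fin 3) : V L₁ L₂ →L[ℂ] H L₁ L₂ :=
  (PiLp.proj 2 (fun _ : Fin 3 => H L₁ L₂) i).comp (V L₁ L₂).subtypeL

lemma toH_eq (w : V L₁ L₂) : toH w = compL 0 w := rfl
lemma d₁_eq (w : V L₁ L₂) : d₁ w = compL 1 w := rfl
lemma d₂_eq (w : V L₁ L₂) : d₂ w = compL 2 w := rfl

@[simp] lemma toH_add (w v : V L₁ L₂) : toH (w + v) = toH w + toH v := rfl
@[simp] lemma d₁_add (w v : V L₁ L₂) : d₁ (w + v) = d₁ w + d₁ v := rfl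
@[simp] lemma d₂_add (w v : V L₁ L₂) : d₂ (w + v) = d₂ w + d₂ v := rfl
@[simp] lemma toH_sub (w v : V L₁ L₂) : toH (w - v) = toH w - toH v := rfl
@[simp] lemma d₁_sub (w v : V L₁ L₂) : d₁ (w - v) = d₁ w - d₁ v := rfl
@[simp] lemma d₂_sub (w v : V L₁ L₂) : d₂ (w - v) = d₂ w - d₂ v := rfl
@[simp] lemma toH_smul (c : ℂ) (v : V L₁ L₂) : toH (c • v) = c • toH v := rfl
@[simp] lemma d₁_smul (c : ℂ) (v : V L₁ L₂) : d₁ (c • v) = c • d₁ v := rfl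
@[simp] lemma d₂_smul (c : ℂ) (v : V L₁ L₂) : d₂ (c • v) = c • d₂ v := rfl
@[simp] lemma toH_zero : toH (0 : V L₁ L₂) = 0 := rfl
@[simp] lemma d₁_zero : d₁ (0 : V L₁ L₂) = 0 := rfl
@[simp] lemma d₂_zero : d₂ (0 : V L₁ L₂) = 0 := rfl

lemma continuous_toH : Continuous (toH : V L₁ L₂ → H L₁ L₂) := (compL 0).continuous
lemma continuous_d₁ : Continuous (d₁ : V L₁ L₂ → H L₁ L₂) := (compL 1).continuous
lemma continuous_d₂ : Continuous (d₂ : V L₁ L₂ → H L₁ L₂) := (compL 2).continuous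

/-- The squared `L²` norm of the gradient. -/
def gradSq (w : V L₁ L₂) : ℝ := ‖d₁ w‖ ^ 2 + ‖d₂ w‖ ^ 2

lemma gradSq_nonneg (w : V L₁ L₂) : 0 ≤ gradSq w := by unfold gradSq; positivity

lemma norm_sq_V (w : V L₁ L₂) : ‖w‖ ^ 2 = ‖toH w‖ ^ 2 + gradSq w := by
  have : ‖w‖ = ‖(w : PiLp 2 (fun _ : Fin 3 => H L₁ L₂))‖ := rfl
  rw [this, PiLp.norm_sq_eq_of_L2, Fin.sum_univ_three, gradSq, ← add_assoc]
  rfl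

lemma norm_toH_le (w : V L₁ L₂) : ‖toH w‖ ≤ ‖w‖ :=
  abs_le_of_sq_le_sq' (by rw [norm_sq_V]; linarith [gradSq_nonneg w]) (norm_nonneg _) |>.2

lemma gradSq_le (w : V L₁ L₂) : gradSq w ≤ ‖w‖ ^ 2 := by
  rw [norm_sq_V]; linarith [sq_nonneg ‖toH w‖]

lemma continuous_gradSq : Continuous (gradSq : V L₁ L₂ → ℝ) :=
  (continuous_d₁.norm.pow 2).add (continuous_d₂.norm.pow 2)

lemma enorm_sq_H (u : H L₁ L₂) : ‖u‖ₑ ^ 2 = ∫⁻ x in rect L₁ L₂, ‖u x‖ₑ ^ 2 := by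
  have h := eLpNorm_nnreal_pow_eq_lintegral (f := u) (μ := rectMeasure L₁ L₂)
    (p := 2) (by norm_num)
  rw [Lp.enorm_def]
  simpa using h

lemma norm_sq_H (u : H L₁ L₂) : ‖u‖ ^ 2 = ∫ x in rect L₁ L₂, ‖u x‖ ^ 2 := by
  have h := L2.inner_def (𝕜 := ℂ) u u
  have h2 : ((‖u‖ ^ 2 : ℝ) : ℂ) = ((∫ x in rect L₁ L₂, ‖u x‖ ^ 2 : ℝ) : ℂ) := by
    rw [← integral_complex_ofReal]
    simpa [inner_self_eq_norm_sq_to_K] using h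
  exact_mod_cast h2

lemma inner_H (u v : H L₁ L₂) : ⟪v, u⟫_ℂ = ∫ x in rect L₁ L₂, u x * conj (v x) := by
  rw [L2.inner_def]
  rfl

/-! ### Test functions -/

namespace IsTestFunction

variable {f g : ℝ × ℝ → ℂ}

lemma contDiff (hf : IsTestFunction L₁ L₂ f) (n : ℕ) : ContDiff ℝ n f :=
  hf.1.of_le (by exact_mod_cast le_top)

lemma add (hf : IsTestFunction L₁ L₂ f) (hg : IsTestFunction L₁ L₂ g) :
    IsTestFunction L₁ L₂ (f + g) :=
  ⟨hf.1.add hg.1, hf.2.1.add hg.2.1,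
    (tsupport_add f g).trans (union_subset hf.2.2 hg.2.2)⟩

lemma const_smul (hf : IsTestFunction L₁ L₂ f) (c : ℂ) : IsTestFunction L₁ L₂ (c • f) :=
  ⟨hf.1.const_smul c, hf.2.1.smul_left (f := fun _ => c),
    (closure_mono (Function.support_const_smul_subset c f)).trans hf.2.2⟩

lemma fderiv (hf : IsTestFunction L₁ L₂ f) (v : ℝ × ℝ) :
    IsTestFunction L₁ L₂ (fun x => fderiv ℝ f x v) := by
  refine ⟨(hf.1.fderiv_right (m := ((⊤ : ℕ∞) : WithTop ℕ∞)) (by simp)).clm_apply contDiff_const,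
    hf.2.1.fderiv_apply ℝ v, (tsupport_fderiv_apply_subset ℝ v).trans hf.2.2⟩

lemma continuous (hf : IsTestFunction L₁ L₂ f) : Continuous f := hf.1.continuous

lemma differentiable (hf : IsTestFunction L₁ L₂ f) : Differentiable ℝ f :=
  (hf.contDiff 1).differentiable (by simp)

lemma memLp (hf : IsTestFunction L₁ L₂ f) : MemLp f 2 (rectMeasure L₁ L₂) :=
  (hf.continuous.memLp_of_hasCompactSupport hf.2.1).restrict _

lemma eq_zero (hf : IsTestFunction L₁ L₂ f) {x : ℝ × ℝ} (hx : x ∉ rect L₁ L₂) : f x = 0 :=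
  image_eq_zero_of_notMem_tsupport fun h => hx (hf.2.2 h)

end IsTestFunction

/-- The property that a member of `V` comes from a test function. -/
def Represents (f : ℝ × ℝ → ℂ) (w : PiLp 2 (fun _ : Fin 3 => H L₁ L₂)) : Prop :=
  (w 0 =ᵐ[rectMeasure L₁ L₂] f) ∧
  (w 1 =ᵐ[rectMeasure L₁ L₂] fun x => fderiv ℝ f x (1, 0)) ∧
  (w 2 =ᵐ[rectMeasure L₁ L₂] fun x => fderiv ℝ f x (0, 1))

/-- Test functions already form a vector space, so taking the span adds nothing and every element of
it can be treated as a single test function. -/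
lemma exists_test_of_mem_span {w : PiLp 2 (fun _ : Fin 3 => H L₁ L₂)}
    (hw : w ∈ Submodule.span ℂ {w | ∃ f : ℝ × ℝ → ℂ, IsTestFunction L₁ L₂ f ∧
      (w 0 =ᵐ[rectMeasure L₁ L₂] f) ∧
      (w 1 =ᵐ[rectMeasure L₁ L₂] fun x => fderiv ℝ f x (1, 0)) ∧
      (w 2 =ᵐ[rectMeasure L₁ L₂] fun x => fderiv ℝ f x (0, 1))}) :
    ∃ f, IsTestFunction L₁ L₂ f ∧ Represents f w := by
  induction hw using Submodule.span_induction with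
  | mem x hx => exact hx
  | zero =>
    refine ⟨0, ⟨contDiff_const, HasCompactSupport.zero, by simp⟩, ?_, ?_, ?_⟩
    · exact Lp.coeFn_zero _ _ _
    · filter_upwards [Lp.coeFn_zero ℂ 2 (rectMeasure L₁ L₂)] with x hx
      simpa using hx
    · filter_upwards [Lp.coeFn_zero ℂ 2 (rectMeasure L₁ L₂)] with x hx
      simpa using hx
  | add x y _ _ hx hy =>
    obtain ⟨f, hf, f0, f1, f2⟩ := hx
    obtain ⟨g, hg, g0, g1, g2⟩ := hy
    refine ⟨f + g, hf.add hg, ?_, ?_, ?_⟩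
    · filter_upwards [f0, g0, Lp.coeFn_add (x 0) (y 0)] with a ha hb h
      rw [PiLp.add_apply, h, Pi.add_apply, Pi.add_apply, ha, hb]
    · filter_upwards [f1, g1, Lp.coeFn_add (x 1) (y 1)] with a ha hb h
      rw [PiLp.add_apply, h, Pi.add_apply, ha, hb, fderiv_add (hf.differentiable a)
        (hg.differentiable a), add_apply]
    · filter_upwards [f2, g2, Lp.coeFn_add (x 2) (y 2)] with a ha hb h
      rw [PiLp.add_apply, h, Pi.add_apply, ha, hb, fderiv_add (hf.differentiable a)
        (hg.differentiable a), add_apply]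
  | smul c x _ hx =>
    obtain ⟨f, hf, f0, f1, f2⟩ := hx
    refine ⟨c • f, hf.const_smul c, ?_, ?_, ?_⟩
    · filter_upwards [f0, Lp.coeFn_smul c (x 0)] with a ha h
      rw [PiLp.smul_apply, h, Pi.smul_apply, Pi.smul_apply, ha]
    · filter_upwards [f1, Lp.coeFn_smul c (x 1)] with a ha h
      rw [PiLp.smul_apply, h, Pi.smul_apply, ha, fderiv_const_smul (hf.differentiable a),
        smul_apply]
    · filter_upwards [f2, Lp.coeFn_smul c (x 2)] with a ha h
      rw [PiLp.smul_apply, h, Pi.smul_apply, ha, fderiv_const_smul (hf.differentiable a),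
        smul_apply]

/-- Every member of `V` is a limit of members given by test functions. -/
lemma exists_seq_test (w : V L₁ L₂) : ∃ (v : ℕ → V L₁ L₂) (f : ℕ → ℝ × ℝ → ℂ),
    (∀ n, IsTestFunction L₁ L₂ (f n) ∧ Represents (f n) (v n).1) ∧
      Tendsto v atTop (𝓝 w) := by
  have hw : (w : PiLp 2 (fun _ : Fin 3 => H L₁ L₂)) ∈ closure _ := w.2
  obtain ⟨x, hx, hlim⟩ := mem_closure_iff_seq_limit.1 hw
  choose f hf using fun n => exists_test_of_mem_span (hx n)
  exact ⟨fun n => ⟨x n, subset_closure (hx n)⟩, f, hf, tendsto_subtype_rng.2 hlim⟩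

/-- A test function gives a member of `V`. -/
lemma exists_V_of_test {f : ℝ × ℝ → ℂ} (hf : IsTestFunction L₁ L₂ f) :
    ∃ w : V L₁ L₂, Represents f w.1 := by
  let w : PiLp 2 (fun _ : Fin 3 => H L₁ L₂) := WithLp.toLp 2
    ![hf.memLp.toLp f, (hf.fderiv (1, 0)).memLp.toLp _, (hf.fderiv (0, 1)).memLp.toLp _]
  have hw : Represents f w :=
    ⟨hf.memLp.coeFn_toLp, (hf.fderiv (1, 0)).memLp.coeFn_toLp,
      (hf.fderiv (0, 1)).memLp.coeFn_toLp⟩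
  exact ⟨⟨w, subset_closure (Submodule.subset_span ⟨f, hf, hw⟩)⟩, hw⟩

/-! ### The Sobolev inequality -/

lemma lintegral_mul_sq_le {α : Type*} [MeasurableSpace α] (μ : Measure α) {f g : α → ℝ≥0∞}
    (hf : AEMeasurable f μ) (hg : AEMeasurable g μ) :
    (∫⁻ x, f x * g x ∂μ) ^ 2 ≤ (∫⁻ x, f x ^ 2 ∂μ) * ∫⁻ x, g x ^ 2 ∂μ := by
  have h := ENNReal.lintegral_mul_le_Lp_mul_Lq μ Real.HolderConjugate.two_two hf hg
  have h2 : ∀ a : ℝ≥0∞, (a ^ (1 / (2 : ℝ))) ^ 2 = a := fun a => by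
    rw [← ENNReal.rpow_natCast, ← ENNReal.rpow_mul]; norm_num
  calc _ ≤ ((∫⁻ x, f x ^ (2 : ℝ) ∂μ) ^ (1 / (2 : ℝ)) *
        (∫⁻ x, g x ^ (2 : ℝ) ∂μ) ^ (1 / (2 : ℝ))) ^ 2 := by gcongr; exact h
    _ = _ := by
      rw [mul_pow, h2, h2]
      simp

lemma norm_clm_prod_le (A : ℝ × ℝ →L[ℝ] ℂ) : ‖A‖ₑ ≤ ‖A (1, 0)‖ₑ + ‖A (0, 1)‖ₑ := by
  have : ‖A‖ ≤ ‖A (1, 0)‖ + ‖A (0, 1)‖ := by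
    refine A.opNorm_le_bound (by positivity) fun x => ?_
    have hx : x = x.1 • (1, 0) + x.2 • (0, 1) := by ext <;> simp
    have h1 : |x.1| ≤ ‖x‖ := norm_fst_le x
    have h2 : |x.2| ≤ ‖x‖ := norm_snd_le x
    calc ‖A x‖ = ‖x.1 • A (1, 0) + x.2 • A (0, 1)‖ := by
          conv_lhs => rw [hx]
          rw [map_add, map_smul, map_smul]
      _ ≤ |x.1| * ‖A (1, 0)‖ + |x.2| * ‖A (0, 1)‖ := by
          refine (norm_add_le _ _).trans ?_
          rw [norm_smul, norm_smul, Real.norm_eq_abs, Real.norm_eq_abs]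
      _ ≤ ‖x‖ * ‖A (1, 0)‖ + ‖x‖ * ‖A (0, 1)‖ := by gcongr
      _ = _ := by ring
  rw [← ofReal_norm, ← ofReal_norm, ← ofReal_norm, ← ENNReal.ofReal_add (norm_nonneg _)
    (norm_nonneg _)]
  exact ENNReal.ofReal_le_ofReal this

/-- One step of the iteration which bounds high powers of a test function. -/
lemma lintegral_pow_step : ∃ C : ℝ≥0, ∀ (f : ℝ × ℝ → ℂ), ContDiff ℝ 1 f → HasCompactSupport f →
    ∀ k : ℕ, ∫⁻ x, ‖f x‖ₑ ^ (2 * (k + 1)) ≤ C * (k + 1) ^ 2 * (∫⁻ x, ‖f x‖ₑ ^ (2 * k)) *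
      ((∫⁻ x, ‖fderiv ℝ f x (1, 0)‖ₑ ^ 2) + ∫⁻ x, ‖fderiv ℝ f x (0, 1)‖ₑ ^ 2) := by
  have hconj : Real.HolderConjugate (Module.finrank ℝ (ℝ × ℝ)) 2 := by
    have : (Module.finrank ℝ (ℝ × ℝ) : ℝ) = 2 := by simp [Module.finrank_prod]
    rw [this]; exact Real.HolderConjugate.two_two
  set C₀ := lintegralPowLePowLIntegralFDerivConst (volume : Measure (ℝ × ℝ)) 2
  refine ⟨2 * C₀, fun f hf hfc k => ?_⟩
  -- The planar inequality `‖F‖₂ ≤ C ‖∇F‖₁` is applied to `F = f^(k+1)`, whose gradient is `(k+1)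
  -- f^k ∇f`. Cauchy–Schwarz then separates `f^k` from `∇f`.
  have hg : ContDiff ℝ 1 fun x => f x ^ (k + 1) := hf.pow _
  have hgc : HasCompactSupport fun x => f x ^ (k + 1) :=
    hfc.comp_left (g := fun z : ℂ => z ^ (k + 1)) (by simp)
  have h := lintegral_pow_le_pow_lintegral_fderiv (volume : Measure (ℝ × ℝ)) hg hgc hconj
  have hfd : ∀ x, fderiv ℝ (fun x => f x ^ (k + 1)) x =
      ((k + 1 : ℕ) * f x ^ k) • fderiv ℝ f x := fun x => by
    rw [fderiv_fun_pow _ (hf.differentiable (by simp) x)]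
    simp
  have hcd : Continuous (fderiv ℝ f) := hf.continuous_fderiv (by simp)
  set a : ℝ × ℝ → ℝ≥0∞ := fun x => ‖fderiv ℝ f x (1, 0)‖ₑ
  set b : ℝ × ℝ → ℝ≥0∞ := fun x => ‖fderiv ℝ f x (0, 1)‖ₑ
  have ha : Measurable a := (hcd.clm_apply continuous_const).enorm.measurable
  have hb : Measurable b := (hcd.clm_apply continuous_const).enorm.measurable
  have hfm : Measurable fun x => ‖f x‖ₑ := hf.continuous.enorm.measurable
  have e1 : ∫⁻ x, ‖fderiv ℝ (fun x => f x ^ (k + 1)) x‖ₑ ≤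
      (k + 1) * ∫⁻ x, ‖f x‖ₑ ^ k * (a x + b x) := by
    rw [← lintegral_const_mul' _ _ (by finiteness)]
    refine lintegral_mono fun x => ?_
    rw [hfd, enorm_smul, enorm_mul, enorm_pow, mul_assoc]
    have : ‖((k + 1 : ℕ) : ℂ)‖ₑ = (k : ℝ≥0∞) + 1 := by
      rw [← ofReal_norm, Complex.norm_natCast]
      simp [ENNReal.ofReal_add]
    rw [this]
    gcongr
    exact norm_clm_prod_le _
  have e2 : ∀ x, (a x + b x) ^ 2 ≤ 2 * (a x ^ 2 + b x ^ 2) := fun x => by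
    have := ENNReal.rpow_add_le_mul_rpow_add_rpow (a x) (b x) (p := 2) (by norm_num)
    norm_num at this
    simpa using this
  calc ∫⁻ x, ‖f x‖ₑ ^ (2 * (k + 1)) = ∫⁻ x, ‖f x ^ (k + 1)‖ₑ ^ (2 : ℝ) := by
        refine lintegral_congr fun x => ?_
        rw [enorm_pow, ENNReal.rpow_two, ← pow_mul, mul_comm]
    _ ≤ C₀ * (∫⁻ x, ‖fderiv ℝ (fun x => f x ^ (k + 1)) x‖ₑ) ^ (2 : ℝ) := h
    _ ≤ C₀ * ((k + 1) * ∫⁻ x, ‖f x‖ₑ ^ k * (a x + b x)) ^ (2 : ℝ) := by gcongr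
    _ = C₀ * (k + 1) ^ 2 * (∫⁻ x, ‖f x‖ₑ ^ k * (a x + b x)) ^ 2 := by
      rw [ENNReal.rpow_two, mul_pow, mul_assoc]
    _ ≤ C₀ * (k + 1) ^ 2 * ((∫⁻ x, (‖f x‖ₑ ^ k) ^ 2) * ∫⁻ x, (a x + b x) ^ 2) := by
      gcongr
      exact lintegral_mul_sq_le _ (hfm.pow_const k).aemeasurable (ha.add hb).aemeasurable
    _ ≤ C₀ * (k + 1) ^ 2 * ((∫⁻ x, (‖f x‖ₑ ^ k) ^ 2) *
        (2 * ((∫⁻ x, a x ^ 2) + ∫⁻ x, b x ^ 2))) := by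
      gcongr
      rw [← lintegral_add_left (ha.pow_const 2), ← lintegral_const_mul' _ _ (by finiteness)]
      exact lintegral_mono e2
    _ = _ := by
      simp_rw [← pow_mul, mul_comm k 2]
      push_cast
      ring

/-- Iterated Sobolev inequality for test functions. -/
lemma lintegral_pow_test (k : ℕ) : ∃ C : ℝ≥0, ∀ (f : ℝ × ℝ → ℂ), ContDiff ℝ 1 f →
    HasCompactSupport f → ∫⁻ x, ‖f x‖ₑ ^ (2 * (k + 1)) ≤ C * (∫⁻ x, ‖f x‖ₑ ^ 2) *
      ((∫⁻ x, ‖fderiv ℝ f x (1, 0)‖ₑ ^ 2) + ∫⁻ x, ‖fderiv ℝ f x (0, 1)‖ₑ ^ 2) ^ k := by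
  obtain ⟨C, hC⟩ := lintegral_pow_step
  induction k with
  | zero => exact ⟨1, fun f _ _ => by simp⟩
  | succ k ih =>
    obtain ⟨C', hC'⟩ := ih
    refine ⟨C * (k + 2) ^ 2 * C', fun f hf hfc => (hC f hf hfc (k + 1)).trans ?_⟩
    calc _ ≤ C * (↑(k + 1) + 1) ^ 2 * (C' * (∫⁻ x, ‖f x‖ₑ ^ 2) *
      ((∫⁻ x, ‖fderiv ℝ f x (1, 0)‖ₑ ^ 2) + ∫⁻ x, ‖fderiv ℝ f x (0, 1)‖ₑ ^ 2) ^ k) *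
      ((∫⁻ x, ‖fderiv ℝ f x (1, 0)‖ₑ ^ 2) + ∫⁻ x, ‖fderiv ℝ f x (0, 1)‖ₑ ^ 2) := by
          gcongr; exact hC' f hf hfc
      _ = _ := by
        have : (((k + 1 : ℕ) : ℝ≥0∞) + 1) = k + 2 := by push_cast; ring
        rw [this]; push_cast; ring

lemma setLIntegral_rect_eq {F : ℝ × ℝ → ℝ≥0∞} (hF : ∀ x ∉ rect L₁ L₂, F x = 0) :
    ∫⁻ x in rect L₁ L₂, F x = ∫⁻ x, F x :=
  setLIntegral_eq_of_support_subset fun x hx => by_contra fun h => hx (hF x h)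

lemma toH_ae_of_tendsto {v : ℕ → H L₁ L₂} {w : H L₁ L₂} (h : Tendsto v atTop (𝓝 w)) :
    ∃ ns : ℕ → ℕ, StrictMono ns ∧ ∀ᵐ x ∂rectMeasure L₁ L₂,
      Tendsto (fun i => v (ns i) x) atTop (𝓝 (w x)) :=
  (tendstoInMeasure_of_tendsto_Lp h).exists_seq_tendsto_ae

/-- Fatou's lemma along an almost everywhere convergent subsequence carries the inequality from test
functions to their closure. The form `‖w‖² ‖∇w‖^{2k}`, with one factor in the weak norm, is kept
because local monotonicity relies on the case `k = 2`. -/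
lemma lintegral_pow_V (k : ℕ) : ∃ C : ℝ≥0, ∀ w : V L₁ L₂,
    ∫⁻ x in rect L₁ L₂, ‖toH w x‖ₑ ^ (2 * (k + 1)) ≤
      C * ‖toH w‖ₑ ^ 2 * (‖d₁ w‖ₑ ^ 2 + ‖d₂ w‖ₑ ^ 2) ^ k := by
  obtain ⟨C, hC⟩ := lintegral_pow_test k
  refine ⟨C, fun w => ?_⟩
  obtain ⟨v, f, hf, hv⟩ := exists_seq_test w
  have hn : ∀ n, ∫⁻ x in rect L₁ L₂, ‖toH (v n) x‖ₑ ^ (2 * (k + 1)) ≤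
      C * ‖toH (v n)‖ₑ ^ 2 * (‖d₁ (v n)‖ₑ ^ 2 + ‖d₂ (v n)‖ₑ ^ 2) ^ k := fun n => by
    obtain ⟨ht, r0, r1, r2⟩ := hf n
    have key : ∀ (u : H L₁ L₂) (g : ℝ × ℝ → ℂ), u =ᵐ[rectMeasure L₁ L₂] g →
        IsTestFunction L₁ L₂ g → ∀ m : ℕ, m ≠ 0 →
        ∫⁻ x in rect L₁ L₂, ‖u x‖ₑ ^ m = ∫⁻ x, ‖g x‖ₑ ^ m := fun u g hu hg m hm => by
      rw [← setLIntegral_rect_eq (L₁ := L₁) (L₂ := L₂) (F := fun x => ‖g x‖ₑ ^ m)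
        fun x hx => by simp [hg.eq_zero hx, hm]]
      refine lintegral_congr_ae ?_
      filter_upwards [hu] with x hx
      rw [hx]
    have r0' : toH (v n) =ᵐ[rectMeasure L₁ L₂] f n := r0
    rw [enorm_sq_H, enorm_sq_H, enorm_sq_H, key _ _ r0' ht _ (by omega),
      key _ _ r0' ht _ (by omega)]
    rw [show ∫⁻ x in rect L₁ L₂, ‖d₁ (v n) x‖ₑ ^ 2 = _ from key _ _ r1 (ht.fderiv _) _ (by omega),
      show ∫⁻ x in rect L₁ L₂, ‖d₂ (v n) x‖ₑ ^ 2 = _ from key _ _ r2 (ht.fderiv _) _ (by omega)]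
    exact hC _ (ht.contDiff 1) ht.2.1
  obtain ⟨ns, hns, hae⟩ := toH_ae_of_tendsto ((continuous_toH.tendsto w).comp hv)
  have hlim : Tendsto (fun i => (C : ℝ≥0∞) * ‖toH (v (ns i))‖ₑ ^ 2 *
      (‖d₁ (v (ns i))‖ₑ ^ 2 + ‖d₂ (v (ns i))‖ₑ ^ 2) ^ k) atTop
      (𝓝 (C * ‖toH w‖ₑ ^ 2 * (‖d₁ w‖ₑ ^ 2 + ‖d₂ w‖ₑ ^ 2) ^ k)) := by
    have hv' := hv.comp hns.tendsto_atTop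
    have t : ∀ F : V L₁ L₂ → H L₁ L₂, Continuous F →
        Tendsto (fun i => ‖F (v (ns i))‖ₑ ^ 2) atTop (𝓝 (‖F w‖ₑ ^ 2)) := fun F hF =>
      ENNReal.Tendsto.pow (((continuous_enorm.comp hF).tendsto w).comp hv')
    refine ENNReal.Tendsto.mul (ENNReal.Tendsto.const_mul (t _ continuous_toH)
      (Or.inr ENNReal.coe_ne_top)) (Or.inr (by finiteness)) ?_ (Or.inr (by finiteness))
    exact ENNReal.Tendsto.pow ((t _ continuous_d₁).add (t _ continuous_d₂))
  calc ∫⁻ x in rect L₁ L₂, ‖toH w x‖ₑ ^ (2 * (k + 1))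
      = ∫⁻ x in rect L₁ L₂, liminf (fun i => ‖toH (v (ns i)) x‖ₑ ^ (2 * (k + 1))) atTop := by
        refine lintegral_congr_ae ?_
        filter_upwards [hae] with x hx
        exact (ENNReal.Tendsto.pow ((continuous_enorm.tendsto _).comp hx)).liminf_eq.symm
    _ ≤ liminf (fun i => ∫⁻ x in rect L₁ L₂, ‖toH (v (ns i)) x‖ₑ ^ (2 * (k + 1))) atTop :=
        lintegral_liminf_le' fun i => (Lp.aestronglyMeasurable _).enorm.pow_const _
    _ ≤ liminf (fun i => (C : ℝ≥0∞) * ‖toH (v (ns i))‖ₑ ^ 2 *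
      (‖d₁ (v (ns i))‖ₑ ^ 2 + ‖d₂ (v (ns i))‖ₑ ^ 2) ^ k) atTop :=
        liminf_le_liminf (Eventually.of_forall fun i => hn _)
    _ = _ := hlim.liminf_eq

end SGGLE

namespace SGGLE

open Filter Topology
open scoped InnerProductSpace

variable {L₁ L₂ : ℝ}

/-! ### Functions in every `L^q`, `q < ∞` -/

/-- Membership in `L^q` for all finite `q`. -/
def AllLp {α : Type*} [MeasurableSpace α] (μ : Measure α) (f : α → ℝ) : Prop :=
  ∀ q : ℝ≥0, MemLp f q μ

namespace AllLp

variable {α : Type*} [MeasurableSpace α] {μ : Measure α} {f g : α → ℝ}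

lemma add (hf : AllLp μ f) (hg : AllLp μ g) : AllLp μ fun x => f x + g x :=
  fun q => (hf q).add (hg q)

lemma const_mul (hf : AllLp μ f) (c : ℝ) : AllLp μ fun x => c * f x :=
  fun q => (hf q).const_mul c

lemma mul (hf : AllLp μ f) (hg : AllLp μ g) : AllLp μ fun x => f x * g x := fun q => by
  have : ENNReal.HolderTriple ((2 * q : ℝ≥0) : ℝ≥0∞) ((2 * q : ℝ≥0) : ℝ≥0∞) (q : ℝ≥0∞) := by
    refine ⟨?_⟩
    push_cast
    rw [ENNReal.mul_inv (Or.inl (by simp)) (Or.inl (by simp)), ← add_mul, ENNReal.inv_two_add_inv_two,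
      one_mul]
  exact (hg (2 * q)).mul' (hf (2 * q))

lemma pow (hf : AllLp μ f) (n : ℕ) (hn : n ≠ 0) : AllLp μ fun x => f x ^ n := by
  induction n with
  | zero => exact absurd rfl hn
  | succ n ih =>
    rcases Nat.eq_zero_or_pos n with h | h
    · subst h; simpa using hf
    · have := (ih (by omega)).mul hf
      simpa only [pow_succ] using this

lemma integrable (hf : AllLp μ f) : Integrable f μ := memLp_one_iff_integrable.1 (by
  simpa using hf 1)

lemma memLp_two (hf : AllLp μ f) : MemLp f 2 μ := by simpa using hf 2

lemma mul_memLp_two (hf : AllLp μ f) (hg : MemLp g 2 μ) : Integrable (fun x => f x * g x) μ :=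
  hf.memLp_two.integrable_mul hg

lemma mono (hg : AllLp μ g) (hf : AEStronglyMeasurable f μ) (h : ∀ x, |f x| ≤ g x) :
    AllLp μ f := fun q => (hg q).mono hf (Eventually.of_forall fun x => by
      rw [Real.norm_eq_abs, Real.norm_eq_abs]
      exact (h x).trans (le_abs_self _))

lemma const [IsFiniteMeasure μ] (c : ℝ) : AllLp μ fun _ => c := fun _ => memLp_const c

lemma rpow [IsFiniteMeasure μ] (hf : AllLp μ f) (h0 : ∀ x, 0 ≤ f x) {r : ℝ} (hr : 0 ≤ r) :
    AllLp μ fun x => f x ^ r := by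
  obtain ⟨n, hn⟩ := exists_nat_ge r
  refine ((const 1).add (hf.pow (n + 1) (by omega))).mono
    ((Real.continuous_rpow_const hr).comp_aestronglyMeasurable (hf 1).1) fun x => ?_
  rw [abs_of_nonneg (Real.rpow_nonneg (h0 x) r)]
  rcases le_total (f x) 1 with h | h
  · exact (Real.rpow_le_one (h0 x) h hr).trans (le_add_of_nonneg_right (pow_nonneg (h0 x) _))
  · rw [← Real.rpow_natCast]
    exact (Real.rpow_le_rpow_of_exponent_le h (by push_cast; linarith)).trans
      (le_add_of_nonneg_left zero_le_one)

end AllLp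

lemma integral_mul_sq_le {α : Type*} [MeasurableSpace α] {μ : Measure α} {f g : α → ℝ}
    (hf : MemLp f 2 μ) (hg : MemLp g 2 μ) :
    (∫ x, f x * g x ∂μ) ^ 2 ≤ (∫ x, f x ^ 2 ∂μ) * ∫ x, g x ^ 2 ∂μ := by
  have h1 := real_inner_mul_inner_self_le (hf.toLp f) (hg.toLp g)
  have e : ∀ {a b : α → ℝ} (ha : MemLp a 2 μ) (hb : MemLp b 2 μ),
      ⟪ha.toLp a, hb.toLp b⟫_ℝ = ∫ x, a x * b x ∂μ := fun ha hb => by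
    rw [L2.inner_def]
    refine integral_congr_ae ?_
    filter_upwards [ha.coeFn_toLp, hb.coeFn_toLp] with x h1 h2
    rw [h1, h2]; simp [mul_comm]
  rw [e hf hg, e hf hf, e hg hg] at h1
  simpa only [sq] using h1

lemma integral_mul_le_sqrt {α : Type*} [MeasurableSpace α] {μ : Measure α} {f g : α → ℝ}
    (hf : MemLp f 2 μ) (hg : MemLp g 2 μ) :
    ∫ x, f x * g x ∂μ ≤ √(∫ x, f x ^ 2 ∂μ) * √(∫ x, g x ^ 2 ∂μ) := by
  rw [← Real.sqrt_mul (integral_nonneg fun x => sq_nonneg _)]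
  exact Real.le_sqrt_of_sq_le (integral_mul_sq_le hf hg)

/-- Hölder's inequality with exponents 2, 4, 4; the double square roots are the `L⁴` norms. -/
lemma integral_mul_mul_le_sqrt {α : Type*} [MeasurableSpace α] {μ : Measure α} {a b c : α → ℝ}
    (ha : MemLp a 2 μ) (hb : AllLp μ b) (hc : AllLp μ c) :
    ∫ x, a x * (b x * c x) ∂μ ≤
      √(∫ x, a x ^ 2 ∂μ) * (√√(∫ x, b x ^ 4 ∂μ) * √√(∫ x, c x ^ 4 ∂μ)) := by
  refine (integral_mul_le_sqrt ha (hb.mul hc).memLp_two).trans ?_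
  gcongr
  rw [← Real.sqrt_mul (Real.sqrt_nonneg _)]
  refine Real.sqrt_le_sqrt ?_
  have := integral_mul_le_sqrt (hb.pow 2 (by omega)).memLp_two (hc.pow 2 (by omega)).memLp_two
  simpa only [mul_pow, ← pow_mul] using this

/-! ### Members of `V` and of `H` as functions -/

lemma memLp_norm_H (u : H L₁ L₂) : MemLp (fun x => ‖u x‖) 2 (rectMeasure L₁ L₂) :=
  (Lp.memLp u).norm

/-- The iterated inequality reaches the even exponent `2(k+1) ≥ q`, and finiteness of the measure
gives all smaller exponents. -/
lemma allLp_toH (w : V L₁ L₂) : AllLp (rectMeasure L₁ L₂) fun x => ‖toH w x‖ := fun q => by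
  obtain ⟨k, hk⟩ := exists_nat_ge q
  obtain ⟨C, hC⟩ := lintegral_pow_V (L₁ := L₁) (L₂ := L₂) k
  have h : MemLp (toH w) ((2 * (k + 1) : ℕ) : ℝ≥0∞) (rectMeasure L₁ L₂) := by
    refine ⟨Lp.aestronglyMeasurable _, ?_⟩
    rw [eLpNorm_lt_top_iff_lintegral_rpow_enorm_lt_top (by simp) (ENNReal.natCast_ne_top _)]
    have := (hC w).trans_lt (by finiteness)
    simpa only [ENNReal.toReal_natCast, ENNReal.rpow_natCast] using this
  refine (h.mono_exponent ?_).norm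
  have h2 : q ≤ ((2 * (k + 1) : ℕ) : ℝ≥0) := hk.trans (by exact_mod_cast by omega)
  exact_mod_cast (ENNReal.coe_le_coe.2 h2)

lemma integral_pow_V (k : ℕ) : ∃ C : ℝ, 0 ≤ C ∧ ∀ w : V L₁ L₂,
    ∫ x in rect L₁ L₂, ‖toH w x‖ ^ (2 * (k + 1)) ≤ C * (‖toH w‖ ^ 2 * gradSq w ^ k) := by
  obtain ⟨C, hC⟩ := lintegral_pow_V (L₁ := L₁) (L₂ := L₂) k
  refine ⟨C, C.2, fun w => ?_⟩
  have hr : C * (‖toH w‖ ^ 2 * gradSq w ^ k) =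
      ((C : ℝ≥0∞) * ‖toH w‖ₑ ^ 2 * (‖d₁ w‖ₑ ^ 2 + ‖d₂ w‖ₑ ^ 2) ^ k).toReal := by
    rw [ENNReal.toReal_mul, ENNReal.toReal_mul, ENNReal.toReal_pow, ENNReal.toReal_pow,
      ENNReal.toReal_add (by finiteness) (by finiteness), ENNReal.toReal_pow, ENNReal.toReal_pow,
      toReal_enorm, toReal_enorm, toReal_enorm, gradSq, mul_assoc]
    rfl
  rw [hr, integral_eq_lintegral_of_nonneg_ae (Eventually.of_forall fun x => by positivity)
    ((allLp_toH w).pow _ (by omega) 1).1]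
  refine ENNReal.toReal_mono (by finiteness) (le_trans (le_of_eq ?_) (hC w))
  refine lintegral_congr fun x => ?_
  rw [ENNReal.ofReal_pow (norm_nonneg _), ofReal_norm]

lemma integral_pow_le_norm (k : ℕ) : ∃ C : ℝ, 0 ≤ C ∧ ∀ w : V L₁ L₂,
    ∫ x in rect L₁ L₂, ‖toH w x‖ ^ (2 * (k + 1)) ≤ C * ‖w‖ ^ (2 * (k + 1)) := by
  obtain ⟨C, hC0, hC⟩ := integral_pow_V (L₁ := L₁) (L₂ := L₂) k
  refine ⟨C, hC0, fun w => (hC w).trans ?_⟩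
  gcongr
  calc ‖toH w‖ ^ 2 * gradSq w ^ k ≤ ‖w‖ ^ 2 * (‖w‖ ^ 2) ^ k := by
        gcongr
        · exact pow_nonneg (gradSq_nonneg w) _
        · exact norm_toH_le w
        · exact gradSq_nonneg w
        · exact gradSq_le w
    _ = _ := by ring

lemma sqrt_sqrt_le_of_le {x C y : ℝ} (hC : 0 ≤ C) (hy : 0 ≤ y) (h : x ≤ C * y ^ 4) :
    √√x ≤ √√C * y := by
  have e : √√(C * y ^ 4) = √√C * y := by
    rw [Real.sqrt_mul hC, show y ^ 4 = (y ^ 2) ^ 2 by ring, Real.sqrt_sq (by positivity),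
      Real.sqrt_mul (Real.sqrt_nonneg _), Real.sqrt_sq hy]
  rw [← e]
  exact Real.sqrt_le_sqrt (Real.sqrt_le_sqrt h)

/-- The `L⁴` norm is controlled by the norm of `V`. -/
lemma sqrt_sqrt_integral_le : ∃ C : ℝ, 0 ≤ C ∧ ∀ w : V L₁ L₂,
    √√(∫ x in rect L₁ L₂, ‖toH w x‖ ^ 4) ≤ C * ‖w‖ := by
  obtain ⟨C, hC0, hC⟩ := integral_pow_le_norm (L₁ := L₁) (L₂ := L₂) 1
  exact ⟨√√C, by positivity, fun w => sqrt_sqrt_le_of_le hC0 (norm_nonneg _) (by simpa using hC w)⟩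

lemma exists_integral_rpow_le (L₁ L₂ : ℝ) {q : ℝ} (hq : 0 ≤ q) (R : ℝ) : ∃ C : ℝ, 0 ≤ C ∧
    ∀ w : V L₁ L₂, ‖w‖ ≤ R → ∫ x in rect L₁ L₂, ‖toH w x‖ ^ q ≤ C := by
  obtain ⟨k, hk⟩ := exists_nat_ge q
  obtain ⟨C, hC0, hC⟩ := integral_pow_le_norm (L₁ := L₁) (L₂ := L₂) k
  refine ⟨(rectMeasure L₁ L₂).real univ + C * |R| ^ (2 * (k + 1)), by positivity, fun w hw => ?_⟩
  have hi := (allLp_toH w).pow (2 * (k + 1)) (by omega)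
  calc ∫ x in rect L₁ L₂, ‖toH w x‖ ^ q
      ≤ ∫ x in rect L₁ L₂, (1 + ‖toH w x‖ ^ (2 * (k + 1))) := by
        refine integral_mono ((allLp_toH w).rpow (fun x => norm_nonneg _) hq).integrable
          ((AllLp.const 1).add hi).integrable fun x => ?_
        dsimp only
        rcases le_total ‖toH w x‖ 1 with h | h
        · exact (Real.rpow_le_one (norm_nonneg _) h hq).trans
            (le_add_of_nonneg_right (by positivity))
        · rw [← Real.rpow_natCast ‖toH w x‖]
          exact (Real.rpow_le_rpow_of_exponent_le h (by push_cast; linarith)).trans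
            (le_add_of_nonneg_left zero_le_one)
    _ = (rectMeasure L₁ L₂).real univ + ∫ x in rect L₁ L₂, ‖toH w x‖ ^ (2 * (k + 1)) := by
        rw [integral_add (integrable_const _) hi.integrable]
        simp
    _ ≤ _ := by
        gcongr
        refine (hC w).trans ?_
        gcongr
        exact hw.trans (le_abs_self R)

/-- The pointwise size of the gradient. -/
def gradN (w : V L₁ L₂) (x : ℝ × ℝ) : ℝ := ‖d₁ w x‖ + ‖d₂ w x‖


lemma memLp_gradN (w : V L₁ L₂) : MemLp (gradN w) 2 (rectMeasure L₁ L₂) :=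
  (memLp_norm_H _).add (memLp_norm_H _)

lemma integral_gradN_sq_le (w : V L₁ L₂) :
    ∫ x in rect L₁ L₂, gradN w x ^ 2 ≤ 2 * gradSq w := by
  rw [gradSq, norm_sq_H, norm_sq_H, ← integral_add (memLp_norm_H _).integrable_sq
    (memLp_norm_H _).integrable_sq, ← integral_const_mul]
  refine integral_mono (memLp_gradN w).integrable_sq
    (((memLp_norm_H _).integrable_sq.add (memLp_norm_H _).integrable_sq).const_mul 2) fun x => ?_
  simp only [gradN]
  nlinarith [sq_nonneg (‖d₁ w x‖ - ‖d₂ w x‖)]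

lemma sqrt_integral_gradN_sq_le (w : V L₁ L₂) :
    √(∫ x in rect L₁ L₂, gradN w x ^ 2) ≤ 2 * ‖w‖ := by
  rw [Real.sqrt_le_left (by positivity)]
  have := integral_gradN_sq_le w
  have := gradSq_le w
  nlinarith [sq_nonneg ‖w‖]

end SGGLE

namespace SGGLE

open Filter Topology
open scoped InnerProductSpace

variable {L₁ L₂ : ℝ}

/-! ### The drift with frozen coefficients -/

/-- The constants of the equation, with the standing assumptions on `σ` and `β`. -/
structure Params where
  σ : ℝ
  α : ℝ
  β : ℝ
  γ : ℝ
  l₁ : ℂ × ℂ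
  l₂ : ℂ × ℂ
  hσ : 2 < σ
  hc : 0 < ellip σ β

namespace Params

variable (𝔭 : Params)

lemma σ_pos : 0 < 𝔭.σ := by linarith [𝔭.hσ]
lemma one_lt_σ : 1 < 𝔭.σ := by linarith [𝔭.hσ]

end Params

/-- The pairing of `|w|^{2σ} w` with `ψ`. -/
def pairP (σ : ℝ) (w ψ : V L₁ L₂) : ℂ :=
  ∫ x in rect L₁ L₂, powMul σ (toH w x) * conj (toH ψ x)

/-- The pairing of the divergence part of the convective term with `ψ`. -/
def pairF₁ (l : ℂ × ℂ) (w ψ : V L₁ L₂) : ℂ :=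
  ∫ x in rect L₁ L₂, ((‖toH w x‖ : ℂ) ^ 2 * toH w x) *
      (l.1 * conj (d₁ ψ x) + l.2 * conj (d₂ ψ x))

/-- The pairing of the remaining part of the convective term with `ψ`. -/
def pairF₂ (l : ℂ × ℂ) (w ψ : V L₁ L₂) : ℂ :=
  ∫ x in rect L₁ L₂, (l.1 * d₁ w x + l.2 * d₂ w x) * (‖toH w x‖ : ℂ) ^ 2 * conj (toH ψ x)

/-- The drift after removal of the jump term by an integrating factor; `A₁` and `A₂` multiply the
power nonlinearity and the convective term. -/
def G (𝔭 : Params) (A₁ A₂ : ℝ) (w ψ : V L₁ L₂) : ℂ :=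
  pairA 𝔭.α w ψ - (1 - Complex.I * 𝔭.β) * (A₁ * pairP 𝔭.σ w ψ)
    + 𝔭.γ * ⟪toH ψ, toH w⟫_ℂ + A₂ * (pairF₂ 𝔭.l₂ w ψ - pairF₁ 𝔭.l₁ w ψ)

lemma pairF_eq (l₁ l₂ : ℂ × ℂ) (w ψ : V L₁ L₂) :
    pairF l₁ l₂ w ψ = pairF₂ l₂ w ψ - pairF₁ l₁ w ψ := by
  rw [pairF, pairF₁, pairF₂]; ring

lemma pairB_eq (σ β γ : ℝ) (l₁ l₂ : ℂ × ℂ) (w ψ : V L₁ L₂) :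
    pairB σ β γ l₁ l₂ w ψ = -(1 - Complex.I * β) * pairP σ w ψ + γ * ⟪toH ψ, toH w⟫_ℂ
      + (pairF₂ l₂ w ψ - pairF₁ l₁ w ψ) := by
  rw [pairB, pairF_eq, inner_H]
  rfl

lemma pairA_eq (α : ℝ) (w ψ : V L₁ L₂) :
    pairA α w ψ = -(1 + Complex.I * α) * (⟪d₁ ψ, d₁ w⟫_ℂ + ⟪d₂ ψ, d₂ w⟫_ℂ) := by
  rw [pairA, inner_H, inner_H, integral_add]
  · exact L2.integrable_inner (𝕜 := ℂ) (d₁ ψ) (d₁ w)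
  · exact L2.integrable_inner (𝕜 := ℂ) (d₂ ψ) (d₂ w)

lemma aesm (u : H L₁ L₂) : AEStronglyMeasurable u (rectMeasure L₁ L₂) := Lp.aestronglyMeasurable u

lemma aesm_conj (u : H L₁ L₂) :
    AEStronglyMeasurable (fun x => conj (u x)) (rectMeasure L₁ L₂) :=
  Complex.continuous_conj.comp_aestronglyMeasurable (aesm u)

lemma aesm_normC (u : H L₁ L₂) (n : ℕ) :
    AEStronglyMeasurable (fun x => (‖u x‖ : ℂ) ^ n) (rectMeasure L₁ L₂) :=
  (by fun_prop : Continuous fun z : ℂ => (‖z‖ : ℂ) ^ n).comp_aestronglyMeasurable (aesm u)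

lemma aesm_lin (l : ℂ × ℂ) (w : V L₁ L₂) :
    AEStronglyMeasurable (fun x => l.1 * d₁ w x + l.2 * d₂ w x) (rectMeasure L₁ L₂) :=
  ((aesm _).const_mul _).add ((aesm _).const_mul _)

lemma aesm_lin_conj (l : ℂ × ℂ) (w : V L₁ L₂) :
    AEStronglyMeasurable (fun x => l.1 * conj (d₁ w x) + l.2 * conj (d₂ w x))
      (rectMeasure L₁ L₂) :=
  ((aesm_conj _).const_mul _).add ((aesm_conj _).const_mul _)

/-- The size of a pair of coefficients. -/
def pairN (l : ℂ × ℂ) : ℝ := ‖l.1‖ + ‖l.2‖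

lemma pairN_nonneg (l : ℂ × ℂ) : 0 ≤ pairN l := by unfold pairN; positivity

lemma norm_lin_le (l : ℂ × ℂ) (a b : ℂ) : ‖l.1 * a + l.2 * b‖ ≤ pairN l * (‖a‖ + ‖b‖) := by
  refine (norm_add_le _ _).trans ?_
  rw [norm_mul, norm_mul, pairN]
  nlinarith [mul_nonneg (norm_nonneg l.1) (norm_nonneg b),
    mul_nonneg (norm_nonneg l.2) (norm_nonneg a)]

lemma norm_lin_conj_le (l : ℂ × ℂ) (a b : ℂ) :
    ‖l.1 * conj a + l.2 * conj b‖ ≤ pairN l * (‖a‖ + ‖b‖) := by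
  simpa using norm_lin_le l (conj a) (conj b)

lemma integrable_pairP {σ : ℝ} (hσ : 1 < σ) (w ψ : V L₁ L₂) :
    Integrable (fun x => powMul σ (toH w x) * conj (toH ψ x)) (rectMeasure L₁ L₂) := by
  refine Integrable.mono' (g := fun x => ‖toH w x‖ ^ (2 * σ + 1) * ‖toH ψ x‖)
    ((((allLp_toH w).rpow (fun x => norm_nonneg _) (by linarith)).mul (allLp_toH ψ)).integrable)
    (((contDiff_powMul hσ.le).continuous.comp_aestronglyMeasurable (aesm _)).mul (aesm_conj _))
    (Eventually.of_forall fun x => ?_)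
  rw [norm_mul, norm_powMul (by linarith), RCLike.norm_conj]

lemma integrable_pairF₁ (l : ℂ × ℂ) (w ψ : V L₁ L₂) :
    Integrable (fun x => ((‖toH w x‖ : ℂ) ^ 2 * toH w x) *
      (l.1 * conj (d₁ ψ x) + l.2 * conj (d₂ ψ x))) (rectMeasure L₁ L₂) := by
  refine Integrable.mono' (g := fun x => (pairN l * ‖toH w x‖ ^ 3) * gradN ψ x)
    ((((allLp_toH w).pow 3 (by omega)).const_mul _).mul_memLp_two (memLp_gradN ψ))
    (((aesm_normC _ 2).mul (aesm _)).mul (aesm_lin_conj l ψ))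
    (Eventually.of_forall fun x => ?_)
  rw [norm_mul, norm_mul, norm_pow, Complex.norm_real, norm_norm]
  have := norm_lin_conj_le l (d₁ ψ x) (d₂ ψ x)
  calc _ ≤ ‖toH w x‖ ^ 2 * ‖toH w x‖ * (pairN l * (‖d₁ ψ x‖ + ‖d₂ ψ x‖)) := by gcongr
    _ = _ := by rw [gradN]; ring

lemma integrable_pairF₂ (l : ℂ × ℂ) (w ψ : V L₁ L₂) :
    Integrable (fun x => (l.1 * d₁ w x + l.2 * d₂ w x) * (‖toH w x‖ : ℂ) ^ 2 *
      conj (toH ψ x)) (rectMeasure L₁ L₂) := by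
  refine Integrable.mono' (g := fun x => (pairN l * (‖toH w x‖ ^ 2 * ‖toH ψ x‖)) * gradN w x)
    (((((allLp_toH w).pow 2 (by omega)).mul (allLp_toH ψ)).const_mul _).mul_memLp_two
      (memLp_gradN w))
    (((aesm_lin l w).mul (aesm_normC _ 2)).mul (aesm_conj _))
    (Eventually.of_forall fun x => ?_)
  rw [norm_mul, norm_mul, norm_pow, Complex.norm_real, norm_norm, RCLike.norm_conj]
  have := norm_lin_le l (d₁ w x) (d₂ w x)
  calc _ ≤ (pairN l * (‖d₁ w x‖ + ‖d₂ w x‖)) * ‖toH w x‖ ^ 2 * ‖toH ψ x‖ := by gcongr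
    _ = _ := by rw [gradN]; ring

/-! ### Conjugate linearity in the test function -/

lemma pairP_add {σ : ℝ} (hσ : 1 < σ) (w ψ ψ' : V L₁ L₂) :
    pairP σ w (ψ + ψ') = pairP σ w ψ + pairP σ w ψ' := by
  rw [pairP, pairP, pairP, ← integral_add (integrable_pairP hσ w ψ) (integrable_pairP hσ w ψ')]
  refine integral_congr_ae ?_
  filter_upwards [Lp.coeFn_add (toH ψ) (toH ψ')] with x hx
  rw [toH_add, hx, Pi.add_apply, map_add, mul_add]

lemma pairP_smul (σ : ℝ) (w ψ : V L₁ L₂) (c : ℂ) :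
    pairP σ w (c • ψ) = conj c * pairP σ w ψ := by
  rw [pairP, pairP, ← integral_const_mul]
  refine integral_congr_ae ?_
  filter_upwards [Lp.coeFn_smul c (toH ψ)] with x hx
  rw [toH_smul, hx, Pi.smul_apply, smul_eq_mul, map_mul]
  ring

lemma pairF₁_add (l : ℂ × ℂ) (w ψ ψ' : V L₁ L₂) :
    pairF₁ l w (ψ + ψ') = pairF₁ l w ψ + pairF₁ l w ψ' := by
  rw [pairF₁, pairF₁, pairF₁,
    ← integral_add (integrable_pairF₁ l w ψ) (integrable_pairF₁ l w ψ')]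
  refine integral_congr_ae ?_
  filter_upwards [Lp.coeFn_add (d₁ ψ) (d₁ ψ'), Lp.coeFn_add (d₂ ψ) (d₂ ψ')] with x h1 h2
  rw [d₁_add, d₂_add, h1, h2, Pi.add_apply, Pi.add_apply, map_add, map_add]
  ring

lemma pairF₁_smul (l : ℂ × ℂ) (w ψ : V L₁ L₂) (c : ℂ) :
    pairF₁ l w (c • ψ) = conj c * pairF₁ l w ψ := by
  rw [pairF₁, pairF₁, ← integral_const_mul]
  refine integral_congr_ae ?_
  filter_upwards [Lp.coeFn_smul c (d₁ ψ), Lp.coeFn_smul c (d₂ ψ)] with x h1 h2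
  rw [d₁_smul, d₂_smul, h1, h2, Pi.smul_apply, Pi.smul_apply, smul_eq_mul, smul_eq_mul, map_mul,
    map_mul]
  ring

lemma pairF₂_add (l : ℂ × ℂ) (w ψ ψ' : V L₁ L₂) :
    pairF₂ l w (ψ + ψ') = pairF₂ l w ψ + pairF₂ l w ψ' := by
  rw [pairF₂, pairF₂, pairF₂,
    ← integral_add (integrable_pairF₂ l w ψ) (integrable_pairF₂ l w ψ')]
  refine integral_congr_ae ?_
  filter_upwards [Lp.coeFn_add (toH ψ) (toH ψ')] with x hx
  rw [toH_add, hx, Pi.add_apply, map_add, mul_add]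

lemma pairF₂_smul (l : ℂ × ℂ) (w ψ : V L₁ L₂) (c : ℂ) :
    pairF₂ l w (c • ψ) = conj c * pairF₂ l w ψ := by
  rw [pairF₂, pairF₂, ← integral_const_mul]
  refine integral_congr_ae ?_
  filter_upwards [Lp.coeFn_smul c (toH ψ)] with x hx
  rw [toH_smul, hx, Pi.smul_apply, smul_eq_mul, map_mul]
  ring

variable (𝔭 : Params)

lemma G_add (A₁ A₂ : ℝ) (w ψ ψ' : V L₁ L₂) :
    G 𝔭 A₁ A₂ w (ψ + ψ') = G 𝔭 A₁ A₂ w ψ + G 𝔭 A₁ A₂ w ψ' := by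
  simp only [G, pairA_eq, pairP_add 𝔭.one_lt_σ, pairF₁_add, pairF₂_add, toH_add, d₁_add, d₂_add,
    inner_add_left]
  ring

lemma G_smul (A₁ A₂ : ℝ) (w ψ : V L₁ L₂) (c : ℂ) :
    G 𝔭 A₁ A₂ w (c • ψ) = conj c * G 𝔭 A₁ A₂ w ψ := by
  simp only [G, pairA_eq, pairP_smul, pairF₁_smul, pairF₂_smul, toH_smul, d₁_smul, d₂_smul,
    inner_smul_left]
  ring

/-- The drift as a conjugate linear functional. -/
def driftForm (A₁ A₂ : ℝ) (w : V L₁ L₂) : V L₁ L₂ →ₗ⋆[ℂ] ℂ where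
  toFun := G 𝔭 A₁ A₂ w
  map_add' := G_add 𝔭 A₁ A₂ w
  map_smul' c ψ := G_smul 𝔭 A₁ A₂ w ψ c

lemma G_sub (A₁ A₂ : ℝ) (w ψ ψ' : V L₁ L₂) :
    G 𝔭 A₁ A₂ w (ψ - ψ') = G 𝔭 A₁ A₂ w ψ - G 𝔭 A₁ A₂ w ψ' :=
  map_sub (driftForm 𝔭 A₁ A₂ w) ψ ψ'

lemma G_sum {ι : Type*} (s : Finset ι) (A₁ A₂ : ℝ) (w : V L₁ L₂) (ψ : ι → V L₁ L₂) :
    G 𝔭 A₁ A₂ w (∑ i ∈ s, ψ i) = ∑ i ∈ s, G 𝔭 A₁ A₂ w (ψ i) :=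
  map_sum (driftForm 𝔭 A₁ A₂ w) ψ s

/-! ### Estimates of differences -/

lemma ae_toH_sub (w w' : V L₁ L₂) :
    ∀ᵐ x ∂rectMeasure L₁ L₂, toH (w - w') x = toH w x - toH w' x := Lp.coeFn_sub _ _
lemma ae_d₁_sub (w w' : V L₁ L₂) :
    ∀ᵐ x ∂rectMeasure L₁ L₂, d₁ (w - w') x = d₁ w x - d₁ w' x := Lp.coeFn_sub _ _
lemma ae_d₂_sub (w w' : V L₁ L₂) :
    ∀ᵐ x ∂rectMeasure L₁ L₂, d₂ (w - w') x = d₂ w x - d₂ w' x := Lp.coeFn_sub _ _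

/-- The weight `|w|^r + |w'|^r`. -/
def wt (r : ℝ) (w w' : V L₁ L₂) (x : ℝ × ℝ) : ℝ := ‖toH w x‖ ^ r + ‖toH w' x‖ ^ r

lemma wt_nonneg (r : ℝ) (w w' : V L₁ L₂) (x : ℝ × ℝ) : 0 ≤ wt r w w' x := by
  unfold wt; positivity

lemma allLp_wt {r : ℝ} (hr : 0 ≤ r) (w w' : V L₁ L₂) :
    AllLp (rectMeasure L₁ L₂) (wt r w w') :=
  ((allLp_toH w).rpow (fun _ => norm_nonneg _) hr).add
    ((allLp_toH w').rpow (fun _ => norm_nonneg _) hr)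

lemma norm_pairP_sub_le {σ : ℝ} (hσ : 1 < σ) (w w' ψ : V L₁ L₂) :
    ‖pairP σ w ψ - pairP σ w' ψ‖ ≤ ∫ x in rect L₁ L₂,
      (2 * σ + 1) * (wt (2 * σ) w w' x * (‖toH (w - w') x‖ * ‖toH ψ x‖)) := by
  rw [pairP, pairP, ← integral_sub (integrable_pairP hσ w ψ) (integrable_pairP hσ w' ψ)]
  refine norm_integral_le_of_norm_le ((((allLp_wt (by linarith) w w').mul
    ((allLp_toH _).mul (allLp_toH _))).const_mul _).integrable) ?_
  filter_upwards [ae_toH_sub w w'] with x hx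
  rw [← sub_mul, norm_mul, RCLike.norm_conj, hx]
  have := norm_powMul_sub_le hσ (toH w x) (toH w' x)
  calc _ ≤ (2 * σ + 1) * (‖toH w x‖ ^ (2 * σ) + ‖toH w' x‖ ^ (2 * σ)) * ‖toH w x - toH w' x‖ *
        ‖toH ψ x‖ := by gcongr
    _ = _ := by rw [wt]; ring

lemma norm_pairF₁_sub_le (l : ℂ × ℂ) (w w' ψ : V L₁ L₂) :
    ‖pairF₁ l w ψ - pairF₁ l w' ψ‖ ≤ ∫ x in rect L₁ L₂,
      2 * pairN l * (gradN ψ x * (wt 2 w w' x * ‖toH (w - w') x‖)) := by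
  rw [pairF₁, pairF₁, ← integral_sub (integrable_pairF₁ l w ψ) (integrable_pairF₁ l w' ψ)]
  refine norm_integral_le_of_norm_le (Integrable.const_mul ((memLp_gradN ψ).integrable_mul
    ((allLp_wt (by norm_num) w w').mul (allLp_toH _)).memLp_two) _) ?_
  filter_upwards [ae_toH_sub w w'] with x hx
  rw [← sub_mul, norm_mul, hx]
  have h1 := norm_cubic_sub_le (toH w x) (toH w' x)
  have h2 := norm_lin_conj_le l (d₁ ψ x) (d₂ ψ x)
  calc _ ≤ (2 * (‖toH w x‖ ^ 2 + ‖toH w' x‖ ^ 2) * ‖toH w x - toH w' x‖) *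
        (pairN l * (‖d₁ ψ x‖ + ‖d₂ ψ x‖)) := by gcongr
    _ = _ := by rw [wt, gradN, Real.rpow_two, Real.rpow_two]; ring

/-- The difference telescopes so that the gradient falls either on `w - w'`, with weight `|w|²`, or
on `w'`; the gradient of `w` by itself never appears. This asymmetry is what later allows `w` to be
a mere energy solution. -/
lemma norm_pairF₂_sub_le (l : ℂ × ℂ) (w w' ψ : V L₁ L₂) :
    ‖pairF₂ l w ψ - pairF₂ l w' ψ‖ ≤ pairN l * (∫ x in rect L₁ L₂,
        gradN (w - w') x * (‖toH w x‖ ^ 2 * ‖toH ψ x‖)) +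
      pairN l * ∫ x in rect L₁ L₂,
        gradN w' x * ((wt 1 w w' x * ‖toH (w - w') x‖) * ‖toH ψ x‖) := by
  have i1 : Integrable (fun x => gradN (w - w') x * (‖toH w x‖ ^ 2 * ‖toH ψ x‖))
      (rectMeasure L₁ L₂) := (memLp_gradN _).integrable_mul
    (((allLp_toH w).pow 2 (by omega)).mul (allLp_toH ψ)).memLp_two
  have i2 : Integrable (fun x => gradN w' x * ((wt 1 w w' x * ‖toH (w - w') x‖) * ‖toH ψ x‖))
      (rectMeasure L₁ L₂) := (memLp_gradN _).integrable_mul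
    (((allLp_wt (by norm_num) w w').mul (allLp_toH _)).mul (allLp_toH ψ)).memLp_two
  rw [pairF₂, pairF₂, ← integral_sub (integrable_pairF₂ l w ψ) (integrable_pairF₂ l w' ψ),
    ← mul_add, ← integral_add i1 i2, ← integral_const_mul]
  refine norm_integral_le_of_norm_le ((i1.add i2).const_mul _) ?_
  filter_upwards [ae_toH_sub w w', ae_d₁_sub w w', ae_d₂_sub w w'] with x h0 h1 h2
  have e : (l.1 * d₁ w x + l.2 * d₂ w x) * (‖toH w x‖ : ℂ) ^ 2 * conj (toH ψ x) -
      (l.1 * d₁ w' x + l.2 * d₂ w' x) * (‖toH w' x‖ : ℂ) ^ 2 * conj (toH ψ x) =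
      (l.1 * d₁ (w - w') x + l.2 * d₂ (w - w') x) * (‖toH w x‖ : ℂ) ^ 2 * conj (toH ψ x) +
      (l.1 * d₁ w' x + l.2 * d₂ w' x) * ((‖toH w x‖ : ℂ) ^ 2 - (‖toH w' x‖ : ℂ) ^ 2) *
        conj (toH ψ x) := by
    rw [h1, h2]; ring
  rw [e]
  refine (norm_add_le _ _).trans ?_
  rw [norm_mul, norm_mul, norm_mul, norm_mul, RCLike.norm_conj, norm_pow, Complex.norm_real,
    norm_norm, mul_add]
  have k1 := norm_lin_le l (d₁ (w - w') x) (d₂ (w - w') x)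
  have k2 := norm_lin_le l (d₁ w' x) (d₂ w' x)
  have k3 := abs_sq_norm_sub_le (toH w x) (toH w' x)
  refine add_le_add ?_ ?_
  · calc _ ≤ (pairN l * (‖d₁ (w - w') x‖ + ‖d₂ (w - w') x‖)) * ‖toH w x‖ ^ 2 * ‖toH ψ x‖ := by
          gcongr
      _ = _ := by rw [gradN]; ring
  · calc _ ≤ (pairN l * (‖d₁ w' x‖ + ‖d₂ w' x‖)) *
          ((‖toH w x‖ + ‖toH w' x‖) * ‖toH w x - toH w' x‖) * ‖toH ψ x‖ := by
          gcongr
          exact mul_nonneg (pairN_nonneg l) (by positivity)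
      _ = _ := by rw [gradN, wt, Real.rpow_one, Real.rpow_one, h0]; ring

end SGGLE

namespace SGGLE

open Filter Topology
open scoped InnerProductSpace

variable {L₁ L₂ : ℝ} (𝔭 : Params)

/-! ### Local Lipschitz continuity of the drift -/

lemma norm_d₁_le (w : V L₁ L₂) : ‖d₁ w‖ ≤ ‖w‖ :=
  abs_le_of_sq_le_sq' ((by unfold gradSq; nlinarith [sq_nonneg ‖d₂ w‖] :
    ‖d₁ w‖ ^ 2 ≤ gradSq w).trans (gradSq_le w)) (norm_nonneg _) |>.2

lemma norm_d₂_le (w : V L₁ L₂) : ‖d₂ w‖ ≤ ‖w‖ :=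
  abs_le_of_sq_le_sq' ((by unfold gradSq; nlinarith [sq_nonneg ‖d₁ w‖] :
    ‖d₂ w‖ ^ 2 ≤ gradSq w).trans (gradSq_le w)) (norm_nonneg _) |>.2

lemma integral_wt {r : ℝ} (hr : 0 ≤ r) (w w' : V L₁ L₂) :
    ∫ x in rect L₁ L₂, wt r w w' x =
      (∫ x in rect L₁ L₂, ‖toH w x‖ ^ r) + ∫ x in rect L₁ L₂, ‖toH w' x‖ ^ r :=
  integral_add ((allLp_toH w).rpow (fun _ => norm_nonneg _) hr).integrable
    ((allLp_toH w').rpow (fun _ => norm_nonneg _) hr).integrable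

lemma wt_sq_le (r : ℝ) (w w' : V L₁ L₂) (x : ℝ × ℝ) :
    wt r w w' x ^ 2 ≤ 2 * wt (2 * r) w w' x := by
  have h : ∀ a : ℝ, 0 ≤ a → a ^ (2 * r) = (a ^ r) ^ 2 := fun a ha => by
    rw [mul_comm, Real.rpow_mul ha, Real.rpow_two]
  rw [wt, wt, h _ (norm_nonneg _), h _ (norm_nonneg _)]
  nlinarith [sq_nonneg (‖toH w x‖ ^ r - ‖toH w' x‖ ^ r)]

lemma wt_pow_four_le (r : ℝ) (w w' : V L₁ L₂) (x : ℝ × ℝ) :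
    wt r w w' x ^ 4 ≤ 8 * wt (2 * (2 * r)) w w' x := by
  have h1 := wt_sq_le r w w' x
  have h2 := wt_sq_le (2 * r) w w' x
  have h3 : wt r w w' x ^ 4 = (wt r w w' x ^ 2) ^ 2 := by ring
  have h4 := pow_le_pow_left₀ (sq_nonneg _) h1 2
  rw [h3]
  nlinarith

/-- Bounds for weights on balls of `V`. -/
lemma exists_integral_wt_le (L₁ L₂ : ℝ) {r : ℝ} (hr : 0 ≤ r) (R : ℝ) : ∃ C : ℝ, 0 ≤ C ∧
    ∀ w w' : V L₁ L₂, ‖w‖ ≤ R → ‖w'‖ ≤ R → ∫ x in rect L₁ L₂, wt r w w' x ≤ C := by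
  obtain ⟨C, hC0, hC⟩ := exists_integral_rpow_le L₁ L₂ hr R
  refine ⟨C + C, by positivity, fun w w' hw hw' => ?_⟩
  rw [integral_wt hr]
  exact add_le_add (hC w hw) (hC w' hw')

/-- Hölder with exponents 2, 4, 4: on a ball of `V` the weight is bounded in `L²`, and the `L⁴`
norms of `w - w'` and `ψ` are controlled by their norms in `V`. -/
lemma exists_norm_pairP_sub_le (L₁ L₂ : ℝ) {σ : ℝ} (hσ : 1 < σ) (R : ℝ) : ∃ C : ℝ, 0 ≤ C ∧
    ∀ w w' ψ : V L₁ L₂, ‖w‖ ≤ R → ‖w'‖ ≤ R →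
      ‖pairP σ w ψ - pairP σ w' ψ‖ ≤ C * ‖w - w'‖ * ‖ψ‖ := by
  obtain ⟨B, hB0, hB⟩ := exists_integral_wt_le L₁ L₂ (r := 2 * (2 * σ)) (by linarith) R
  obtain ⟨C, hC0, hC⟩ := sqrt_sqrt_integral_le (L₁ := L₁) (L₂ := L₂)
  refine ⟨(2 * σ + 1) * (√(2 * B) * (C * C)), by positivity, fun w w' ψ hw hw' => ?_⟩
  refine (norm_pairP_sub_le hσ w w' ψ).trans ?_
  rw [integral_const_mul]
  have hwt := allLp_wt (r := 2 * σ) (by linarith) w w'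
  have h := integral_mul_mul_le_sqrt hwt.memLp_two (allLp_toH (w - w')) (allLp_toH ψ)
  have h2 : ∫ x in rect L₁ L₂, wt (2 * σ) w w' x ^ 2 ≤ 2 * B := by
    refine (integral_mono (hwt.pow 2 (by omega)).integrable
      ((allLp_wt (by linarith) w w').const_mul 2).integrable (wt_sq_le _ w w')).trans ?_
    rw [integral_const_mul]
    linarith [hB w w' hw hw']
  calc _ ≤ (2 * σ + 1) * (√(2 * B) * ((C * ‖w - w'‖) * (C * ‖ψ‖))) := by
        refine mul_le_mul_of_nonneg_left (h.trans ?_) (by positivity)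
        gcongr
        · exact hC _
        · exact hC _
    _ = _ := by ring

lemma exists_norm_pairF₁_sub_le (L₁ L₂ : ℝ) (l : ℂ × ℂ) (R : ℝ) : ∃ C : ℝ, 0 ≤ C ∧
    ∀ w w' ψ : V L₁ L₂, ‖w‖ ≤ R → ‖w'‖ ≤ R →
      ‖pairF₁ l w ψ - pairF₁ l w' ψ‖ ≤ C * ‖w - w'‖ * ‖ψ‖ := by
  obtain ⟨B, hB0, hB⟩ := exists_integral_wt_le L₁ L₂ (r := 2 * (2 * 2)) (by norm_num) R
  obtain ⟨C, hC0, hC⟩ := sqrt_sqrt_integral_le (L₁ := L₁) (L₂ := L₂)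
  refine ⟨2 * pairN l * (2 * (√√(8 * B) * C)),
    mul_nonneg (mul_nonneg zero_le_two (pairN_nonneg l)) (by positivity), fun w w' ψ hw hw' => ?_⟩
  refine (norm_pairF₁_sub_le l w w' ψ).trans ?_
  rw [integral_const_mul]
  have hwt := allLp_wt (r := 2) (by norm_num) w w'
  have h := integral_mul_mul_le_sqrt (memLp_gradN ψ) hwt (allLp_toH (w - w'))
  have h2 : ∫ x in rect L₁ L₂, wt 2 w w' x ^ 4 ≤ 8 * B := by
    refine (integral_mono (hwt.pow 4 (by omega)).integrable
      ((allLp_wt (by norm_num) w w').const_mul 8).integrable (wt_pow_four_le _ w w')).trans ?_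
    rw [integral_const_mul]
    linarith [hB w w' hw hw']
  calc _ ≤ 2 * pairN l * ((2 * ‖ψ‖) * (√√(8 * B) * (C * ‖w - w'‖))) := by
        refine mul_le_mul_of_nonneg_left (h.trans ?_)
          (mul_nonneg zero_le_two (pairN_nonneg l))
        gcongr
        · exact sqrt_integral_gradN_sq_le ψ
        · exact hC _
    _ = _ := by ring

lemma exists_norm_pairF₂_sub_le (L₁ L₂ : ℝ) (l : ℂ × ℂ) (R : ℝ) : ∃ C : ℝ, 0 ≤ C ∧
    ∀ w w' ψ : V L₁ L₂, ‖w‖ ≤ R → ‖w'‖ ≤ R →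
      ‖pairF₂ l w ψ - pairF₂ l w' ψ‖ ≤ C * ‖w - w'‖ * ‖ψ‖ := by
  obtain ⟨B, hB0, hB⟩ := exists_integral_rpow_le L₁ L₂ (q := 8) (by norm_num) R
  obtain ⟨B', hB0', hB'⟩ := exists_integral_wt_le L₁ L₂ (r := 2 * (2 * 2)) (by norm_num) R
  obtain ⟨C, hC0, hC⟩ := sqrt_sqrt_integral_le (L₁ := L₁) (L₂ := L₂)
  obtain ⟨C8, hC80, hC8⟩ := integral_pow_le_norm (L₁ := L₁) (L₂ := L₂) 3
  have hN := pairN_nonneg l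
  refine ⟨pairN l * (2 * (√√B * C)) + pairN l * (2 * |R| * ((√√(8 * √(2 * B')) * √√√C8) * C)),
    by positivity, fun w w' ψ hw hw' => ?_⟩
  refine (norm_pairF₂_sub_le l w w' ψ).trans ?_
  have h1 : ∫ x in rect L₁ L₂, gradN (w - w') x * (‖toH w x‖ ^ 2 * ‖toH ψ x‖) ≤
      (2 * ‖w - w'‖) * (√√B * (C * ‖ψ‖)) := by
    refine (integral_mul_mul_le_sqrt (memLp_gradN _) ((allLp_toH w).pow 2 (by omega))
      (allLp_toH ψ)).trans ?_
    gcongr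
    · exact sqrt_integral_gradN_sq_le _
    · refine le_trans (le_of_eq ?_) (hB w hw)
      refine integral_congr_ae (Eventually.of_forall fun x => ?_)
      dsimp only
      rw [← pow_mul, ← Real.rpow_natCast]
      norm_num
    · exact hC _
  have h2 : ∫ x in rect L₁ L₂, (wt 1 w w' x * ‖toH (w - w') x‖) ^ 4 ≤
      (8 * √(2 * B') * √C8) * ‖w - w'‖ ^ 4 := by
    have hwt := allLp_wt (r := 1) (by norm_num) w w'
    have hz := allLp_toH (w - w')
    have k1 : ∫ x in rect L₁ L₂, wt (2 * (2 * 1)) w w' x * ‖toH (w - w') x‖ ^ 4 ≤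
        √(2 * B') * √(C8 * ‖w - w'‖ ^ 8) := by
      refine (integral_mul_le_sqrt (allLp_wt (by norm_num) w w').memLp_two
        (hz.pow 4 (by omega)).memLp_two).trans ?_
      gcongr
      · refine (integral_mono ((allLp_wt (by norm_num) w w').pow 2 (by omega)).integrable
          ((allLp_wt (by norm_num) w w').const_mul 2).integrable
          (wt_sq_le (2 * (2 * 1)) w w')).trans ?_
        rw [integral_const_mul]
        have := hB' w w' hw hw'
        norm_num at this ⊢
        linarith
      · simpa only [← pow_mul] using hC8 (w - w')
    have e8 : √(C8 * ‖w - w'‖ ^ 8) = √C8 * ‖w - w'‖ ^ 4 := by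
      rw [Real.sqrt_mul hC80, show ‖w - w'‖ ^ 8 = (‖w - w'‖ ^ 4) ^ 2 by ring,
        Real.sqrt_sq (by positivity)]
    have hi1 := (hwt.mul hz).pow 4 (by omega)
    have hi2 := ((allLp_wt (r := 2 * (2 * 1)) (by norm_num) w w').mul
      (hz.pow 4 (by omega))).const_mul 8
    calc _ ≤ ∫ x in rect L₁ L₂, 8 * (wt (2 * (2 * 1)) w w' x * ‖toH (w - w') x‖ ^ 4) := by
          refine integral_mono hi1.integrable hi2.integrable fun x => ?_
          dsimp only
          rw [mul_pow, ← mul_assoc]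
          exact mul_le_mul_of_nonneg_right (wt_pow_four_le 1 w w' x) (by positivity)
      _ ≤ 8 * (√(2 * B') * (√C8 * ‖w - w'‖ ^ 4)) := by
          rw [integral_const_mul, ← e8]; gcongr
      _ = _ := by ring
  have h3 : ∫ x in rect L₁ L₂, gradN w' x * ((wt 1 w w' x * ‖toH (w - w') x‖) * ‖toH ψ x‖) ≤
      (2 * |R|) * (((√√(8 * √(2 * B')) * √√√C8) * ‖w - w'‖) * (C * ‖ψ‖)) := by
    refine (integral_mul_mul_le_sqrt (memLp_gradN _)
      ((allLp_wt (by norm_num) w w').mul (allLp_toH _)) (allLp_toH ψ)).trans ?_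
    gcongr
    · exact (sqrt_integral_gradN_sq_le _).trans (by gcongr; exact hw'.trans (le_abs_self R))
    · refine (sqrt_sqrt_le_of_le (by positivity) (norm_nonneg _) h2).trans (le_of_eq ?_)
      rw [Real.sqrt_mul (by positivity), Real.sqrt_mul (by positivity)]
    · exact hC _
  calc _ ≤ pairN l * ((2 * ‖w - w'‖) * (√√B * (C * ‖ψ‖))) +
        pairN l * ((2 * |R|) * (((√√(8 * √(2 * B')) * √√√C8) * ‖w - w'‖) * (C * ‖ψ‖))) := by gcongr
    _ = _ := by ring

lemma pairA_sub_left (α : ℝ) (w w' ψ : V L₁ L₂) :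
    pairA α w ψ - pairA α w' ψ = pairA α (w - w') ψ := by
  simp only [pairA_eq, d₁_sub, d₂_sub, inner_sub_right]
  ring

lemma norm_pairA_le (α : ℝ) (w ψ : V L₁ L₂) :
    ‖pairA α w ψ‖ ≤ 2 * (1 + |α|) * (‖w‖ * ‖ψ‖) := by
  rw [pairA_eq, norm_mul, norm_neg]
  have h1 : ‖(1 : ℂ) + Complex.I * α‖ ≤ 1 + |α| := by
    refine (norm_add_le _ _).trans ?_
    simp
  have h2 : ‖⟪d₁ ψ, d₁ w⟫_ℂ‖ ≤ ‖w‖ * ‖ψ‖ := by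
    rw [mul_comm]
    exact (norm_inner_le_norm _ _).trans (mul_le_mul (norm_d₁_le ψ) (norm_d₁_le w)
      (norm_nonneg _) (norm_nonneg _))
  have h3 : ‖⟪d₂ ψ, d₂ w⟫_ℂ‖ ≤ ‖w‖ * ‖ψ‖ := by
    rw [mul_comm]
    exact (norm_inner_le_norm _ _).trans (mul_le_mul (norm_d₂_le ψ) (norm_d₂_le w)
      (norm_nonneg _) (norm_nonneg _))
  calc _ ≤ (1 + |α|) * (‖w‖ * ‖ψ‖ + ‖w‖ * ‖ψ‖) := by
        gcongr
        exact (norm_add_le _ _).trans (add_le_add h2 h3)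
    _ = _ := by ring

lemma G_zero_left (A₁ A₂ : ℝ) (ψ : V L₁ L₂) : G 𝔭 A₁ A₂ 0 ψ = 0 := by
  have h0 : ∀ᵐ x ∂rectMeasure L₁ L₂, toH (0 : V L₁ L₂) x = 0 := Lp.coeFn_zero _ _ _
  have h1 : pairP 𝔭.σ (0 : V L₁ L₂) ψ = 0 := by
    rw [pairP]
    refine integral_eq_zero_of_ae ?_
    filter_upwards [h0] with x hx
    rw [hx, powMul_zero, zero_mul, Pi.zero_apply]
  have h2 : pairF₁ 𝔭.l₁ (0 : V L₁ L₂) ψ = 0 := by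
    rw [pairF₁]
    refine integral_eq_zero_of_ae ?_
    filter_upwards [h0] with x hx
    rw [hx, mul_zero, zero_mul, Pi.zero_apply]
  have h3 : pairF₂ 𝔭.l₂ (0 : V L₁ L₂) ψ = 0 := by
    rw [pairF₂]
    refine integral_eq_zero_of_ae ?_
    filter_upwards [h0] with x hx
    rw [hx, norm_zero, Complex.ofReal_zero, zero_pow two_ne_zero, mul_zero, zero_mul, Pi.zero_apply]
  simp [G, pairA_eq, h1, h2, h3]

lemma G_sub_left (A₁ A₂ : ℝ) (w w' ψ : V L₁ L₂) :
    G 𝔭 A₁ A₂ w ψ - G 𝔭 A₁ A₂ w' ψ = pairA 𝔭.α (w - w') ψ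
      - (1 - Complex.I * 𝔭.β) * (A₁ * (pairP 𝔭.σ w ψ - pairP 𝔭.σ w' ψ))
      + 𝔭.γ * ⟪toH ψ, toH (w - w')⟫_ℂ
      + A₂ * ((pairF₂ 𝔭.l₂ w ψ - pairF₂ 𝔭.l₂ w' ψ) - (pairF₁ 𝔭.l₁ w ψ - pairF₁ 𝔭.l₁ w' ψ)) := by
  rw [← pairA_sub_left, toH_sub, inner_sub_right, G, G]
  ring

lemma exists_norm_G_sub_le (L₁ L₂ R M : ℝ) : ∃ C : ℝ, 0 ≤ C ∧
    ∀ A₁ A₂ : ℝ, |A₁| ≤ M → |A₂| ≤ M → ∀ w w' ψ : V L₁ L₂, ‖w‖ ≤ R → ‖w'‖ ≤ R →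
      ‖G 𝔭 A₁ A₂ w ψ - G 𝔭 A₁ A₂ w' ψ‖ ≤ C * ‖w - w'‖ * ‖ψ‖ := by
  obtain ⟨CP, hCP0, hCP⟩ := exists_norm_pairP_sub_le L₁ L₂ 𝔭.one_lt_σ R
  obtain ⟨C1, hC10, hC1⟩ := exists_norm_pairF₁_sub_le L₁ L₂ 𝔭.l₁ R
  obtain ⟨C2, hC20, hC2⟩ := exists_norm_pairF₂_sub_le L₁ L₂ 𝔭.l₂ R
  refine ⟨2 * (1 + |𝔭.α|) + ‖1 - Complex.I * 𝔭.β‖ * (|M| * CP) + |𝔭.γ| + |M| * (C2 + C1),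
    by positivity, fun A₁ A₂ h₁ h₂ w w' ψ hw hw' => ?_⟩
  have hA : ∀ a : ℝ, |a| ≤ M → ‖(a : ℂ)‖ ≤ |M| := fun a ha => by
    rw [Complex.norm_real]; exact ha.trans (le_abs_self M)
  rw [G_sub_left]
  have e1 := norm_pairA_le 𝔭.α (w - w') ψ
  have e2 : ‖(1 - Complex.I * 𝔭.β) * (A₁ * (pairP 𝔭.σ w ψ - pairP 𝔭.σ w' ψ))‖ ≤
      ‖1 - Complex.I * 𝔭.β‖ * (|M| * (CP * ‖w - w'‖ * ‖ψ‖)) := by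
    rw [norm_mul, norm_mul]
    gcongr
    · exact hA A₁ h₁
    · exact hCP w w' ψ hw hw'
  have e3 : ‖(𝔭.γ : ℂ) * ⟪toH ψ, toH (w - w')⟫_ℂ‖ ≤ |𝔭.γ| * (‖w - w'‖ * ‖ψ‖) := by
    rw [norm_mul, Complex.norm_real, Real.norm_eq_abs]
    gcongr
    rw [mul_comm]
    exact (norm_inner_le_norm _ _).trans (mul_le_mul (norm_toH_le _) (norm_toH_le _)
      (norm_nonneg _) (norm_nonneg _))
  have e4 : ‖(A₂ : ℂ) * ((pairF₂ 𝔭.l₂ w ψ - pairF₂ 𝔭.l₂ w' ψ)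
      - (pairF₁ 𝔭.l₁ w ψ - pairF₁ 𝔭.l₁ w' ψ))‖ ≤
      |M| * (C2 * ‖w - w'‖ * ‖ψ‖ + C1 * ‖w - w'‖ * ‖ψ‖) := by
    rw [norm_mul]
    gcongr
    · exact hA A₂ h₂
    · exact (norm_sub_le _ _).trans (add_le_add (hC2 w w' ψ hw hw') (hC1 w w' ψ hw hw'))
  refine (norm_add_le _ _).trans ((add_le_add ((norm_add_le _ _).trans
    (add_le_add ((norm_sub_le _ _).trans (add_le_add e1 e2)) e3)) e4).trans (le_of_eq ?_))
  ring

lemma exists_norm_G_le (L₁ L₂ R M : ℝ) : ∃ C : ℝ, 0 ≤ C ∧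
    ∀ A₁ A₂ : ℝ, |A₁| ≤ M → |A₂| ≤ M → ∀ w ψ : V L₁ L₂, ‖w‖ ≤ R →
      ‖G 𝔭 A₁ A₂ w ψ‖ ≤ C * ‖ψ‖ := by
  obtain ⟨C, hC0, hC⟩ := exists_norm_G_sub_le 𝔭 L₁ L₂ |R| M
  refine ⟨C * |R|, by positivity, fun A₁ A₂ h₁ h₂ w ψ hw => ?_⟩
  have hw' := hw.trans (le_abs_self R)
  have h := hC A₁ A₂ h₁ h₂ w 0 ψ hw' (by simp)
  rw [G_zero_left, sub_zero, sub_zero] at h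
  exact h.trans (by gcongr)

/-- The drift is jointly continuous. -/
lemma continuous_G : Continuous fun p : (ℝ × ℝ) × (V L₁ L₂ × V L₁ L₂) =>
    G 𝔭 p.1.1 p.1.2 p.2.1 p.2.2 := by
  rw [continuous_iff_continuousAt]
  rintro ⟨⟨a₁, a₂⟩, ⟨w, ψ⟩⟩
  obtain ⟨C, hC0, hC⟩ := exists_norm_G_sub_le 𝔭 L₁ L₂ (‖w‖ + 1) (max |a₁| |a₂| + 1)
  obtain ⟨C', hC0', hC'⟩ := exists_norm_G_le 𝔭 L₁ L₂ (‖w‖ + 1) (max |a₁| |a₂| + 1)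
  have hG : Tendsto (fun p : (ℝ × ℝ) × (V L₁ L₂ × V L₁ L₂) => G 𝔭 p.1.1 p.1.2 w ψ)
      (𝓝 ((a₁, a₂), (w, ψ))) (𝓝 (G 𝔭 a₁ a₂ w ψ)) := by
    have : Continuous fun p : (ℝ × ℝ) × (V L₁ L₂ × V L₁ L₂) => G 𝔭 p.1.1 p.1.2 w ψ := by
      unfold G; fun_prop
    exact this.tendsto _
  have hsq : Tendsto (fun p : (ℝ × ℝ) × (V L₁ L₂ × V L₁ L₂) =>
      C' * ‖p.2.2 - ψ‖ + C * ‖p.2.1 - w‖ * ‖ψ‖) (𝓝 ((a₁, a₂), (w, ψ))) (𝓝 0) := by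
    have : Continuous fun p : (ℝ × ℝ) × (V L₁ L₂ × V L₁ L₂) =>
      C' * ‖p.2.2 - ψ‖ + C * ‖p.2.1 - w‖ * ‖ψ‖ := by fun_prop
    simpa using this.tendsto ((a₁, a₂), (w, ψ))
  have hdiff : Tendsto (fun p : (ℝ × ℝ) × (V L₁ L₂ × V L₁ L₂) =>
      G 𝔭 p.1.1 p.1.2 p.2.1 p.2.2 - G 𝔭 p.1.1 p.1.2 w ψ) (𝓝 ((a₁, a₂), (w, ψ))) (𝓝 0) := by
    refine squeeze_zero_norm' ?_ hsq
    have n1 : ∀ᶠ p : (ℝ × ℝ) × (V L₁ L₂ × V L₁ L₂) in 𝓝 ((a₁, a₂), (w, ψ)), |p.1.1| < |a₁| + 1 :=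
      (by fun_prop : Continuous fun p : (ℝ × ℝ) × (V L₁ L₂ × V L₁ L₂) => |p.1.1|).tendsto _
        |>.eventually (gt_mem_nhds (by simp))
    have n2 : ∀ᶠ p : (ℝ × ℝ) × (V L₁ L₂ × V L₁ L₂) in 𝓝 ((a₁, a₂), (w, ψ)), |p.1.2| < |a₂| + 1 :=
      (by fun_prop : Continuous fun p : (ℝ × ℝ) × (V L₁ L₂ × V L₁ L₂) => |p.1.2|).tendsto _
        |>.eventually (gt_mem_nhds (by simp))
    have n3 : ∀ᶠ p : (ℝ × ℝ) × (V L₁ L₂ × V L₁ L₂) in 𝓝 ((a₁, a₂), (w, ψ)), ‖p.2.1‖ < ‖w‖ + 1 :=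
      (by fun_prop : Continuous fun p : (ℝ × ℝ) × (V L₁ L₂ × V L₁ L₂) => ‖p.2.1‖).tendsto _
        |>.eventually (gt_mem_nhds (by simp))
    filter_upwards [n1, n2, n3] with p h1 h2 h3
    have b1 : |p.1.1| ≤ max |a₁| |a₂| + 1 := h1.le.trans (by gcongr; exact le_max_left _ _)
    have b2 : |p.1.2| ≤ max |a₁| |a₂| + 1 := h2.le.trans (by gcongr; exact le_max_right _ _)
    have e : G 𝔭 p.1.1 p.1.2 p.2.1 p.2.2 - G 𝔭 p.1.1 p.1.2 w ψ =
        G 𝔭 p.1.1 p.1.2 p.2.1 (p.2.2 - ψ) + (G 𝔭 p.1.1 p.1.2 p.2.1 ψ - G 𝔭 p.1.1 p.1.2 w ψ) := by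
      rw [G_sub]; ring
    rw [e]
    exact (norm_add_le _ _).trans (add_le_add (hC' _ _ b1 b2 _ _ h3.le)
      (hC _ _ b1 b2 _ _ _ h3.le (by linarith)))
  have := hdiff.add hG
  simpa [ContinuousAt] using this

end SGGLE

namespace SGGLE

open Filter Topology
open scoped InnerProductSpace

variable {L₁ L₂ : ℝ} (𝔭 : Params)

/-! ### Local monotonicity -/

lemma pairA_self_re (α : ℝ) (z : V L₁ L₂) : (pairA α z z).re = -gradSq z := by
  rw [pairA_eq, gradSq, inner_self_eq_norm_sq_to_K, inner_self_eq_norm_sq_to_K]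
  have : ((‖d₁ z‖ : ℂ) ^ 2 + (‖d₂ z‖ : ℂ) ^ 2) = ((‖d₁ z‖ ^ 2 + ‖d₂ z‖ ^ 2 : ℝ) : ℂ) := by
    push_cast; rfl
  change (-(1 + Complex.I * α) * ((‖d₁ z‖ : ℂ) ^ 2 + (‖d₂ z‖ : ℂ) ^ 2)).re = _
  rw [this, Complex.re_mul_ofReal]
  simp

/-- The weighted `L²` norm of `w - w'` which measures the dissipation of the nonlinearity. -/
def wtSq (r : ℝ) (w w' : V L₁ L₂) : ℝ :=
  ∫ x in rect L₁ L₂, wt r w w' x * ‖toH (w - w') x‖ ^ 2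

lemma integrable_wtSq {r : ℝ} (hr : 0 ≤ r) (w w' : V L₁ L₂) :
    Integrable (fun x => wt r w w' x * ‖toH (w - w') x‖ ^ 2) (rectMeasure L₁ L₂) :=
  ((allLp_wt hr w w').mul ((allLp_toH _).pow 2 (by omega))).integrable

lemma wtSq_nonneg (r : ℝ) (w w' : V L₁ L₂) : 0 ≤ wtSq r w w' :=
  integral_nonneg fun x => mul_nonneg (wt_nonneg r w w' x) (sq_nonneg _)

lemma le_re_pairP_sub {σ β : ℝ} (hσ : 1 < σ) (hc : 0 ≤ ellip σ β) (w w' : V L₁ L₂) :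
    ellip σ β / (2 * (2 * σ + 1)) * wtSq (2 * σ) w w' ≤
      ((1 - Complex.I * β) * (pairP σ w (w - w') - pairP σ w' (w - w'))).re := by
  have hi := ((integrable_pairP hσ w (w - w')).sub (integrable_pairP hσ w' (w - w'))).const_mul
    (1 - Complex.I * β)
  rw [pairP, pairP, ← integral_sub (integrable_pairP hσ w _) (integrable_pairP hσ w' _),
    ← integral_const_mul, wtSq, ← integral_const_mul]
  refine le_trans ?_ (le_of_eq (integral_re hi))
  refine integral_mono_ae ((integrable_wtSq (by linarith) w w').const_mul _) hi.re ?_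
  filter_upwards [ae_toH_sub w w'] with x hx
  have := re_mul_powMul_sub_ge hσ hc (toH w x) (toH w' x)
  simp only [Pi.sub_apply, wt]
  rw [hx, ← sub_mul]
  refine le_trans (le_of_eq (by ring)) (this.trans (le_of_eq ?_))
  rw [mul_assoc]; rfl

/-- As `σ > 2`, the exponent `4` lies strictly below `2σ`, so the weight of order four created by
the convective terms is an arbitrarily small part of the dissipative weight plus a constant. -/
lemma wtSq_four_le {σ : ℝ} (hσ : 2 < σ) {η : ℝ} (hη : 0 < η) : ∃ C : ℝ, 0 ≤ C ∧
    ∀ w w' : V L₁ L₂, wtSq 4 w w' ≤ η * wtSq (2 * σ) w w' + C * ‖toH (w - w')‖ ^ 2 := by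
  obtain ⟨C, hC0, hC⟩ := exists_rpow_le_add (r := 4) (s := 2 * σ) (by norm_num) (by linarith) hη
  refine ⟨2 * C, by positivity, fun w w' => ?_⟩
  rw [wtSq, wtSq, norm_sq_H, ← integral_const_mul, ← integral_const_mul,
    ← integral_add ((integrable_wtSq (by linarith) w w').const_mul _)
      ((memLp_norm_H _).integrable_sq.const_mul _)]
  refine integral_mono (integrable_wtSq (by norm_num) w w')
    (((integrable_wtSq (by linarith) w w').const_mul _).add
      ((memLp_norm_H _).integrable_sq.const_mul _)) fun x => ?_
  dsimp only
  rw [← mul_assoc, ← add_mul]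
  refine mul_le_mul_of_nonneg_right ?_ (sq_nonneg _)
  have h1 := hC _ (norm_nonneg (toH w x))
  have h2 := hC _ (norm_nonneg (toH w' x))
  rw [wt, wt]
  linarith

lemma norm_pairF₁_sub_self_le (l : ℂ × ℂ) (w w' : V L₁ L₂) :
    ‖pairF₁ l w (w - w') - pairF₁ l w' (w - w')‖ ≤
      4 * pairN l * (√(gradSq (w - w')) * √(wtSq 4 w w')) := by
  refine (norm_pairF₁_sub_le l w w' _).trans ?_
  rw [integral_const_mul]
  have hA := (allLp_wt (r := 2) (by norm_num) w w').mul (allLp_toH (w - w'))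
  have h1 := integral_mul_le_sqrt (memLp_gradN (w - w')) hA.memLp_two
  have h2 : ∫ x in rect L₁ L₂, (wt 2 w w' x * ‖toH (w - w') x‖) ^ 2 ≤ 2 * wtSq 4 w w' := by
    rw [wtSq, ← integral_const_mul]
    refine integral_mono (hA.pow 2 (by omega)).integrable
      ((integrable_wtSq (by norm_num) w w').const_mul 2) fun x => ?_
    have := wt_sq_le 2 w w' x
    norm_num at this
    dsimp only
    rw [mul_pow, ← mul_assoc]
    exact mul_le_mul_of_nonneg_right this (sq_nonneg _)
  have h3 : √2 * √2 = 2 := Real.mul_self_sqrt (by norm_num)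
  calc _ ≤ 2 * pairN l * (√(2 * gradSq (w - w')) * √(2 * wtSq 4 w w')) := by
        refine mul_le_mul_of_nonneg_left (h1.trans ?_) (mul_nonneg zero_le_two (pairN_nonneg l))
        gcongr
        exact integral_gradN_sq_le _
    _ = 2 * pairN l * ((√2 * √2) * (√(gradSq (w - w')) * √(wtSq 4 w w'))) := by
        rw [Real.sqrt_mul (by norm_num), Real.sqrt_mul (by norm_num)]; ring
    _ = _ := by rw [h3]; ring

/-- In the term containing `∇w'` only the `L²` norm of that gradient is spent. The remaining factor,
weight times `|z|²`, has a square that is split as (weight² `|z|`) times `|z|³`: Cauchy–Schwarz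
turns the first part into the weight of order four, and the second into the sixth power integral,
bounded by `‖z‖² ‖∇z‖⁴`. The result is of order one in `∇z`, so that it can be absorbed. -/
lemma exists_norm_pairF₂_sub_self_le (L₁ L₂ : ℝ) (l : ℂ × ℂ) : ∃ D : ℝ, 0 ≤ D ∧
    ∀ w w' : V L₁ L₂, ‖pairF₂ l w (w - w') - pairF₂ l w' (w - w')‖ ≤
      2 * pairN l * (√(gradSq (w - w')) * √(wtSq 4 w w')) +
      √(D * gradSq w' * (√(wtSq 4 w w') * ‖toH (w - w')‖)) * √(gradSq (w - w')) := by
  obtain ⟨C6, hC60, hC6⟩ := integral_pow_V (L₁ := L₁) (L₂ := L₂) 2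
  refine ⟨pairN l ^ 2 * (2 * (√8 * √C6)), by positivity, fun w w' => ?_⟩
  set z := w - w' with hz
  have hN := pairN_nonneg l
  have hgz := gradSq_nonneg z
  have hgw := gradSq_nonneg w'
  refine (norm_pairF₂_sub_le l w w' z).trans (add_le_add ?_ ?_)
  · have h1 := integral_mul_le_sqrt (memLp_gradN z)
      (((allLp_toH w).pow 2 (by omega)).mul (allLp_toH z)).memLp_two
    have h2 : ∫ x in rect L₁ L₂, (‖toH w x‖ ^ 2 * ‖toH z x‖) ^ 2 ≤ wtSq 4 w w' := by
      refine integral_mono ((((allLp_toH w).pow 2 (by omega)).mul (allLp_toH z)).pow 2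
        (by omega)).integrable (integrable_wtSq (by norm_num) w w') fun x => ?_
      dsimp only
      rw [mul_pow, ← pow_mul, ← hz]
      refine mul_le_mul_of_nonneg_right ?_ (sq_nonneg _)
      rw [wt, ← Real.rpow_natCast]
      norm_num
    have h3 : √(2 : ℝ) ≤ 2 := by
      rw [Real.sqrt_le_left (by norm_num)]; norm_num
    calc _ ≤ pairN l * (√(2 * gradSq z) * √(wtSq 4 w w')) := by
          refine mul_le_mul_of_nonneg_left (h1.trans ?_) hN
          gcongr
          exact integral_gradN_sq_le _
      _ = pairN l * (√2 * (√(gradSq z) * √(wtSq 4 w w'))) := by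
          rw [Real.sqrt_mul (by norm_num)]; ring
      _ ≤ pairN l * (2 * (√(gradSq z) * √(wtSq 4 w w'))) := by gcongr
      _ = _ := by ring
  · have hA := (allLp_wt (r := 1) (by norm_num) w w').mul (allLp_toH z)
    have h1 := integral_mul_le_sqrt (memLp_gradN w') (hA.mul (allLp_toH z)).memLp_two
    have hB := ((allLp_wt (r := 1) (by norm_num) w w').pow 2 (by omega)).mul (allLp_toH z)
    have hC := (allLp_toH z).pow 3 (by omega)
    have h2 : ∫ x in rect L₁ L₂, ((wt 1 w w' x * ‖toH z x‖) * ‖toH z x‖) ^ 2 ≤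
        √(8 * wtSq 4 w w') * √(C6 * (‖toH z‖ ^ 2 * gradSq z ^ 2)) := by
      calc _ = ∫ x in rect L₁ L₂, (wt 1 w w' x ^ 2 * ‖toH z x‖) * ‖toH z x‖ ^ 3 :=
            integral_congr_ae (Eventually.of_forall fun x => by dsimp only; ring)
        _ ≤ _ := integral_mul_le_sqrt hB.memLp_two hC.memLp_two
        _ ≤ _ := by
          gcongr
          · rw [wtSq, ← integral_const_mul]
            refine integral_mono (hB.pow 2 (by omega)).integrable
              ((integrable_wtSq (by norm_num) w w').const_mul 8) fun x => ?_
            have := wt_pow_four_le 1 w w' x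
            norm_num at this
            dsimp only
            rw [mul_pow, ← pow_mul, ← mul_assoc, ← hz]
            exact mul_le_mul_of_nonneg_right this (sq_nonneg _)
          · simpa only [← pow_mul] using hC6 z
    have e : √(8 * wtSq 4 w w') * √(C6 * (‖toH z‖ ^ 2 * gradSq z ^ 2)) =
        (√8 * √C6) * (√(wtSq 4 w w') * ‖toH z‖) * gradSq z := by
      rw [Real.sqrt_mul (by norm_num), Real.sqrt_mul hC60, ← mul_pow,
        Real.sqrt_sq (mul_nonneg (norm_nonneg _) hgz)]
      ring
    rw [e] at h2
    calc _ ≤ pairN l * (√(2 * gradSq w') *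
          √((√8 * √C6) * (√(wtSq 4 w w') * ‖toH z‖) * gradSq z)) := by
          refine mul_le_mul_of_nonneg_left (h1.trans ?_) hN
          gcongr
          exact integral_gradN_sq_le _
      _ = _ := by
          rw [← Real.sqrt_mul (by positivity), ← mul_assoc, Real.sqrt_mul (by positivity),
            ← mul_assoc]
          congr 1
          conv_lhs => rw [← Real.sqrt_sq hN]
          rw [← Real.sqrt_mul (by positivity)]
          congr 1; ring

lemma mul_le_sq_add_sq (a b : ℝ) : a * b ≤ a ^ 2 + b ^ 2 := by
  nlinarith [sq_nonneg (a - b), sq_nonneg (a + b)]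

set_option maxHeartbeats 400000 in
/-- Local monotonicity of the drift: only the gradient of the second argument enters. -/
theorem exists_local_monotone (L₁ L₂ : ℝ) {m M : ℝ} (hm : 0 < m) : ∃ κ K : ℝ, 0 < κ ∧ 0 ≤ K ∧
    ∀ A₁ A₂ : ℝ, m ≤ A₁ → |A₂| ≤ M → ∀ w w' : V L₁ L₂,
      (G 𝔭 A₁ A₂ w (w - w') - G 𝔭 A₁ A₂ w' (w - w')).re ≤
        -(1 / 2) * gradSq (w - w') - κ * wtSq (2 * 𝔭.σ) w w'
          + K * (1 + gradSq w' ^ 2) * ‖toH (w - w')‖ ^ 2 := by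
  obtain ⟨D, hD0, hD⟩ := exists_norm_pairF₂_sub_self_le L₁ L₂ 𝔭.l₂
  set c₀ := ellip 𝔭.σ 𝔭.β / (2 * (2 * 𝔭.σ + 1)) with hc₀
  have hσ := 𝔭.σ_pos
  have hc₀0 : 0 < c₀ := by have := 𝔭.hc; positivity
  -- The total coefficient of `√gradSq · √(wtSq 4)` in the two convective terms.
  set E := |M| * (4 * pairN 𝔭.l₁ + 2 * pairN 𝔭.l₂) with hE
  -- Two applications of Young's inequality below create `E² + 1` times `wtSq 4`; with this
  -- parameter the cost is half of the dissipation `m c₀` of the power nonlinearity.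
  have hη : 0 < (m * c₀ / 2) / (E ^ 2 + 1) := by positivity
  obtain ⟨C, hC0, hC⟩ := wtSq_four_le (L₁ := L₁) (L₂ := L₂) 𝔭.hσ hη
  refine ⟨m * c₀ / 2, |𝔭.γ| + (E ^ 2 + 1) * C + (M ^ 2 * D) ^ 2, by positivity, by positivity,
    fun A₁ A₂ hA₁ hA₂ w w' => ?_⟩
  rw [G_sub_left]
  set z := w - w' with hz
  set n := ‖toH z‖ with hn
  set s := √(gradSq z) with hs
  set q := √(wtSq 4 w w') with hq
  set Q := wtSq (2 * 𝔭.σ) w w' with hQ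
  set g' := gradSq w' with hg'
  have hg'0 : 0 ≤ g' := gradSq_nonneg w'
  have hs2 : s ^ 2 = gradSq z := Real.sq_sqrt (gradSq_nonneg z)
  have hq2 : q ^ 2 = wtSq 4 w w' := Real.sq_sqrt (wtSq_nonneg _ _ _)
  have hs0 : 0 ≤ s := Real.sqrt_nonneg _
  have hq0 : 0 ≤ q := Real.sqrt_nonneg _
  have hn0 : 0 ≤ n := norm_nonneg _
  have hQ0 : 0 ≤ Q := wtSq_nonneg _ _ _
  have e1 := pairA_self_re 𝔭.α z
  have e2 : m * c₀ * Q ≤ ((1 - Complex.I * 𝔭.β) *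
      (A₁ * (pairP 𝔭.σ w z - pairP 𝔭.σ w' z))).re := by
    have h := le_re_pairP_sub 𝔭.one_lt_σ 𝔭.hc.le w w'
    rw [mul_left_comm, Complex.re_ofReal_mul]
    calc m * c₀ * Q ≤ A₁ * (c₀ * Q) := by
          rw [mul_assoc]
          exact mul_le_mul_of_nonneg_right hA₁ (by positivity)
      _ ≤ _ := mul_le_mul_of_nonneg_left h (hm.le.trans hA₁)
  have e3 : ((𝔭.γ : ℂ) * ⟪toH z, toH z⟫_ℂ).re ≤ |𝔭.γ| * n ^ 2 := by
    refine (Complex.re_le_norm _).trans ?_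
    rw [norm_mul, Complex.norm_real, Real.norm_eq_abs, sq]
    gcongr
    exact norm_inner_le_norm _ _
  have e4 : ((A₂ : ℂ) * ((pairF₂ 𝔭.l₂ w z - pairF₂ 𝔭.l₂ w' z)
      - (pairF₁ 𝔭.l₁ w z - pairF₁ 𝔭.l₁ w' z))).re ≤
      E * (s * q) + |M| * √(D * g' * (q * n)) * s := by
    refine (Complex.re_le_norm _).trans ?_
    rw [norm_mul]
    have hA : ‖(A₂ : ℂ)‖ ≤ |M| := by
      rw [Complex.norm_real]; exact hA₂.trans (le_abs_self M)
    calc _ ≤ |M| * ((2 * pairN 𝔭.l₂ * (s * q) + √(D * g' * (q * n)) * s)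
          + 4 * pairN 𝔭.l₁ * (s * q)) := by
          gcongr
          exact (norm_sub_le _ _).trans (add_le_add (hD w w') (norm_pairF₁_sub_self_le 𝔭.l₁ w w'))
      _ = _ := by rw [hE]; ring
  have y1 : E * (s * q) ≤ s ^ 2 / 4 + E ^ 2 * q ^ 2 := by
    nlinarith [sq_nonneg (s / 2 - E * q)]
  have hr : √(D * g' * (q * n)) ^ 2 = D * g' * (q * n) := Real.sq_sqrt (by positivity)
  -- Young's inequality twice: first against the gradient `s` of the difference, then between `q`
  -- and `g' n`. The second step is the origin of the square of `gradSq w'`. Together with `y1`, the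
  -- gradient is charged `s²/2`, which leaves the factor `1/2`.
  have y2 : |M| * √(D * g' * (q * n)) * s ≤ s ^ 2 / 4 + q ^ 2 + (M ^ 2 * D) ^ 2 * (g' ^ 2 * n ^ 2) := by
    have h1 : |M| * √(D * g' * (q * n)) * s ≤ s ^ 2 / 4 + (|M| * √(D * g' * (q * n))) ^ 2 := by
      nlinarith [sq_nonneg (s / 2 - |M| * √(D * g' * (q * n)))]
    rw [mul_pow, hr, sq_abs] at h1
    have h2 := mul_le_sq_add_sq q (M ^ 2 * D * g' * n)
    have e : M ^ 2 * (D * g' * (q * n)) = q * (M ^ 2 * D * g' * n) := by ring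
    have e' : (M ^ 2 * D) ^ 2 * (g' ^ 2 * n ^ 2) = (M ^ 2 * D * g' * n) ^ 2 := by ring
    rw [e] at h1
    rw [e']
    linarith
  have y3 : (E ^ 2 + 1) * q ^ 2 ≤ m * c₀ / 2 * Q + (E ^ 2 + 1) * C * n ^ 2 := by
    have h := mul_le_mul_of_nonneg_left (hC w w') (by positivity : 0 ≤ E ^ 2 + 1)
    rw [hq2]
    refine h.trans (le_of_eq ?_)
    field_simp; rfl
  have y4 : 0 ≤ (|𝔭.γ| + (E ^ 2 + 1) * C) * g' ^ 2 * n ^ 2 := by positivity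
  have y5 : 0 ≤ (M ^ 2 * D) ^ 2 * n ^ 2 := by positivity
  simp only [Complex.add_re, Complex.sub_re] at e1 e2 e3 e4 ⊢
  have e6 : (|𝔭.γ| + (E ^ 2 + 1) * C + (M ^ 2 * D) ^ 2) * (1 + g' ^ 2) * n ^ 2 =
      |𝔭.γ| * n ^ 2 + (E ^ 2 + 1) * C * n ^ 2 + (M ^ 2 * D) ^ 2 * (g' ^ 2 * n ^ 2)
      + (|𝔭.γ| + (E ^ 2 + 1) * C) * g' ^ 2 * n ^ 2 + (M ^ 2 * D) ^ 2 * n ^ 2 := by ring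
  rw [e6]
  linarith

end SGGLE

namespace SGGLE

open Filter Topology
open scoped InnerProductSpace

variable {L₁ L₂ : ℝ} (𝔭 : Params)

/-! ### Domination of the drift by the energy density -/

/-- The exponent `2σ + 2`. -/
def Params.p : ℝ := 2 * 𝔭.σ + 2

lemma Params.six_lt_p : 6 < 𝔭.p := by unfold Params.p; linarith [𝔭.hσ]

/-- The energy density `‖w‖² + ‖w‖_p^p`. -/
def bulk (w : V L₁ L₂) : ℝ := ‖w‖ ^ 2 + ∫ x in rect L₁ L₂, ‖toH w x‖ ^ 𝔭.p

lemma bulk_nonneg (w : V L₁ L₂) : 0 ≤ bulk 𝔭 w :=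
  add_nonneg (sq_nonneg _) (integral_nonneg fun _ => by positivity)

lemma norm_sq_le_bulk (w : V L₁ L₂) : ‖w‖ ^ 2 ≤ bulk 𝔭 w :=
  le_add_of_nonneg_right (integral_nonneg fun _ => by positivity)

lemma integral_rpow_le_bulk (w : V L₁ L₂) : ∫ x in rect L₁ L₂, ‖toH w x‖ ^ 𝔭.p ≤ bulk 𝔭 w :=
  le_add_of_nonneg_left (sq_nonneg _)

lemma integrable_rpow (w : V L₁ L₂) {r : ℝ} (hr : 0 ≤ r) :
    Integrable (fun x => ‖toH w x‖ ^ r) (rectMeasure L₁ L₂) :=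
  ((allLp_toH w).rpow (fun _ => norm_nonneg _) hr).integrable

/-- The sixth power is what a cubic term paired with a gradient in `L²` requires, and `σ > 2` puts
`6` strictly between `2` and `p = 2σ + 2`. -/
lemma integral_pow_six_le_bulk (w : V L₁ L₂) : ∫ x in rect L₁ L₂, ‖toH w x‖ ^ 6 ≤ bulk 𝔭 w := by
  have hp := 𝔭.six_lt_p
  calc ∫ x in rect L₁ L₂, ‖toH w x‖ ^ 6
      ≤ ∫ x in rect L₁ L₂, (‖toH w x‖ ^ 2 + ‖toH w x‖ ^ 𝔭.p) := by
        refine integral_mono ((allLp_toH w).pow 6 (by omega)).integrable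
          ((memLp_norm_H _).integrable_sq.add (integrable_rpow w (by linarith))) fun x => ?_
        dsimp only
        rcases le_total ‖toH w x‖ 1 with h | h
        · exact (pow_le_pow_of_le_one (norm_nonneg _) h (by omega)).trans
            (le_add_of_nonneg_right (by positivity))
        · rw [← Real.rpow_natCast ‖toH w x‖ 6]
          exact (Real.rpow_le_rpow_of_exponent_le h (by push_cast; linarith)).trans
            (le_add_of_nonneg_left (by positivity))
    _ = ‖toH w‖ ^ 2 + ∫ x in rect L₁ L₂, ‖toH w x‖ ^ 𝔭.p := by
        rw [integral_add (memLp_norm_H _).integrable_sq (integrable_rpow w (by linarith)),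
          norm_sq_H]
    _ ≤ _ := by
        unfold bulk
        gcongr
        exact norm_toH_le w

/-- Domination by an arbitrarily small multiple of the energy density of the first argument and a
multiple of the one of the second. -/
def YoungDominated (Φ : V L₁ L₂ → V L₁ L₂ → ℝ) : Prop :=
  ∀ η : ℝ, 0 < η → ∃ C : ℝ, 0 ≤ C ∧ ∀ w ψ, Φ w ψ ≤ η * bulk 𝔭 w + C * bulk 𝔭 ψ

namespace YoungDominated

variable {𝔭} {Φ Φ' : V L₁ L₂ → V L₁ L₂ → ℝ}

lemma add (h : YoungDominated 𝔭 Φ) (h' : YoungDominated 𝔭 Φ') :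
    YoungDominated 𝔭 fun w ψ => Φ w ψ + Φ' w ψ := fun η hη => by
  obtain ⟨C, hC0, hC⟩ := h (η / 2) (by positivity)
  obtain ⟨C', hC0', hC'⟩ := h' (η / 2) (by positivity)
  exact ⟨C + C', by positivity, fun w ψ => by linarith [hC w ψ, hC' w ψ]⟩

lemma const_mul (h : YoungDominated 𝔭 Φ) {c : ℝ} (hc : 0 ≤ c) :
    YoungDominated 𝔭 fun w ψ => c * Φ w ψ := fun η hη => by
  obtain ⟨C, hC0, hC⟩ := h (η / (c + 1)) (by positivity)
  refine ⟨c * C, by positivity, fun w ψ => ?_⟩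
  have h1 : c * (η / (c + 1)) ≤ η := by
    rw [← mul_div_assoc, div_le_iff₀ (by positivity)]; nlinarith
  have h2 := mul_le_mul_of_nonneg_right h1 (bulk_nonneg 𝔭 w)
  calc c * Φ w ψ ≤ c * (η / (c + 1) * bulk 𝔭 w + C * bulk 𝔭 ψ) := by gcongr; exact hC w ψ
    _ = c * (η / (c + 1)) * bulk 𝔭 w + c * C * bulk 𝔭 ψ := by ring
    _ ≤ _ := by linarith

lemma mono (h : YoungDominated 𝔭 Φ') (hle : ∀ w ψ, Φ w ψ ≤ Φ' w ψ) : YoungDominated 𝔭 Φ :=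
  fun η hη => by
    obtain ⟨C, hC0, hC⟩ := h η hη
    exact ⟨C, hC0, fun w ψ => (hle w ψ).trans (hC w ψ)⟩

end YoungDominated

lemma mul_le_mul_sq_add {η : ℝ} (hη : 0 < η) (x y : ℝ) : x * y ≤ η * x ^ 2 + η⁻¹ * y ^ 2 := by
  have h := mul_le_sq_add_sq (√η * x) ((√η)⁻¹ * y)
  have h0 : √η ≠ 0 := (Real.sqrt_pos.2 hη).ne'
  rw [mul_pow, mul_pow, inv_pow, Real.sq_sqrt hη.le] at h
  calc x * y = √η * x * ((√η)⁻¹ * y) := by field_simp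
    _ ≤ _ := h

lemma youngDominated_norm_mul :
    YoungDominated 𝔭 fun w ψ : V L₁ L₂ => ‖w‖ * ‖ψ‖ := fun η hη =>
  ⟨η⁻¹, by positivity, fun w ψ => (mul_le_mul_sq_add hη _ _).trans (by
    gcongr
    · exact norm_sq_le_bulk 𝔭 w
    · exact norm_sq_le_bulk 𝔭 ψ)⟩

lemma youngDominated_pairP :
    YoungDominated 𝔭 fun w ψ : V L₁ L₂ => ‖pairP 𝔭.σ w ψ‖ := fun η hη => by
  have hp := 𝔭.six_lt_p
  obtain ⟨C, hC0, hC⟩ := exists_rpow_mul_le_add (p := 𝔭.p) (by linarith) hη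
  refine ⟨C, hC0, fun w ψ => ?_⟩
  have h1 := (integrable_rpow w (by linarith : 0 ≤ 𝔭.p)).const_mul η
  have h2 := (integrable_rpow ψ (by linarith : 0 ≤ 𝔭.p)).const_mul C
  calc ‖pairP 𝔭.σ w ψ‖ ≤ ∫ x in rect L₁ L₂, (η * ‖toH w x‖ ^ 𝔭.p + C * ‖toH ψ x‖ ^ 𝔭.p) := by
        refine norm_integral_le_of_norm_le (h1.add h2) (Eventually.of_forall fun x => ?_)
        rw [norm_mul, norm_powMul 𝔭.σ_pos.le, RCLike.norm_conj]
        convert hC _ _ (norm_nonneg (toH w x)) (norm_nonneg (toH ψ x)) using 3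
        unfold Params.p; ring
    _ = η * (∫ x in rect L₁ L₂, ‖toH w x‖ ^ 𝔭.p) + C * ∫ x in rect L₁ L₂, ‖toH ψ x‖ ^ 𝔭.p := by
        rw [integral_add h1 h2, integral_const_mul, integral_const_mul]
    _ ≤ _ := by
        gcongr
        · exact integral_rpow_le_bulk 𝔭 w
        · exact integral_rpow_le_bulk 𝔭 ψ

lemma integral_gradN_sq_le_bulk (w : V L₁ L₂) :
    ∫ x in rect L₁ L₂, gradN w x ^ 2 ≤ 2 * bulk 𝔭 w := by
  linarith [integral_gradN_sq_le w, gradSq_le w, norm_sq_le_bulk 𝔭 w]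

lemma youngDominated_pairF₁ (l : ℂ × ℂ) :
    YoungDominated 𝔭 fun w ψ : V L₁ L₂ => ‖pairF₁ l w ψ‖ := by
  have key : YoungDominated 𝔭 fun w ψ : V L₁ L₂ =>
      ∫ x in rect L₁ L₂, ‖toH w x‖ ^ 3 * gradN ψ x := fun η hη => by
    refine ⟨2 * η⁻¹, by positivity, fun w ψ => ?_⟩
    have h1 := ((allLp_toH w).pow 6 (by omega)).integrable.const_mul η
    have h2 := (memLp_gradN ψ).integrable_sq.const_mul η⁻¹
    calc _ ≤ ∫ x in rect L₁ L₂, (η * ‖toH w x‖ ^ 6 + η⁻¹ * gradN ψ x ^ 2) := by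
          refine integral_mono (((allLp_toH w).pow 3 (by omega)).mul_memLp_two (memLp_gradN ψ))
            (h1.add h2) fun x => ?_
          refine (mul_le_mul_sq_add hη _ _).trans (le_of_eq ?_)
          ring
      _ = η * (∫ x in rect L₁ L₂, ‖toH w x‖ ^ 6) + η⁻¹ * ∫ x in rect L₁ L₂, gradN ψ x ^ 2 := by
          rw [integral_add h1 h2, integral_const_mul, integral_const_mul]
      _ ≤ η * bulk 𝔭 w + η⁻¹ * (2 * bulk 𝔭 ψ) := by
          gcongr
          · exact integral_pow_six_le_bulk 𝔭 w
          · exact integral_gradN_sq_le_bulk 𝔭 ψ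
      _ = _ := by ring
  refine (key.const_mul (pairN_nonneg l)).mono fun w ψ => ?_
  rw [← integral_const_mul]
  refine norm_integral_le_of_norm_le ((((allLp_toH w).pow 3 (by omega)).mul_memLp_two
    (memLp_gradN ψ)).const_mul _) (Eventually.of_forall fun x => ?_)
  rw [norm_mul, norm_mul, norm_pow, Complex.norm_real, norm_norm]
  have := norm_lin_conj_le l (d₁ ψ x) (d₂ ψ x)
  calc _ ≤ ‖toH w x‖ ^ 2 * ‖toH w x‖ * (pairN l * (‖d₁ ψ x‖ + ‖d₂ ψ x‖)) := by gcongr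
    _ = _ := by rw [gradN]; ring

lemma youngDominated_pairF₂ (l : ℂ × ℂ) :
    YoungDominated 𝔭 fun w ψ : V L₁ L₂ => ‖pairF₂ l w ψ‖ := by
  have key : YoungDominated 𝔭 fun w ψ : V L₁ L₂ =>
      ∫ x in rect L₁ L₂, (‖toH w x‖ ^ 2 * ‖toH ψ x‖) * gradN w x := fun η hη => by
    set ε := η / 3 with hε
    have hε0 : 0 < ε := by positivity
    -- Separating the gradient first leaves `ε⁻¹ |w|⁴ |ψ|²`. Young's inequality with exponent `3` in
    -- `|w|²` and `|ψ|²` is then used with parameter `ε²`, so that the prefactor `ε⁻¹` leaves `ε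
    -- |w|⁶`. With `ε = η/3` the gradient costs `2ε` and the sixth power `ε`.
    obtain ⟨C, hC0, hC⟩ := exists_rpow_mul_le_add (p := 3) (by norm_num)
      (η := ε * ε) (by positivity)
    refine ⟨ε⁻¹ * C, by positivity, fun w ψ => ?_⟩
    have h1 := ((allLp_toH w).pow 6 (by omega)).integrable.const_mul ε
    have h2 := (memLp_gradN w).integrable_sq.const_mul ε
    have h3 := ((allLp_toH ψ).pow 6 (by omega)).integrable.const_mul (ε⁻¹ * C)
    calc _ ≤ ∫ x in rect L₁ L₂, (ε * gradN w x ^ 2 + ε * ‖toH w x‖ ^ 6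
          + ε⁻¹ * C * ‖toH ψ x‖ ^ 6) := by
          refine integral_mono ((((allLp_toH w).pow 2 (by omega)).mul (allLp_toH ψ)).mul_memLp_two
            (memLp_gradN w)) ((h2.add h1).add h3) fun x => ?_
          dsimp only
          have e1 := mul_le_mul_sq_add hε0 (gradN w x) (‖toH w x‖ ^ 2 * ‖toH ψ x‖)
          have e2 := hC (‖toH w x‖ ^ 2) (‖toH ψ x‖ ^ 2) (by positivity) (by positivity)
          norm_num [← pow_mul] at e2
          have e3 := mul_le_mul_of_nonneg_left e2 (by positivity : 0 ≤ ε⁻¹)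
          have e4 : ε⁻¹ * (ε * ε * ‖toH w x‖ ^ 6 + C * ‖toH ψ x‖ ^ 6) =
              ε * ‖toH w x‖ ^ 6 + ε⁻¹ * C * ‖toH ψ x‖ ^ 6 := by
            field_simp
          rw [e4] at e3
          calc _ = gradN w x * (‖toH w x‖ ^ 2 * ‖toH ψ x‖) := by ring
            _ ≤ _ := e1
            _ = ε * gradN w x ^ 2 + ε⁻¹ * (‖toH w x‖ ^ 4 * ‖toH ψ x‖ ^ 2) := by ring
            _ ≤ _ := by linarith
      _ = ε * (∫ x in rect L₁ L₂, gradN w x ^ 2) + ε * (∫ x in rect L₁ L₂, ‖toH w x‖ ^ 6)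
          + ε⁻¹ * C * ∫ x in rect L₁ L₂, ‖toH ψ x‖ ^ 6 := by
          rw [← integral_const_mul, ← integral_const_mul, ← integral_const_mul,
            ← integral_add h2 h1]
          exact integral_add (h2.add h1) h3
      _ ≤ ε * (2 * bulk 𝔭 w) + ε * bulk 𝔭 w + ε⁻¹ * C * bulk 𝔭 ψ := by
          gcongr
          · exact integral_gradN_sq_le_bulk 𝔭 w
          · exact integral_pow_six_le_bulk 𝔭 w
          · exact integral_pow_six_le_bulk 𝔭 ψ
      _ = _ := by rw [hε]; ring
  refine (key.const_mul (pairN_nonneg l)).mono fun w ψ => ?_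
  rw [← integral_const_mul]
  refine norm_integral_le_of_norm_le (((((allLp_toH w).pow 2 (by omega)).mul
    (allLp_toH ψ)).mul_memLp_two (memLp_gradN w)).const_mul _) (Eventually.of_forall fun x => ?_)
  rw [norm_mul, norm_mul, norm_pow, Complex.norm_real, norm_norm, RCLike.norm_conj]
  have := norm_lin_le l (d₁ w x) (d₂ w x)
  calc _ ≤ (pairN l * (‖d₁ w x‖ + ‖d₂ w x‖)) * ‖toH w x‖ ^ 2 * ‖toH ψ x‖ := by gcongr
    _ = _ := by rw [gradN]; ring

/-- The drift is dominated by the energy density, uniformly for bounded coefficients. -/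
theorem exists_norm_G_le_bulk (L₁ L₂ M : ℝ) {η : ℝ} (hη : 0 < η) : ∃ C : ℝ, 0 ≤ C ∧
    ∀ A₁ A₂ : ℝ, |A₁| ≤ M → |A₂| ≤ M → ∀ w ψ : V L₁ L₂,
      ‖G 𝔭 A₁ A₂ w ψ‖ ≤ η * bulk 𝔭 w + C * bulk 𝔭 ψ := by
  have h := ((((youngDominated_norm_mul (L₁ := L₁) (L₂ := L₂) 𝔭).const_mul
      (by positivity : 0 ≤ 2 * (1 + |𝔭.α|) + |𝔭.γ|)).add
    ((youngDominated_pairP 𝔭).const_mul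
      (by positivity : 0 ≤ ‖1 - Complex.I * 𝔭.β‖ * |M|))).add
    (((youngDominated_pairF₂ 𝔭 𝔭.l₂).add (youngDominated_pairF₁ 𝔭 𝔭.l₁)).const_mul
      (abs_nonneg M))) η hη
  obtain ⟨C, hC0, hC⟩ := h
  refine ⟨C, hC0, fun A₁ A₂ h₁ h₂ w ψ => le_trans ?_ (hC w ψ)⟩
  have hA₁ : ‖(A₁ : ℂ)‖ ≤ |M| := by rw [Complex.norm_real]; exact h₁.trans (le_abs_self M)
  have hA₂ : ‖(A₂ : ℂ)‖ ≤ |M| := by rw [Complex.norm_real]; exact h₂.trans (le_abs_self M)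
  have e1 := norm_pairA_le 𝔭.α w ψ
  have e2 : ‖(1 - Complex.I * 𝔭.β) * (A₁ * pairP 𝔭.σ w ψ)‖ ≤
      ‖1 - Complex.I * 𝔭.β‖ * |M| * ‖pairP 𝔭.σ w ψ‖ := by
    rw [norm_mul, norm_mul, ← mul_assoc]; gcongr
  have e3 : ‖(𝔭.γ : ℂ) * ⟪toH ψ, toH w⟫_ℂ‖ ≤ |𝔭.γ| * (‖w‖ * ‖ψ‖) := by
    rw [norm_mul, Complex.norm_real, Real.norm_eq_abs, mul_comm ‖w‖]
    gcongr
    refine (norm_inner_le_norm _ _).trans ?_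
    gcongr <;> exact norm_toH_le _
  have e4 : ‖(A₂ : ℂ) * (pairF₂ 𝔭.l₂ w ψ - pairF₁ 𝔭.l₁ w ψ)‖ ≤
      |M| * (‖pairF₂ 𝔭.l₂ w ψ‖ + ‖pairF₁ 𝔭.l₁ w ψ‖) := by
    rw [norm_mul]; gcongr; exact norm_sub_le _ _
  rw [G]
  refine (norm_add_le _ _).trans ?_
  have h5 := norm_add_le (pairA 𝔭.α w ψ - (1 - Complex.I * 𝔭.β) * (A₁ * pairP 𝔭.σ w ψ))
    (𝔭.γ * ⟪toH ψ, toH w⟫_ℂ)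
  have h6 := norm_sub_le (pairA 𝔭.α w ψ) ((1 - Complex.I * 𝔭.β) * (A₁ * pairP 𝔭.σ w ψ))
  linarith

/-! ### The embedding into `L^p` -/

/-- The exponent `2σ + 2` as an extended number. -/
def Params.pE : ℝ≥0∞ := ENNReal.ofReal (2 * 𝔭.σ + 2)

instance : Fact (1 ≤ 𝔭.pE) := ⟨by
  rw [Params.pE, ENNReal.one_le_ofReal]; linarith [𝔭.hσ]⟩

lemma Params.pE_toReal : 𝔭.pE.toReal = 𝔭.p := by
  rw [pE, ENNReal.toReal_ofReal (by linarith [𝔭.hσ]), p]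

lemma Params.pE_ne_top : 𝔭.pE ≠ ∞ := ENNReal.ofReal_ne_top

lemma Params.pE_ne_zero : 𝔭.pE ≠ 0 := (zero_lt_one.trans_le Fact.out).ne'

lemma memLp_toH (w : V L₁ L₂) : MemLp (toH w) 𝔭.pE (rectMeasure L₁ L₂) :=
  (memLp_norm_iff (aesm _)).1 (allLp_toH w (2 * 𝔭.σ + 2).toNNReal)

lemma enorm_toLp_rpow {u : ℝ × ℝ → ℂ} (hu : MemLp u 𝔭.pE (rectMeasure L₁ L₂)) :
    ‖hu.toLp u‖ₑ ^ 𝔭.p = ∫⁻ x in rect L₁ L₂, ‖u x‖ₑ ^ 𝔭.p := by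
  have hp := 𝔭.six_lt_p
  rw [Lp.enorm_toLp, eLpNorm_eq_lintegral_rpow_enorm_toReal 𝔭.pE_ne_zero 𝔭.pE_ne_top,
    ← ENNReal.rpow_mul, 𝔭.pE_toReal, one_div, inv_mul_cancel₀ (by linarith), ENNReal.rpow_one]

lemma norm_toLp_rpow (w : V L₁ L₂) :
    ‖(memLp_toH 𝔭 w).toLp (toH w)‖ ^ 𝔭.p = ∫ x in rect L₁ L₂, ‖toH w x‖ ^ 𝔭.p := by
  have hp := 𝔭.six_lt_p
  rw [integral_eq_lintegral_of_nonneg_ae (Eventually.of_forall fun x => by positivity)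
    (integrable_rpow w (by linarith)).1, ← toReal_enorm, ENNReal.toReal_rpow, enorm_toLp_rpow]
  congr 1
  refine lintegral_congr fun x => ?_
  rw [← ofReal_norm, ENNReal.ofReal_rpow_of_nonneg (norm_nonneg _) (by linarith)]

/-- The embedding of `V` into `L^p`, as a linear map. -/
def embedₗ : V L₁ L₂ →ₗ[ℂ] Lp ℂ 𝔭.pE (rectMeasure L₁ L₂) where
  toFun w := (memLp_toH 𝔭 w).toLp (toH w)
  map_add' w w' := by
    rw [← MemLp.toLp_add]
    exact MemLp.toLp_congr _ _ (Lp.coeFn_add _ _)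
  map_smul' c w := by
    rw [RingHom.id_apply, ← MemLp.toLp_const_smul]
    exact MemLp.toLp_congr _ _ (Lp.coeFn_smul _ _)

/-- The embedding of `V` into `L^p`. -/
def embed : V L₁ L₂ →L[ℂ] Lp ℂ 𝔭.pE (rectMeasure L₁ L₂) := by
  refine (embedₗ 𝔭).mkContinuousOfExistsBound ?_
  have hp := 𝔭.six_lt_p
  obtain ⟨C, hC0, hC⟩ := exists_integral_rpow_le L₁ L₂ (by linarith : 0 ≤ 𝔭.p) 1
  have := LinearMap.bound_of_ball_bound (r := 1) one_pos (C ^ (𝔭.p⁻¹)) (embedₗ (L₁ := L₁) (L₂ := L₂) 𝔭)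
    fun w hw => ?_
  · exact this
  · rw [Real.le_rpow_inv_iff_of_pos (norm_nonneg _) hC0 (by linarith)]
    refine (norm_toLp_rpow 𝔭 w).trans_le (hC w ?_)
    exact (mem_ball_zero_iff.1 hw).le

lemma norm_embed_rpow (w : V L₁ L₂) :
    ‖embed 𝔭 w‖ ^ 𝔭.p = ∫ x in rect L₁ L₂, ‖toH w x‖ ^ 𝔭.p := norm_toLp_rpow 𝔭 w

lemma bulk_eq (w : V L₁ L₂) : bulk 𝔭 w = ‖w‖ ^ 2 + ‖embed 𝔭 w‖ ^ 𝔭.p := by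
  rw [bulk, norm_embed_rpow]

lemma continuous_bulk : Continuous (bulk 𝔭 : V L₁ L₂ → ℝ) := by
  have : (bulk 𝔭 : V L₁ L₂ → ℝ) = fun w => ‖w‖ ^ 2 + ‖embed 𝔭 w‖ ^ 𝔭.p := funext (bulk_eq 𝔭)
  rw [this]
  have hp := 𝔭.six_lt_p
  exact (continuous_norm.pow 2).add
    (((embed 𝔭).continuous.norm).rpow_const fun _ => Or.inr (by linarith))

lemma bulk_add_le (w w' : V L₁ L₂) : bulk 𝔭 (w + w') ≤ 2 ^ 𝔭.p * (bulk 𝔭 w + bulk 𝔭 w') := by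
  have hp := 𝔭.six_lt_p
  have key : ∀ {q a b c : ℝ}, 2 ≤ q → q ≤ 𝔭.p → 0 ≤ a → 0 ≤ b → 0 ≤ c → c ≤ a + b →
      c ^ q ≤ 2 ^ 𝔭.p * (a ^ q + b ^ q) := fun {q a b c} hq hqp ha hb hc h => by
    have h1 : c ≤ 2 * max a b := by
      linarith [le_max_left a b, le_max_right a b]
    have h2 : (max a b) ^ q ≤ a ^ q + b ^ q := by
      rcases le_total a b with h | h
      · rw [max_eq_right h]; exact le_add_of_nonneg_left (by positivity)
      · rw [max_eq_left h]; exact le_add_of_nonneg_right (by positivity)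
    calc c ^ q ≤ (2 * max a b) ^ q := Real.rpow_le_rpow hc h1 (by linarith)
      _ = 2 ^ q * (max a b) ^ q := Real.mul_rpow (by norm_num) (ha.trans (le_max_left _ _))
      _ ≤ 2 ^ 𝔭.p * (a ^ q + b ^ q) := by
        gcongr
        · norm_num
  have h1 := key (q := 2) le_rfl (by linarith) (norm_nonneg w) (norm_nonneg w') (norm_nonneg _)
    (norm_add_le w w')
  have h2 := key (q := 𝔭.p) (by linarith) le_rfl (norm_nonneg (embed 𝔭 w))
    (norm_nonneg (embed 𝔭 w')) (norm_nonneg (embed 𝔭 (w + w'))) (by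
      rw [map_add]; exact norm_add_le _ _)
  simp only [Real.rpow_two] at h1
  rw [bulk_eq, bulk_eq, bulk_eq]
  linarith

end SGGLE

namespace SGGLE

open Filter Topology
open scoped InnerProductSpace

variable {L₁ L₂ : ℝ} (𝔭 : Params)

/-! ### Time translations -/

/-- Translations act continuously on `Lp` for finite `p`; this is continuity at zero expressed on
functions. -/
lemma tendsto_eLpNorm_translate {E : Type*} [NormedAddCommGroup E] {p : ℝ≥0∞} [Fact (1 ≤ p)]
    (hp : p ≠ ∞) {f : ℝ → E} (hf : MemLp f p volume) :
    Tendsto (fun h : ℝ => eLpNorm (fun s => f (s + h) - f s) p volume) (𝓝 0) (𝓝 0) := by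
  have : Fact (p ≠ ∞) := ⟨hp⟩
  have hc : Continuous fun h : ℝ => (DomAddAct.mk h) +ᵥ hf.toLp f := by
    have h1 : Continuous fun h : ℝ => DomAddAct.mk h := DomAddAct.continuous_mk
    exact h1.vadd continuous_const
  have h0 : Tendsto (fun h : ℝ => ‖((DomAddAct.mk h) +ᵥ hf.toLp f) - hf.toLp f‖ₑ) (𝓝 0) (𝓝 0) := by
    have h2 := ((hc.sub (continuous_const (y := hf.toLp f))).enorm).tendsto 0
    have e : ‖((DomAddAct.mk (0 : ℝ)) +ᵥ hf.toLp f) - hf.toLp f‖ₑ = 0 := by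
      have : DomAddAct.mk (0 : ℝ) +ᵥ hf.toLp f = hf.toLp f := by
        rw [DomAddAct.mk_vadd_toLp]
        refine MemLp.toLp_congr _ _ (Eventually.of_forall fun s => ?_)
        simp
      rw [this]; simp
    dsimp only [Pi.sub_apply] at h2
    rwa [e] at h2
  refine h0.congr fun h => ?_
  rw [DomAddAct.mk_vadd_toLp, ← MemLp.toLp_sub, Lp.enorm_toLp]
  refine eLpNorm_congr_ae (Eventually.of_forall fun s => ?_)
  simp [vadd_eq_add, add_comm]

lemma lintegral_bulk_eq {f : ℝ → V L₁ L₂} (hf : StronglyMeasurable f) :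
    ∫⁻ s, ENNReal.ofReal (bulk 𝔭 (f s)) =
      eLpNorm f 2 volume ^ (2 : ℝ) + eLpNorm (fun s => embed 𝔭 (f s)) 𝔭.pE volume ^ 𝔭.p := by
  have hp := 𝔭.six_lt_p
  have h1 := eLpNorm_eq_lintegral_rpow_enorm_toReal (f := f) (μ := volume) two_ne_zero
    ENNReal.ofNat_ne_top
  have h2 := eLpNorm_eq_lintegral_rpow_enorm_toReal (f := fun s => embed 𝔭 (f s)) (μ := volume)
    𝔭.pE_ne_zero 𝔭.pE_ne_top
  rw [h1, h2, ← ENNReal.rpow_mul, ← ENNReal.rpow_mul, 𝔭.pE_toReal]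
  norm_num
  rw [inv_mul_cancel₀ (by linarith), ENNReal.rpow_one, ← lintegral_add_left]
  · refine lintegral_congr fun s => ?_
    rw [bulk_eq, ENNReal.ofReal_add (by positivity) (by positivity), ENNReal.ofReal_pow (norm_nonneg _),
      ofReal_norm, ← ENNReal.ofReal_rpow_of_nonneg (norm_nonneg _) (by linarith), ofReal_norm]
  · exact hf.enorm.pow_const 2

/-- The modulus of continuity of a function of time with respect to translations. -/
def modulus (w : ℝ → V L₁ L₂) (h : ℝ) : ℝ≥0∞ :=
  ∫⁻ s, ENNReal.ofReal (bulk 𝔭 (w (s + h) - w s))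

lemma tendsto_modulus {w : ℝ → V L₁ L₂} (hw : StronglyMeasurable w) (h2 : MemLp w 2 volume)
    (hp : MemLp (fun s => embed 𝔭 (w s)) 𝔭.pE volume) :
    Tendsto (modulus 𝔭 w) (𝓝 0) (𝓝 0) := by
  have hp6 := 𝔭.six_lt_p
  have e : modulus 𝔭 w = fun h => eLpNorm (fun s => w (s + h) - w s) 2 volume ^ (2 : ℝ) +
      eLpNorm (fun s => embed 𝔭 (w (s + h)) - embed 𝔭 (w s)) 𝔭.pE volume ^ 𝔭.p := funext fun h => by
    have := lintegral_bulk_eq 𝔭 ((hw.comp_measurable (measurable_add_const h)).sub hw)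
    simp only [Pi.sub_apply, Function.comp_apply, map_sub] at this
    rw [modulus, this]
    rfl
  rw [e]
  have t1 := (tendsto_eLpNorm_translate ENNReal.ofNat_ne_top h2).ennrpow_const 2
  have t2 := (tendsto_eLpNorm_translate 𝔭.pE_ne_top hp).ennrpow_const 𝔭.p
  have := t1.add t2
  rwa [ENNReal.zero_rpow_of_pos (by norm_num), ENNReal.zero_rpow_of_pos (by linarith),
    add_zero] at this

lemma integrable_bulk {w : ℝ → V L₁ L₂} (hw : StronglyMeasurable w) (h2 : MemLp w 2 volume)
    (hp : MemLp (fun s => embed 𝔭 (w s)) 𝔭.pE volume) :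
    Integrable (fun s => bulk 𝔭 (w s)) volume := by
  have hp6 := 𝔭.six_lt_p
  refine ⟨((continuous_bulk 𝔭).comp_stronglyMeasurable hw).aestronglyMeasurable, ?_⟩
  rw [hasFiniteIntegral_iff_ofReal (Eventually.of_forall fun s => bulk_nonneg 𝔭 _),
    lintegral_bulk_eq 𝔭 hw]
  exact ENNReal.add_lt_top.2 ⟨ENNReal.rpow_lt_top_of_nonneg (by norm_num) h2.2.ne,
    ENNReal.rpow_lt_top_of_nonneg (by linarith) hp.2.ne⟩

/-! ### The energy identity, by averaging over time translations. -/

lemma bulk_neg (w : V L₁ L₂) : bulk 𝔭 (-w) = bulk 𝔭 w := by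
  rw [bulk_eq, bulk_eq, map_neg, norm_neg, norm_neg]

/-- The integral of `Ψ(s + ε) - Ψ(s)` telescopes to the integrals of `Ψ` over the last and the first
interval of length `ε`, hence to `ε (Ψ b - Ψ a)` up to `o(ε)` by continuity. A bound `o(ε)` on it
forces the end values to agree, so estimates that hold only after integration in time suffice. -/
lemma eq_of_integral_translate_le {Ψ : ℝ → ℝ} {a b : ℝ} (hab : a < b)
    (hc : ContinuousOn Ψ (Icc a b))
    (h : ∀ η > 0, ∃ δ > 0, ∀ ε, 0 < ε → ε < δ → ε < b - a →
      |∫ s in a..(b - ε), (Ψ (s + ε) - Ψ s)| ≤ η * ε) : Ψ a = Ψ b := by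
  set Q : ℝ → ℝ := fun t => ∫ s in a..t, Ψ s with hQ
  have hi : IntervalIntegrable Ψ volume a b := hc.intervalIntegrable_of_Icc hab.le
  have hii : ∀ x ∈ Icc a b, ∀ y ∈ Icc a b, IntervalIntegrable Ψ volume x y := fun x hx y hy =>
    hi.mono_set (by
      rw [uIcc_of_le hab.le]; exact uIcc_subset_Icc hx hy)
  by_contra hne
  set η := |Ψ b - Ψ a| / 4 with hη
  have hη0 : 0 < η := by
    have : 0 < |Ψ b - Ψ a| := abs_pos.2 (sub_ne_zero.2 (Ne.symm hne))
    positivity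
  obtain ⟨δ, hδ, hd⟩ := h η hη0
  obtain ⟨δ₁, hδ₁, h1⟩ := Metric.continuousWithinAt_iff.1 (hc a (left_mem_Icc.2 hab.le)) η hη0
  obtain ⟨δ₂, hδ₂, h2⟩ := Metric.continuousWithinAt_iff.1 (hc b (right_mem_Icc.2 hab.le)) η hη0
  obtain ⟨ε, hε0, hε⟩ : ∃ ε, 0 < ε ∧ ε < min (min δ (b - a)) (min δ₁ δ₂) :=
    exists_between (by
      have : 0 < b - a := by linarith
      positivity)
  simp only [lt_min_iff] at hε
  have k := hd ε hε0 hε.1.1 hε.1.2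
  have e : ∫ s in a..(b - ε), (Ψ (s + ε) - Ψ s) =
      (∫ s in (b - ε)..b, Ψ s) - ∫ s in a..(a + ε), Ψ s := by
    have m1 : a + ε ∈ Icc a b := ⟨by linarith, by linarith [hε.1.2]⟩
    have m2 : b - ε ∈ Icc a b := ⟨by linarith [hε.1.2], by linarith⟩
    have ma := left_mem_Icc.2 hab.le
    have mb := right_mem_Icc.2 hab.le
    have i1 : IntervalIntegrable (fun s => Ψ (s + ε)) volume a (b - ε) := by
      have := (hii _ m1 _ mb).comp_add_right (c := ε)
      simpa using this
    rw [intervalIntegral.integral_sub i1 (hii _ ma _ m2), intervalIntegral.integral_comp_add_right,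
      sub_add_cancel]
    have s1 := intervalIntegral.integral_add_adjacent_intervals (hii _ ma _ m1) (hii _ m1 _ mb)
    have s2 := intervalIntegral.integral_add_adjacent_intervals (hii _ ma _ m2) (hii _ m2 _ mb)
    linarith
  rw [e] at k
  have b1 : ‖∫ s in a..(a + ε), (Ψ s - Ψ a)‖ ≤ η * |a + ε - a| := by
    refine intervalIntegral.norm_integral_le_of_norm_le_const fun s hs => ?_
    rw [uIoc_of_le (by linarith)] at hs
    refine (h1 ⟨hs.1.le, by linarith [hs.2, hε.1.2]⟩ ?_).le
    rw [Real.dist_eq, abs_of_nonneg (by linarith [hs.1])]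
    linarith [hs.2, hε.2.1]
  have b2 : ‖∫ s in (b - ε)..b, (Ψ s - Ψ b)‖ ≤ η * |b - (b - ε)| := by
    refine intervalIntegral.norm_integral_le_of_norm_le_const fun s hs => ?_
    rw [uIoc_of_le (by linarith)] at hs
    refine (h2 ⟨by linarith [hs.1, hε.1.2], hs.2⟩ ?_).le
    rw [Real.dist_eq, abs_sub_comm, abs_of_nonneg (by linarith [hs.2])]
    linarith [hs.1, hε.2.2]
  rw [intervalIntegral.integral_sub (hii _ (left_mem_Icc.2 hab.le) _
    ⟨by linarith, by linarith [hε.1.2]⟩) (by simp), intervalIntegral.integral_const,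
    add_sub_cancel_left, Real.norm_eq_abs, abs_of_pos hε0, smul_eq_mul] at b1
  rw [intervalIntegral.integral_sub (hii _ ⟨by linarith [hε.1.2], by linarith⟩ _
    (right_mem_Icc.2 hab.le)) (by simp), intervalIntegral.integral_const,
    sub_sub_cancel, Real.norm_eq_abs, abs_of_pos hε0, smul_eq_mul] at b2
  have f : ε * |Ψ b - Ψ a| ≤ 3 * (η * ε) := by
    rw [← abs_of_pos hε0, ← abs_mul, abs_of_pos hε0]
    have : ε * (Ψ b - Ψ a) = ((∫ s in (b - ε)..b, Ψ s) - ∫ s in a..(a + ε), Ψ s)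
        - ((∫ s in (b - ε)..b, Ψ s) - ε * Ψ b) + ((∫ s in a..(a + ε), Ψ s) - ε * Ψ a) := by ring
    rw [this]
    refine (abs_add_le _ _).trans ?_
    have := abs_sub ((∫ s in (b - ε)..b, Ψ s) - ∫ s in a..(a + ε), Ψ s)
      ((∫ s in (b - ε)..b, Ψ s) - ε * Ψ b)
    linarith
  have : |Ψ b - Ψ a| = 4 * η := by rw [hη]; ring
  rw [this] at f
  nlinarith

/-- A time dependent functional of the test function which is dominated by the energy density. -/
structure Dominated (F : ℝ → V L₁ L₂ →ₗ⋆[ℂ] ℂ) (k : ℝ → ℝ) : Prop where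
  measurable : ∀ (ρ : ℝ × ℝ → ℝ) (g : ℝ × ℝ → V L₁ L₂), Measurable ρ → StronglyMeasurable g →
    Measurable fun q => F (ρ q) (g q)
  integrable : Integrable k volume
  nonneg : ∀ r, 0 ≤ k r
  bound : ∀ η : ℝ, 0 < η → ∃ C : ℝ, 0 ≤ C ∧ ∀ r ψ, ‖F r ψ‖ ≤ η * k r + C * bulk 𝔭 ψ

namespace Dominated

variable {𝔭} {F : ℝ → V L₁ L₂ →ₗ⋆[ℂ] ℂ} {k : ℝ → ℝ}

lemma measurable_comp (hF : Dominated 𝔭 F k) {w : ℝ → V L₁ L₂} (hw : StronglyMeasurable w) :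
    Measurable fun r => F r (w r) :=
  (hF.measurable Prod.fst (fun q => w q.1) measurable_fst
    (hw.comp_measurable measurable_fst)).comp (measurable_id.prodMk (measurable_const (a := (0 : ℝ))))

lemma integrable_comp (hF : Dominated 𝔭 F k) {w : ℝ → V L₁ L₂} (hw : StronglyMeasurable w)
    (hb : Integrable (fun s => bulk 𝔭 (w s)) volume) :
    Integrable (fun r => F r (w r)) volume := by
  obtain ⟨C, hC0, hC⟩ := hF.bound 1 one_pos
  exact ((hF.integrable.const_mul 1).add (hb.const_mul C)).mono'
    (hF.measurable_comp hw).aestronglyMeasurable (Eventually.of_forall fun r => hC r _)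

lemma intervalIntegrable_test (hF : Dominated 𝔭 F k) (ψ : V L₁ L₂) (a b : ℝ) :
    IntervalIntegrable (fun r => F r ψ) volume a b := by
  obtain ⟨C, hC0, hC⟩ := hF.bound 1 one_pos
  refine IntervalIntegrable.mono_fun' (g := fun r => 1 * k r + C * bulk 𝔭 ψ)
    ((hF.integrable.const_mul 1).intervalIntegrable.add intervalIntegrable_const)
    (hF.measurable_comp stronglyMeasurable_const).aestronglyMeasurable
    (Eventually.of_forall fun r => hC r _)

/-- The averaged error made by freezing the test function in the energy identity. -/
lemma lintegral_error_le (hF : Dominated 𝔭 F k) {w : ℝ → V L₁ L₂} (hw : StronglyMeasurable w)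
    {η : ℝ} (hη : 0 < η) : ∃ C : ℝ≥0, ∀ ε : ℝ,
      ∫⁻ s, ∫⁻ τ in Ioc 0 ε, ‖F (s + τ) (w s + w (s + ε) - (w (s + τ) + w (s + τ)))‖ₑ ≤
      ∫⁻ τ in Ioc 0 ε, (ENNReal.ofReal (η * ∫ r, k r)
        + C * (modulus 𝔭 w τ + modulus 𝔭 w (ε - τ))) := by
  obtain ⟨C, hC0, hC⟩ := hF.bound η hη
  refine ⟨(C * 2 ^ 𝔭.p).toNNReal, fun ε => ?_⟩
  have hm : Measurable fun q : ℝ × ℝ =>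
      ‖F (q.1 + q.2) (w q.1 + w (q.1 + ε) - (w (q.1 + q.2) + w (q.1 + q.2)))‖ₑ := by
    refine (hF.measurable (fun q => q.1 + q.2) _ (by fun_prop) ?_).enorm
    have h1 : ∀ ρ : ℝ × ℝ → ℝ, Measurable ρ → StronglyMeasurable fun q => w (ρ q) :=
      fun ρ hρ => hw.comp_measurable hρ
    exact ((h1 _ measurable_fst).add (h1 _ (by fun_prop))).sub
      ((h1 _ (by fun_prop)).add (h1 _ (by fun_prop)))
  rw [lintegral_lintegral_swap (f := fun s τ =>
    ‖F (s + τ) (w s + w (s + ε) - (w (s + τ) + w (s + τ)))‖ₑ) hm.aemeasurable]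
  refine lintegral_mono fun τ => ?_
  have mb : ∀ (ρ ρ' : ℝ → ℝ), Measurable ρ → Measurable ρ' →
      Measurable fun s => ENNReal.ofReal (bulk 𝔭 (w (ρ s) - w (ρ' s))) := fun ρ ρ' h h' =>
    ((continuous_bulk 𝔭).comp_stronglyMeasurable
      ((hw.comp_measurable h).sub (hw.comp_measurable h'))).measurable.ennreal_ofReal
  calc ∫⁻ s, ‖F (s + τ) (w s + w (s + ε) - (w (s + τ) + w (s + τ)))‖ₑ
      ≤ ∫⁻ s, (ENNReal.ofReal (η * k (s + τ)) + ((C * 2 ^ 𝔭.p).toNNReal : ℝ≥0∞) *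
          (ENNReal.ofReal (bulk 𝔭 (w (s + τ) - w s)) +
            ENNReal.ofReal (bulk 𝔭 (w (s + ε) - w (s + τ))))) := by
        refine lintegral_mono fun s => ?_
        -- The error in the test function is a difference of increments of `w` over time lags `τ`
        -- and `ε - τ`, which explains the two moduli. The energy density of the functional itself
        -- is not small under translation, so it is the free parameter `η` that makes its
        -- contribution small.
        have e : w s + w (s + ε) - (w (s + τ) + w (s + τ)) =
            -(w (s + τ) - w s) + (w (s + ε) - w (s + τ)) := by abel
        have h1 := hC (s + τ) (w s + w (s + ε) - (w (s + τ) + w (s + τ)))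
        have h2 := bulk_add_le 𝔭 (-(w (s + τ) - w s)) (w (s + ε) - w (s + τ))
        rw [bulk_neg, ← e] at h2
        have h3 := mul_le_mul_of_nonneg_left h2 hC0
        rw [← ofReal_norm, ENNReal.ofNNReal_toNNReal, ← ENNReal.ofReal_add (bulk_nonneg _ _)
          (bulk_nonneg _ _), ← ENNReal.ofReal_mul (by positivity), ← ENNReal.ofReal_add
          (mul_nonneg hη.le (hF.nonneg _)) (mul_nonneg (by positivity)
            (add_nonneg (bulk_nonneg _ _) (bulk_nonneg _ _)))]
        exact ENNReal.ofReal_le_ofReal (by linarith)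
    _ = _ := by
        have hk : Integrable (fun s => η * k (s + τ)) volume :=
          (hF.integrable.comp_add_right τ).const_mul η
        rw [lintegral_add_left' hk.aestronglyMeasurable.aemeasurable.ennreal_ofReal,
          lintegral_const_mul' _ _ ENNReal.coe_ne_top, lintegral_add_left (mb _ _ (by fun_prop) (by fun_prop)),
          ← ofReal_integral_eq_lintegral_ofReal hk (Eventually.of_forall fun s =>
            mul_nonneg hη.le (hF.nonneg _)), integral_const_mul, integral_add_right_eq_self]
        congr 3
        refine Eq.trans ?_ (lintegral_add_right_eq_self
          (fun s => ENNReal.ofReal (bulk 𝔭 (w (s + (ε - τ)) - w s))) τ)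
        refine lintegral_congr fun s => ?_
        rw [add_add_sub_cancel]

/-- The energy identity. -/
theorem energy_identity (hF : Dominated 𝔭 F k) {T : ℝ} {w : ℝ → V L₁ L₂}
    (hw : StronglyMeasurable w) (h2 : MemLp w 2 volume)
    (hp : MemLp (fun s => embed 𝔭 (w s)) 𝔭.pE volume) {v : ℝ → H L₁ L₂}
    (hv : ContinuousOn v (Icc 0 T)) (hwv : ∀ᵐ s, s ∈ Icc 0 T → toH (w s) = v s)
    (heq : ∀ a b, 0 ≤ a → a ≤ b → b ≤ T → ∀ ψ : V L₁ L₂,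
      ⟪toH ψ, v b⟫_ℂ - ⟪toH ψ, v a⟫_ℂ = ∫ r in a..b, F r ψ)
    {a b : ℝ} (ha : 0 ≤ a) (hab : a ≤ b) (hb : b ≤ T) :
    ‖v b‖ ^ 2 - ‖v a‖ ^ 2 = 2 * (∫ r in a..b, F r (w r)).re := by
  rcases hab.eq_or_lt with rfl | hab
  · simp
  have hFi := hF.integrable_comp hw (integrable_bulk 𝔭 hw h2 hp)
  -- The claim is that `Ψ` takes the same value at `a` and `b`. The weak equation on `[s, s + ε]`,
  -- tested with `w(s) + w(s + ε)`, yields the exact increment of `‖v‖²`; replacing this frozen test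
  -- function by `2 w(r)` costs the averaged error of `lintegral_error_le`. No time derivative with
  -- values in a dual space enters.
  set Ψ : ℝ → ℝ := fun s => ‖v s‖ ^ 2 - 2 * (∫ r in a..s, F r (w r)).re with hΨ
  have hsub : Icc a b ⊆ Icc 0 T := Icc_subset_Icc ha hb
  have hΨc : ContinuousOn Ψ (Icc a b) := by
    refine ((hv.mono hsub).norm.pow 2).sub (Continuous.continuousOn ?_)
    exact continuous_const.mul (Complex.continuous_re.comp
      (intervalIntegral.continuous_primitive (fun x y => hFi.intervalIntegrable) a))
  suffices Ψ a = Ψ b by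
    simp only [hΨ, intervalIntegral.integral_same, Complex.zero_re] at this
    linarith
  refine eq_of_integral_translate_le hab hΨc fun η hη => ?_
  have hk0 : 0 ≤ ∫ r, k r := integral_nonneg hF.nonneg
  -- `η₁` makes the contribution of `∫ k` at most `η/2`. It determines the constant `C`, after which
  -- `η₂` can be chosen so that `C` times the two moduli is at most `η/2`.
  set η₁ := η / 2 / ((∫ r, k r) + 1) with hη₁
  have hη₁0 : 0 < η₁ := by positivity
  obtain ⟨C, hC⟩ := hF.lintegral_error_le hw hη₁0
  have hmod := tendsto_modulus 𝔭 hw h2 hp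
  set η₂ : ℝ := η / 4 / ((C : ℝ) + 1) with hη₂
  have hη₂0 : 0 < η₂ := by positivity
  obtain ⟨δ, hδ, hd⟩ := Metric.eventually_nhds_iff.1
    (hmod.eventually (gt_mem_nhds (ENNReal.ofReal_pos.2 hη₂0)))
  refine ⟨δ, hδ, fun ε hε hεδ hεb => ?_⟩
  have hpt : ∀ᵐ s, s ∈ Ioc a (b - ε) → ‖Ψ (s + ε) - Ψ s‖ₑ ≤
      ∫⁻ τ in Ioc 0 ε, ‖F (s + τ) (w s + w (s + ε) - (w (s + τ) + w (s + τ)))‖ₑ := by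
    have hwv' : ∀ᵐ s, s + ε ∈ Icc 0 T → toH (w (s + ε)) = v (s + ε) :=
      (measurePreserving_add_right volume ε).quasiMeasurePreserving.ae hwv
    filter_upwards [hwv, hwv'] with s h1 h2 hs
    have hs0 : s ∈ Icc 0 T := hsub ⟨hs.1.le, by linarith [hs.2]⟩
    have hs1 : s + ε ∈ Icc 0 T := hsub ⟨by linarith [hs.1], by linarith [hs.2]⟩
    have e1 := h1 hs0
    have e2 := h2 hs1
    -- Polarization, `‖y‖² - ‖x‖² = Re ⟪x + y, y - x⟫`. The sum is an admissible test function
    -- because `v` agrees with `w` at both times, which holds for almost every `s`.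
    have e3 : ‖v (s + ε)‖ ^ 2 - ‖v s‖ ^ 2 = (∫ r in s..(s + ε), F r (w s + w (s + ε))).re := by
      rw [← heq s (s + ε) hs0.1 (by linarith) hs1.2, toH_add, e1, e2, inner_add_left,
        inner_add_left]
      have hself : ∀ x : H L₁ L₂, (⟪x, x⟫_ℂ).re = ‖x‖ ^ 2 := fun x => inner_self_eq_norm_sq (𝕜 := ℂ) x
      simp only [Complex.sub_re, Complex.add_re, hself]
      rw [← inner_conj_symm (v (s + ε)) (v s), Complex.conj_re]
      ring
    have e4 : Ψ (s + ε) - Ψ s =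
        (∫ r in s..(s + ε), F r (w s + w (s + ε) - (w r + w r))).re := by
      have i1 : IntervalIntegrable (fun r => F r (w r)) volume s (s + ε) := hFi.intervalIntegrable
      have : ∫ r in s..(s + ε), F r (w s + w (s + ε) - (w r + w r)) =
          (∫ r in s..(s + ε), F r (w s + w (s + ε))) - 2 * ∫ r in s..(s + ε), F r (w r) := by
        rw [← intervalIntegral.integral_const_mul, ← intervalIntegral.integral_sub
          (hF.intervalIntegrable_test _ _ _) (i1.const_mul 2)]
        refine intervalIntegral.integral_congr fun r _ => ?_
        simp only [map_sub, map_add (F r) (w r), two_mul]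
      rw [this, Complex.sub_re, ← e3, hΨ]
      dsimp only
      rw [← intervalIntegral.integral_add_adjacent_intervals
        (hFi.intervalIntegrable (a := a) (b := s)) i1]
      simp only [Complex.add_re, Complex.mul_re, Complex.re_ofNat, Complex.im_ofNat]
      ring
    rw [e4]
    have e5 : ∫ r in s..(s + ε), F r (w s + w (s + ε) - (w r + w r)) =
        ∫ τ in Ioc 0 ε, F (s + τ) (w s + w (s + ε) - (w (s + τ) + w (s + τ))) := by
      rw [← intervalIntegral.integral_of_le hε.le]
      have := intervalIntegral.integral_comp_add_left (a := 0) (b := ε)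
        (fun r => F r (w s + w (s + ε) - (w r + w r))) s
      rw [this, add_zero]
    rw [e5]
    refine le_trans ?_ (enorm_integral_le_lintegral_enorm _)
    rw [← ofReal_norm, ← ofReal_norm]
    exact ENNReal.ofReal_le_ofReal (Complex.abs_re_le_norm _)
  have hfin : ‖∫ s in a..(b - ε), (Ψ (s + ε) - Ψ s)‖ₑ ≤ ENNReal.ofReal (η * ε) := by
    rw [intervalIntegral.integral_of_le (by linarith)]
    calc _ ≤ ∫⁻ s in Ioc a (b - ε), ‖Ψ (s + ε) - Ψ s‖ₑ := enorm_integral_le_lintegral_enorm _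
      _ ≤ ∫⁻ s in Ioc a (b - ε), ∫⁻ τ in Ioc 0 ε,
          ‖F (s + τ) (w s + w (s + ε) - (w (s + τ) + w (s + τ)))‖ₑ :=
        setLIntegral_mono_ae' measurableSet_Ioc hpt
      _ ≤ ∫⁻ s, ∫⁻ τ in Ioc 0 ε,
          ‖F (s + τ) (w s + w (s + ε) - (w (s + τ) + w (s + τ)))‖ₑ := setLIntegral_le_lintegral _ _
      _ ≤ _ := hC ε
      _ ≤ ∫⁻ τ in Ioc 0 ε, ENNReal.ofReal η := by
        refine setLIntegral_mono' measurableSet_Ioc fun τ hτ => ?_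
        have m1 := (hd (y := τ) (by rw [Real.dist_eq, sub_zero, abs_of_pos hτ.1]; linarith [hτ.2])).le
        have m2 := (hd (y := ε - τ) (by
          rw [Real.dist_eq, sub_zero, abs_of_nonneg (by linarith [hτ.2])]; linarith [hτ.1])).le
        calc _ ≤ ENNReal.ofReal (η₁ * ∫ r, k r) + C * (ENNReal.ofReal η₂ + ENNReal.ofReal η₂) := by
              gcongr
          _ = ENNReal.ofReal (η₁ * (∫ r, k r) + C * (η₂ + η₂)) := by
              rw [ENNReal.ofReal_add (by positivity) (by positivity),
                ENNReal.ofReal_mul (NNReal.coe_nonneg C), ENNReal.ofReal_add hη₂0.le hη₂0.le]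
              simp
          _ ≤ _ := by
              refine ENNReal.ofReal_le_ofReal ?_
              have q1 : η₁ * (∫ r, k r) ≤ η / 2 := by
                rw [hη₁, div_mul_eq_mul_div, div_le_iff₀ (by positivity)]
                nlinarith
              have q2 : C * (η₂ + η₂) ≤ η / 2 := by
                have : (C : ℝ) * (η₂ + η₂) = (C / (C + 1)) * (η / 2) := by
                  rw [hη₂]; ring
                rw [this]
                have : (C : ℝ) / (C + 1) ≤ 1 := by
                  rw [div_le_one (by positivity)]; linarith
                nlinarith
              linarith
      _ = _ := by
        rw [setLIntegral_const, Real.volume_Ioc, sub_zero, ENNReal.ofReal_mul hη.le]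
  rw [← ofReal_norm, ENNReal.ofReal_le_ofReal_iff (by positivity)] at hfin
  exact hfin

end Dominated

end SGGLE

namespace SGGLE

open Filter Topology
open scoped InnerProductSpace ContDiff

variable {L₁ L₂ : ℝ}

/-! ### Integration by parts on the rectangle -/

lemma integrable_rect_of_continuous {E : Type*} [NormedAddCommGroup E] {F : ℝ × ℝ → E}
    (hF : Continuous F) : Integrable F (rectMeasure L₁ L₂) :=
  (hF.continuousOn.integrableOn_compact isCompact_Icc).mono_set (rect_subset_Icc L₁ L₂)

lemma memLp_rect_of_continuous {F : ℝ × ℝ → ℂ} (hF : Continuous F) :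
    MemLp F 2 (rectMeasure L₁ L₂) :=
  (memLp_two_iff_integrable_sq_norm hF.aestronglyMeasurable).2
    (integrable_rect_of_continuous (hF.norm.pow 2))

lemma hasDerivAt_fst {F : ℝ × ℝ → ℂ} (hF : Differentiable ℝ F) (x y : ℝ) :
    HasDerivAt (fun t => F (t, y)) (fderiv ℝ F (x, y) (1, 0)) x := by
  have h := (hF (x, y)).hasFDerivAt.comp_hasDerivAt x
    ((hasDerivAt_id x).prodMk (hasDerivAt_const x y))
  exact h

lemma hasDerivAt_snd {F : ℝ × ℝ → ℂ} (hF : Differentiable ℝ F) (x y : ℝ) :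
    HasDerivAt (fun t => F (x, t)) (fderiv ℝ F (x, y) (0, 1)) y := by
  have h := (hF (x, y)).hasFDerivAt.comp_hasDerivAt y
    ((hasDerivAt_const y x).prodMk (hasDerivAt_id y))
  exact h

/-- Vanishing on the lines that bound the rectangle. -/
structure VanishesOnSides (L₁ L₂ : ℝ) (F : ℝ × ℝ → ℂ) : Prop where
  left : ∀ y, F (0, y) = 0
  right : ∀ y, F (L₁, y) = 0
  bottom : ∀ x, F (x, 0) = 0
  top : ∀ x, F (x, L₂) = 0

namespace VanishesOnSides

variable {F E : ℝ × ℝ → ℂ}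

lemma of_imp (hF : VanishesOnSides L₁ L₂ F) (h : ∀ x, F x = 0 → E x = 0) :
    VanishesOnSides L₁ L₂ E :=
  ⟨fun y => h _ (hF.left y), fun y => h _ (hF.right y), fun y => h _ (hF.bottom y),
    fun y => h _ (hF.top y)⟩

lemma add (hF : VanishesOnSides L₁ L₂ F) (hE : VanishesOnSides L₁ L₂ E) :
    VanishesOnSides L₁ L₂ fun x => F x + E x :=
  ⟨fun y => by simp [hF.left, hE.left], fun y => by simp [hF.right, hE.right],
    fun y => by simp [hF.bottom, hE.bottom], fun y => by simp [hF.top, hE.top]⟩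

end VanishesOnSides

lemma rectMeasure_eq_prod (L₁ L₂ : ℝ) : rectMeasure L₁ L₂ =
    (volume.restrict (Ioo 0 L₁)).prod (volume.restrict (Ioo 0 L₂)) := by
  rw [Measure.prod_restrict]; rfl

lemma integral_fderiv_fst_eq_zero (hL₁ : 0 ≤ L₁) {F : ℝ × ℝ → ℂ} (hF : ContDiff ℝ 1 F)
    (h : VanishesOnSides L₁ L₂ F) : ∫ x in rect L₁ L₂, fderiv ℝ F x (1, 0) = 0 := by
  have hc : Continuous fun x => fderiv ℝ F x (1, 0) :=
    (hF.continuous_fderiv one_ne_zero).clm_apply continuous_const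
  have hi := integrable_rect_of_continuous (L₁ := L₁) (L₂ := L₂) hc
  rw [rectMeasure_eq_prod] at hi
  rw [show volume.restrict (rect L₁ L₂) = _ from rectMeasure_eq_prod L₁ L₂]
  rw [integral_prod_symm _ hi]
  refine integral_eq_zero_of_ae (Eventually.of_forall fun y => ?_)
  dsimp only
  rw [← integral_Ioc_eq_integral_Ioo, ← intervalIntegral.integral_of_le hL₁,
    intervalIntegral.integral_eq_sub_of_hasDerivAt
      (fun x _ => hasDerivAt_fst (hF.differentiable one_ne_zero) x y)]
  · simp [h.left, h.right]
  · exact (hc.comp (by fun_prop : Continuous fun x : ℝ => (x, y))).intervalIntegrable _ _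

lemma integral_fderiv_snd_eq_zero (hL₂ : 0 ≤ L₂) {F : ℝ × ℝ → ℂ} (hF : ContDiff ℝ 1 F)
    (h : VanishesOnSides L₁ L₂ F) : ∫ x in rect L₁ L₂, fderiv ℝ F x (0, 1) = 0 := by
  have hc : Continuous fun x => fderiv ℝ F x (0, 1) :=
    (hF.continuous_fderiv one_ne_zero).clm_apply continuous_const
  have hi := integrable_rect_of_continuous (L₁ := L₁) (L₂ := L₂) hc
  rw [rectMeasure_eq_prod] at hi
  rw [show volume.restrict (rect L₁ L₂) = _ from rectMeasure_eq_prod L₁ L₂]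
  rw [integral_prod _ hi]
  refine integral_eq_zero_of_ae (Eventually.of_forall fun x => ?_)
  dsimp only
  rw [← integral_Ioc_eq_integral_Ioo, ← intervalIntegral.integral_of_le hL₂,
    intervalIntegral.integral_eq_sub_of_hasDerivAt
      (fun y _ => hasDerivAt_snd (hF.differentiable one_ne_zero) x y)]
  · simp [h.bottom, h.top]
  · exact (hc.comp (by fun_prop : Continuous fun y : ℝ => (x, y))).intervalIntegrable _ _

lemma fderiv_mul_conj {F E : ℝ × ℝ → ℂ} (hF : ContDiff ℝ 1 F) (hE : ContDiff ℝ 1 E)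
    (x v : ℝ × ℝ) : fderiv ℝ (fun y => F y * conj (E y)) x v =
      fderiv ℝ F x v * conj (E x) + F x * conj (fderiv ℝ E x v) := by
  have h1 := (hF.differentiable one_ne_zero x).hasFDerivAt
  have h2 := (Complex.conjCLE.toContinuousLinearMap.hasFDerivAt).comp x
    (hE.differentiable one_ne_zero x).hasFDerivAt
  have h3 : HasFDerivAt (fun y => F y * conj (E y)) _ x := h1.mul h2
  rw [h3.fderiv]
  simp
  ring

lemma contDiff_mul_conj {F E : ℝ × ℝ → ℂ} {n : ℕ∞ω} (hF : ContDiff ℝ n F) (hE : ContDiff ℝ n E) :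
    ContDiff ℝ n fun y => F y * conj (E y) :=
  hF.mul (Complex.conjCLE.toContinuousLinearMap.contDiff.comp hE)

lemma integrable_parts {F E : ℝ × ℝ → ℂ} (hF : ContDiff ℝ 1 F) (hE : ContDiff ℝ 1 E) (v : ℝ × ℝ) :
    Integrable (fun x => fderiv ℝ F x v * conj (E x)) (rectMeasure L₁ L₂) ∧
    Integrable (fun x => F x * conj (fderiv ℝ E x v)) (rectMeasure L₁ L₂) := by
  have h1 := (hF.continuous_fderiv one_ne_zero).clm_apply (continuous_const (y := v))
  have h2 := (hE.continuous_fderiv one_ne_zero).clm_apply (continuous_const (y := v))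
  exact ⟨integrable_rect_of_continuous (h1.mul (Complex.continuous_conj.comp hE.continuous)),
    integrable_rect_of_continuous (hF.continuous.mul (Complex.continuous_conj.comp h2))⟩

lemma integral_parts_fst {F E : ℝ × ℝ → ℂ} (hF : ContDiff ℝ 1 F) (hE : ContDiff ℝ 1 E)
    (h : VanishesOnSides L₁ L₂ fun y => F y * conj (E y)) (hL₁ : 0 ≤ L₁) :
    ∫ x in rect L₁ L₂, F x * conj (fderiv ℝ E x (1, 0)) =
      -∫ x in rect L₁ L₂, fderiv ℝ F x (1, 0) * conj (E x) := by
  have h0 := integral_fderiv_fst_eq_zero hL₁ (contDiff_mul_conj hF hE) h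
  simp only [fderiv_mul_conj hF hE] at h0
  have hi := integrable_parts (L₁ := L₁) (L₂ := L₂) hF hE (1, 0)
  rw [integral_add hi.1 hi.2] at h0
  exact eq_neg_of_add_eq_zero_right h0

lemma integral_parts_snd {F E : ℝ × ℝ → ℂ} (hF : ContDiff ℝ 1 F) (hE : ContDiff ℝ 1 E)
    (h : VanishesOnSides L₁ L₂ fun y => F y * conj (E y)) (hL₂ : 0 ≤ L₂) :
    ∫ x in rect L₁ L₂, F x * conj (fderiv ℝ E x (0, 1)) =
      -∫ x in rect L₁ L₂, fderiv ℝ F x (0, 1) * conj (E x) := by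
  have h0 := integral_fderiv_snd_eq_zero hL₂ (contDiff_mul_conj hF hE) h
  simp only [fderiv_mul_conj hF hE] at h0
  have hi := integrable_parts (L₁ := L₁) (L₂ := L₂) hF hE (0, 1)
  rw [integral_add hi.1 hi.2] at h0
  exact eq_neg_of_add_eq_zero_right h0

lemma IsTestFunction.vanishes {f : ℝ × ℝ → ℂ} (hf : IsTestFunction L₁ L₂ f) :
    VanishesOnSides L₁ L₂ f :=
  ⟨fun _ => hf.eq_zero (by simp [rect]), fun _ => hf.eq_zero (by simp [rect]),
    fun _ => hf.eq_zero (by simp [rect]), fun _ => hf.eq_zero (by simp [rect])⟩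

lemma inner_eq_integral_of_ae {u v : H L₁ L₂} {f g : ℝ × ℝ → ℂ}
    (hu : u =ᵐ[rectMeasure L₁ L₂] f) (hv : v =ᵐ[rectMeasure L₁ L₂] g) :
    ⟪v, u⟫_ℂ = ∫ x in rect L₁ L₂, f x * conj (g x) := by
  rw [inner_H]
  refine integral_congr_ae ?_
  filter_upwards [hu, hv] with x h1 h2
  rw [h1, h2]

/-- Integration by parts against a member of `V`, in the first variable. -/
lemma inner_d₁_eq (hL₁ : 0 ≤ L₁) {F : ℝ × ℝ → ℂ} (hF : ContDiff ℝ 1 F) {u u' : H L₁ L₂}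
    (hu : u =ᵐ[rectMeasure L₁ L₂] F) (hu' : u' =ᵐ[rectMeasure L₁ L₂] fun x => fderiv ℝ F x (1, 0))
    (ψ : V L₁ L₂) : ⟪d₁ ψ, u⟫_ℂ = -⟪toH ψ, u'⟫_ℂ := by
  -- The boundary term vanishes through the approximants of `ψ`, so nothing is required of `F` on
  -- the boundary. This matters because `F` will be a derivative of an eigenfunction, which does not
  -- vanish there.
  obtain ⟨v, f, hf, hv⟩ := exists_seq_test ψ
  have t1 : Tendsto (fun n => ⟪d₁ (v n), u⟫_ℂ) atTop (𝓝 ⟪d₁ ψ, u⟫_ℂ) :=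
    ((continuous_d₁.tendsto _).comp hv).inner tendsto_const_nhds
  have t2 : Tendsto (fun n => -⟪toH (v n), u'⟫_ℂ) atTop (𝓝 (-⟪toH ψ, u'⟫_ℂ)) :=
    (((continuous_toH.tendsto _).comp hv).inner tendsto_const_nhds).neg
  refine tendsto_nhds_unique t1 (t2.congr fun n => ?_)
  obtain ⟨h1, h2⟩ := hf n
  have e1 : ⟪toH (v n), u'⟫_ℂ = _ := inner_eq_integral_of_ae hu' h2.1
  have e2 : ⟪d₁ (v n), u⟫_ℂ = _ := inner_eq_integral_of_ae hu h2.2.1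
  rw [e1, e2,
    integral_parts_fst hF (h1.contDiff 1) (h1.vanishes.of_imp fun x hx => by simp [hx]) hL₁]

/-- Integration by parts against a member of `V`, in the second variable. -/
lemma inner_d₂_eq (hL₂ : 0 ≤ L₂) {F : ℝ × ℝ → ℂ} (hF : ContDiff ℝ 1 F) {u u' : H L₁ L₂}
    (hu : u =ᵐ[rectMeasure L₁ L₂] F) (hu' : u' =ᵐ[rectMeasure L₁ L₂] fun x => fderiv ℝ F x (0, 1))
    (ψ : V L₁ L₂) : ⟪d₂ ψ, u⟫_ℂ = -⟪toH ψ, u'⟫_ℂ := by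
  obtain ⟨v, f, hf, hv⟩ := exists_seq_test ψ
  have t1 : Tendsto (fun n => ⟪d₂ (v n), u⟫_ℂ) atTop (𝓝 ⟪d₂ ψ, u⟫_ℂ) :=
    ((continuous_d₂.tendsto _).comp hv).inner tendsto_const_nhds
  have t2 : Tendsto (fun n => -⟪toH (v n), u'⟫_ℂ) atTop (𝓝 (-⟪toH ψ, u'⟫_ℂ)) :=
    (((continuous_toH.tendsto _).comp hv).inner tendsto_const_nhds).neg
  refine tendsto_nhds_unique t1 (t2.congr fun n => ?_)
  obtain ⟨h1, h2⟩ := hf n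
  have e1 : ⟪toH (v n), u'⟫_ℂ = _ := inner_eq_integral_of_ae hu' h2.1
  have e2 : ⟪d₂ (v n), u⟫_ℂ = _ := inner_eq_integral_of_ae hu h2.2.2
  rw [e1, e2,
    integral_parts_snd hF (h1.contDiff 1) (h1.vanishes.of_imp fun x hx => by simp [hx]) hL₂]

/-- A member of `V` is determined by its function. -/
lemma toH_injective (hL₁ : 0 ≤ L₁) (hL₂ : 0 ≤ L₂) {ψ : V L₁ L₂} (h : toH ψ = 0) : ψ = 0 := by
  -- An element of `H` orthogonal to all test functions is zero. For the gradient components this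
  -- orthogonality comes from moving the derivative to the test function: the gradient is closable.
  have key : ∀ (q : H L₁ L₂), (∀ f : ℝ × ℝ → ℂ, IsTestFunction L₁ L₂ f → ∀ u : H L₁ L₂,
      u =ᵐ[rectMeasure L₁ L₂] f → ⟪q, u⟫_ℂ = 0) → q = 0 := fun q hq => by
    have h0 : ∀ᵐ x ∂volume, x ∈ rect L₁ L₂ → conj (q x) = 0 := by
      refine IsOpen.ae_eq_zero_of_integral_contDiff_smul_eq_zero (isOpen_rect L₁ L₂) ?_ ?_
      · have hi : IntegrableOn (fun x => conj (q x)) (rect L₁ L₂) :=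
          Complex.conjCLE.toContinuousLinearMap.integrable_comp
            ((Lp.memLp q).integrable (by norm_num))
        exact hi.locallyIntegrableOn
      · intro g hg hgs hgr
        have hf : IsTestFunction L₁ L₂ fun x => (g x : ℂ) :=
          ⟨Complex.ofRealCLM.contDiff.comp hg, hgs.comp_left (g := fun x : ℝ => (x : ℂ)) (by simp),
            (tsupport_comp_subset (by simp : ((0 : ℝ) : ℂ) = 0) g).trans hgr⟩
        have h1 := hq _ hf (hf.memLp.toLp _) hf.memLp.coeFn_toLp
        rw [inner_H] at h1
        rw [← setIntegral_eq_integral_of_forall_compl_eq_zero (s := rect L₁ L₂), ← h1]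
        · refine integral_congr_ae ?_
          filter_upwards [hf.memLp.coeFn_toLp] with x hx
          rw [hx, Complex.real_smul]
        · intro x hx
          rw [image_eq_zero_of_notMem_tsupport fun h => hx (hgr h), zero_smul]
    have h1 : ∀ᵐ x ∂rectMeasure L₁ L₂, q x = 0 := by
      rw [ae_restrict_iff' (measurableSet_rect L₁ L₂)]
      filter_upwards [h0] with x hx hxr
      simpa using hx hxr
    exact Lp.ext (EventuallyEq.trans h1 (Lp.coeFn_zero _ _ _).symm)
  have e1 : d₁ ψ = 0 := key _ fun f hf u hu => by
    rw [inner_d₁_eq hL₁ (hf.contDiff 1) hu (hf.fderiv (1, 0)).memLp.coeFn_toLp, h, inner_zero_left,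
      neg_zero]
  have e2 : d₂ ψ = 0 := key _ fun f hf u hu => by
    rw [inner_d₂_eq hL₂ (hf.contDiff 1) hu (hf.fderiv (0, 1)).memLp.coeFn_toLp, h, inner_zero_left,
      neg_zero]
  have h0 : ‖ψ‖ ^ 2 = 0 := by
    rw [norm_sq_V, h, gradSq, e1, e2]; simp
  exact norm_eq_zero.1 (pow_eq_zero_iff two_ne_zero |>.1 h0)

end SGGLE

namespace SGGLE

open Filter Topology
open scoped InnerProductSpace ContDiff

variable {L₁ L₂ : ℝ}

/-! ### Cutting off near the end points of an interval -/

/-- A smooth function which vanishes up to `1` and equals one from `2` on. -/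
def step (y : ℝ) : ℝ := Real.smoothTransition (y - 1)

lemma contDiff_step : ContDiff ℝ ∞ step :=
  Real.smoothTransition.contDiff.comp (contDiff_id.sub contDiff_const)

lemma step_of_le {y : ℝ} (h : y ≤ 1) : step y = 0 :=
  Real.smoothTransition.zero_of_nonpos (by linarith)

lemma step_of_ge {y : ℝ} (h : 2 ≤ y) : step y = 1 :=
  Real.smoothTransition.one_of_one_le (by linarith)

lemma abs_step_le (y : ℝ) : |step y| ≤ 1 := by
  rw [step, abs_of_nonneg (Real.smoothTransition.nonneg _)]
  exact Real.smoothTransition.le_one _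

/-- The derivative of `step` is supported in `[1, 2]`. The quantity `y step'(y)` is invariant under
scaling, so this bound serves the cut-offs at all scales at once. -/
lemma exists_mul_deriv_step_le : ∃ M : ℝ, 0 ≤ M ∧ ∀ y, |y * deriv step y| ≤ M := by
  have hc : Continuous fun y => y * deriv step y :=
    continuous_id.mul (contDiff_step.continuous_deriv (by simp))
  obtain ⟨M, hM⟩ := isCompact_Icc.exists_bound_of_continuousOn (s := Icc (1 : ℝ) 2) hc.continuousOn
  refine ⟨max M 0, le_max_right _ _, fun y => ?_⟩
  by_cases hy : y ∈ Icc (1 : ℝ) 2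
  · exact (hM y hy).trans (le_max_left _ _)
  · have : deriv step y = 0 := by
      rcases lt_or_ge y 1 with h | h
      · have : step =ᶠ[𝓝 y] fun _ => 0 := by
          filter_upwards [gt_mem_nhds h] with z hz using step_of_le (le_of_lt hz)
        rw [this.deriv_eq]; simp
      · have h2 : 2 < y := by
          by_contra h'
          exact hy ⟨h, not_lt.1 h'⟩
        have : step =ᶠ[𝓝 y] fun _ => 1 := by
          filter_upwards [lt_mem_nhds h2] with z hz using step_of_ge (le_of_lt hz)
        rw [this.deriv_eq]; simp
    rw [this]; simp

/-- The cut-off at distance `1/(n+1)` from an end point has a derivative of order `n + 1`, but only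
in a layer where `φ`, which vanishes at that end point, is at most its Lipschitz constant times the
distance. The product stays bounded, and near each interior point the cut-off is eventually one. -/
lemma exists_cutoff_seq {L : ℝ} (hL : 0 < L) {φ : ℝ → ℝ} (hφ : ContDiff ℝ ∞ φ) (h0 : φ 0 = 0)
    (h1 : φ L = 0) : ∃ p : ℕ → ℝ → ℝ, (∀ n, ContDiff ℝ ∞ (p n)) ∧
      (∀ n, ∃ a b, 0 < a ∧ b < L ∧ ∀ x, x ∉ Icc a b → p n x = 0) ∧
      (∃ C : ℝ, 0 ≤ C ∧ ∀ n, ∀ x ∈ Ioo 0 L, |p n x| ≤ C ∧ |deriv (p n) x| ≤ C) ∧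
      ∀ x ∈ Ioo 0 L, Tendsto (fun n => p n x) atTop (𝓝 (φ x)) ∧
        Tendsto (fun n => deriv (p n) x) atTop (𝓝 (deriv φ x)) := by
  have hN : ∀ n : ℕ, (0 : ℝ) < n + 1 := fun n => by positivity
  have hs : ∀ a b : ℝ, ContDiff ℝ ∞ fun x => step (a * (b - x)) := fun a b =>
    contDiff_step.comp (contDiff_const.mul (contDiff_const.sub contDiff_id))
  have hs' : ∀ a : ℝ, ContDiff ℝ ∞ fun x => step (a * x) := fun a =>
    contDiff_step.comp (contDiff_const.mul contDiff_id)
  refine ⟨fun n x => φ x * (step ((n + 1) * x) * step ((n + 1) * (L - x))), fun n =>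
    hφ.mul ((hs' _).mul (hs _ _)), fun n => ⟨1 / (n + 1), L - 1 / (n + 1), by positivity, ?_, ?_⟩,
    ?_, ?_⟩
  · have := hN n
    have : 0 < 1 / ((n : ℝ) + 1) := by positivity
    linarith
  · intro x hx
    rw [mem_Icc, not_and_or, not_le, not_le] at hx
    rcases hx with hx | hx
    · rw [lt_div_iff₀ (hN n)] at hx
      simp [step_of_le (by linarith : ((n : ℝ) + 1) * x ≤ 1)]
    · have : L - x < 1 / (n + 1) := by linarith
      rw [lt_div_iff₀ (hN n)] at this
      simp [step_of_le (by linarith : ((n : ℝ) + 1) * (L - x) ≤ 1)]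
  · obtain ⟨M, hM0, hM⟩ := exists_mul_deriv_step_le
    obtain ⟨K, hK⟩ := isCompact_Icc.exists_bound_of_continuousOn (s := Icc (0 : ℝ) L)
      (hφ.continuous_deriv (by simp)).continuousOn
    have hK0 : 0 ≤ K := (norm_nonneg _).trans (hK 0 (left_mem_Icc.2 hL.le))
    have hlip : ∀ x ∈ Icc 0 L, ∀ y ∈ Icc 0 L, |φ y - φ x| ≤ K * |y - x| := fun x hx y hy =>
      (convex_Icc 0 L).norm_image_sub_le_of_norm_deriv_le
        (fun z _ => hφ.differentiable (by simp) z) hK hx hy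
    -- `K * L` bounds the function; the other three terms come from the product rule for the
    -- derivative.
    refine ⟨K * L + (K + K * M + K * M), by positivity, fun n x hx => ?_⟩
    have hxI : x ∈ Icc 0 L := ⟨hx.1.le, hx.2.le⟩
    have l0 : |φ x| ≤ K * x := by
      have := hlip 0 (left_mem_Icc.2 hL.le) x hxI
      rwa [h0, sub_zero, sub_zero, abs_of_pos hx.1] at this
    have l1 : |φ x| ≤ K * (L - x) := by
      have := hlip L (right_mem_Icc.2 hL.le) x hxI
      rwa [h1, sub_zero, abs_sub_comm, abs_of_pos (show 0 < L - x by linarith [hx.2])] at this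
    have b1 := abs_step_le ((n + 1) * x)
    have b2 := abs_step_le ((n + 1) * (L - x))
    constructor
    · rw [abs_mul, abs_mul]
      have : |step ((n + 1) * x)| * |step ((n + 1) * (L - x))| ≤ 1 :=
        mul_le_one₀ b1 (abs_nonneg _) b2
      calc _ ≤ |φ x| * 1 := by gcongr
        _ ≤ K * L := by
          rw [mul_one]
          exact l0.trans (mul_le_mul_of_nonneg_left hx.2.le hK0)
        _ ≤ _ := le_add_of_nonneg_right (by positivity)
    · have d0 := (hφ.differentiable (by simp) x).hasDerivAt
      have dstep : ∀ y, HasDerivAt step (deriv step y) y := fun y =>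
        (contDiff_step.differentiable (by simp) y).hasDerivAt
      have d1 : HasDerivAt (fun x => step (((n : ℝ) + 1) * x))
          (deriv step ((n + 1) * x) * ((n + 1) * 1)) x :=
        (dstep _).comp x ((hasDerivAt_id x).const_mul _)
      have d2 : HasDerivAt (fun x => step (((n : ℝ) + 1) * (L - x)))
          (deriv step ((n + 1) * (L - x)) * ((n + 1) * (-1))) x :=
        (dstep _).comp x (((hasDerivAt_id x).const_sub L).const_mul _)
      have d3 := d0.mul (d1.mul d2)
      have e : deriv (fun x => φ x * (step (((n : ℝ) + 1) * x) * step ((n + 1) * (L - x)))) x = _ :=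
        d3.deriv
      rw [e]
      have m1 := hM ((n + 1) * x)
      have m2 := hM ((n + 1) * (L - x))
      have k1 : |φ x * (deriv step ((n + 1) * x) * ((n + 1) * 1) * step ((n + 1) * (L - x)))| ≤
          K * M := by
        rw [abs_mul, abs_mul]
        calc _ ≤ (K * x) * (|deriv step ((n + 1) * x) * ((n + 1) * 1)| * 1) := by
              gcongr
              exact mul_nonneg hK0 hx.1.le
          _ = K * |(n + 1) * x * deriv step ((n + 1) * x)| := by
              simp only [abs_mul, abs_of_pos (hN n), abs_of_pos hx.1, mul_one]; ring
          _ ≤ _ := by gcongr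
      have k2 : |φ x * (step ((n + 1) * x) * (deriv step ((n + 1) * (L - x)) * ((n + 1) * (-1))))| ≤
          K * M := by
        have hLx : 0 < L - x := by linarith [hx.2]
        rw [abs_mul, abs_mul]
        calc _ ≤ (K * (L - x)) * (1 * |deriv step ((n + 1) * (L - x)) * ((n + 1) * (-1))|) := by
              gcongr
          _ = K * |(n + 1) * (L - x) * deriv step ((n + 1) * (L - x))| := by
              simp only [abs_mul, abs_of_pos (hN n), abs_of_pos hLx, abs_neg, abs_one,
                mul_one, one_mul]
              ring
          _ ≤ _ := by gcongr
      have k0 : |deriv φ x * (step ((n + 1) * x) * step ((n + 1) * (L - x)))| ≤ K := by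
        rw [abs_mul, abs_mul]
        have : |step ((n + 1) * x)| * |step ((n + 1) * (L - x))| ≤ 1 :=
          mul_le_one₀ b1 (abs_nonneg _) b2
        calc _ ≤ |deriv φ x| * 1 := by gcongr
          _ ≤ K := by rw [mul_one]; exact hK x hxI
      simp only [Pi.mul_apply, mul_add (φ x)]
      refine (abs_add_le _ _).trans ?_
      have := abs_add_le (φ x * (deriv step ((n + 1) * x) * ((n + 1) * 1) * step ((n + 1) * (L - x))))
        (φ x * (step ((n + 1) * x) * (deriv step ((n + 1) * (L - x)) * ((n + 1) * (-1)))))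
      have : 0 ≤ K * L := by positivity
      linarith
  · intro x hx
    have hLx : 0 < L - x := by linarith [hx.2]
    -- From this index on, both rescaled arguments exceed `2` in a neighbourhood of `x`, where
    -- `step` is one.
    obtain ⟨N, hN1⟩ := exists_nat_gt (2 / min x (L - x))
    have hm : 0 < min x (L - x) := lt_min hx.1 hLx
    rw [div_lt_iff₀ hm] at hN1
    have hev : ∀ n ≥ N, (fun z => φ z * (step (((n : ℝ) + 1) * z) * step ((n + 1) * (L - z))))
        =ᶠ[𝓝 x] φ := fun n hn => by
      have hn' : (N : ℝ) ≤ n := by exact_mod_cast hn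
      have q1 : 2 < ((n : ℝ) + 1) * x := by
        nlinarith [min_le_left x (L - x), mul_le_mul_of_nonneg_right hn' hm.le, hN n]
      have q2 : 2 < ((n : ℝ) + 1) * (L - x) := by
        nlinarith [min_le_right x (L - x), mul_le_mul_of_nonneg_right hn' hm.le, hN n]
      have o1 : ∀ᶠ z in 𝓝 x, 2 < ((n : ℝ) + 1) * z :=
        (by fun_prop : Continuous fun z : ℝ => ((n : ℝ) + 1) * z).continuousAt.eventually
          (lt_mem_nhds q1)
      have o2 : ∀ᶠ z in 𝓝 x, 2 < ((n : ℝ) + 1) * (L - z) :=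
        (by fun_prop : Continuous fun z : ℝ => ((n : ℝ) + 1) * (L - z)).continuousAt.eventually
          (lt_mem_nhds q2)
      filter_upwards [o1, o2] with z h1 h2
      rw [step_of_ge h1.le, step_of_ge h2.le]; ring
    exact ⟨tendsto_const_nhds.congr' ((eventually_ge_atTop N).mono fun n hn =>
        (hev n hn).eq_of_nhds.symm),
      tendsto_const_nhds.congr' ((eventually_ge_atTop N).mono fun n hn =>
        (hev n hn).deriv_eq.symm)⟩

/-! ### Membership in `V` -/

lemma tendsto_H_of_dominated {u : ℕ → H L₁ L₂} {v : H L₁ L₂} {f : ℕ → ℝ × ℝ → ℂ} {F : ℝ × ℝ → ℂ}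
    {C : ℝ} (hu : ∀ n, u n =ᵐ[rectMeasure L₁ L₂] f n) (hv : v =ᵐ[rectMeasure L₁ L₂] F)
    (hb : ∀ n, ∀ x ∈ rect L₁ L₂, ‖f n x‖ ≤ C)
    (hl : ∀ x ∈ rect L₁ L₂, Tendsto (fun n => f n x) atTop (𝓝 (F x))) :
    Tendsto u atTop (𝓝 v) := by
  rw [tendsto_iff_norm_sub_tendsto_zero]
  have h : Tendsto (fun n => ∫ x in rect L₁ L₂, ‖(u n - v) x‖ ^ 2) atTop (𝓝 0) := by
    have hae : ∀ᵐ x ∂rectMeasure L₁ L₂, ∀ n, (u n - v) x = f n x - F x := by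
      rw [ae_all_iff]
      intro n
      filter_upwards [Lp.coeFn_sub (u n) v, hu n, hv] with x h1 h2 h3
      rw [h1, Pi.sub_apply, h2, h3]
    have hmem : ∀ᵐ x ∂rectMeasure L₁ L₂, x ∈ rect L₁ L₂ := ae_restrict_mem (measurableSet_rect _ _)
    have := tendsto_integral_of_dominated_convergence (μ := rectMeasure L₁ L₂)
      (F := fun n x => ‖(u n - v) x‖ ^ 2) (f := fun _ => (0 : ℝ)) (fun _ => (C + C) ^ 2)
      (fun n => ((Lp.aestronglyMeasurable _).norm.pow 2)) (integrable_const _) ?_ ?_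
    · simpa using this
    · intro n
      filter_upwards [hae, hmem] with x hx hxr
      rw [hx n, Real.norm_eq_abs, abs_of_nonneg (by positivity)]
      have hF : ‖F x‖ ≤ C := le_of_tendsto (hl x hxr).norm (Eventually.of_forall fun n => hb n x hxr)
      have := (norm_sub_le (f n x) (F x)).trans (add_le_add (hb n x hxr) hF)
      gcongr
    · filter_upwards [hae, hmem] with x hx hxr
      have := (((hl x hxr).sub_const (F x)).norm.pow 2)
      rw [sub_self, norm_zero, zero_pow two_ne_zero] at this
      exact this.congr fun n => by rw [hx n]
  have h2 : Tendsto (fun n => ‖u n - v‖ ^ 2) atTop (𝓝 0) :=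
    h.congr fun n => (norm_sq_H _).symm
  have h3 := h2.sqrt
  simpa using h3

/-- The product of two real functions of one variable, as a complex function on the plane. -/
def tensor (φ ψ : ℝ → ℝ) (x : ℝ × ℝ) : ℂ := ((φ x.1 * ψ x.2 : ℝ) : ℂ)

lemma contDiff_tensor {φ ψ : ℝ → ℝ} {n : ℕ∞ω} (hφ : ContDiff ℝ n φ) (hψ : ContDiff ℝ n ψ) :
    ContDiff ℝ n (tensor φ ψ) :=
  Complex.ofRealCLM.contDiff.comp ((hφ.comp contDiff_fst).mul (hψ.comp contDiff_snd))

lemma fderiv_tensor_fst {φ ψ : ℝ → ℝ} (hφ : Differentiable ℝ φ) (hψ : Differentiable ℝ ψ) :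
    (fun x => fderiv ℝ (tensor φ ψ) x (1, 0)) = tensor (deriv φ) ψ := by
  funext x
  have hd : Differentiable ℝ (tensor φ ψ) :=
    Complex.ofRealCLM.differentiable.comp
      ((hφ.comp differentiable_fst).mul (hψ.comp differentiable_snd))
  have h1 := hasDerivAt_fst hd x.1 x.2
  have h2 : HasDerivAt (fun t => tensor φ ψ (t, x.2)) (tensor (deriv φ) ψ x) x.1 :=
    (((hφ x.1).hasDerivAt.mul_const (ψ x.2))).ofReal_comp
  exact h1.unique h2

lemma fderiv_tensor_snd {φ ψ : ℝ → ℝ} (hφ : Differentiable ℝ φ) (hψ : Differentiable ℝ ψ) :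
    (fun x => fderiv ℝ (tensor φ ψ) x (0, 1)) = tensor φ (deriv ψ) := by
  funext x
  have hd : Differentiable ℝ (tensor φ ψ) :=
    Complex.ofRealCLM.differentiable.comp
      ((hφ.comp differentiable_fst).mul (hψ.comp differentiable_snd))
  have h1 := hasDerivAt_snd hd x.1 x.2
  have h2 : HasDerivAt (fun t => tensor φ ψ (x.1, t)) (tensor φ (deriv ψ) x) x.2 :=
    (((hψ x.2).hasDerivAt.const_mul (φ x.1))).ofReal_comp
  exact h1.unique h2

lemma isTestFunction_tensor {φ ψ : ℝ → ℝ} (hφ : ContDiff ℝ ∞ φ) (hψ : ContDiff ℝ ∞ ψ)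
    {a b a' b' : ℝ} (ha : 0 < a) (hb : b < L₁) (ha' : 0 < a') (hb' : b' < L₂)
    (hs : ∀ x, x ∉ Icc a b → φ x = 0) (hs' : ∀ x, x ∉ Icc a' b' → ψ x = 0) :
    IsTestFunction L₁ L₂ (tensor φ ψ) := by
  have h0 : Function.support (tensor φ ψ) ⊆ Icc a b ×ˢ Icc a' b' := fun x hx => by
    by_contra h
    rw [mem_prod, not_and_or] at h
    rcases h with h | h
    · exact hx (by simp [tensor, hs _ h])
    · exact hx (by simp [tensor, hs' _ h])
  have hc : IsCompact (Icc a b ×ˢ Icc a' b') := isCompact_Icc.prod isCompact_Icc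
  refine ⟨contDiff_tensor hφ hψ, HasCompactSupport.of_support_subset_isCompact hc h0,
    (closure_minimal h0 hc.isClosed).trans ?_⟩
  exact prod_mono (fun x hx => ⟨ha.trans_le hx.1, hx.2.trans_lt hb⟩)
    fun x hx => ⟨ha'.trans_le hx.1, hx.2.trans_lt hb'⟩

/-- Products of the one-dimensional cut-off sequences are test functions that converge boundedly on
the rectangle together with their first derivatives, so dominated convergence applies to each of the
three components. -/
lemma exists_V_tensor (hL₁ : 0 < L₁) (hL₂ : 0 < L₂) {φ ψ : ℝ → ℝ} (hφ : ContDiff ℝ ∞ φ)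
    (hψ : ContDiff ℝ ∞ ψ) (h0 : φ 0 = 0) (h1 : φ L₁ = 0) (h0' : ψ 0 = 0) (h1' : ψ L₂ = 0) :
    ∃ w : V L₁ L₂, Represents (tensor φ ψ) w.1 := by
  obtain ⟨p, pc, ps, ⟨C, hC0, hC⟩, pl⟩ := exists_cutoff_seq hL₁ hφ h0 h1
  obtain ⟨q, qc, qs, ⟨C', hC0', hC'⟩, ql⟩ := exists_cutoff_seq hL₂ hψ h0' h1'
  have htest : ∀ n, IsTestFunction L₁ L₂ (tensor (p n) (q n)) := fun n => by
    obtain ⟨a, b, ha, hb, hs⟩ := ps n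
    obtain ⟨a', b', ha', hb', hs'⟩ := qs n
    exact isTestFunction_tensor (pc n) (qc n) ha hb ha' hb' hs hs'
  choose w hw using fun n => exists_V_of_test (htest n)
  have dp : ∀ n, Differentiable ℝ (p n) := fun n => (pc n).differentiable (by simp)
  have dq : ∀ n, Differentiable ℝ (q n) := fun n => (qc n).differentiable (by simp)
  have dφ : Differentiable ℝ φ := hφ.differentiable (by simp)
  have dψ : Differentiable ℝ ψ := hψ.differentiable (by simp)
  have cf : Continuous (tensor φ ψ) := (contDiff_tensor hφ hψ).continuous
  have cd : ∀ v : ℝ × ℝ, Continuous fun x => fderiv ℝ (tensor φ ψ) x v := fun v =>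
    ((contDiff_tensor hφ hψ).continuous_fderiv (by simp)).clm_apply continuous_const
  have m0 : MemLp (tensor φ ψ) 2 (rectMeasure L₁ L₂) := memLp_rect_of_continuous cf
  have m1 := memLp_rect_of_continuous (L₁ := L₁) (L₂ := L₂) (cd (1, 0))
  have m2 := memLp_rect_of_continuous (L₁ := L₁) (L₂ := L₂) (cd (0, 1))
  let W : PiLp 2 (fun _ : Fin 3 => H L₁ L₂) := WithLp.toLp 2
    ![m0.toLp _, m1.toLp _, m2.toLp _]
  have hrep : Represents (tensor φ ψ) W := ⟨m0.coeFn_toLp, m1.coeFn_toLp, m2.coeFn_toLp⟩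
  have hbd : ∀ {a b c d : ℝ}, |a| ≤ c → |b| ≤ d → 0 ≤ c → ‖((a * b : ℝ) : ℂ)‖ ≤ c * d :=
    fun ha hb hc => by
      rw [Complex.norm_real, Real.norm_eq_abs, abs_mul]; gcongr
  have hlim : ∀ {a b : ℕ → ℝ} {a₀ b₀ : ℝ}, Tendsto a atTop (𝓝 a₀) → Tendsto b atTop (𝓝 b₀) →
      Tendsto (fun n => ((a n * b n : ℝ) : ℂ)) atTop (𝓝 ((a₀ * b₀ : ℝ) : ℂ)) := fun ha hb =>
    (Complex.continuous_ofReal.tendsto _).comp (ha.mul hb)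
  have t : Tendsto (fun n => (w n).1) atTop (𝓝 W) := by
    have e : ∀ n, (w n).1 = WithLp.toLp 2 (fun i => (w n).1 i) := fun n => rfl
    have e' : W = WithLp.toLp 2 (fun i => W i) := rfl
    rw [e']
    refine ((PiLp.continuous_toLp 2 _).tendsto _).comp (f := fun n i => (w n).1 i)
      (tendsto_pi_nhds.2 fun i => ?_)
    fin_cases i
    · exact tendsto_H_of_dominated (fun n => (hw n).1) hrep.1
        (fun n x hx => hbd (hC n _ hx.1).1 (hC' n _ hx.2).1 hC0)
        fun x hx => hlim (pl _ hx.1).1 (ql _ hx.2).1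
    · refine tendsto_H_of_dominated (C := C * C') (fun n => (hw n).2.1) hrep.2.1 (fun n => ?_) ?_
      · intro x hx
        have h1 : fderiv ℝ (tensor (p n) (q n)) x (1, 0) = _ :=
          congrFun (fderiv_tensor_fst (dp n) (dq n)) x
        rw [h1]
        exact hbd (hC n _ hx.1).2 (hC' n _ hx.2).1 hC0
      · intro x hx
        have h1 : ∀ n, fderiv ℝ (tensor (p n) (q n)) x (1, 0) = _ := fun n =>
          congrFun (fderiv_tensor_fst (dp n) (dq n)) x
        have h2 : fderiv ℝ (tensor φ ψ) x (1, 0) = _ := congrFun (fderiv_tensor_fst dφ dψ) x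
        simp only [h1, h2]
        exact hlim (pl _ hx.1).2 (ql _ hx.2).1
    · refine tendsto_H_of_dominated (C := C * C') (fun n => (hw n).2.2) hrep.2.2 (fun n => ?_) ?_
      · intro x hx
        have h1 : fderiv ℝ (tensor (p n) (q n)) x (0, 1) = _ :=
          congrFun (fderiv_tensor_snd (dp n) (dq n)) x
        rw [h1]
        exact hbd (hC n _ hx.1).1 (hC' n _ hx.2).2 hC0
      · intro x hx
        have h1 : ∀ n, fderiv ℝ (tensor (p n) (q n)) x (0, 1) = _ := fun n =>
          congrFun (fderiv_tensor_snd (dp n) (dq n)) x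
        have h2 : fderiv ℝ (tensor φ ψ) x (0, 1) = _ := congrFun (fderiv_tensor_snd dφ dψ) x
        simp only [h1, h2]
        exact hlim (pl _ hx.1).1 (ql _ hx.2).2
  have hclosed : IsClosed (V L₁ L₂ : Set (PiLp 2 (fun _ : Fin 3 => H L₁ L₂))) :=
    Submodule.isClosed_topologicalClosure _
  exact ⟨⟨W, hclosed.mem_of_tendsto t (Eventually.of_forall fun n => (w n).2)⟩, hrep⟩

end SGGLE

namespace SGGLE

open Filter Topology
open scoped InnerProductSpace ContDiff

variable {L₁ L₂ : ℝ}

/-! ### Sine functions -/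

/-- The frequency of the `j`-th sine function on `(0, L)`. -/
def freq (L : ℝ) (j : ℕ) : ℝ := (j + 1) * Real.pi / L

/-- The `j`-th sine function on `(0, L)`. -/
def sinFn (L : ℝ) (j : ℕ) (x : ℝ) : ℝ := Real.sin (freq L j * x)

lemma freq_pos {L : ℝ} (hL : 0 < L) (j : ℕ) : 0 < freq L j := by
  have := Real.pi_pos
  unfold freq; positivity

lemma freq_injective {L : ℝ} (hL : 0 < L) : Function.Injective (freq L) := fun i j h => by
  have hπ := Real.pi_pos
  unfold freq at h
  have : ((i : ℝ) + 1) = j + 1 := by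
    field_simp at h
    linarith
  exact_mod_cast add_right_cancel this

lemma contDiff_sinFn (L : ℝ) (j : ℕ) : ContDiff ℝ ∞ (sinFn L j) :=
  Real.contDiff_sin.comp (contDiff_const.mul contDiff_id)

lemma sinFn_zero (L : ℝ) (j : ℕ) : sinFn L j 0 = 0 := by simp [sinFn]

lemma sinFn_right {L : ℝ} (hL : 0 < L) (j : ℕ) : sinFn L j L = 0 := by
  have : freq L j * L = ((j + 1 : ℕ) : ℝ) * Real.pi := by
    unfold freq; push_cast; field_simp
  rw [sinFn, this, Real.sin_nat_mul_pi]

lemma deriv_deriv_sinFn (L : ℝ) (j : ℕ) :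
    deriv (deriv (sinFn L j)) = fun x => -(freq L j ^ 2) * sinFn L j x := by
  have h1 : deriv (sinFn L j) = fun x => freq L j * Real.cos (freq L j * x) := funext fun x => by
    have := ((Real.hasDerivAt_sin (freq L j * x)).comp x ((hasDerivAt_id x).const_mul (freq L j)))
    refine (HasDerivAt.deriv this).trans ?_
    ring
  rw [h1]
  funext x
  have := ((Real.hasDerivAt_cos (freq L j * x)).comp x
    ((hasDerivAt_id x).const_mul (freq L j))).const_mul (freq L j)
  refine (HasDerivAt.deriv this).trans ?_
  rw [sinFn]; ring

/-- The product sine functions on the rectangle. -/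
def sinProd (L₁ L₂ : ℝ) (s : ℕ × ℕ) : ℝ × ℝ → ℂ := tensor (sinFn L₁ s.1) (sinFn L₂ s.2)

/-- The second derivative in the direction `v`. -/
def deriv₂ (v : ℝ × ℝ) (U : ℝ × ℝ → ℂ) (x : ℝ × ℝ) : ℂ :=
  fderiv ℝ (fun y => fderiv ℝ U y v) x v

lemma deriv₂_fst_sinProd (s : ℕ × ℕ) (x : ℝ × ℝ) :
    deriv₂ (1, 0) (sinProd L₁ L₂ s) x = -(freq L₁ s.1 ^ 2 : ℝ) * sinProd L₁ L₂ s x := by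
  have hd := (contDiff_sinFn L₁ s.1).differentiable (by simp)
  have hd' := (contDiff_sinFn L₂ s.2).differentiable (by simp)
  have hdd : Differentiable ℝ (deriv (sinFn L₁ s.1)) :=
    ((contDiff_infty_iff_deriv.1 (contDiff_sinFn L₁ s.1)).2).differentiable (by simp)
  rw [deriv₂, sinProd, fderiv_tensor_fst hd hd']
  have := congrFun (fderiv_tensor_fst hdd hd') x
  rw [this, tensor, tensor, deriv_deriv_sinFn]
  push_cast
  ring

lemma deriv₂_snd_sinProd (s : ℕ × ℕ) (x : ℝ × ℝ) :
    deriv₂ (0, 1) (sinProd L₁ L₂ s) x = -(freq L₂ s.2 ^ 2 : ℝ) * sinProd L₁ L₂ s x := by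
  have hd := (contDiff_sinFn L₁ s.1).differentiable (by simp)
  have hd' := (contDiff_sinFn L₂ s.2).differentiable (by simp)
  have hdd : Differentiable ℝ (deriv (sinFn L₂ s.2)) :=
    ((contDiff_infty_iff_deriv.1 (contDiff_sinFn L₂ s.2)).2).differentiable (by simp)
  rw [deriv₂, sinProd, fderiv_tensor_snd hd hd']
  have := congrFun (fderiv_tensor_snd hd hdd) x
  rw [this, tensor, tensor, deriv_deriv_sinFn]
  push_cast
  ring

lemma vanishes_sinProd (hL₁ : 0 < L₁) (hL₂ : 0 < L₂) (s : ℕ × ℕ) :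
    VanishesOnSides L₁ L₂ (sinProd L₁ L₂ s) := by
  constructor <;> intro y <;>
    simp [sinProd, tensor, sinFn_zero, sinFn_right hL₁, sinFn_right hL₂]

lemma contDiff_sinProd (s : ℕ × ℕ) : ContDiff ℝ ∞ (sinProd L₁ L₂ s) :=
  contDiff_tensor (contDiff_sinFn _ _) (contDiff_sinFn _ _)

/-! ### Completeness -/

/-- The product sine functions as real continuous functions. -/
def sinC (L₁ L₂ : ℝ) (s : ℕ × ℕ) : C(ℝ × ℝ, ℝ) where
  toFun x := sinFn L₁ s.1 x.1 * sinFn L₂ s.2 x.2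
  continuous_toFun := ((contDiff_sinFn _ _).continuous.comp continuous_fst).mul
    ((contDiff_sinFn _ _).continuous.comp continuous_snd)

/-- The span of the product sine functions. -/
def sinSpan (L₁ L₂ : ℝ) : Submodule ℝ C(ℝ × ℝ, ℝ) := Submodule.span ℝ (range (sinC L₁ L₂))

/-- The multipliers of the span of the product sine functions. -/
def sinMult (L₁ L₂ : ℝ) : Subalgebra ℝ C(ℝ × ℝ, ℝ) where
  carrier := {φ | ∀ e ∈ sinSpan L₁ L₂, φ * e ∈ sinSpan L₁ L₂}
  mul_mem' {φ ψ} hφ hψ e he := by rw [mul_assoc]; exact hφ _ (hψ e he)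
  add_mem' {φ ψ} hφ hψ e he := by rw [add_mul]; exact add_mem (hφ e he) (hψ e he)
  algebraMap_mem' r e he := by
    rw [Algebra.algebraMap_eq_smul_one, smul_mul_assoc, one_mul]
    exact Submodule.smul_mem _ r he

lemma mem_sinMult_of_range {φ : C(ℝ × ℝ, ℝ)} (h : ∀ s, φ * sinC L₁ L₂ s ∈ sinSpan L₁ L₂) :
    φ ∈ sinMult L₁ L₂ := fun e he => by
  induction he using Submodule.span_induction with
  | mem x hx => obtain ⟨s, rfl⟩ := hx; exact h s
  | zero => simp
  | add x y _ _ hx hy => rw [mul_add]; exact add_mem hx hy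
  | smul a x _ hx => rw [mul_smul_comm]; exact Submodule.smul_mem _ a hx

/-- Multiplication by the lowest cosine moves a sine to its two neighbouring frequencies. For the
lowest sine the lower neighbour is zero, so the span of the sines is preserved. -/
lemma cos_mul_sinFn_zero (L x : ℝ) :
    Real.cos (freq L 0 * x) * sinFn L 0 x = 1 / 2 * sinFn L 1 x := by
  have : freq L 1 * x = freq L 0 * x + freq L 0 * x := by unfold freq; push_cast; ring
  rw [sinFn, sinFn, this, Real.sin_add]; ring

lemma cos_mul_sinFn_succ (L : ℝ) (j : ℕ) (x : ℝ) :
    Real.cos (freq L 0 * x) * sinFn L (j + 1) x =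
      1 / 2 * sinFn L (j + 2) x + 1 / 2 * sinFn L j x := by
  have h1 : freq L (j + 2) * x = freq L (j + 1) * x + freq L 0 * x := by
    unfold freq; push_cast; ring
  have h2 : freq L j * x = freq L (j + 1) * x - freq L 0 * x := by unfold freq; push_cast; ring
  rw [sinFn, sinFn, sinFn, h1, h2, Real.sin_add, Real.sin_sub]; ring

/-- The lowest cosine in the first variable. -/
def cosC₁ (L₁ : ℝ) : C(ℝ × ℝ, ℝ) where
  toFun x := Real.cos (freq L₁ 0 * x.1)

/-- The lowest cosine in the second variable. -/
def cosC₂ (L₂ : ℝ) : C(ℝ × ℝ, ℝ) where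
  toFun x := Real.cos (freq L₂ 0 * x.2)

lemma sinC_mem (s : ℕ × ℕ) : sinC L₁ L₂ s ∈ sinSpan L₁ L₂ := Submodule.subset_span ⟨s, rfl⟩

lemma cosC₁_mem : cosC₁ L₁ ∈ sinMult L₁ L₂ := mem_sinMult_of_range fun ⟨j, k⟩ => by
  cases j with
  | zero =>
    have : cosC₁ L₁ * sinC L₁ L₂ (0, k) = (1 / 2 : ℝ) • sinC L₁ L₂ (1, k) := by
      ext x
      change Real.cos (freq L₁ 0 * x.1) * (sinFn L₁ 0 x.1 * sinFn L₂ k x.2) =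
        1 / 2 * (sinFn L₁ 1 x.1 * sinFn L₂ k x.2)
      rw [← mul_assoc, cos_mul_sinFn_zero, mul_assoc]
    rw [this]
    exact Submodule.smul_mem _ _ (sinC_mem _)
  | succ j =>
    have : cosC₁ L₁ * sinC L₁ L₂ (j + 1, k) =
        (1 / 2 : ℝ) • sinC L₁ L₂ (j + 2, k) + (1 / 2 : ℝ) • sinC L₁ L₂ (j, k) := by
      ext x
      change Real.cos (freq L₁ 0 * x.1) * (sinFn L₁ (j + 1) x.1 * sinFn L₂ k x.2) =
        1 / 2 * (sinFn L₁ (j + 2) x.1 * sinFn L₂ k x.2) + 1 / 2 * (sinFn L₁ j x.1 * sinFn L₂ k x.2)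
      rw [← mul_assoc, cos_mul_sinFn_succ]; ring
    rw [this]
    exact add_mem (Submodule.smul_mem _ _ (sinC_mem _)) (Submodule.smul_mem _ _ (sinC_mem _))

lemma cosC₂_mem : cosC₂ L₂ ∈ sinMult L₁ L₂ := mem_sinMult_of_range fun ⟨j, k⟩ => by
  cases k with
  | zero =>
    have : cosC₂ L₂ * sinC L₁ L₂ (j, 0) = (1 / 2 : ℝ) • sinC L₁ L₂ (j, 1) := by
      ext x
      change Real.cos (freq L₂ 0 * x.2) * (sinFn L₁ j x.1 * sinFn L₂ 0 x.2) =
        1 / 2 * (sinFn L₁ j x.1 * sinFn L₂ 1 x.2)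
      rw [mul_left_comm, cos_mul_sinFn_zero]; ring
    rw [this]
    exact Submodule.smul_mem _ _ (sinC_mem _)
  | succ k =>
    have : cosC₂ L₂ * sinC L₁ L₂ (j, k + 1) =
        (1 / 2 : ℝ) • sinC L₁ L₂ (j, k + 2) + (1 / 2 : ℝ) • sinC L₁ L₂ (j, k) := by
      ext x
      change Real.cos (freq L₂ 0 * x.2) * (sinFn L₁ j x.1 * sinFn L₂ (k + 1) x.2) =
        1 / 2 * (sinFn L₁ j x.1 * sinFn L₂ (k + 2) x.2) + 1 / 2 * (sinFn L₁ j x.1 * sinFn L₂ k x.2)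
      rw [mul_left_comm, cos_mul_sinFn_succ]; ring
    rw [this]
    exact add_mem (Submodule.smul_mem _ _ (sinC_mem _)) (Submodule.smul_mem _ _ (sinC_mem _))

lemma cos_freq_injOn {L : ℝ} (hL : 0 < L) : InjOn (fun x => Real.cos (freq L 0 * x)) (Icc 0 L) := by
  have hπ := Real.pi_pos
  have hf := freq_pos hL 0
  have hL' : freq L 0 * L = Real.pi := by unfold freq; push_cast; field_simp; ring
  have hm : ∀ z ∈ Icc 0 L, freq L 0 * z ∈ Icc 0 Real.pi := fun z hz =>
    ⟨mul_nonneg hf.le hz.1, by rw [← hL']; exact mul_le_mul_of_nonneg_left hz.2 hf.le⟩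
  intro x hx y hy h
  exact mul_left_cancel₀ hf.ne' (Real.injOn_cos (hm x hx) (hm y hy) h)

/-- The multipliers are dense in the continuous functions on the closed rectangle. -/
lemma exists_sinMult_near (hL₁ : 0 < L₁) (hL₂ : 0 < L₂) (g : C(ℝ × ℝ, ℝ)) {ε : ℝ} (hε : 0 < ε) :
    ∃ φ ∈ sinMult L₁ L₂, ∀ x ∈ rect L₁ L₂, |φ x - g x| ≤ ε := by
  let K : Set (ℝ × ℝ) := Icc (0, 0) (L₁, L₂)
  have : CompactSpace K := isCompact_iff_compactSpace.1 isCompact_Icc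
  let ι : C(K, ℝ × ℝ) := ⟨Subtype.val, continuous_subtype_val⟩
  let ρ : C(ℝ × ℝ, ℝ) →ₐ[ℝ] C(K, ℝ) := ContinuousMap.compRightAlgHom ℝ ℝ ι
  -- The lowest cosine in each variable is a multiplier and is injective on its interval.
  -- Stone–Weierstrass is applied to the multipliers because they form an algebra with constants,
  -- whereas every element of the sine span vanishes on the boundary.
  have hsep : ((sinMult L₁ L₂).map ρ).SeparatesPoints := by
    intro x y hxy
    by_cases h1 : (x : ℝ × ℝ).1 = (y : ℝ × ℝ).1
    · have h2 : (x : ℝ × ℝ).2 ≠ (y : ℝ × ℝ).2 := fun h2 => hxy (Subtype.ext (Prod.ext h1 h2))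
      refine ⟨ρ (cosC₂ L₂), ⟨ρ (cosC₂ L₂), ⟨_, cosC₂_mem, rfl⟩, rfl⟩, fun h => h2 ?_⟩
      exact cos_freq_injOn hL₂ ⟨x.2.1.2, x.2.2.2⟩ ⟨y.2.1.2, y.2.2.2⟩ h
    · refine ⟨ρ (cosC₁ L₁), ⟨ρ (cosC₁ L₁), ⟨_, cosC₁_mem, rfl⟩, rfl⟩, fun h => h1 ?_⟩
      exact cos_freq_injOn hL₁ ⟨x.2.1.1, x.2.2.1⟩ ⟨y.2.1.1, y.2.2.1⟩ h
  obtain ⟨⟨_, φ, hφ, rfl⟩, h⟩ := ContinuousMap.exists_mem_subalgebra_near_continuousMap_of_separatesPoints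
    ((sinMult L₁ L₂).map ρ) hsep (ρ g) ε hε
  refine ⟨φ, hφ, fun x hx => ?_⟩
  have := (ContinuousMap.norm_lt_iff _ hε).1 h ⟨x, rect_subset_Icc L₁ L₂ hx⟩
  exact this.le

/-- A function orthogonal to all sine products is orthogonal to every multiplier times the lowest
product `e₀`. The multipliers are uniformly dense on the rectangle, so `e₀ q = 0` almost everywhere,
and `e₀` is positive in the interior. -/
lemma ae_eq_zero_of_forall_sinC (hL₁ : 0 < L₁) (hL₂ : 0 < L₂) {q : ℝ × ℝ → ℂ}
    (hq : Integrable q (rectMeasure L₁ L₂))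
    (h : ∀ s, ∫ x in rect L₁ L₂, sinC L₁ L₂ s x • q x = 0) : q =ᵐ[rectMeasure L₁ L₂] 0 := by
  have hint : ∀ e : C(ℝ × ℝ, ℝ), Integrable (fun x => e x • q x) (rectMeasure L₁ L₂) := fun e => by
    obtain ⟨C, hC⟩ := isCompact_Icc.exists_bound_of_continuousOn (s := Icc ((0 : ℝ), (0 : ℝ)) (L₁, L₂))
      e.continuous.continuousOn
    refine hq.bdd_smul C e.continuous.aestronglyMeasurable ?_
    filter_upwards [ae_restrict_mem (measurableSet_rect L₁ L₂)] with x hx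
    exact hC x (rect_subset_Icc L₁ L₂ hx)
  have hspan : ∀ e ∈ sinSpan L₁ L₂, ∫ x in rect L₁ L₂, e x • q x = 0 := fun e he => by
    induction he using Submodule.span_induction with
    | mem x hx => obtain ⟨s, rfl⟩ := hx; exact h s
    | zero => simp
    | add x y _ _ hx hy =>
      simp only [ContinuousMap.add_apply, add_smul]
      rw [integral_add (hint x) (hint y), hx, hy, add_zero]
    | smul a x _ hx =>
      simp only [ContinuousMap.smul_apply, smul_assoc]
      rw [integral_smul, hx, smul_zero]
  set e₀ := sinC L₁ L₂ (0, 0) with he₀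
  have hg : ∀ g : C(ℝ × ℝ, ℝ), ∫ x in rect L₁ L₂, g x • (e₀ x • q x) = 0 := fun g => by
    set B := ∫ x in rect L₁ L₂, ‖e₀ x • q x‖ with hB
    have hB0 : 0 ≤ B := integral_nonneg fun _ => norm_nonneg _
    have hi : ∀ φ : C(ℝ × ℝ, ℝ), Integrable (fun x => φ x • (e₀ x • q x)) (rectMeasure L₁ L₂) :=
      fun φ => by simpa only [ContinuousMap.mul_apply, mul_smul] using hint (φ * e₀)
    have hle : ∀ ε > 0, ‖∫ x in rect L₁ L₂, g x • (e₀ x • q x)‖ ≤ ε * B := fun ε hε => by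
      obtain ⟨φ, hφ, hφg⟩ := exists_sinMult_near hL₁ hL₂ g hε
      have h0 := hspan _ (hφ e₀ (sinC_mem _))
      simp only [ContinuousMap.mul_apply, mul_smul] at h0
      rw [← sub_zero (∫ x in rect L₁ L₂, g x • (e₀ x • q x)), ← h0, ← integral_sub (hi g) (hi φ),
        hB, ← integral_const_mul]
      refine norm_integral_le_of_norm_le ((hint e₀).norm.const_mul ε) ?_
      filter_upwards [ae_restrict_mem (measurableSet_rect L₁ L₂)] with x hx
      rw [← sub_smul, norm_smul, Real.norm_eq_abs, abs_sub_comm]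
      gcongr
      exact hφg x hx
    have : ‖∫ x in rect L₁ L₂, g x • (e₀ x • q x)‖ ≤ 0 := by
      refine le_of_forall_pos_le_add fun ε hε => ?_
      refine (hle (ε / (B + 1)) (by positivity)).trans ?_
      rw [zero_add, div_mul_eq_mul_div, div_le_iff₀ (by positivity)]
      nlinarith
    exact norm_le_zero_iff.1 this
  have h0 : ∀ᵐ x ∂volume, x ∈ rect L₁ L₂ → e₀ x • q x = 0 := by
    refine IsOpen.ae_eq_zero_of_integral_contDiff_smul_eq_zero (isOpen_rect L₁ L₂) ?_ ?_
    · exact IntegrableOn.locallyIntegrableOn (hint e₀)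
    · intro g hgc hgs hgr
      rw [← hg ⟨g, hgc.continuous⟩]
      refine (setIntegral_eq_integral_of_forall_compl_eq_zero fun x hx => ?_).symm
      rw [ContinuousMap.coe_mk, image_eq_zero_of_notMem_tsupport fun h => hx (hgr h), zero_smul]
  have hpos : ∀ {L x : ℝ}, 0 < L → x ∈ Ioo 0 L → 0 < sinFn L 0 x := fun {L x} hL hx => by
    have hf := freq_pos hL 0
    have hL' : freq L 0 * L = Real.pi := by unfold freq; push_cast; field_simp; ring
    refine Real.sin_pos_of_pos_of_lt_pi (mul_pos hf hx.1) ?_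
    rw [← hL']
    exact mul_lt_mul_of_pos_left hx.2 hf
  rw [EventuallyEq, ae_restrict_iff' (measurableSet_rect L₁ L₂)]
  filter_upwards [h0] with x hx hxr
  refine (smul_eq_zero.1 (hx hxr)).resolve_left (ne_of_gt ?_)
  exact mul_pos (hpos hL₁ hxr.1) (hpos hL₂ hxr.2)

end SGGLE

namespace SGGLE

open Filter Topology
open scoped InnerProductSpace ContDiff

variable {L₁ L₂ : ℝ}

/-! ### The eigenbasis of the Laplacian -/

/-- A member of `V` given by a smooth function on the plane that vanishes on the sides. -/
structure SmoothRep (u : V L₁ L₂) (U : ℝ × ℝ → ℂ) : Prop where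
  contDiff : ContDiff ℝ ∞ U
  vanishes : VanishesOnSides L₁ L₂ U
  rep : Represents U u.1

namespace SmoothRep

variable {u : V L₁ L₂} {U : ℝ × ℝ → ℂ}

lemma toH_ae (h : SmoothRep u U) : toH u =ᵐ[rectMeasure L₁ L₂] U := h.rep.1
lemma d₁_ae (h : SmoothRep u U) :
    d₁ u =ᵐ[rectMeasure L₁ L₂] fun x => fderiv ℝ U x (1, 0) := h.rep.2.1
lemma d₂_ae (h : SmoothRep u U) :
    d₂ u =ᵐ[rectMeasure L₁ L₂] fun x => fderiv ℝ U x (0, 1) := h.rep.2.2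

lemma differentiable (h : SmoothRep u U) : Differentiable ℝ U :=
  h.contDiff.differentiable (by simp)

lemma contDiff_fderiv (h : SmoothRep u U) (v : ℝ × ℝ) : ContDiff ℝ ∞ fun x => fderiv ℝ U x v :=
  (h.contDiff.fderiv_right (m := ∞) (by simp)).clm_apply contDiff_const

lemma smul (h : SmoothRep u U) (c : ℂ) : SmoothRep (c • u) (fun x => c * U x) := by
  have hf : ∀ x v, fderiv ℝ (fun x => c * U x) x v = c * fderiv ℝ U x v := fun x v => by
    rw [fderiv_const_mul (h.differentiable x)]; rfl
  refine ⟨contDiff_const.mul h.contDiff, h.vanishes.of_imp fun x hx => by simp [hx], ?_, ?_, ?_⟩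
  · filter_upwards [Lp.coeFn_smul c (toH u), h.toH_ae] with x h1 h2
    exact h1.trans (by rw [Pi.smul_apply, h2, smul_eq_mul])
  · filter_upwards [Lp.coeFn_smul c (d₁ u), h.d₁_ae] with x h1 h2
    exact h1.trans (by rw [Pi.smul_apply, h2, smul_eq_mul, hf])
  · filter_upwards [Lp.coeFn_smul c (d₂ u), h.d₂_ae] with x h1 h2
    exact h1.trans (by rw [Pi.smul_apply, h2, smul_eq_mul, hf])

lemma add {u' : V L₁ L₂} {U' : ℝ × ℝ → ℂ} (h : SmoothRep u U) (h' : SmoothRep u' U') :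
    SmoothRep (u + u') (fun x => U x + U' x) := by
  have hf : ∀ x v, fderiv ℝ (fun x => U x + U' x) x v = fderiv ℝ U x v + fderiv ℝ U' x v :=
    fun x v => by
      rw [fderiv_fun_add (h.differentiable x) (h'.differentiable x)]; rfl
  refine ⟨h.contDiff.add h'.contDiff, h.vanishes.add h'.vanishes, ?_, ?_, ?_⟩
  · filter_upwards [Lp.coeFn_add (toH u) (toH u'), h.toH_ae, h'.toH_ae] with x h1 h2 h3
    exact h1.trans (by rw [Pi.add_apply, h2, h3])
  · filter_upwards [Lp.coeFn_add (d₁ u) (d₁ u'), h.d₁_ae, h'.d₁_ae] with x h1 h2 h3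
    exact h1.trans (by rw [Pi.add_apply, h2, h3, hf])
  · filter_upwards [Lp.coeFn_add (d₂ u) (d₂ u'), h.d₂_ae, h'.d₂_ae] with x h1 h2 h3
    exact h1.trans (by rw [Pi.add_apply, h2, h3, hf])

lemma deriv₂_smul (h : SmoothRep u U) (c : ℂ) (v x : ℝ × ℝ) :
    deriv₂ v (fun x => c * U x) x = c * deriv₂ v U x := by
  have hf : (fun x => fderiv ℝ (fun x => c * U x) x v) = fun x => c * fderiv ℝ U x v :=
    funext fun x => by rw [fderiv_const_mul (h.differentiable x)]; rfl
  rw [deriv₂, hf, fderiv_const_mul ((h.contDiff_fderiv v).differentiable (by simp) x)]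
  rfl

lemma deriv₂_add {u' : V L₁ L₂} {U' : ℝ × ℝ → ℂ} (h : SmoothRep u U) (h' : SmoothRep u' U')
    (v x : ℝ × ℝ) : deriv₂ v (fun x => U x + U' x) x = deriv₂ v U x + deriv₂ v U' x := by
  have hf : (fun x => fderiv ℝ (fun x => U x + U' x) x v) =
      fun x => fderiv ℝ U x v + fderiv ℝ U' x v :=
    funext fun x => by rw [fderiv_fun_add (h.differentiable x) (h'.differentiable x)]; rfl
  rw [deriv₂, hf, fderiv_fun_add ((h.contDiff_fderiv v).differentiable (by simp) x)
    ((h'.contDiff_fderiv v).differentiable (by simp) x)]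
  rfl

lemma zero : SmoothRep (0 : V L₁ L₂) (fun _ => 0) := by
  refine ⟨contDiff_const, ⟨fun _ => rfl, fun _ => rfl, fun _ => rfl, fun _ => rfl⟩, ?_, ?_, ?_⟩
  · exact Lp.coeFn_zero _ _ _
  · filter_upwards [Lp.coeFn_zero ℂ 2 (rectMeasure L₁ L₂)] with x hx
    exact hx.trans (by simp)
  · filter_upwards [Lp.coeFn_zero ℂ 2 (rectMeasure L₁ L₂)] with x hx
    exact hx.trans (by simp)

end SmoothRep

/-- An orthonormal family of smooth eigenfunctions of the Dirichlet Laplacian which is complete. -/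
structure EigenBasis (L₁ L₂ : ℝ) where
  e : ℕ × ℕ → V L₁ L₂
  E : ℕ × ℕ → ℝ × ℝ → ℂ
  lam : ℕ × ℕ → ℝ
  rep : ∀ s, SmoothRep (e s) (E s)
  lap : ∀ s x, deriv₂ (1, 0) (E s) x + deriv₂ (0, 1) (E s) x = -lam s * E s x
  orthonormal : Orthonormal ℂ fun s => toH (e s)
  lam_pos : ∀ s, 0 < lam s
  lam_large : ∀ R : ℝ, ∃ N : ℕ, ∀ n, N ≤ n → ∀ s, s ∉ Finset.range n ×ˢ Finset.range n → R ≤ lam s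
  complete : ∀ x : H L₁ L₂, (∀ s, ⟪toH (e s), x⟫_ℂ = 0) → x = 0

lemma inner_d₁_of_eigen (hL₁ : 0 ≤ L₁) {u : V L₁ L₂} {U : ℝ × ℝ → ℂ} (hu : SmoothRep u U) {μ : ℝ}
    (h : ∀ x, deriv₂ (1, 0) U x = -(μ : ℂ) * U x) (ψ : V L₁ L₂) :
    ⟪d₁ ψ, d₁ u⟫_ℂ = μ * ⟪toH ψ, toH u⟫_ℂ := by
  have h2 : ((-(μ : ℂ)) • toH u : H L₁ L₂) =ᵐ[rectMeasure L₁ L₂]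
      fun x => fderiv ℝ (fun y => fderiv ℝ U y (1, 0)) x (1, 0) := by
    filter_upwards [Lp.coeFn_smul (-(μ : ℂ)) (toH u), hu.toH_ae] with x h1 h2
    rw [h1, Pi.smul_apply, h2, smul_eq_mul, ← h x, deriv₂]
  rw [inner_d₁_eq hL₁ ((hu.contDiff_fderiv (1, 0)).of_le (by simp)) hu.d₁_ae h2, inner_smul_right]
  ring

lemma inner_d₂_of_eigen (hL₂ : 0 ≤ L₂) {u : V L₁ L₂} {U : ℝ × ℝ → ℂ} (hu : SmoothRep u U) {μ : ℝ}
    (h : ∀ x, deriv₂ (0, 1) U x = -(μ : ℂ) * U x) (ψ : V L₁ L₂) :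
    ⟪d₂ ψ, d₂ u⟫_ℂ = μ * ⟪toH ψ, toH u⟫_ℂ := by
  have h2 : ((-(μ : ℂ)) • toH u : H L₁ L₂) =ᵐ[rectMeasure L₁ L₂]
      fun x => fderiv ℝ (fun y => fderiv ℝ U y (0, 1)) x (0, 1) := by
    filter_upwards [Lp.coeFn_smul (-(μ : ℂ)) (toH u), hu.toH_ae] with x h1 h2
    rw [h1, Pi.smul_apply, h2, smul_eq_mul, ← h x, deriv₂]
  rw [inner_d₂_eq hL₂ ((hu.contDiff_fderiv (0, 1)).of_le (by simp)) hu.d₂_ae h2, inner_smul_right]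
  ring

/-- The symmetric form `c` is read as an eigenvalue times the inner product in two ways; with
different eigenvalues, both hold only if the inner product vanishes. -/
lemma inner_eq_zero_of_eigen {A : Type*} [NormedAddCommGroup A] [InnerProductSpace ℂ A] {x y : A}
    {μ μ' : ℝ} {c : ℂ} (hμ : μ ≠ μ') (h : c = μ * ⟪x, y⟫_ℂ) (h' : conj c = μ' * ⟪y, x⟫_ℂ) :
    ⟪x, y⟫_ℂ = 0 := by
  have h2 : c = μ' * ⟪x, y⟫_ℂ := by
    have := congrArg conj h'
    rwa [Complex.conj_conj, map_mul, Complex.conj_ofReal, inner_conj_symm] at this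
  have h3 : ((μ : ℂ) - μ') * ⟪x, y⟫_ℂ = 0 := by rw [sub_mul, ← h, ← h2, sub_self]
  refine (mul_eq_zero.1 h3).resolve_left fun h4 => hμ ?_
  exact_mod_cast sub_eq_zero.1 h4

lemma exists_le_freq_sq {L : ℝ} (hL : 0 < L) (R : ℝ) :
    ∃ N : ℕ, ∀ j, N ≤ j → R ≤ freq L j ^ 2 := by
  have hπ := Real.pi_pos
  obtain ⟨N, hN⟩ := exists_nat_ge ((|R| + 1) * L / Real.pi)
  refine ⟨N, fun j hj => ?_⟩
  have h1 : |R| + 1 ≤ freq L j := by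
    have : (N : ℝ) ≤ j := by exact_mod_cast hj
    rw [div_le_iff₀ hπ] at hN
    rw [freq, le_div_iff₀ hL]
    nlinarith
  nlinarith [le_abs_self R, abs_nonneg R]

/-- The product sine functions, normalized in `H`. Their Laplace eigenvalues may coincide for
different indices, so orthogonality is deduced from the second derivative in a single variable,
chosen where the indices differ. -/
theorem nonempty_eigenBasis (hL₁ : 0 < L₁) (hL₂ : 0 < L₂) : Nonempty (EigenBasis L₁ L₂) := by
  have hπ := Real.pi_pos
  choose w hw using fun s : ℕ × ℕ => exists_V_tensor (L₁ := L₁) (L₂ := L₂) hL₁ hL₂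
    (contDiff_sinFn L₁ s.1) (contDiff_sinFn L₂ s.2) (sinFn_zero _ _) (sinFn_right hL₁ _)
    (sinFn_zero _ _) (sinFn_right hL₂ _)
  have hr : ∀ s, SmoothRep (w s) (sinProd L₁ L₂ s) := fun s =>
    ⟨contDiff_sinProd s, vanishes_sinProd hL₁ hL₂ s, hw s⟩
  -- A continuous function that vanishes almost everywhere on an open set vanishes on it, but both
  -- sines equal one at their quarter periods, which lie inside.
  have hne : ∀ s, toH (w s) ≠ 0 := fun s h0 => by
    have h1 : sinProd L₁ L₂ s =ᵐ[volume.restrict (rect L₁ L₂)] fun _ => 0 := by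
      have := (hr s).toH_ae
      rw [h0] at this
      exact this.symm.trans (Lp.coeFn_zero _ _ _)
    have h2 := Measure.eqOn_open_of_ae_eq h1 (isOpen_rect L₁ L₂)
      (hr s).contDiff.continuous.continuousOn continuousOn_const
    have hm : ∀ {L : ℝ} (j : ℕ), 0 < L → Real.pi / 2 / freq L j ∈ Ioo 0 L := fun {L} j hL => by
      have hf := freq_pos hL j
      refine ⟨by positivity, ?_⟩
      rw [div_lt_iff₀ hf, freq, mul_div_cancel₀ _ hL.ne']
      nlinarith [(Nat.cast_nonneg j : (0 : ℝ) ≤ j)]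
    have h3 := h2 (x := (Real.pi / 2 / freq L₁ s.1, Real.pi / 2 / freq L₂ s.2))
      ⟨hm _ hL₁, hm _ hL₂⟩
    have hs : ∀ {L : ℝ} (j : ℕ), 0 < L → sinFn L j (Real.pi / 2 / freq L j) = 1 :=
      fun {L} j hL => by
        rw [sinFn, mul_div_cancel₀ _ (freq_pos hL j).ne', Real.sin_pi_div_two]
    simp [sinProd, tensor, hs _ hL₁, hs _ hL₂] at h3
  have hn : ∀ s, (‖toH (w s)‖ : ℂ) ≠ 0 := fun s => by simpa using hne s
  have g1 : ∀ s ψ, ⟪d₁ ψ, d₁ (w s)⟫_ℂ = (freq L₁ s.1 ^ 2 : ℝ) * ⟪toH ψ, toH (w s)⟫_ℂ := fun s ψ =>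
    inner_d₁_of_eigen hL₁.le (hr s) (deriv₂_fst_sinProd s) ψ
  have g2 : ∀ s ψ, ⟪d₂ ψ, d₂ (w s)⟫_ℂ = (freq L₂ s.2 ^ 2 : ℝ) * ⟪toH ψ, toH (w s)⟫_ℂ := fun s ψ =>
    inner_d₂_of_eigen hL₂.le (hr s) (deriv₂_snd_sinProd s) ψ
  have hsq : ∀ {L : ℝ} {i j : ℕ}, 0 < L → i ≠ j → freq L i ^ 2 ≠ freq L j ^ 2 :=
    fun {L i j} hL hij h => hij (freq_injective hL
      ((sq_eq_sq₀ (freq_pos hL i).le (freq_pos hL j).le).1 h))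
  have horth : ∀ s t, s ≠ t → ⟪toH (w s), toH (w t)⟫_ℂ = 0 := fun s t hst => by
    by_cases h1 : s.1 = t.1
    · have h2 : s.2 ≠ t.2 := fun h2 => hst (Prod.ext h1 h2)
      refine inner_eq_zero_of_eigen (hsq hL₂ h2.symm) (g2 t (w s)) ?_
      rw [inner_conj_symm, g2]
    · refine inner_eq_zero_of_eigen (hsq hL₁ (Ne.symm h1)) (g1 t (w s)) ?_
      rw [inner_conj_symm, g1]
  refine ⟨{
    e := fun s => ((‖toH (w s)‖ : ℂ)⁻¹) • w s
    E := fun s x => ((‖toH (w s)‖ : ℂ)⁻¹) * sinProd L₁ L₂ s x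
    lam := fun s => freq L₁ s.1 ^ 2 + freq L₂ s.2 ^ 2
    rep := fun s => (hr s).smul _
    lap := fun s x => by
      rw [(hr s).deriv₂_smul, (hr s).deriv₂_smul, deriv₂_fst_sinProd, deriv₂_snd_sinProd]
      push_cast; ring
    orthonormal := ⟨fun s => by
      dsimp only
      rw [toH_smul, norm_smul, norm_inv, Complex.norm_real, norm_norm, inv_mul_cancel₀]
      simpa using hne s, fun s t hst => by
      simp only [toH_smul, inner_smul_left, inner_smul_right, horth s t hst, mul_zero]⟩
    lam_pos := fun s => add_pos (pow_pos (freq_pos hL₁ _) 2) (pow_pos (freq_pos hL₂ _) 2)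
    lam_large := fun R => by
      obtain ⟨N, hN⟩ := exists_le_freq_sq hL₁ R
      obtain ⟨N', hN'⟩ := exists_le_freq_sq hL₂ R
      refine ⟨max N N', fun n hn s hs => ?_⟩
      simp only [Finset.mem_product, Finset.mem_range, not_and_or, not_lt] at hs
      rcases hs with h | h
      · linarith [hN s.1 (by omega), sq_nonneg (freq L₂ s.2)]
      · linarith [hN' s.2 (by omega), sq_nonneg (freq L₁ s.1)]
    complete := fun ψ hψ => by
      refine Lp.ext ?_
      refine (ae_eq_zero_of_forall_sinC hL₁ hL₂ ((Lp.memLp ψ).integrable (by norm_num))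
        fun s => ?_).trans (Lp.coeFn_zero _ _ _).symm
      have h1 := hψ s
      rw [toH_smul, inner_smul_left, mul_eq_zero] at h1
      have h2 := h1.resolve_left (by simpa using hne s)
      rw [inner_H] at h2
      rw [← h2]
      refine integral_congr_ae ?_
      filter_upwards [(hr s).toH_ae] with x hx
      rw [hx, sinProd, tensor, Complex.conj_ofReal, Complex.real_smul, mul_comm]
      rfl }⟩

namespace EigenBasis

variable (B : EigenBasis L₁ L₂)

lemma inner_grad (hL₁ : 0 ≤ L₁) (hL₂ : 0 ≤ L₂) {u u' : V L₁ L₂} {U U' : ℝ × ℝ → ℂ}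
    (hu : SmoothRep u U) (hu' : SmoothRep u' U')
    (h : ∀ x, deriv₂ (1, 0) U x + deriv₂ (0, 1) U x = -U' x) (ψ : V L₁ L₂) :
    ⟪d₁ ψ, d₁ u⟫_ℂ + ⟪d₂ ψ, d₂ u⟫_ℂ = ⟪toH ψ, toH u'⟫_ℂ := by
  have c1 := memLp_rect_of_continuous (L₁ := L₁) (L₂ := L₂)
    (((hu.contDiff_fderiv (1, 0)).continuous_fderiv (by simp)).clm_apply
      (continuous_const (y := ((1 : ℝ), (0 : ℝ)))))
  have c2 := memLp_rect_of_continuous (L₁ := L₁) (L₂ := L₂)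
    (((hu.contDiff_fderiv (0, 1)).continuous_fderiv (by simp)).clm_apply
      (continuous_const (y := ((0 : ℝ), (1 : ℝ)))))
  rw [inner_d₁_eq hL₁ ((hu.contDiff_fderiv (1, 0)).of_le (by simp)) hu.d₁_ae c1.coeFn_toLp,
    inner_d₂_eq hL₂ ((hu.contDiff_fderiv (0, 1)).of_le (by simp)) hu.d₂_ae c2.coeFn_toLp,
    ← neg_add, ← inner_add_right, ← inner_neg_right]
  congr 1
  refine Lp.ext ?_
  filter_upwards [Lp.coeFn_neg (c1.toLp _ + c2.toLp _), Lp.coeFn_add (c1.toLp _) (c2.toLp _),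
    c1.coeFn_toLp, c2.coeFn_toLp, hu'.toH_ae] with x h1 h2 h3 h4 h5
  rw [h1, Pi.neg_apply, h2, Pi.add_apply, h3, h4, h5, ← neg_eq_iff_eq_neg.2 (h x)]
  rfl

/-- Finite combinations of the eigenfunctions are smooth, and so is their Laplacian. -/
lemma exists_smoothRep_sum (S : Finset (ℕ × ℕ)) (c : ℕ × ℕ → ℂ) : ∃ U U' : ℝ × ℝ → ℂ,
    SmoothRep (∑ s ∈ S, c s • B.e s) U ∧ SmoothRep (∑ s ∈ S, ((B.lam s : ℂ) * c s) • B.e s) U' ∧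
      ∀ x, deriv₂ (1, 0) U x + deriv₂ (0, 1) U x = -U' x := by
  classical
  induction S using Finset.induction_on with
  | empty =>
    refine ⟨fun _ => 0, fun _ => 0, by simpa using SmoothRep.zero, by simpa using SmoothRep.zero,
      fun x => ?_⟩
    simp [deriv₂]
  | insert a S ha ih =>
    obtain ⟨U, U', h1, h2, h3⟩ := ih
    refine ⟨fun x => c a * B.E a x + U x, fun x => (B.lam a * c a) * B.E a x + U' x, ?_, ?_,
      fun x => ?_⟩
    · rw [Finset.sum_insert ha]; exact ((B.rep a).smul _).add h1
    · rw [Finset.sum_insert ha]; exact ((B.rep a).smul _).add h2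
    · rw [((B.rep a).smul _).deriv₂_add h1, ((B.rep a).smul _).deriv₂_add h1,
        (B.rep a).deriv₂_smul, (B.rep a).deriv₂_smul]
      linear_combination h3 x + c a * B.lap a x

end EigenBasis

end SGGLE

namespace SGGLE

open Filter Topology
open scoped InnerProductSpace ContDiff

variable {L₁ L₂ : ℝ}

/-! ### The `H¹` estimate for smooth functions -/

lemma norm_powMulDeriv_one_le (z h : ℂ) : ‖powMulDeriv 1 z h‖ ≤ 3 * ‖z‖ ^ 2 * ‖h‖ := by
  rw [powMulDeriv_apply]
  refine (norm_add_le _ _).trans ?_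
  have h1 : |(conj z * h).re| ≤ ‖z‖ * ‖h‖ := by
    refine (Complex.abs_re_le_norm _).trans ?_
    rw [norm_mul, RCLike.norm_conj]
  rw [norm_mul, norm_mul, Complex.norm_real, Complex.norm_real, Real.norm_of_nonneg (by positivity),
    Real.norm_eq_abs]
  norm_num [abs_mul]
  have := mul_le_mul_of_nonneg_right h1 (norm_nonneg z)
  simp only [Complex.mul_re, Complex.conj_re, Complex.conj_im, neg_mul, sub_neg_eq_add] at this
  nlinarith

/-- The squared size of the gradient of a function on the plane. -/
def gsq (U : ℝ × ℝ → ℂ) (x : ℝ × ℝ) : ℝ :=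
  ‖fderiv ℝ U x (1, 0)‖ ^ 2 + ‖fderiv ℝ U x (0, 1)‖ ^ 2

namespace SmoothRep

variable {u u' : V L₁ L₂} {U U' : ℝ × ℝ → ℂ}

lemma continuous_fderiv (h : SmoothRep u U) (v : ℝ × ℝ) : Continuous fun x => fderiv ℝ U x v :=
  (h.contDiff_fderiv v).continuous

lemma continuous_gsq (h : SmoothRep u U) : Continuous (gsq U) :=
  ((h.continuous_fderiv _).norm.pow 2).add ((h.continuous_fderiv _).norm.pow 2)

lemma gradSq_eq (h : SmoothRep u U) : gradSq u = ∫ x in rect L₁ L₂, gsq U x := by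
  rw [gradSq, norm_sq_H, norm_sq_H, ← integral_add (memLp_norm_H _).integrable_sq
    (memLp_norm_H _).integrable_sq]
  refine integral_congr_ae ?_
  filter_upwards [h.d₁_ae, h.d₂_ae] with x h1 h2
  rw [h1, h2, gsq]

lemma norm_toH_sq_eq (h : SmoothRep u U) : ‖toH u‖ ^ 2 = ∫ x in rect L₁ L₂, ‖U x‖ ^ 2 := by
  rw [norm_sq_H]
  refine integral_congr_ae ?_
  filter_upwards [h.toH_ae] with x h1
  rw [h1]

lemma contDiff_powMul_comp (h : SmoothRep u U) {σ : ℝ} (hσ : 1 ≤ σ) :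
    ContDiff ℝ 1 fun x => powMul σ (U x) :=
  (contDiff_powMul hσ).comp (h.contDiff.of_le (by simp))

lemma fderiv_powMul_comp (h : SmoothRep u U) {σ : ℝ} (hσ : 1 ≤ σ) (x v : ℝ × ℝ) :
    fderiv ℝ (fun x => powMul σ (U x)) x v = powMulDeriv σ (U x) (fderiv ℝ U x v) := by
  have := ((hasFDerivAt_powMul hσ (U x)).comp x (h.differentiable x).hasFDerivAt).fderiv
  exact congrArg (fun A => A v) this

/-- Integration by parts of the power nonlinearity against the Laplacian. -/
lemma pairP_laplace (hL₁ : 0 ≤ L₁) (hL₂ : 0 ≤ L₂) (h : SmoothRep u U) (h' : SmoothRep u' U')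
    (hl : ∀ x, deriv₂ (1, 0) U x + deriv₂ (0, 1) U x = -U' x) {σ : ℝ} (hσ : 1 ≤ σ) :
    pairP σ u u' = ∫ x in rect L₁ L₂,
      (powMulDeriv σ (U x) (fderiv ℝ U x (1, 0)) * conj (fderiv ℝ U x (1, 0)) +
        powMulDeriv σ (U x) (fderiv ℝ U x (0, 1)) * conj (fderiv ℝ U x (0, 1))) := by
  have hN := h.contDiff_powMul_comp hσ
  -- The boundary terms vanish through the nonlinearity, which is zero where `U` is; the derivatives
  -- of `U` in the other factor need not vanish on the sides.
  have hv : ∀ E : ℝ × ℝ → ℂ, VanishesOnSides L₁ L₂ fun x => powMul σ (U x) * conj (E x) := fun E =>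
    h.vanishes.of_imp fun x hx => by rw [hx, powMul_zero, zero_mul]
  have c1 : ContDiff ℝ 1 fun x => fderiv ℝ U x (1, 0) := (h.contDiff_fderiv _).of_le (by simp)
  have c2 : ContDiff ℝ 1 fun x => fderiv ℝ U x (0, 1) := (h.contDiff_fderiv _).of_le (by simp)
  have e1 := integral_parts_fst hN c1 (hv _) hL₁
  have e2 := integral_parts_snd hN c2 (hv _) hL₂
  have i1 := integrable_parts (L₁ := L₁) (L₂ := L₂) hN c1 (1, 0)
  have i2 := integrable_parts (L₁ := L₁) (L₂ := L₂) hN c2 (0, 1)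
  simp only [h.fderiv_powMul_comp hσ] at e1 e2 i1 i2
  rw [integral_add i1.1 i2.1, eq_neg_iff_add_eq_zero.1 e1 |> fun h => (eq_neg_of_add_eq_zero_right h),
    eq_neg_iff_add_eq_zero.1 e2 |> fun h => (eq_neg_of_add_eq_zero_right h), ← neg_add,
    ← integral_add i1.2 i2.2, ← integral_neg, pairP]
  refine integral_congr_ae ?_
  filter_upwards [h.toH_ae, h'.toH_ae] with x h1 h2
  rw [h1, h2, ← mul_add, ← map_add, ← mul_neg, ← map_neg]
  congr 2
  rw [← neg_eq_iff_eq_neg.2 (hl x)]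
  rfl

/-- Integration by parts of the divergence part of the convective term. -/
lemma pairF₁_parts (hL₁ : 0 ≤ L₁) (hL₂ : 0 ≤ L₂) (h : SmoothRep u U) (h' : SmoothRep u' U')
    (l : ℂ × ℂ) : pairF₁ l u u' = -∫ x in rect L₁ L₂,
      (l.1 * powMulDeriv 1 (U x) (fderiv ℝ U x (1, 0)) +
        l.2 * powMulDeriv 1 (U x) (fderiv ℝ U x (0, 1))) * conj (U' x) := by
  have hN := h.contDiff_powMul_comp le_rfl
  have hv : VanishesOnSides L₁ L₂ fun x => powMul 1 (U x) * conj (U' x) :=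
    h.vanishes.of_imp fun x hx => by rw [hx, powMul_zero, zero_mul]
  have c' : ContDiff ℝ 1 U' := h'.contDiff.of_le (by simp)
  have e1 := integral_parts_fst hN c' hv hL₁
  have e2 := integral_parts_snd hN c' hv hL₂
  have i1 := integrable_parts (L₁ := L₁) (L₂ := L₂) hN c' (1, 0)
  have i2 := integrable_parts (L₁ := L₁) (L₂ := L₂) hN c' (0, 1)
  simp only [h.fderiv_powMul_comp le_rfl] at e1 e2 i1 i2
  have r : ∫ x in rect L₁ L₂, (l.1 * powMulDeriv 1 (U x) (fderiv ℝ U x (1, 0)) +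
        l.2 * powMulDeriv 1 (U x) (fderiv ℝ U x (0, 1))) * conj (U' x) =
      l.1 * (∫ x in rect L₁ L₂, powMulDeriv 1 (U x) (fderiv ℝ U x (1, 0)) * conj (U' x)) +
      l.2 * ∫ x in rect L₁ L₂, powMulDeriv 1 (U x) (fderiv ℝ U x (0, 1)) * conj (U' x) := by
    rw [← integral_const_mul, ← integral_const_mul,
      ← integral_add (i1.1.const_mul _) (i2.1.const_mul _)]
    exact integral_congr_ae (Eventually.of_forall fun x => by ring)
  have q : pairF₁ l u u' = l.1 * (∫ x in rect L₁ L₂, powMul 1 (U x) *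
        conj (fderiv ℝ U' x (1, 0))) +
      l.2 * ∫ x in rect L₁ L₂, powMul 1 (U x) * conj (fderiv ℝ U' x (0, 1)) := by
    rw [← integral_const_mul, ← integral_const_mul,
      ← integral_add (i1.2.const_mul _) (i2.2.const_mul _), pairF₁]
    refine integral_congr_ae ?_
    filter_upwards [h.toH_ae, h'.d₁_ae, h'.d₂_ae] with x h1 h2 h3
    rw [h1, h2, h3, powMul]
    norm_num
    ring
  rw [q, r, e1, e2]
  ring

end SmoothRep

variable (𝔭 : Params)

set_option maxHeartbeats 400000 in
/-- The `H¹` estimate of the drift. -/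
theorem exists_re_G_laplace_le (hL₁ : 0 ≤ L₁) (hL₂ : 0 ≤ L₂) {m M : ℝ} (hm : 0 < m) :
    ∃ K : ℝ, 0 ≤ K ∧ ∀ A₁ A₂ : ℝ, m ≤ A₁ → |A₂| ≤ M → ∀ (u u' : V L₁ L₂) (U U' : ℝ × ℝ → ℂ),
      SmoothRep u U → SmoothRep u' U' →
      (∀ x, deriv₂ (1, 0) U x + deriv₂ (0, 1) U x = -U' x) →
      (G 𝔭 A₁ A₂ u u').re ≤ -(1 / 2) * ‖toH u'‖ ^ 2 + K * gradSq u := by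
  set c := ellip 𝔭.σ 𝔭.β with hc
  have hc0 : 0 < c := 𝔭.hc
  have hσ := 𝔭.hσ
  -- After integration by parts the convective term is bounded by `D |∇U| |U|² |U'|`, with `|∇U|`
  -- the sum of the sizes of the two partial derivatives; the `3` comes from differentiating `|z|²
  -- z`.
  set D := |M| * (pairN 𝔭.l₂ + 3 * pairN 𝔭.l₁) with hD
  have hD0 : 0 ≤ D := by
    have := pairN_nonneg 𝔭.l₁; have := pairN_nonneg 𝔭.l₂; positivity
  -- Young's inequality leaves `D² |U|⁴ |∇U|²`. With this parameter it is absorbed by the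
  -- dissipation `m c |U|^{2σ} |∇U|²` up to a multiple of `|∇U|²`, again because `4 < 2σ`.
  obtain ⟨C, hC0, hC⟩ := exists_rpow_le_add (r := 4) (s := 2 * 𝔭.σ) (by norm_num) (by linarith)
    (η := m * c / (D ^ 2 + 1)) (by positivity)
  refine ⟨|𝔭.γ| + D ^ 2 * C, by positivity, fun A₁ A₂ hA₁ hA₂ u u' U U' h h' hl => ?_⟩
  have hA₁0 : 0 < A₁ := hm.trans_le hA₁
  have hgr := fun ψ => EigenBasis.inner_grad hL₁ hL₂ h h' hl ψ
  have cU : Continuous U := h.contDiff.continuous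
  have cU' : Continuous U' := h'.contDiff.continuous
  have cg := h.continuous_gsq
  have crp : Continuous fun x => ‖U x‖ ^ (2 * 𝔭.σ) := cU.norm.rpow_const fun _ => Or.inr (by linarith)
  -- the elliptic part
  have e1 : (pairA 𝔭.α u u').re = -‖toH u'‖ ^ 2 := by
    rw [pairA_eq, hgr u', inner_self_eq_norm_sq_to_K]
    change (-(1 + Complex.I * 𝔭.α) * ((‖toH u'‖ : ℂ) ^ 2)).re = _
    have : ((‖toH u'‖ : ℂ) ^ 2) = ((‖toH u'‖ ^ 2 : ℝ) : ℂ) := by push_cast; rfl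
    rw [this, Complex.re_mul_ofReal]
    simp
  have e2 : ((𝔭.γ : ℂ) * ⟪toH u', toH u⟫_ℂ).re ≤ |𝔭.γ| * gradSq u := by
    have : (⟪toH u', toH u⟫_ℂ).re = gradSq u := by
      rw [← inner_conj_symm, ← hgr u, Complex.conj_re, Complex.add_re]
      exact congrArg₂ (· + ·) (inner_self_eq_norm_sq (𝕜 := ℂ) _) (inner_self_eq_norm_sq (𝕜 := ℂ) _)
    rw [Complex.re_ofReal_mul, this]
    exact mul_le_mul_of_nonneg_right (le_abs_self _) (gradSq_nonneg u)
  -- the power nonlinearity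
  set X := ∫ x in rect L₁ L₂, ‖U x‖ ^ (2 * 𝔭.σ) * gsq U x with hX
  have hX0 : 0 ≤ X := integral_nonneg fun x => by unfold gsq; positivity
  have iX : Integrable (fun x => ‖U x‖ ^ (2 * 𝔭.σ) * gsq U x) (rectMeasure L₁ L₂) :=
    integrable_rect_of_continuous (crp.mul cg)
  have e3 : m * c * X ≤ ((1 - Complex.I * 𝔭.β) * (A₁ * pairP 𝔭.σ u u')).re := by
    have hN := h.contDiff_powMul_comp 𝔭.one_lt_σ.le
    have cN : ∀ v, Continuous fun x => powMulDeriv 𝔭.σ (U x) (fderiv ℝ U x v) := fun v => by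
      have := (hN.continuous_fderiv one_ne_zero).clm_apply (continuous_const (y := v))
      simpa only [h.fderiv_powMul_comp 𝔭.one_lt_σ.le] using this
    have cP : Continuous fun x => (1 - Complex.I * 𝔭.β) *
        (powMulDeriv 𝔭.σ (U x) (fderiv ℝ U x (1, 0)) * conj (fderiv ℝ U x (1, 0)) +
        powMulDeriv 𝔭.σ (U x) (fderiv ℝ U x (0, 1)) * conj (fderiv ℝ U x (0, 1))) :=
      continuous_const.mul (((cN _).mul (Complex.continuous_conj.comp (h.continuous_fderiv _))).add
        ((cN _).mul (Complex.continuous_conj.comp (h.continuous_fderiv _))))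
    have iP := integrable_rect_of_continuous (L₁ := L₁) (L₂ := L₂) cP
    have key : c * X ≤ ((1 - Complex.I * 𝔭.β) * pairP 𝔭.σ u u').re := by
      rw [h.pairP_laplace hL₁ hL₂ h' hl 𝔭.one_lt_σ.le, ← integral_const_mul,
        ← integral_const_mul]
      refine le_trans ?_ (le_of_eq (integral_re iP))
      refine integral_mono (iX.const_mul c) iP.re fun x => ?_
      have k1 := le_re_powMulDeriv 𝔭.one_lt_σ 𝔭.β (U x) (fderiv ℝ U x (1, 0))
      have k2 := le_re_powMulDeriv 𝔭.one_lt_σ 𝔭.β (U x) (fderiv ℝ U x (0, 1))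
      have : RCLike.re ((1 - Complex.I * 𝔭.β) *
          (powMulDeriv 𝔭.σ (U x) (fderiv ℝ U x (1, 0)) * conj (fderiv ℝ U x (1, 0)) +
          powMulDeriv 𝔭.σ (U x) (fderiv ℝ U x (0, 1)) * conj (fderiv ℝ U x (0, 1)))) =
          ((1 - Complex.I * 𝔭.β) * powMulDeriv 𝔭.σ (U x) (fderiv ℝ U x (1, 0)) *
            conj (fderiv ℝ U x (1, 0))).re +
          ((1 - Complex.I * 𝔭.β) * powMulDeriv 𝔭.σ (U x) (fderiv ℝ U x (0, 1)) *
            conj (fderiv ℝ U x (0, 1))).re := by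
        rw [mul_add, ← mul_assoc, ← mul_assoc]; exact Complex.add_re _ _
      rw [this, gsq]
      linarith
    rw [mul_left_comm, Complex.re_ofReal_mul]
    calc m * c * X = m * (c * X) := by ring
      _ ≤ A₁ * (c * X) := by gcongr
      _ ≤ _ := by gcongr
  -- the convective term
  have iY : Integrable (fun x => 1 / 2 * ‖U' x‖ ^ 2 + D ^ 2 * (‖U x‖ ^ (4 : ℝ) * gsq U x))
      (rectMeasure L₁ L₂) :=
    integrable_rect_of_continuous ((continuous_const.mul (cU'.norm.pow 2)).add
      (continuous_const.mul ((cU.norm.rpow_const fun _ => Or.inr (by norm_num)).mul cg)))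
  have iZ : Integrable (fun x => (m * c) * (‖U x‖ ^ (2 * 𝔭.σ) * gsq U x) + D ^ 2 * C * gsq U x)
      (rectMeasure L₁ L₂) :=
    (iX.const_mul _).add ((integrable_rect_of_continuous cg).const_mul _)
  have iW : Integrable (fun x => 1 / 2 * ‖U' x‖ ^ 2) (rectMeasure L₁ L₂) :=
    (integrable_rect_of_continuous (cU'.norm.pow 2)).const_mul _
  have e4 : ((A₂ : ℂ) * (pairF₂ 𝔭.l₂ u u' - pairF₁ 𝔭.l₁ u u')).re ≤
      1 / 2 * ‖toH u'‖ ^ 2 + m * c * X + D ^ 2 * C * gradSq u := by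
    have hA : ‖(A₂ : ℂ)‖ ≤ |M| := by
      rw [Complex.norm_real]; exact hA₂.trans (le_abs_self M)
    set Q : ℝ × ℝ → ℂ := fun x => (𝔭.l₂.1 * fderiv ℝ U x (1, 0) + 𝔭.l₂.2 * fderiv ℝ U x (0, 1)) *
        (‖U x‖ : ℂ) ^ 2 * conj (U' x) + (𝔭.l₁.1 * powMulDeriv 1 (U x) (fderiv ℝ U x (1, 0)) +
        𝔭.l₁.2 * powMulDeriv 1 (U x) (fderiv ℝ U x (0, 1))) * conj (U' x) with hQ
    have hN1 := h.contDiff_powMul_comp (σ := 1) le_rfl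
    have cN1 : ∀ v, Continuous fun x => powMulDeriv 1 (U x) (fderiv ℝ U x v) := fun v => by
      have := (hN1.continuous_fderiv one_ne_zero).clm_apply (continuous_const (y := v))
      simpa only [h.fderiv_powMul_comp le_rfl] using this
    have i1 : Integrable (fun x => (𝔭.l₂.1 * fderiv ℝ U x (1, 0) + 𝔭.l₂.2 * fderiv ℝ U x (0, 1)) *
        (‖U x‖ : ℂ) ^ 2 * conj (U' x)) (rectMeasure L₁ L₂) := by
      refine integrable_rect_of_continuous ((Continuous.mul ?_ ?_).mul
        (Complex.continuous_conj.comp cU'))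
      · exact (continuous_const.mul (h.continuous_fderiv _)).add
          (continuous_const.mul (h.continuous_fderiv _))
      · exact (Complex.continuous_ofReal.comp cU.norm).pow 2
    have i2 : Integrable (fun x => (𝔭.l₁.1 * powMulDeriv 1 (U x) (fderiv ℝ U x (1, 0)) +
        𝔭.l₁.2 * powMulDeriv 1 (U x) (fderiv ℝ U x (0, 1))) * conj (U' x)) (rectMeasure L₁ L₂) :=
      integrable_rect_of_continuous (((continuous_const.mul (cN1 _)).add
        (continuous_const.mul (cN1 _))).mul (Complex.continuous_conj.comp cU'))
    have eQ : pairF₂ 𝔭.l₂ u u' - pairF₁ 𝔭.l₁ u u' = ∫ x in rect L₁ L₂, Q x := by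
      rw [h.pairF₁_parts hL₁ hL₂ h', sub_neg_eq_add, hQ, integral_add i1 i2]
      congr 1
      refine integral_congr_ae ?_
      filter_upwards [h.toH_ae, h'.toH_ae, h.d₁_ae, h.d₂_ae] with x h1 h2 h3 h4
      rw [h1, h2, h3, h4]
    have b1 : ((A₂ : ℂ) * (pairF₂ 𝔭.l₂ u u' - pairF₁ 𝔭.l₁ u u')).re ≤
        ∫ x in rect L₁ L₂, (1 / 2 * ‖U' x‖ ^ 2 + D ^ 2 * (‖U x‖ ^ (4 : ℝ) * gsq U x)) := by
      refine (Complex.re_le_norm _).trans ?_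
      rw [eQ, ← integral_const_mul]
      refine norm_integral_le_of_norm_le iY (Eventually.of_forall fun x => ?_)
      set a := ‖fderiv ℝ U x (1, 0)‖ with ha
      set b := ‖fderiv ℝ U x (0, 1)‖ with hb
      have q1 : ‖Q x‖ ≤ (pairN 𝔭.l₂ + 3 * pairN 𝔭.l₁) * (a + b) * ‖U x‖ ^ 2 * ‖U' x‖ := by
        have t1 := norm_lin_le 𝔭.l₂ (fderiv ℝ U x (1, 0)) (fderiv ℝ U x (0, 1))
        have t2 := norm_lin_le 𝔭.l₁ (powMulDeriv 1 (U x) (fderiv ℝ U x (1, 0)))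
          (powMulDeriv 1 (U x) (fderiv ℝ U x (0, 1)))
        have t3 := norm_powMulDeriv_one_le (U x) (fderiv ℝ U x (1, 0))
        have t4 := norm_powMulDeriv_one_le (U x) (fderiv ℝ U x (0, 1))
        have t5 : ‖powMulDeriv 1 (U x) (fderiv ℝ U x (1, 0))‖ +
          ‖powMulDeriv 1 (U x) (fderiv ℝ U x (0, 1))‖ ≤ 3 * ‖U x‖ ^ 2 * (a + b) := by linarith
        have t6 := t2.trans (mul_le_mul_of_nonneg_left t5 (pairN_nonneg _))
        calc ‖Q x‖ ≤ pairN 𝔭.l₂ * (a + b) * ‖U x‖ ^ 2 * ‖U' x‖ +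
              pairN 𝔭.l₁ * (3 * ‖U x‖ ^ 2 * (a + b)) * ‖U' x‖ := by
              refine (norm_add_le _ _).trans (add_le_add ?_ ?_)
              · rw [norm_mul, norm_mul, norm_pow, Complex.norm_real, norm_norm, RCLike.norm_conj]
                gcongr
              · rw [norm_mul, RCLike.norm_conj]
                gcongr
          _ = _ := by ring
      have q2 : ‖(A₂ : ℂ) * Q x‖ ≤ D * ((a + b) * ‖U x‖ ^ 2) * ‖U' x‖ := by
        rw [norm_mul]
        calc _ ≤ |M| * ((pairN 𝔭.l₂ + 3 * pairN 𝔭.l₁) * (a + b) * ‖U x‖ ^ 2 * ‖U' x‖) := by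
              gcongr
          _ = _ := by rw [hD]; ring
      refine q2.trans ?_
      have q3 : ‖U x‖ ^ (4 : ℝ) = ‖U x‖ ^ 4 := by
        rw [← Real.rpow_natCast]; norm_num
      rw [q3, gsq, ← ha, ← hb]
      have q4 : (a + b) ^ 2 ≤ 2 * (a ^ 2 + b ^ 2) := by nlinarith [sq_nonneg (a - b)]
      have q5 := mul_le_mul_of_nonneg_left q4 (by positivity : 0 ≤ D ^ 2 * ‖U x‖ ^ 4)
      have q6 := two_mul_le_add_sq (D * ((a + b) * ‖U x‖ ^ 2)) ‖U' x‖
      have q7 : (D * ((a + b) * ‖U x‖ ^ 2)) ^ 2 = D ^ 2 * ‖U x‖ ^ 4 * (a + b) ^ 2 := by ring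
      rw [q7] at q6
      linarith
    have b2 : ∫ x in rect L₁ L₂, (1 / 2 * ‖U' x‖ ^ 2 + D ^ 2 * (‖U x‖ ^ (4 : ℝ) * gsq U x)) ≤
        ∫ x in rect L₁ L₂, (1 / 2 * ‖U' x‖ ^ 2 +
          ((m * c) * (‖U x‖ ^ (2 * 𝔭.σ) * gsq U x) + D ^ 2 * C * gsq U x)) := by
      refine integral_mono iY (iW.add iZ) fun x => ?_
      have k := hC ‖U x‖ (norm_nonneg _)
      have hg0 : 0 ≤ gsq U x := by unfold gsq; positivity
      have k2 := mul_le_mul_of_nonneg_left (mul_le_mul_of_nonneg_right k hg0) (sq_nonneg D)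
      have k3 : D ^ 2 * (m * c / (D ^ 2 + 1)) ≤ m * c := by
        rw [← mul_div_assoc, div_le_iff₀ (by positivity)]
        have : 0 < m * c := by positivity
        nlinarith
      have k4 := mul_le_mul_of_nonneg_right k3
        (by positivity : 0 ≤ ‖U x‖ ^ (2 * 𝔭.σ) * gsq U x)
      dsimp only
      linarith
    refine b1.trans (b2.trans (le_of_eq ?_))
    rw [integral_add iW iZ, integral_add (iX.const_mul _)
      ((integrable_rect_of_continuous cg).const_mul _), integral_const_mul, integral_const_mul,
      integral_const_mul, ← h'.norm_toH_sq_eq, ← h.gradSq_eq]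
    ring
  simp only [G, Complex.add_re, Complex.sub_re]
  linarith

end SGGLE

/-! ### Eigenfunction expansions in `V`, and Grönwall's lemma with dissipation. -/

namespace SGGLE

open Filter Topology
open scoped InnerProductSpace ContDiff

variable {L₁ L₂ : ℝ}

instance instInnerV : Inner ℂ (V L₁ L₂) := InnerProductSpace.toInner

instance : CompleteSpace (V L₁ L₂) := by unfold V; infer_instance

lemma inner_V (ψ u : V L₁ L₂) :
    ⟪ψ, u⟫_ℂ = ⟪toH ψ, toH u⟫_ℂ + (⟪d₁ ψ, d₁ u⟫_ℂ + ⟪d₂ ψ, d₂ u⟫_ℂ) := by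
  have : ⟪ψ, u⟫_ℂ = ⟪(ψ : PiLp 2 (fun _ : Fin 3 => H L₁ L₂)), u⟫_ℂ := rfl
  rw [this, PiLp.inner_apply, Fin.sum_univ_three, add_assoc]
  rfl

namespace EigenBasis

variable (B : EigenBasis L₁ L₂)

/-- The finite combination of eigenfunctions with given coefficients. -/
def comb (S : Finset (ℕ × ℕ)) (c : ℕ × ℕ → ℂ) : V L₁ L₂ := ∑ s ∈ S, c s • B.e s

lemma toH_comb (S : Finset (ℕ × ℕ)) (c : ℕ × ℕ → ℂ) :
    toH (B.comb S c) = ∑ s ∈ S, c s • toH (B.e s) := by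
  simp only [comb, toH_eq, map_sum, map_smul]

lemma inner_comb_comb (S : Finset (ℕ × ℕ)) (c c' : ℕ × ℕ → ℂ) :
    ⟪toH (B.comb S c), toH (B.comb S c')⟫_ℂ = ∑ s ∈ S, conj (c s) * c' s := by
  rw [toH_comb, toH_comb]; exact B.orthonormal.inner_sum c c' S

lemma norm_toH_comb_sq (S : Finset (ℕ × ℕ)) (c : ℕ × ℕ → ℂ) :
    ‖toH (B.comb S c)‖ ^ 2 = ∑ s ∈ S, ‖c s‖ ^ 2 := by
  have h : (⟪toH (B.comb S c), toH (B.comb S c)⟫_ℂ).re = _ := inner_self_eq_norm_sq (𝕜 := ℂ) _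
  rw [← h, inner_comb_comb, Complex.re_sum]
  refine Finset.sum_congr rfl fun s _ => ?_
  rw [← Complex.normSq_eq_conj_mul_self, Complex.ofReal_re, Complex.normSq_eq_norm_sq]

/-- The Laplacian, up to the sign, of a finite combination of eigenfunctions. -/
def lapComb (S : Finset (ℕ × ℕ)) (c : ℕ × ℕ → ℂ) : V L₁ L₂ :=
  B.comb S fun s => (B.lam s : ℂ) * c s

lemma inner_grad_comb (hL₁ : 0 ≤ L₁) (hL₂ : 0 ≤ L₂) (S : Finset (ℕ × ℕ)) (c : ℕ × ℕ → ℂ)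
    (ψ : V L₁ L₂) :
    ⟪d₁ ψ, d₁ (B.comb S c)⟫_ℂ + ⟪d₂ ψ, d₂ (B.comb S c)⟫_ℂ = ⟪toH ψ, toH (B.lapComb S c)⟫_ℂ := by
  obtain ⟨U, U', h, h', hl⟩ := B.exists_smoothRep_sum S c
  exact inner_grad hL₁ hL₂ h h' hl ψ

lemma gradSq_comb (hL₁ : 0 ≤ L₁) (hL₂ : 0 ≤ L₂) (S : Finset (ℕ × ℕ)) (c : ℕ × ℕ → ℂ) :
    gradSq (B.comb S c) = ∑ s ∈ S, B.lam s * ‖c s‖ ^ 2 := by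
  have h := congrArg Complex.re (B.inner_grad_comb hL₁ hL₂ S c (B.comb S c))
  have h1 : (⟪d₁ (B.comb S c), d₁ (B.comb S c)⟫_ℂ).re = _ := inner_self_eq_norm_sq (𝕜 := ℂ) _
  have h2 : (⟪d₂ (B.comb S c), d₂ (B.comb S c)⟫_ℂ).re = _ := inner_self_eq_norm_sq (𝕜 := ℂ) _
  rw [Complex.add_re, h1, h2, lapComb, inner_comb_comb, Complex.re_sum] at h
  rw [gradSq, h]
  refine Finset.sum_congr rfl fun s _ => ?_
  rw [mul_left_comm, Complex.re_ofReal_mul, ← Complex.normSq_eq_conj_mul_self, Complex.ofReal_re,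
    Complex.normSq_eq_norm_sq]

lemma norm_comb_sq (hL₁ : 0 ≤ L₁) (hL₂ : 0 ≤ L₂) (S : Finset (ℕ × ℕ)) (c : ℕ × ℕ → ℂ) :
    ‖B.comb S c‖ ^ 2 = ∑ s ∈ S, (1 + B.lam s) * ‖c s‖ ^ 2 := by
  rw [norm_sq_V, norm_toH_comb_sq, B.gradSq_comb hL₁ hL₂, ← Finset.sum_add_distrib]
  exact Finset.sum_congr rfl fun s _ => by ring

lemma inner_e (hL₁ : 0 ≤ L₁) (hL₂ : 0 ≤ L₂) (ψ : V L₁ L₂) (s : ℕ × ℕ) :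
    ⟪ψ, B.e s⟫_ℂ = ((1 + B.lam s : ℝ) : ℂ) * ⟪toH ψ, toH (B.e s)⟫_ℂ := by
  have h := B.inner_grad_comb hL₁ hL₂ {s} (fun _ => 1) ψ
  simp only [comb, lapComb, Finset.sum_singleton, one_smul, mul_one, toH_smul,
    inner_smul_right] at h
  rw [inner_V, h]; push_cast; ring

/-- The eigenfunctions, normalized in `V`. -/
def normalized (s : ℕ × ℕ) : V L₁ L₂ := ((√(1 + B.lam s))⁻¹ : ℂ) • B.e s

lemma one_add_lam_pos (s : ℕ × ℕ) : 0 < 1 + B.lam s := by linarith [B.lam_pos s]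

lemma inner_normalized (hL₁ : 0 ≤ L₁) (hL₂ : 0 ≤ L₂) (s : ℕ × ℕ) (ψ : V L₁ L₂) :
    ⟪B.normalized s, ψ⟫_ℂ = (√(1 + B.lam s) : ℂ) * ⟪toH (B.e s), toH ψ⟫_ℂ := by
  have hp := Real.sqrt_pos.2 (B.one_add_lam_pos s)
  have hsq : ((1 + B.lam s : ℝ) : ℂ) = (√(1 + B.lam s) : ℂ) * (√(1 + B.lam s) : ℂ) := by
    rw [← Complex.ofReal_mul, Real.mul_self_sqrt (B.one_add_lam_pos s).le]
  have hne : (√(1 + B.lam s) : ℂ) ≠ 0 := by exact_mod_cast hp.ne'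
  have h := congrArg conj (B.inner_e hL₁ hL₂ ψ s)
  have hc : conj ⟪ψ, B.e s⟫_ℂ = ⟪B.e s, ψ⟫_ℂ := inner_conj_symm _ _
  have hc' : conj ⟪toH ψ, toH (B.e s)⟫_ℂ = ⟪toH (B.e s), toH ψ⟫_ℂ := inner_conj_symm _ _
  rw [hc, map_mul, Complex.conj_ofReal, hc', hsq] at h
  have he : ⟪((√(1 + B.lam s))⁻¹ : ℂ) • B.e s, ψ⟫_ℂ =
    conj ((√(1 + B.lam s))⁻¹ : ℂ) * ⟪B.e s, ψ⟫_ℂ := inner_smul_left (𝕜 := ℂ) (B.e s) ψ _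
  rw [normalized, he, h, map_inv₀, Complex.conj_ofReal]
  field_simp

/-- The one-dimensional projections in `V` and in `H` agree: the normalizing factor enters once in
the coefficient and once, inverted, in the vector. The truncations of the expansion are therefore
the same in both spaces. -/
lemma inner_normalized_smul (hL₁ : 0 ≤ L₁) (hL₂ : 0 ≤ L₂) (s : ℕ × ℕ) (ψ : V L₁ L₂) :
    ⟪B.normalized s, ψ⟫_ℂ • B.normalized s = ⟪toH (B.e s), toH ψ⟫_ℂ • B.e s := by
  have hp := Real.sqrt_pos.2 (B.one_add_lam_pos s)
  have hne : (√(1 + B.lam s) : ℂ) ≠ 0 := by exact_mod_cast hp.ne'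
  rw [B.inner_normalized hL₁ hL₂, normalized, smul_smul]
  congr 1
  field_simp

lemma orthonormal_normalized (hL₁ : 0 ≤ L₁) (hL₂ : 0 ≤ L₂) : Orthonormal ℂ B.normalized := by
  classical
  rw [orthonormal_iff_ite]
  intro s t
  have h0 := orthonormal_iff_ite.1 B.orthonormal s t
  have hp := Real.sqrt_pos.2 (B.one_add_lam_pos s)
  have hne : (√(1 + B.lam s) : ℂ) ≠ 0 := by exact_mod_cast hp.ne'
  rw [B.inner_normalized hL₁ hL₂, normalized, toH_smul, inner_smul_right, h0]
  split_ifs with h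
  · subst h; field_simp
  · simp

/-- The truncated expansion in eigenfunctions. -/
def proj (S : Finset (ℕ × ℕ)) (ψ : V L₁ L₂) : V L₁ L₂ :=
  B.comb S fun s => ⟪toH (B.e s), toH ψ⟫_ℂ

/-- The index sets of the Galerkin scheme. -/
def _root_.SGGLE.square (n : ℕ) : Finset (ℕ × ℕ) := Finset.range n ×ˢ Finset.range n

lemma _root_.SGGLE.square_mono {m n : ℕ} (h : m ≤ n) : square m ⊆ square n :=
  Finset.product_subset_product (Finset.range_mono h) (Finset.range_mono h)

/-- Orthogonality to an eigenfunction in `V` and in `H` differ by a positive factor, so completeness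
in `H` and injectivity of `toH` make the normalized eigenfunctions a Hilbert basis of `V`. The
squares are increasing and exhaust all indices. -/
lemma tendsto_proj (hL₁ : 0 ≤ L₁) (hL₂ : 0 ≤ L₂) (ψ : V L₁ L₂) :
    Tendsto (fun n => B.proj (square n) ψ) atTop (𝓝 ψ) := by
  have hbot : (Submodule.span ℂ (Set.range B.normalized))ᗮ = ⊥ := by
    rw [Submodule.eq_bot_iff]
    intro x hx
    refine toH_injective hL₁ hL₂ (B.complete _ fun s => ?_)
    have h := (Submodule.mem_orthogonal _ _).1 hx _
      (Submodule.subset_span (Set.mem_range_self s))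
    rw [B.inner_normalized hL₁ hL₂] at h
    have hp := Real.sqrt_pos.2 (B.one_add_lam_pos s)
    exact (mul_eq_zero.1 h).resolve_left (by exact_mod_cast hp.ne')
  have h := (HilbertBasis.mkOfOrthogonalEqBot (B.orthonormal_normalized hL₁ hL₂)
    hbot).hasSum_repr ψ
  simp only [HilbertBasis.repr_apply_apply, HilbertBasis.coe_mkOfOrthogonalEqBot,
    B.inner_normalized_smul hL₁ hL₂] at h
  refine h.comp (tendsto_atTop_finset_of_monotone (fun m n hmn => square_mono hmn) fun s =>
    ⟨s.1 + s.2 + 1, ?_⟩)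
  simp only [square, Finset.mem_product, Finset.mem_range]; omega

/-- The high modes are controlled by the Laplacian. -/
lemma norm_comb_sq_le (hL₁ : 0 ≤ L₁) (hL₂ : 0 ≤ L₂) {S S' : Finset (ℕ × ℕ)} (hS : S' ⊆ S)
    (c : ℕ × ℕ → ℂ) {R : ℝ} (hR : 1 ≤ R) (h : ∀ s ∈ S', R ≤ B.lam s) :
    ‖B.comb S' c‖ ^ 2 ≤ 2 / R * ‖toH (B.lapComb S c)‖ ^ 2 := by
  have hR0 : 0 < R := by linarith
  rw [B.norm_comb_sq hL₁ hL₂, lapComb, norm_toH_comb_sq, Finset.mul_sum]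
  refine le_trans (Finset.sum_le_sum fun s hs => ?_)
    (Finset.sum_le_sum_of_subset_of_nonneg hS fun s _ _ => by positivity)
  have h1 := h s hs
  rw [norm_mul, Complex.norm_real, mul_pow, Real.norm_eq_abs, sq_abs, ← mul_assoc]
  -- With `1 ≤ R ≤ λ` one has `1 + λ ≤ 2λ ≤ 2λ²/R`.
  refine mul_le_mul_of_nonneg_right ?_ (sq_nonneg _)
  rw [div_mul_eq_mul_div, le_div_iff₀ hR0]
  nlinarith

end EigenBasis

/-- Gronwall's inequality for a differential inequality with a dissipation term. -/
lemma gronwall_dissipation {T K ρ : ℝ} (hT : 0 ≤ T) (hK : 0 ≤ K) {f f' d r : ℝ → ℝ}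
    (hd : ContinuousOn d (Icc 0 T)) (hr : ContinuousOn r (Icc 0 T))
    (hd0 : ∀ t ∈ Icc 0 T, 0 ≤ d t) (hr0 : ∀ t ∈ Icc 0 T, 0 ≤ r t)
    (hf : ∀ t ∈ Icc 0 T, HasDerivWithinAt f (f' t) (Icc 0 T) t)
    (hle : ∀ t ∈ Icc 0 T, f' t ≤ -d t + K * f t + r t)
    (hf0 : ∀ t ∈ Icc 0 T, 0 ≤ f t)
    (hρ : f 0 + ∫ t in (0 : ℝ)..T, r t ≤ ρ) :
    (∀ t ∈ Icc 0 T, f t ≤ ρ * Real.exp (K * T)) ∧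
      ∫ t in (0 : ℝ)..T, d t ≤ ρ * (1 + K * T * Real.exp (K * T)) := by
  have hfc : ContinuousOn f (Icc 0 T) := fun t ht => (hf t ht).continuousWithinAt
  have ii : ∀ {k : ℝ → ℝ}, ContinuousOn k (Icc 0 T) → ∀ {t}, t ∈ Icc 0 T →
      IntervalIntegrable k volume 0 t := fun hk t ht =>
    (hk.mono (Icc_subset_Icc_right ht.2)).intervalIntegrable_of_Icc ht.1
  have hmono : ∀ {k : ℝ → ℝ}, ContinuousOn k (Icc 0 T) → (∀ t ∈ Icc 0 T, 0 ≤ k t) →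
      ∀ t ∈ Icc 0 T, ∫ s in (0 : ℝ)..t, k s ≤ ∫ s in (0 : ℝ)..T, k s := fun hk hk0 t ht => by
    refine intervalIntegral.integral_mono_interval le_rfl ht.1 ht.2 ?_ (ii hk ⟨hT, le_rfl⟩)
    exact (ae_restrict_iff' measurableSet_Ioc).2
      (Eventually.of_forall fun s hs => hk0 s (Ioc_subset_Icc_self hs))
  -- The integrated inequality is used twice: without the dissipation it bounds `f`, and then, with
  -- this bound inserted, it bounds the integral of `d`.
  have main : ∀ t ∈ Icc 0 T,
      f t + ∫ s in (0 : ℝ)..t, d s ≤ ρ + K * ∫ s in (0 : ℝ)..t, f s := by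
    intro t ht
    have hsub : Icc 0 t ⊆ Icc 0 T := Icc_subset_Icc_right ht.2
    have h := intervalIntegral.sub_le_integral_of_hasDeriv_right_of_le (g := f) (g' := f')
      (φ := fun s => -d s + K * f s + r s) ht.1 (hfc.mono hsub)
      (fun s hs => by
        have hs' : s ∈ Icc 0 T := hsub (Ioo_subset_Icc_self hs)
        exact ((hf s hs').hasDerivAt (Icc_mem_nhds hs.1 (hs.2.trans_le ht.2))).hasDerivWithinAt)
      (((hd.neg.add (hfc.const_smul K)).add hr).mono hsub).integrableOn_Icc
      (fun s hs => hle s (hsub (Ioo_subset_Icc_self hs)))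
    have hn : IntervalIntegrable (fun s => -d s) volume 0 t := (ii hd ht).neg
    rw [intervalIntegral.integral_add (hn.add ((ii hfc ht).const_mul K)) (ii hr ht),
      intervalIntegral.integral_add hn ((ii hfc ht).const_mul K),
      intervalIntegral.integral_neg, intervalIntegral.integral_const_mul] at h
    linarith [hmono hr hr0 t ht]
  have nn : ∀ {k : ℝ → ℝ}, (∀ t ∈ Icc 0 T, 0 ≤ k t) → ∀ t ∈ Icc 0 T,
      0 ≤ ∫ s in (0 : ℝ)..t, k s := fun hk t ht =>
    intervalIntegral.integral_nonneg ht.1 fun s hs => hk s ⟨hs.1, hs.2.trans ht.2⟩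
  have h0 : (0 : ℝ) ∈ Icc 0 T := ⟨le_rfl, hT⟩
  have hT' : T ∈ Icc 0 T := ⟨hT, le_rfl⟩
  have hρ0 : 0 ≤ ρ := by linarith [hf0 0 h0, nn hr0 T hT']
  have hb : ∀ t ∈ Icc 0 T, f t ≤ ρ * Real.exp (K * T) := fun t ht => by
    have := le_mul_exp_of_le_add_integral (T := T) (c := ρ) hK hfc
      (fun t ht => by linarith [main t ht, nn hd0 t ht]) ht
    refine this.trans ?_
    gcongr
    exact ht.2
  refine ⟨hb, ?_⟩
  have h1 : ∫ s in (0 : ℝ)..T, f s ≤ ∫ _ in (0 : ℝ)..T, ρ * Real.exp (K * T) :=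
    intervalIntegral.integral_mono_on hT (ii hfc hT') (by simp) hb
  rw [intervalIntegral.integral_const, smul_eq_mul, sub_zero] at h1
  have h2 := main T hT'
  have h3 := hf0 T hT'
  have h4 := mul_le_mul_of_nonneg_left h1 hK
  nlinarith

end SGGLE

/-! ### Coercivity and global solvability of the Galerkin system. -/

namespace SGGLE

open Filter Topology
open scoped InnerProductSpace ContDiff

variable {L₁ L₂ : ℝ} (𝔭 : Params)

lemma continuousOn_G_comp {X : Type*} [TopologicalSpace X] {a b : X → ℝ} {w ψ : X → V L₁ L₂}
    {s : Set X} (ha : ContinuousOn a s) (hb : ContinuousOn b s) (hw : ContinuousOn w s)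
    (hψ : ContinuousOn ψ s) : ContinuousOn (fun x => G 𝔭 (a x) (b x) (w x) (ψ x)) s := by
  have h : ContinuousOn (fun x => ((a x, b x), (w x, ψ x))) s :=
    ContinuousOn.prodMk (ha.prodMk hb) (hw.prodMk hψ)
  have h2 := (continuous_G (L₁ := L₁) (L₂ := L₂) 𝔭).comp_continuousOn h
  exact h2

lemma gradSq_zero : gradSq (0 : V L₁ L₂) = 0 := by simp [gradSq]

/-- The drift is coercive. -/
theorem exists_coercive (L₁ L₂ : ℝ) {m M : ℝ} (hm : 0 < m) : ∃ κ K : ℝ, 0 < κ ∧ 0 ≤ K ∧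
    ∀ A₁ A₂ : ℝ, m ≤ A₁ → |A₂| ≤ M → ∀ w : V L₁ L₂,
      (G 𝔭 A₁ A₂ w w).re ≤ -(1 / 2) * gradSq w - κ * (∫ x in rect L₁ L₂, ‖toH w x‖ ^ 𝔭.p)
          + K * ‖toH w‖ ^ 2 := by
  obtain ⟨κ, K, hκ, hK, h⟩ := exists_local_monotone 𝔭 L₁ L₂ (M := M) hm
  refine ⟨κ, K, hκ, hK, fun A₁ A₂ h₁ h₂ w => ?_⟩
  -- Coercivity is local monotonicity against zero: the drift vanishes at zero, so does the gradient
  -- factor, and the weighted norm becomes the integral of `|w|^{2σ} |w|² = |w|^p`.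
  have h0 := h A₁ A₂ h₁ h₂ w 0
  have hw : wtSq (2 * 𝔭.σ) w (0 : V L₁ L₂) = ∫ x in rect L₁ L₂, ‖toH w x‖ ^ 𝔭.p := by
    rw [wtSq]
    refine integral_congr_ae ?_
    have hz : ∀ᵐ x ∂rectMeasure L₁ L₂, toH (0 : V L₁ L₂) x = 0 := Lp.coeFn_zero _ _ _
    have hσ := 𝔭.hσ
    filter_upwards [hz] with x hx
    simp only [hx, wt, sub_zero, norm_zero]
    rw [Real.zero_rpow (by linarith), add_zero, Params.p,
      Real.rpow_add' (norm_nonneg _) (by linarith), Real.rpow_two]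
  rw [sub_zero, G_zero_left, sub_zero, hw, gradSq_zero] at h0
  simpa using h0

/-- Continuous coefficients of the transformed equation, between fixed bounds. -/
structure Coeffs (m M : ℝ) (A₁ A₂ : ℝ → ℝ) : Prop where
  pos : 0 < m
  cont₁ : Continuous A₁
  cont₂ : Continuous A₂
  lower : ∀ t, m ≤ A₁ t
  upper₁ : ∀ t, |A₁ t| ≤ M
  upper₂ : ∀ t, |A₂ t| ≤ M

namespace EigenBasis

variable (B : EigenBasis L₁ L₂)

/-- Combinations of finitely many eigenfunctions, as a linear map. -/
def combL (S : Finset (ℕ × ℕ)) : EuclideanSpace ℂ S →ₗ[ℂ] V L₁ L₂ :=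
  ∑ s : S, (EuclideanSpace.proj (𝕜 := ℂ) s).toLinearMap.smulRight (B.e s)

lemma combL_apply (S : Finset (ℕ × ℕ)) (x : EuclideanSpace ℂ S) :
    B.combL S x = ∑ s : S, x s • B.e s := by
  simp [combL]

lemma combL_eq_comb (S : Finset (ℕ × ℕ)) (x : EuclideanSpace ℂ S) (c : ℕ × ℕ → ℂ)
    (h : ∀ s : S, c s = x s) : B.combL S x = B.comb S c := by
  rw [combL_apply, comb, ← Finset.sum_coe_sort S fun s => c s • B.e s]
  exact Finset.sum_congr rfl fun s _ => by rw [h]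

open Classical in
/-- Extension of finitely many coefficients by zero. -/
def extend (S : Finset (ℕ × ℕ)) (x : EuclideanSpace ℂ S) (s : ℕ × ℕ) : ℂ :=
  if h : s ∈ S then x ⟨s, h⟩ else 0

lemma extend_coe (S : Finset (ℕ × ℕ)) (x : EuclideanSpace ℂ S) (s : S) : extend S x s = x s := by
  simp [extend]

lemma norm_toH_combL (S : Finset (ℕ × ℕ)) (x : EuclideanSpace ℂ S) :
    ‖toH (B.combL S x)‖ = ‖x‖ := by
  rw [← sq_eq_sq₀ (norm_nonneg _) (norm_nonneg _), B.combL_eq_comb S x _ fun s => extend_coe S x s,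
    norm_toH_comb_sq, EuclideanSpace.norm_sq_eq, ← Finset.sum_coe_sort S fun s => ‖extend S x s‖ ^ 2]
  exact Finset.sum_congr rfl fun s _ => by rw [extend_coe]

lemma exists_norm_combL_le (S : Finset (ℕ × ℕ)) :
    ∃ Λ : ℝ, 0 < Λ ∧ ∀ x, ‖B.combL S x‖ ≤ Λ * ‖x‖ :=
  (LinearMap.toContinuousLinearMap (B.combL S)).bound

/-- The vector field of the Galerkin system. -/
def field (A₁ A₂ : ℝ → ℝ) (S : Finset (ℕ × ℕ)) (t : ℝ) (x : EuclideanSpace ℂ S) :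
    EuclideanSpace ℂ S :=
  WithLp.toLp 2 fun s : S => G 𝔭 (A₁ t) (A₂ t) (B.combL S x) (B.e s)

/-- By conjugate linearity in the test function, pairing the field with a coefficient vector tests
the drift with the corresponding combination. All estimates of `G` thereby become estimates of the
field. -/
lemma inner_field (A₁ A₂ : ℝ → ℝ) (S : Finset (ℕ × ℕ)) (t : ℝ) (x z : EuclideanSpace ℂ S) :
    ⟪z, B.field 𝔭 A₁ A₂ S t x⟫_ℂ = G 𝔭 (A₁ t) (A₂ t) (B.combL S x) (B.combL S z) := by
  rw [B.combL_apply S z, G_sum, PiLp.inner_apply]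
  refine Finset.sum_congr rfl fun s _ => ?_
  exact (mul_comm _ _).trans (G_smul 𝔭 (A₁ t) (A₂ t) (B.combL S x) (B.e s) (z s)).symm

lemma continuous_field {m M : ℝ} {A₁ A₂ : ℝ → ℝ} (hA : Coeffs m M A₁ A₂)
    (S : Finset (ℕ × ℕ)) (x : EuclideanSpace ℂ S) :
    Continuous fun t => B.field 𝔭 A₁ A₂ S t x := by
  refine (PiLp.continuous_toLp 2 _).comp (continuous_pi fun s => ?_)
  rw [← continuousOn_univ]
  exact continuousOn_G_comp 𝔭 hA.cont₁.continuousOn hA.cont₂.continuousOn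
    (w := fun _ => B.combL S x) (ψ := fun _ => B.e s) continuousOn_const continuousOn_const

/-- The difference of the fields is tested with itself. In finite dimension the norm of `V` is
controlled by that of the coefficients, so the local Lipschitz bound of `G` applies. -/
lemma exists_field_lipschitz {m M : ℝ} {A₁ A₂ : ℝ → ℝ} (hA : Coeffs m M A₁ A₂)
    (S : Finset (ℕ × ℕ)) (R : ℝ) : ∃ L : ℝ, 0 ≤ L ∧ ∀ t x y, ‖x‖ ≤ R → ‖y‖ ≤ R →
      ‖B.field 𝔭 A₁ A₂ S t x - B.field 𝔭 A₁ A₂ S t y‖ ≤ L * ‖x - y‖ := by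
  obtain ⟨Λ, hΛ0, hΛ⟩ := B.exists_norm_combL_le S
  obtain ⟨C, hC0, hC⟩ := exists_norm_G_sub_le 𝔭 L₁ L₂ (Λ * R) M
  refine ⟨C * Λ * Λ, by positivity, fun t x y hx hy => ?_⟩
  set z := B.field 𝔭 A₁ A₂ S t x - B.field 𝔭 A₁ A₂ S t y with hz
  have h1 : ‖z‖ ^ 2 ≤ C * Λ * Λ * ‖x - y‖ * ‖z‖ := by
    have e : (⟪z, z⟫_ℂ).re = ‖z‖ ^ 2 := inner_self_eq_norm_sq (𝕜 := ℂ) z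
    have e2 : ⟪z, z⟫_ℂ = ⟪z, B.field 𝔭 A₁ A₂ S t x⟫_ℂ - ⟪z, B.field 𝔭 A₁ A₂ S t y⟫_ℂ := by
      rw [← inner_sub_right]
    rw [← e, e2, inner_field, inner_field]
    refine (Complex.re_le_norm _).trans ((hC _ _ (hA.upper₁ t) (hA.upper₂ t) _ _ _
      ((hΛ x).trans (by gcongr)) ((hΛ y).trans (by gcongr))).trans ?_)
    rw [← map_sub]
    calc C * ‖B.combL S (x - y)‖ * ‖B.combL S z‖ ≤ C * (Λ * ‖x - y‖) * (Λ * ‖z‖) := by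
          gcongr
          · exact hΛ _
          · exact hΛ _
      _ = _ := by ring
  rcases (norm_nonneg z).eq_or_lt with h0 | h0
  · rw [← h0]; positivity
  · nlinarith

/-- The Galerkin system has a global solution. -/
theorem exists_galerkin {m M T : ℝ} (hT : 0 ≤ T) {A₁ A₂ : ℝ → ℝ} (hA : Coeffs m M A₁ A₂)
    (S : Finset (ℕ × ℕ)) (a : ℕ × ℕ → ℂ) : ∃ c : ℝ → ℕ × ℕ → ℂ, (∀ s ∈ S, c 0 s = a s) ∧
      ∀ t ∈ Icc 0 T, ∀ s ∈ S, HasDerivWithinAt (fun t => c t s)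
        (G 𝔭 (A₁ t) (A₂ t) (B.comb S (c t)) (B.e s)) (Icc 0 T) t := by
  obtain ⟨κ, K, hκ, hK, hco⟩ := exists_coercive 𝔭 L₁ L₂ (M := M) hA.pos
  have hX : ∀ t ∈ Icc 0 T, ∀ x : EuclideanSpace ℂ S,
      (⟪x, B.field 𝔭 A₁ A₂ S t x⟫_ℂ).re ≤ K * ‖x‖ ^ 2 := fun t _ x => by
    rw [inner_field]
    refine (hco _ _ (hA.lower t) (hA.upper₂ t) _).trans ?_
    rw [norm_toH_combL]
    have h1 := gradSq_nonneg (B.combL S x)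
    have h2 : 0 ≤ ∫ z in rect L₁ L₂, ‖toH (B.combL S x) z‖ ^ 𝔭.p :=
      integral_nonneg fun _ => by positivity
    have h3 := mul_nonneg hκ.le h2
    linarith
  obtain ⟨y, hy0, hy⟩ := exists_global_solution hT hK (B.field 𝔭 A₁ A₂ S)
    (fun x => (B.continuous_field 𝔭 hA S x).continuousOn)
    (fun R => by
      obtain ⟨L, hL0, hL⟩ := B.exists_field_lipschitz 𝔭 hA S R
      exact ⟨L, hL0, fun t _ => hL t⟩)
    hX (WithLp.toLp 2 fun s : S => a s)
  refine ⟨fun t => extend S (y t), fun s hs => ?_, fun t ht s hs => ?_⟩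
  · exact (extend_coe S (y 0) ⟨s, hs⟩).trans (by rw [hy0])
  · have h := ((EuclideanSpace.proj (𝕜 := ℂ) (⟨s, hs⟩ : S)).restrictScalars ℝ).hasFDerivAt
      |>.comp_hasDerivWithinAt t (hy t ht)
    rw [← B.combL_eq_comb S (y t) _ fun s => extend_coe S (y t) s]
    refine h.congr_of_eventuallyEq ?_ ?_
    · exact Eventually.of_forall fun t => extend_coe S (y t) ⟨s, hs⟩
    · exact extend_coe S (y t) ⟨s, hs⟩

end EigenBasis

end SGGLE

/-! ### A priori bounds for the Galerkin approximations. -/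

namespace SGGLE

open Filter Topology
open scoped InnerProductSpace ContDiff

variable {L₁ L₂ : ℝ} (𝔭 : Params)

/-- The weight one gives the derivative of the squared norm in `H`; the weight `lam` gives that of
`gradSq`, which amounts to testing with the negative Laplacian. -/
lemma hasDerivWithinAt_sum_norm_sq {ι : Type*} {S : Finset ι} {c : ℝ → ι → ℂ} {c' : ι → ℂ}
    {I : Set ℝ} {t : ℝ} (μ : ι → ℝ) (h : ∀ s ∈ S, HasDerivWithinAt (fun t => c t s) (c' s) I t) :
    HasDerivWithinAt (fun t => ∑ s ∈ S, μ s * ‖c t s‖ ^ 2)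
      (2 * (∑ s ∈ S, conj ((μ s : ℂ) * c t s) * c' s).re) I t := by
  have h1 := HasDerivWithinAt.fun_sum fun s hs => ((h s hs).norm_sq.const_mul (μ s))
  refine h1.congr_deriv ?_
  rw [Complex.re_sum, Finset.mul_sum]
  refine Finset.sum_congr rfl fun s _ => ?_
  rw [map_mul, Complex.conj_ofReal, mul_assoc, Complex.re_ofReal_mul, Complex.inner]
  simp only [Complex.mul_re, Complex.conj_re, Complex.conj_im]
  ring

namespace EigenBasis

variable (B : EigenBasis L₁ L₂)

lemma G_comb (a b : ℝ) (w : V L₁ L₂) (S : Finset (ℕ × ℕ)) (c : ℕ × ℕ → ℂ) :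
    G 𝔭 a b w (B.comb S c) = ∑ s ∈ S, conj (c s) * G 𝔭 a b w (B.e s) := by
  rw [comb, G_sum]
  exact Finset.sum_congr rfl fun s _ => G_smul 𝔭 _ _ _ _ _

lemma comb_congr {S : Finset (ℕ × ℕ)} {c c' : ℕ × ℕ → ℂ} (h : ∀ s ∈ S, c s = c' s) :
    B.comb S c = B.comb S c' := Finset.sum_congr rfl fun s hs => by rw [h s hs]

/-- The coefficients of a Galerkin approximation with modes in `S`. -/
structure IsGalerkin (T : ℝ) (A₁ A₂ : ℝ → ℝ) (u₀ : V L₁ L₂) (S : Finset (ℕ × ℕ))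
    (c : ℝ → ℕ × ℕ → ℂ) : Prop where
  init : ∀ s ∈ S, c 0 s = ⟪toH (B.e s), toH u₀⟫_ℂ
  deriv : ∀ t ∈ Icc 0 T, ∀ s ∈ S, HasDerivWithinAt (fun t => c t s)
    (G 𝔭 (A₁ t) (A₂ t) (B.comb S (c t)) (B.e s)) (Icc 0 T) t

namespace IsGalerkin

variable {B} {𝔭} {T m M : ℝ} {A₁ A₂ : ℝ → ℝ} {u₀ : V L₁ L₂} {S : Finset (ℕ × ℕ)}
  {c : ℝ → ℕ × ℕ → ℂ}

lemma comb_zero (h : B.IsGalerkin 𝔭 T A₁ A₂ u₀ S c) : B.comb S (c 0) = B.proj S u₀ :=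
  B.comb_congr h.init

lemma continuousOn_coeff (h : B.IsGalerkin 𝔭 T A₁ A₂ u₀ S c) {s : ℕ × ℕ} (hs : s ∈ S) :
    ContinuousOn (fun t => c t s) (Icc 0 T) := fun t ht => (h.deriv t ht s hs).continuousWithinAt

lemma continuousOn (h : B.IsGalerkin 𝔭 T A₁ A₂ u₀ S c) :
    ContinuousOn (fun t => B.comb S (c t)) (Icc 0 T) :=
  continuousOn_finsetSum _ fun _ hs => (h.continuousOn_coeff hs).smul continuousOn_const

lemma continuousOn_lap (h : B.IsGalerkin 𝔭 T A₁ A₂ u₀ S c) :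
    ContinuousOn (fun t => B.lapComb S (c t)) (Icc 0 T) :=
  continuousOn_finsetSum _ fun _ hs =>
    (continuousOn_const.mul (h.continuousOn_coeff hs)).smul continuousOn_const

lemma hasDerivWithinAt_inner (h : B.IsGalerkin 𝔭 T A₁ A₂ u₀ S c) (ψ : V L₁ L₂) {t : ℝ}
    (ht : t ∈ Icc 0 T) : HasDerivWithinAt (fun t => ⟪toH ψ, toH (B.comb S (c t))⟫_ℂ)
      (G 𝔭 (A₁ t) (A₂ t) (B.comb S (c t)) (B.proj S ψ)) (Icc 0 T) t := by
  have e : ∀ t, ⟪toH ψ, toH (B.comb S (c t))⟫_ℂ = ∑ s ∈ S, c t s * ⟪toH ψ, toH (B.e s)⟫_ℂ := by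
    intro t
    rw [toH_comb, inner_sum]
    exact Finset.sum_congr rfl fun s _ => inner_smul_right _ _ _
  simp only [e]
  refine (HasDerivWithinAt.fun_sum fun s hs => (h.deriv t ht s hs).mul_const _).congr_deriv ?_
  rw [proj, G_comb]
  refine Finset.sum_congr rfl fun s _ => ?_
  have hc : conj ⟪toH (B.e s), toH ψ⟫_ℂ = ⟪toH ψ, toH (B.e s)⟫_ℂ := inner_conj_symm _ _
  rw [hc, mul_comm]

lemma inner_eq (h : B.IsGalerkin 𝔭 T A₁ A₂ u₀ S c) (hA : Coeffs m M A₁ A₂) (ψ : V L₁ L₂)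
    {t : ℝ} (ht : t ∈ Icc 0 T) : ⟪toH ψ, toH (B.comb S (c t))⟫_ℂ =
      ⟪toH ψ, toH (B.proj S u₀)⟫_ℂ +
        ∫ s in (0 : ℝ)..t, G 𝔭 (A₁ s) (A₂ s) (B.comb S (c s)) (B.proj S ψ) := by
  have hsub : Icc 0 t ⊆ Icc 0 T := Icc_subset_Icc_right ht.2
  have hc : ContinuousOn (fun s => G 𝔭 (A₁ s) (A₂ s) (B.comb S (c s)) (B.proj S ψ)) (Icc 0 T) :=
    continuousOn_G_comp 𝔭 hA.cont₁.continuousOn hA.cont₂.continuousOn h.continuousOn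
      continuousOn_const
  rw [intervalIntegral.integral_eq_sub_of_hasDerivAt_of_le ht.1
    (f := fun t => ⟪toH ψ, toH (B.comb S (c t))⟫_ℂ)
    (fun s hs => (h.hasDerivWithinAt_inner ψ (hsub hs)).continuousWithinAt.mono hsub)
    (fun s hs => (h.hasDerivWithinAt_inner ψ (hsub (Ioo_subset_Icc_self hs))).hasDerivAt
      (Icc_mem_nhds hs.1 (hs.2.trans_le ht.2)))
    ((hc.mono hsub).intervalIntegrable_of_Icc ht.1), h.comb_zero]
  ring

lemma hasDerivWithinAt_norm_sq (h : B.IsGalerkin 𝔭 T A₁ A₂ u₀ S c) {t : ℝ}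
    (ht : t ∈ Icc 0 T) : HasDerivWithinAt (fun t => ‖toH (B.comb S (c t))‖ ^ 2)
      (2 * (G 𝔭 (A₁ t) (A₂ t) (B.comb S (c t)) (B.comb S (c t))).re) (Icc 0 T) t := by
  have := hasDerivWithinAt_sum_norm_sq (fun _ => 1) (h.deriv t ht)
  simp only [norm_toH_comb_sq]
  rw [B.G_comb 𝔭 _ _ _ S (c t)]
  simpa using this

lemma hasDerivWithinAt_gradSq (hL₁ : 0 ≤ L₁) (hL₂ : 0 ≤ L₂) (h : B.IsGalerkin 𝔭 T A₁ A₂ u₀ S c)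
    {t : ℝ} (ht : t ∈ Icc 0 T) : HasDerivWithinAt (fun t => gradSq (B.comb S (c t)))
      (2 * (G 𝔭 (A₁ t) (A₂ t) (B.comb S (c t)) (B.lapComb S (c t))).re) (Icc 0 T) t := by
  have := hasDerivWithinAt_sum_norm_sq B.lam (h.deriv t ht)
  simp only [B.gradSq_comb hL₁ hL₂]
  rw [lapComb, B.G_comb 𝔭]
  exact this

end IsGalerkin

/-- Galerkin approximations are bounded in `V`, and their Laplacians in `L²(0,T;H)`. -/
theorem exists_galerkin_bound (hL₁ : 0 ≤ L₁) (hL₂ : 0 ≤ L₂) {T m M : ℝ} (hT : 0 ≤ T)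
    {A₁ A₂ : ℝ → ℝ} (hA : Coeffs m M A₁ A₂) (u₀ : V L₁ L₂) : ∃ R C : ℝ, 0 ≤ R ∧ 0 ≤ C ∧
      ∀ n c, B.IsGalerkin 𝔭 T A₁ A₂ u₀ (square n) c →
        (∀ t ∈ Icc 0 T, ‖B.comb (square n) (c t)‖ ≤ R) ∧
        ∫ t in (0 : ℝ)..T, ‖toH (B.lapComb (square n) (c t))‖ ^ 2 ≤ C := by
  -- The initial values are bounded in `V` because they converge there; the regularity of `u₀`
  -- enters at this point.
  obtain ⟨P, hP⟩ := (B.tendsto_proj hL₁ hL₂ u₀).norm.bddAbove_range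
  replace hP : ∀ n, ‖B.proj (square n) u₀‖ ≤ P := fun n => hP (Set.mem_range_self n)
  have hP0 : 0 ≤ P := (norm_nonneg _).trans (hP 0)
  obtain ⟨K₁, hK₁, h₁⟩ := exists_re_G_laplace_le 𝔭 hL₁ hL₂ (M := M) hA.pos
  obtain ⟨κ, K₂, hκ, hK₂, h₂⟩ := exists_coercive 𝔭 L₁ L₂ (M := M) hA.pos
  refine ⟨P * √(Real.exp (2 * K₁ * T) + Real.exp (2 * K₂ * T)),
    P ^ 2 * (1 + 2 * K₁ * T * Real.exp (2 * K₁ * T)), by positivity, by positivity,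
    fun n c h => ?_⟩
  have e1 := gronwall_dissipation hT (K := 2 * K₁) (ρ := P ^ 2) (by positivity)
    (d := fun t => ‖toH (B.lapComb (square n) (c t))‖ ^ 2) (r := fun _ => 0)
    ((continuous_toH.comp_continuousOn h.continuousOn_lap).norm.pow 2) continuousOn_const (fun t _ => sq_nonneg _)
    (fun t _ => le_rfl) (fun t ht => h.hasDerivWithinAt_gradSq hL₁ hL₂ ht)
    (fun t ht => by
      obtain ⟨U, U', k1, k2, k3⟩ := B.exists_smoothRep_sum (square n) (c t)
      have := h₁ _ _ (hA.lower t) (hA.upper₂ t) _ _ U U' k1 k2 k3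
      change (G 𝔭 (A₁ t) (A₂ t) (B.comb (square n) (c t)) (B.lapComb (square n) (c t))).re ≤
        -(1 / 2) * ‖toH (B.lapComb (square n) (c t))‖ ^ 2
          + K₁ * gradSq (B.comb (square n) (c t)) at this
      linarith)
    (fun t _ => gradSq_nonneg _)
    (by
      rw [h.comb_zero, intervalIntegral.integral_zero, add_zero]
      exact (gradSq_le _).trans (by gcongr; exact hP n))
  have e2 := gronwall_dissipation hT (K := 2 * K₂) (ρ := P ^ 2) (by positivity)
    (d := fun _ => 0) (r := fun _ => 0) continuousOn_const continuousOn_const (fun t _ => le_rfl)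
    (fun t _ => le_rfl) (fun t ht => h.hasDerivWithinAt_norm_sq ht)
    (fun t ht => by
      have := h₂ _ _ (hA.lower t) (hA.upper₂ t) (B.comb (square n) (c t))
      have k1 := gradSq_nonneg (B.comb (square n) (c t))
      have k2 : 0 ≤ ∫ z in rect L₁ L₂, ‖toH (B.comb (square n) (c t)) z‖ ^ 𝔭.p :=
        integral_nonneg fun _ => by positivity
      have k3 := mul_nonneg hκ.le k2
      linarith)
    (fun t _ => sq_nonneg _)
    (by
      rw [h.comb_zero, intervalIntegral.integral_zero, add_zero]
      have := (norm_toH_le _).trans (hP n)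
      gcongr)
  refine ⟨fun t ht => ?_, e1.2⟩
  refine abs_le_of_sq_le_sq' ?_ (by positivity) |>.2
  rw [norm_sq_V, mul_pow, Real.sq_sqrt (by positivity)]
  linarith [e1.1 t ht, e2.1 t ht]

end EigenBasis

end SGGLE

/-! ### The Cauchy property of the Galerkin approximations. -/

namespace SGGLE

open Filter Topology
open scoped InnerProductSpace ContDiff

variable {L₁ L₂ : ℝ} (𝔭 : Params)

namespace EigenBasis

variable (B : EigenBasis L₁ L₂)

open Classical in
lemma comb_sub_of_subset {S S' : Finset (ℕ × ℕ)} (h : S' ⊆ S) (c c' : ℕ × ℕ → ℂ) :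
    B.comb S (fun s => c s - if s ∈ S' then c' s else 0) = B.comb S c - B.comb S' c' := by
  have e : B.comb S' c' = ∑ s ∈ S, (if s ∈ S' then c' s else 0) • B.e s := by
    simp only [ite_smul, zero_smul]
    rw [Finset.sum_ite_mem, Finset.inter_eq_right.2 h, comb]
  rw [e, comb, comb, ← Finset.sum_sub_distrib]
  exact Finset.sum_congr rfl fun s _ => by rw [sub_smul]

open Classical in
lemma comb_sdiff {S S' : Finset (ℕ × ℕ)} (h : S' ⊆ S) (c : ℕ × ℕ → ℂ) :
    B.comb (S \ S') c = B.comb S c - B.comb S' c := by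
  rw [eq_sub_iff_add_eq]; exact Finset.sum_sdiff h

open Classical in
-- The coarse system can be tested only with modes in `S'`, whereas the difference also contains the
-- modes of the fine solution outside `S'`. Testing the coarse drift with the full difference
-- therefore needs a correction, its value on these high modes, which is the last term.
lemma IsGalerkin.hasDerivWithinAt_norm_sub_sq {B : EigenBasis L₁ L₂} {𝔭 : Params} {T : ℝ}
    {A₁ A₂ : ℝ → ℝ} {u₀ : V L₁ L₂} {S S' : Finset (ℕ × ℕ)} (hS : S' ⊆ S) {c c' : ℝ → ℕ × ℕ → ℂ}
    (h : B.IsGalerkin 𝔭 T A₁ A₂ u₀ S c) (h' : B.IsGalerkin 𝔭 T A₁ A₂ u₀ S' c') {t : ℝ}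
    (ht : t ∈ Icc 0 T) :
    HasDerivWithinAt (fun t => ‖toH (B.comb S (c t) - B.comb S' (c' t))‖ ^ 2)
      (2 * ((G 𝔭 (A₁ t) (A₂ t) (B.comb S (c t)) (B.comb S (c t) - B.comb S' (c' t))
        - G 𝔭 (A₁ t) (A₂ t) (B.comb S' (c' t)) (B.comb S (c t) - B.comb S' (c' t))).re
        + (G 𝔭 (A₁ t) (A₂ t) (B.comb S' (c' t)) (B.comb (S \ S') (c t))).re))
      (Icc 0 T) t := by
  set z : ℝ → ℕ × ℕ → ℂ := fun t s => c t s - if s ∈ S' then c' t s else 0 with hz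
  have hzc : ∀ t, B.comb S (z t) = B.comb S (c t) - B.comb S' (c' t) := fun t =>
    B.comb_sub_of_subset hS (c t) (c' t)
  have hd : ∀ s ∈ S, HasDerivWithinAt (fun t => z t s)
      (G 𝔭 (A₁ t) (A₂ t) (B.comb S (c t)) (B.e s) -
        if s ∈ S' then G 𝔭 (A₁ t) (A₂ t) (B.comb S' (c' t)) (B.e s) else 0) (Icc 0 T) t := by
    intro s hs
    refine (h.deriv t ht s hs).sub ?_
    split_ifs with hs'
    · exact h'.deriv t ht s hs'
    · exact hasDerivWithinAt_const _ _ _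
  have hq : B.comb S' (z t) = B.comb S (z t) - B.comb (S \ S') (c t) := by
    rw [← B.comb_congr (S := S \ S') (c := z t) (fun s hs => by
      simp [hz, (Finset.mem_sdiff.1 hs).2]), B.comb_sdiff hS]
    abel
  have key := hasDerivWithinAt_sum_norm_sq (fun _ => 1) hd
  simp only [← hzc, norm_toH_comb_sq]
  simp only [one_mul, Complex.ofReal_one] at key
  convert key using 2
  rw [← Complex.add_re]
  congr 1
  simp only [mul_sub, Finset.sum_sub_distrib]
  have e1 : ∑ s ∈ S, conj (z t s) *
      (if s ∈ S' then G 𝔭 (A₁ t) (A₂ t) (B.comb S' (c' t)) (B.e s) else 0) =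
      G 𝔭 (A₁ t) (A₂ t) (B.comb S' (c' t)) (B.comb S' (z t)) := by
    simp only [mul_ite, mul_zero]
    rw [Finset.sum_ite_mem, Finset.inter_eq_right.2 hS, G_comb]
  rw [e1, ← G_comb, hq, G_sub]
  ring

/-- The Galerkin approximations form a Cauchy sequence. -/
theorem exists_galerkin_cauchy (hL₁ : 0 ≤ L₁) (hL₂ : 0 ≤ L₂) {T m M : ℝ} (hT : 0 ≤ T)
    {A₁ A₂ : ℝ → ℝ} (hA : Coeffs m M A₁ A₂) (u₀ : V L₁ L₂) {ε : ℝ} (hε : 0 < ε) :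
    ∃ N : ℕ, ∀ k n c' c, N ≤ k → k ≤ n → B.IsGalerkin 𝔭 T A₁ A₂ u₀ (square k) c' →
      B.IsGalerkin 𝔭 T A₁ A₂ u₀ (square n) c →
        (∀ t ∈ Icc 0 T, ‖toH (B.comb (square n) (c t) - B.comb (square k) (c' t))‖ ^ 2 ≤ ε) ∧
        ∫ t in (0 : ℝ)..T, gradSq (B.comb (square n) (c t) - B.comb (square k) (c' t)) ≤ ε := by
  classical
  obtain ⟨R, C₁, hR, hC₁, hb⟩ := B.exists_galerkin_bound 𝔭 hL₁ hL₂ hT hA u₀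
  obtain ⟨κ, K₀, hκ, hK₀, hmon⟩ := exists_local_monotone 𝔭 L₁ L₂ (M := M) hA.pos
  obtain ⟨C, hC, hG⟩ := exists_norm_G_le 𝔭 L₁ L₂ R M
  set K : ℝ := 2 * (K₀ * (1 + (R ^ 2) ^ 2)) with hK
  have hK0 : 0 ≤ K := by positivity
  -- `Q` dominates both Grönwall factors, and `D` the time integral of the high mode error per unit
  -- of `η`. The choice of `η` then limits that error to `ε/(2Q)`, and the initial error receives
  -- the same share.
  set Q : ℝ := 1 + K * T * Real.exp (K * T) + Real.exp (K * T) with hQ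
  have hQ0 : 0 < Q := by positivity
  set D : ℝ := 2 * C * (T + C₁) + 1 with hD
  have hD0 : 0 < D := by positivity
  set η : ℝ := ε / (2 * Q * D) with hη
  have hη0 : 0 < η := by positivity
  -- If all eigenvalues outside the coarse index set are at least `ρ`, the high modes have norm in
  -- `V` at most `η` times the norm of the Laplacian.
  set ρ : ℝ := max 1 (2 / η ^ 2) with hρ
  have hρ1 : 1 ≤ ρ := le_max_left _ _
  have hρη : 2 / ρ ≤ η ^ 2 := by
    rw [div_le_iff₀ (by linarith), ← div_le_iff₀' (by positivity)]
    exact le_max_right _ _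
  obtain ⟨N₁, hN₁⟩ := B.lam_large ρ
  obtain ⟨N₂, hN₂⟩ := Metric.cauchySeq_iff.1 (B.tendsto_proj hL₁ hL₂ u₀).cauchySeq
    (√(ε / (2 * Q))) (by positivity)
  refine ⟨max N₁ N₂, fun k n c' c hk hkn h' h => ?_⟩
  have hS := square_mono hkn
  obtain ⟨hb1, hb2⟩ := hb n c h
  obtain ⟨hb1', -⟩ := hb k c' h'
  have hlap : ContinuousOn (fun t => ‖toH (B.lapComb (square n) (c t))‖ ^ 2) (Icc 0 T) :=
    (continuous_toH.comp_continuousOn h.continuousOn_lap).norm.pow 2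
  have hcz : ContinuousOn
      (fun t => gradSq (B.comb (square n) (c t) - B.comb (square k) (c' t))) (Icc 0 T) :=
    continuous_gradSq.comp_continuousOn (h.continuousOn.sub h'.continuousOn)
  -- The linear bound in the Laplacian is weakened to a quadratic one, because it is the time
  -- integral of the square that is under control.
  have hq : ∀ t, ‖B.comb (square n \ square k) (c t)‖ ≤
      η * (1 + ‖toH (B.lapComb (square n) (c t))‖ ^ 2) := by
    intro t
    have h1 := B.norm_comb_sq_le hL₁ hL₂ (S := square n) (S' := square n \ square k)
      Finset.sdiff_subset (c t) hρ1
      (fun s hs => hN₁ k (le_trans (le_max_left _ _) hk) s (Finset.mem_sdiff.1 hs).2)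
    set x := ‖toH (B.lapComb (square n) (c t))‖
    have h2 : ‖B.comb (square n \ square k) (c t)‖ ^ 2 ≤ (η * x) ^ 2 := by
      rw [mul_pow]; exact h1.trans (by gcongr)
    have h3 := abs_le_of_sq_le_sq' h2 (by positivity) |>.2
    refine h3.trans (mul_le_mul_of_nonneg_left ?_ hη0.le)
    nlinarith [sq_nonneg (x - 1)]
  have e := gronwall_dissipation hT hK0 (ρ := ε / Q)
    (f := fun t => ‖toH (B.comb (square n) (c t) - B.comb (square k) (c' t))‖ ^ 2)
    (d := fun t => gradSq (B.comb (square n) (c t) - B.comb (square k) (c' t)))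
    (r := fun t => 2 * C * η * (1 + ‖toH (B.lapComb (square n) (c t))‖ ^ 2))
    hcz (continuousOn_const.mul (continuousOn_const.add hlap)) (fun t _ => gradSq_nonneg _)
    (fun t _ => by positivity)
    (fun t ht => h.hasDerivWithinAt_norm_sub_sq hS h' ht)
    (fun t ht => by
      have k1 := hmon _ _ (hA.lower t) (hA.upper₂ t) (B.comb (square n) (c t))
        (B.comb (square k) (c' t))
      have k2 := (Complex.re_le_norm _).trans (hG _ _ (hA.upper₁ t) (hA.upper₂ t)
        (B.comb (square k) (c' t)) (B.comb (square n \ square k) (c t)) (hb1' t ht))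
      have k3 := mul_le_mul_of_nonneg_left (hq t) hC
      have k4 := mul_nonneg hκ.le
        (wtSq_nonneg (2 * 𝔭.σ) (B.comb (square n) (c t)) (B.comb (square k) (c' t)))
      have k5 : gradSq (B.comb (square k) (c' t)) ^ 2 ≤ (R ^ 2) ^ 2 := by
        have := (gradSq_le _).trans (pow_le_pow_left₀ (norm_nonneg _) (hb1' t ht) 2)
        exact pow_le_pow_left₀ (gradSq_nonneg _) this 2
      have k6 : K₀ * (1 + gradSq (B.comb (square k) (c' t)) ^ 2) *
          ‖toH (B.comb (square n) (c t) - B.comb (square k) (c' t))‖ ^ 2 ≤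
          K₀ * (1 + (R ^ 2) ^ 2) *
          ‖toH (B.comb (square n) (c t) - B.comb (square k) (c' t))‖ ^ 2 := by gcongr
      simp only [hK]
      linarith)
    (fun t _ => sq_nonneg _)
    (by
      have k1 : ‖toH (B.comb (square n) (c 0) - B.comb (square k) (c' 0))‖ ^ 2 ≤
          ε / (2 * Q) := by
        rw [h.comb_zero, h'.comb_zero]
        have hk2 := le_trans (le_max_right N₁ N₂) hk
        have := hN₂ n (hk2.trans hkn) k hk2
        rw [dist_eq_norm] at this
        rw [← Real.sq_sqrt (show 0 ≤ ε / (2 * Q) by positivity)]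
        have h5 := (norm_toH_le _).trans this.le
        gcongr
      have k2 : ∫ t in (0 : ℝ)..T, 2 * C * η * (1 + ‖toH (B.lapComb (square n) (c t))‖ ^ 2) ≤
          ε / (2 * Q) := by
        rw [intervalIntegral.integral_const_mul, intervalIntegral.integral_add (by simp)
          (hlap.intervalIntegrable_of_Icc hT), intervalIntegral.integral_const, smul_eq_mul,
          mul_one, sub_zero]
        calc 2 * C * η * (T + ∫ t in (0 : ℝ)..T, ‖toH (B.lapComb (square n) (c t))‖ ^ 2)
            ≤ 2 * C * η * (T + C₁) := by gcongr
          _ = η * (2 * C * (T + C₁)) := by ring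
          _ ≤ η * D := by gcongr; rw [hD]; linarith
          _ = ε / (2 * Q) := by rw [hη]; field_simp
      have k3 : ε / Q = ε / (2 * Q) + ε / (2 * Q) := by field_simp; norm_num
      rw [k3]
      exact add_le_add k1 k2)
  have hexp : 0 < Real.exp (K * T) := Real.exp_pos _
  have hKT : 0 ≤ K * T * Real.exp (K * T) := by positivity
  have hQε : ε / Q * Q = ε := div_mul_cancel₀ _ hQ0.ne'
  have hεQ : 0 ≤ ε / Q := by positivity
  refine ⟨fun t ht => (e.1 t ht).trans ?_, e.2.trans ?_⟩
  · calc ε / Q * Real.exp (K * T) ≤ ε / Q * Q := by gcongr; rw [hQ]; linarith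
      _ = ε := hQε
  · calc ε / Q * (1 + K * T * Real.exp (K * T)) ≤ ε / Q * Q := by gcongr; rw [hQ]; linarith
      _ = ε := hQε

end EigenBasis

end SGGLE

/-! ### The strong solution as limit of the Galerkin scheme. -/

namespace SGGLE

open Filter Topology
open scoped InnerProductSpace ContDiff

variable {L₁ L₂ : ℝ} (𝔭 : Params)

lemma norm_toLp_two_sq {α E : Type*} [MeasurableSpace α] {μ : Measure α} [NormedAddCommGroup E]
    {f : α → E} (hf : MemLp f 2 μ) : ‖hf.toLp f‖ ^ 2 = ∫ a, ‖f a‖ ^ 2 ∂μ := by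
  have h0 : 0 ≤ ∫ a, ‖f a‖ ^ 2 ∂μ := integral_nonneg fun _ => by positivity
  have h := hf.eLpNorm_eq_integral_rpow_norm (by norm_num) (by norm_num)
  simp only [ENNReal.toReal_ofNat, Real.rpow_two] at h
  rw [Lp.norm_toLp, h, ENNReal.toReal_ofReal (by positivity), ← Real.rpow_natCast,
    ← Real.rpow_mul h0]
  norm_num

/-- A strong solution of the transformed equation. -/
structure IsStrongSolution (T R : ℝ) (A₁ A₂ : ℝ → ℝ) (u₀ : V L₁ L₂) (v : ℝ → H L₁ L₂)
    (w : ℝ → V L₁ L₂) : Prop where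
  continuousOn : ContinuousOn v (Icc 0 T)
  stronglyMeasurable : StronglyMeasurable w
  norm_le : ∀ t, ‖w t‖ ≤ R
  eq_zero : ∀ t, t ∉ Icc 0 T → w t = 0
  version : ∀ᵐ t, t ∈ Icc 0 T → toH (w t) = v t
  equation : ∀ t ∈ Icc 0 T, ∀ ψ : V L₁ L₂, ⟪toH ψ, v t⟫_ℂ =
    ⟪toH ψ, toH u₀⟫_ℂ + ∫ s in (0 : ℝ)..t, G 𝔭 (A₁ s) (A₂ s) (w s) ψ

/-- The approximations converge uniformly in `H` and strongly in `L²(0,T;V)`, hence almost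
everywhere in `V` along a subsequence. There the drift is jointly continuous, and the uniform bound
in `V` dominates it, so the equation passes to the limit with its nonlinear terms. -/
theorem exists_strongSolution (hL₁ : 0 < L₁) (hL₂ : 0 < L₂) {T m M : ℝ} (hT : 0 ≤ T)
    {A₁ A₂ : ℝ → ℝ} (hA : Coeffs m M A₁ A₂) (u₀ : V L₁ L₂) :
    ∃ R v w, IsStrongSolution 𝔭 T R A₁ A₂ u₀ v w := by
  have : SecondCountableTopologyEither ℝ (V L₁ L₂) := secondCountableTopologyEither_of_left ℝ _
  obtain ⟨B⟩ := nonempty_eigenBasis hL₁ hL₂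
  choose c hc0 hc using fun n => B.exists_galerkin 𝔭 hT hA (square n)
    (fun s => ⟪toH (B.e s), toH u₀⟫_ℂ)
  have hgal : ∀ n, B.IsGalerkin 𝔭 T A₁ A₂ u₀ (square n) (c n) := fun n => ⟨hc0 n, hc n⟩
  obtain ⟨R, C₀, hR, -, hb⟩ := B.exists_galerkin_bound 𝔭 hL₁.le hL₂.le hT hA u₀
  set u : ℕ → ℝ → V L₁ L₂ := fun n t => B.comb (square n) (c n t) with hu
  have hcu : ∀ n, ContinuousOn (u n) (Icc 0 T) := fun n => (hgal n).continuousOn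
  have hbu : ∀ n, ∀ t ∈ Icc 0 T, ‖u n t‖ ≤ R := fun n => (hb n _ (hgal n)).1
  have hcau : ∀ ε : ℝ, 0 < ε → ∃ N : ℕ, ∀ k ≥ N, ∀ n ≥ N,
      (∀ t ∈ Icc 0 T, ‖toH (u n t - u k t)‖ ^ 2 ≤ ε) ∧
        ∫ t in (0 : ℝ)..T, gradSq (u n t - u k t) ≤ ε := by
    intro ε hε
    obtain ⟨N, hN⟩ := B.exists_galerkin_cauchy 𝔭 hL₁.le hL₂.le hT hA u₀ hε
    refine ⟨N, fun k hk n hn => ?_⟩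
    rcases le_total k n with h | h
    · exact hN k n _ _ hk h (hgal k) (hgal n)
    · have h1 := hN n k _ _ hn h (hgal n) (hgal k)
      have e : ∀ t, u n t - u k t = -(B.comb (square k) (c k t) - B.comb (square n) (c n t)) :=
        fun t => by simp [hu]
      have e1 : ∀ z : V L₁ L₂, ‖toH (-z)‖ = ‖toH z‖ := fun z => by simp [toH_eq]
      have e2 : ∀ z : V L₁ L₂, gradSq (-z) = gradSq z := fun z => by
        simp [gradSq, d₁_eq, d₂_eq]
      simp only [e, e1, e2]
      exact h1
  have hunif : UniformCauchySeqOn (fun n t => toH (u n t)) atTop (Icc 0 T) := by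
    rw [Metric.uniformCauchySeqOn_iff]
    intro ε hε
    obtain ⟨N, hN⟩ := hcau ((ε / 2) ^ 2) (by positivity)
    refine ⟨N, fun n hn k hk t ht => ?_⟩
    have h1 := abs_le_of_sq_le_sq' ((hN k hk n hn).1 t ht) (by positivity) |>.2
    rw [toH_sub] at h1
    rw [dist_eq_norm]; linarith
  have hlim : ∀ t, ∃ l, t ∈ Icc 0 T → Tendsto (fun n => toH (u n t)) atTop (𝓝 l) := by
    intro t
    by_cases ht : t ∈ Icc 0 T
    · obtain ⟨l, hl⟩ := cauchySeq_tendsto_of_complete (hunif.cauchySeq ht)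
      exact ⟨l, fun _ => hl⟩
    · exact ⟨0, fun h => absurd h ht⟩
  choose v hv using hlim
  have hvc : ContinuousOn v (Icc 0 T) :=
    (hunif.tendstoUniformlyOn_of_tendsto hv).continuousOn
      (Frequently.of_forall fun n => continuous_toH.comp_continuousOn (hcu n))
  set μ : Measure ℝ := volume.restrict (Icc 0 T) with hμ
  have hmem : ∀ n, MemLp (u n) 2 μ := fun n =>
    MemLp.of_bound ((hcu n).aestronglyMeasurable measurableSet_Icc) R
      ((ae_restrict_iff' measurableSet_Icc).2 (Eventually.of_forall (hbu n)))
  have hcL : CauchySeq fun n => (hmem n).toLp (u n) := by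
    rw [Metric.cauchySeq_iff]
    intro ε hε
    -- The uniform bound in `H` is integrated over a time `T` and the gradient part is added once,
    -- for a total of at most `ε²/2`.
    obtain ⟨N, hN⟩ := hcau (ε ^ 2 / (2 * (T + 1))) (by positivity)
    refine ⟨N, fun n hn k hk => ?_⟩
    obtain ⟨h1, h2⟩ := hN k hk n hn
    rw [dist_eq_norm, ← MemLp.toLp_sub]
    refine abs_lt_of_sq_lt_sq' ?_ hε.le |>.2
    rw [norm_toLp_two_sq, hμ, integral_Icc_eq_integral_Ioc, ← intervalIntegral.integral_of_le hT]
    simp only [Pi.sub_apply, norm_sq_V]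
    have c1 : ContinuousOn (fun t => ‖toH (u n t - u k t)‖ ^ 2) (Icc 0 T) :=
      (continuous_toH.comp_continuousOn ((hcu n).sub (hcu k))).norm.pow 2
    have c2 : ContinuousOn (fun t => gradSq (u n t - u k t)) (Icc 0 T) :=
      continuous_gradSq.comp_continuousOn ((hcu n).sub (hcu k))
    rw [intervalIntegral.integral_add (c1.intervalIntegrable_of_Icc hT)
      (c2.intervalIntegrable_of_Icc hT)]
    have h3 : ∫ t in (0 : ℝ)..T, ‖toH (u n t - u k t)‖ ^ 2 ≤
        ∫ _ in (0 : ℝ)..T, ε ^ 2 / (2 * (T + 1)) :=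
      intervalIntegral.integral_mono_on hT (c1.intervalIntegrable_of_Icc hT) (by simp) h1
    rw [intervalIntegral.integral_const, sub_zero, smul_eq_mul] at h3
    have h4 : T * (ε ^ 2 / (2 * (T + 1))) + ε ^ 2 / (2 * (T + 1)) = ε ^ 2 / 2 := by
      field_simp
    nlinarith [sq_pos_of_pos hε]
  obtain ⟨g, hg⟩ := cauchySeq_tendsto_of_complete hcL
  obtain ⟨ns, hns, hae⟩ := (tendstoInMeasure_of_tendsto_Lp hg).exists_seq_tendsto_ae
  have hae' : ∀ᵐ t ∂μ, Tendsto (fun i => u (ns i) t) atTop (𝓝 (g t)) := by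
    have h1 : ∀ᵐ t ∂μ, ∀ n, (hmem n).toLp (u n) t = u n t :=
      ae_all_iff.2 fun n => (hmem n).coeFn_toLp
    filter_upwards [hae, h1] with t h2 h3
    simpa only [h3] using h2
  -- The bound by `R` is known for the limit only almost everywhere; setting the limit to zero off
  -- `E` makes it hold at every time and also extends it by zero outside `[0,T]`.
  set E : Set ℝ := Icc 0 T ∩ {t | ‖g t‖ ≤ R} with hE
  have hgm : StronglyMeasurable g := Lp.stronglyMeasurable g
  have hEm : MeasurableSet E :=
    measurableSet_Icc.inter (hgm.norm.measurable measurableSet_Iic)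
  set w : ℝ → V L₁ L₂ := E.indicator g with hw
  have hwlim : ∀ᵐ t ∂μ, Tendsto (fun i => u (ns i) t) atTop (𝓝 (w t)) := by
    filter_upwards [hae', ae_restrict_mem measurableSet_Icc] with t h1 h2
    have h3 : ‖g t‖ ≤ R := le_of_tendsto h1.norm (Eventually.of_forall fun i => hbu _ t h2)
    rwa [hw, indicator_of_mem (show t ∈ E from ⟨h2, h3⟩)]
  have hwm : StronglyMeasurable w := hgm.indicator hEm
  have hwR : ∀ t, ‖w t‖ ≤ R := by
    intro t
    by_cases h : t ∈ E
    · rw [hw, indicator_of_mem h]; exact h.2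
    · rw [hw, indicator_of_notMem h, norm_zero]; exact hR
  refine ⟨R, v, w, hvc, hwm, hwR, fun t ht => indicator_of_notMem (fun h => ht h.1) _, ?_, ?_⟩
  · have h1 : ∀ᵐ t ∂μ, toH (w t) = v t := by
      filter_upwards [hwlim, ae_restrict_mem measurableSet_Icc] with t h1 h2
      exact tendsto_nhds_unique ((continuous_toH.tendsto _).comp h1)
        ((hv t h2).comp hns.tendsto_atTop)
    exact (ae_restrict_iff' measurableSet_Icc).1 h1
  · intro t ht ψ
    obtain ⟨P, hP⟩ := (B.tendsto_proj hL₁.le hL₂.le ψ).norm.bddAbove_range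
    replace hP : ∀ n, ‖B.proj (square n) ψ‖ ≤ P := fun n => hP (Set.mem_range_self n)
    obtain ⟨C, hC0, hC⟩ := exists_norm_G_le 𝔭 L₁ L₂ R M
    have l1 : Tendsto (fun i => ⟪toH ψ, toH (u (ns i) t)⟫_ℂ) atTop (𝓝 ⟪toH ψ, v t⟫_ℂ) :=
      tendsto_const_nhds.inner ((hv t ht).comp hns.tendsto_atTop)
    have l2 : Tendsto (fun i => ⟪toH ψ, toH (B.proj (square (ns i)) u₀)⟫_ℂ) atTop
        (𝓝 ⟪toH ψ, toH u₀⟫_ℂ) :=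
      tendsto_const_nhds.inner ((continuous_toH.tendsto _).comp
        ((B.tendsto_proj hL₁.le hL₂.le u₀).comp hns.tendsto_atTop))
    have hI : uIoc 0 t ⊆ Icc 0 T := by
      rw [uIoc_of_le ht.1]
      exact fun s hs => ⟨hs.1.le, hs.2.trans ht.2⟩
    have l3 : Tendsto (fun i => ∫ s in (0 : ℝ)..t,
        G 𝔭 (A₁ s) (A₂ s) (u (ns i) s) (B.proj (square (ns i)) ψ)) atTop
        (𝓝 (∫ s in (0 : ℝ)..t, G 𝔭 (A₁ s) (A₂ s) (w s) ψ)) := by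
      refine intervalIntegral.tendsto_integral_filter_of_dominated_convergence
        (fun _ => C * P) (Eventually.of_forall fun i => ?_) (Eventually.of_forall fun i => ?_)
        (by simp) ?_
      · exact ((continuousOn_G_comp 𝔭 hA.cont₁.continuousOn hA.cont₂.continuousOn (hcu (ns i))
          continuousOn_const).mono hI).aestronglyMeasurable measurableSet_uIoc
      · refine Eventually.of_forall fun s hs => ?_
        exact (hC _ _ (hA.upper₁ s) (hA.upper₂ s) _ _ (hbu _ s (hI hs))).trans
          (mul_le_mul_of_nonneg_left (hP _) hC0)
      · filter_upwards [(ae_restrict_iff' measurableSet_Icc).1 hwlim] with s hs h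
        have k1 : Tendsto (fun i => ((A₁ s, A₂ s), (u (ns i) s, B.proj (square (ns i)) ψ))) atTop
            (𝓝 ((A₁ s, A₂ s), (w s, ψ))) :=
          tendsto_const_nhds.prodMk_nhds ((hs (hI h)).prodMk_nhds
            ((B.tendsto_proj hL₁.le hL₂.le ψ).comp hns.tendsto_atTop))
        have k2 := ((continuous_G (L₁ := L₁) (L₂ := L₂) 𝔭).tendsto
          ((A₁ s, A₂ s), (w s, ψ))).comp k1
        exact k2
    refine tendsto_nhds_unique l1 (Tendsto.congr (fun i => ?_) (l2.add l3))
    exact ((hgal (ns i)).inner_eq hA ψ ht).symm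

end SGGLE

/-! ### Energy solutions: weak-strong uniqueness and energy bounds. -/

namespace SGGLE

open Filter Topology
open scoped InnerProductSpace ContDiff

variable {L₁ L₂ : ℝ} (𝔭 : Params)

namespace Dominated

variable {𝔭} {F F' : ℝ → V L₁ L₂ →ₗ⋆[ℂ] ℂ} {k k' : ℝ → ℝ}

lemma sub (h : Dominated 𝔭 F k) (h' : Dominated 𝔭 F' k') :
    Dominated 𝔭 (fun r => F r - F' r) (fun r => k r + k' r) where
  measurable ρ g hρ hg := (h.measurable ρ g hρ hg).sub (h'.measurable ρ g hρ hg)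
  integrable := h.integrable.add h'.integrable
  nonneg r := add_nonneg (h.nonneg r) (h'.nonneg r)
  bound η hη := by
    obtain ⟨C, hC0, hC⟩ := h.bound η hη
    obtain ⟨C', hC0', hC'⟩ := h'.bound η hη
    refine ⟨C + C', by positivity, fun r ψ => ?_⟩
    have := norm_sub_le (F r ψ) (F' r ψ)
    rw [LinearMap.sub_apply]
    linarith [hC r ψ, hC' r ψ]

end Dominated

lemma dominated_driftForm {m M : ℝ} {A₁ A₂ : ℝ → ℝ} (hA : Coeffs m M A₁ A₂) {w : ℝ → V L₁ L₂}
    (hw : StronglyMeasurable w) (hb : Integrable (fun s => bulk 𝔭 (w s)) volume) :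
    Dominated 𝔭 (fun r => driftForm 𝔭 (A₁ r) (A₂ r) (w r)) (fun r => bulk 𝔭 (w r)) where
  measurable ρ g hρ hg := by
    have h1 : StronglyMeasurable fun q => ((A₁ (ρ q), A₂ (ρ q)), (w (ρ q), g q)) :=
      ((hA.cont₁.measurable.comp hρ).stronglyMeasurable.prodMk
        (hA.cont₂.measurable.comp hρ).stronglyMeasurable).prodMk
        ((hw.comp_measurable hρ).prodMk hg)
    have h2 := (continuous_G (L₁ := L₁) (L₂ := L₂) 𝔭).comp_stronglyMeasurable h1
    exact h2.measurable
  integrable := hb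
  nonneg r := bulk_nonneg 𝔭 _
  bound η hη := by
    obtain ⟨C, hC0, hC⟩ := exists_norm_G_le_bulk 𝔭 L₁ L₂ M hη
    exact ⟨C, hC0, fun r ψ => hC _ _ (hA.upper₁ r) (hA.upper₂ r) _ _⟩

/-- A solution of the transformed equation in the energy class, extended by zero. -/
structure IsEnergySolution (T : ℝ) (A₁ A₂ : ℝ → ℝ) (u₀ : V L₁ L₂) (v : ℝ → H L₁ L₂)
    (w : ℝ → V L₁ L₂) : Prop where
  continuousOn : ContinuousOn v (Icc 0 T)
  stronglyMeasurable : StronglyMeasurable w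
  memLp_two : MemLp w 2 volume
  memLp_p : MemLp (fun s => embed 𝔭 (w s)) 𝔭.pE volume
  version : ∀ᵐ t, t ∈ Icc 0 T → toH (w t) = v t
  equation : ∀ t ∈ Icc 0 T, ∀ ψ : V L₁ L₂, ⟪toH ψ, v t⟫_ℂ =
    ⟪toH ψ, toH u₀⟫_ℂ + ∫ s in (0 : ℝ)..t, G 𝔭 (A₁ s) (A₂ s) (w s) ψ

lemma memLp_of_bound_of_eq_zero {E : Type*} [NormedAddCommGroup E] {T R : ℝ} {p : ℝ≥0∞}
    {f : ℝ → E} (hf : AEStronglyMeasurable f volume) (hR : ∀ t, ‖f t‖ ≤ R)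
    (h0 : ∀ t, t ∉ Icc 0 T → f t = 0) : MemLp f p volume := by
  have h : (Icc 0 T).indicator f = f := by
    ext t
    by_cases ht : t ∈ Icc 0 T
    · rw [indicator_of_mem ht]
    · rw [indicator_of_notMem ht, h0 t ht]
  rw [← h, memLp_indicator_iff_restrict measurableSet_Icc]
  exact MemLp.of_bound hf.restrict R (Eventually.of_forall hR)

variable {𝔭} {T R m M : ℝ} {A₁ A₂ : ℝ → ℝ} {u₀ : V L₁ L₂} {v v' : ℝ → H L₁ L₂} {w w' : ℝ → V L₁ L₂}

lemma IsStrongSolution.isEnergySolution (h : IsStrongSolution 𝔭 T R A₁ A₂ u₀ v w) :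
    IsEnergySolution 𝔭 T A₁ A₂ u₀ v w where
  continuousOn := h.continuousOn
  stronglyMeasurable := h.stronglyMeasurable
  memLp_two := memLp_of_bound_of_eq_zero h.stronglyMeasurable.aestronglyMeasurable h.norm_le
    h.eq_zero
  memLp_p := memLp_of_bound_of_eq_zero (R := ‖embed (L₁ := L₁) (L₂ := L₂) 𝔭‖ * R)
    ((embed 𝔭).continuous.comp_aestronglyMeasurable h.stronglyMeasurable.aestronglyMeasurable)
    (fun t => ((embed 𝔭).le_opNorm _).trans (by gcongr; exact h.norm_le t))
    (fun t ht => by rw [h.eq_zero t ht, map_zero])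
  version := h.version
  equation := h.equation

namespace IsEnergySolution

lemma integrable_bulk (h : IsEnergySolution 𝔭 T A₁ A₂ u₀ v w) :
    Integrable (fun s => bulk 𝔭 (w s)) volume :=
  SGGLE.integrable_bulk 𝔭 h.stronglyMeasurable h.memLp_two h.memLp_p

lemma integrable_gradSq (h : IsEnergySolution 𝔭 T A₁ A₂ u₀ v w) :
    Integrable (fun t => gradSq (w t)) volume := by
  refine h.integrable_bulk.mono'
    (continuous_gradSq.comp_stronglyMeasurable h.stronglyMeasurable).aestronglyMeasurable
    (Eventually.of_forall fun t => ?_)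
  rw [Real.norm_of_nonneg (gradSq_nonneg _)]
  exact (gradSq_le _).trans (norm_sq_le_bulk 𝔭 _)

lemma integrable_integral_rpow (h : IsEnergySolution 𝔭 T A₁ A₂ u₀ v w) :
    Integrable (fun t => ∫ x in rect L₁ L₂, ‖toH (w t) x‖ ^ 𝔭.p) volume := by
  have hp := 𝔭.six_lt_p
  have hc : Continuous fun z : V L₁ L₂ => ∫ x in rect L₁ L₂, ‖toH z x‖ ^ 𝔭.p := by
    simp only [← norm_embed_rpow]
    exact ((embed 𝔭).continuous.norm).rpow_const fun _ => Or.inr (by linarith)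
  refine h.integrable_bulk.mono'
    (hc.comp_stronglyMeasurable h.stronglyMeasurable).aestronglyMeasurable
    (Eventually.of_forall fun t => ?_)
  rw [Real.norm_of_nonneg (integral_nonneg fun _ => by positivity)]
  exact integral_rpow_le_bulk 𝔭 _

lemma dominated (h : IsEnergySolution 𝔭 T A₁ A₂ u₀ v w) (hA : Coeffs m M A₁ A₂) :
    Dominated 𝔭 (fun r => driftForm 𝔭 (A₁ r) (A₂ r) (w r)) (fun r => bulk 𝔭 (w r)) :=
  dominated_driftForm 𝔭 hA h.stronglyMeasurable h.integrable_bulk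

lemma increment (h : IsEnergySolution 𝔭 T A₁ A₂ u₀ v w) (hA : Coeffs m M A₁ A₂) {a b : ℝ}
    (ha : 0 ≤ a) (hab : a ≤ b) (hb : b ≤ T) (ψ : V L₁ L₂) :
    ⟪toH ψ, v b⟫_ℂ - ⟪toH ψ, v a⟫_ℂ = ∫ r in a..b, driftForm 𝔭 (A₁ r) (A₂ r) (w r) ψ := by
  have hi := (h.dominated hA).intervalIntegrable_test ψ
  rw [h.equation b ⟨ha.trans hab, hb⟩, h.equation a ⟨ha, hab.trans hb⟩, add_sub_add_left_eq_sub]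
  exact intervalIntegral.integral_interval_sub_left (hi 0 b) (hi 0 a)

lemma initial (hL₁ : 0 < L₁) (hL₂ : 0 < L₂) (hT : 0 ≤ T)
    (h : IsEnergySolution 𝔭 T A₁ A₂ u₀ v w) : v 0 = toH u₀ := by
  obtain ⟨B⟩ := nonempty_eigenBasis hL₁ hL₂
  refine sub_eq_zero.1 (B.complete _ fun s => ?_)
  rw [inner_sub_right, h.equation 0 ⟨le_rfl, hT⟩, intervalIntegral.integral_same]
  ring

/-- An energy solution coincides with a strong solution with the same initial value. -/
theorem eq_strong (hL₁ : 0 < L₁) (hL₂ : 0 < L₂) (hT : 0 ≤ T) (hA : Coeffs m M A₁ A₂)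
    (h : IsEnergySolution 𝔭 T A₁ A₂ u₀ v w) (h' : IsStrongSolution 𝔭 T R A₁ A₂ u₀ v' w') :
    EqOn v v' (Icc 0 T) := by
  have he' := h'.isEnergySolution
  obtain ⟨κ, K, hκ, hK, hmon⟩ := exists_local_monotone 𝔭 L₁ L₂ (M := M) hA.pos
  -- The difference of the two drifts is dominated by the sum of the energy densities, so the energy
  -- identity applies to the difference of the solutions.
  have hF := (h.dominated hA).sub (he'.dominated hA)
  have hwm : StronglyMeasurable fun s => w s - w' s :=
    h.stronglyMeasurable.sub h'.stronglyMeasurable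
  have hw2 : MemLp (fun s => w s - w' s) 2 volume := h.memLp_two.sub he'.memLp_two
  have hwp : MemLp (fun s => embed 𝔭 (w s - w' s)) 𝔭.pE volume := by
    simp only [map_sub]; exact h.memLp_p.sub he'.memLp_p
  have hv : ContinuousOn (fun t => v t - v' t) (Icc 0 T) := h.continuousOn.sub h'.continuousOn
  have hver : ∀ᵐ s, s ∈ Icc 0 T → toH (w s - w' s) = v s - v' s := by
    filter_upwards [h.version, h'.version] with s h1 h2 hs
    rw [toH_sub, h1 hs, h2 hs]
  have hid := fun {a b} => hF.energy_identity (T := T) hwm hw2 hwp hv hver (fun a b ha hab hb ψ => by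
    have i1 := (h.dominated hA).intervalIntegrable_test ψ a b
    have i2 := (he'.dominated hA).intervalIntegrable_test ψ a b
    have e := intervalIntegral.integral_sub i1 i2
    rw [inner_sub_right, inner_sub_right]
    refine Eq.trans ?_ e.symm
    rw [← h.increment hA ha hab hb ψ, ← he'.increment hA ha hab hb ψ]
    ring) (a := a) (b := b)
  -- The strong solution stands in the second slot of the local monotonicity, where its bound `R` in
  -- `V` controls the only gradient that occurs. The factor `2` belongs to the energy identity.
  set Kt : ℝ := 2 * (K * (1 + (R ^ 2) ^ 2)) with hKt
  have hKt0 : 0 ≤ Kt := by positivity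
  have hFi := hF.integrable_comp hwm (SGGLE.integrable_bulk 𝔭 hwm hw2 hwp)
  have hvsq : ContinuousOn (fun t => ‖v t - v' t‖ ^ 2) (Icc 0 T) := hv.norm.pow 2
  have key : ∀ t ∈ Icc 0 T, ‖v t - v' t‖ ^ 2 ≤ 0 + Kt * ∫ s in (0 : ℝ)..t, ‖v s - v' s‖ ^ 2 := by
    intro t ht
    have e := hid le_rfl ht.1 ht.2
    rw [h.initial hL₁ hL₂ hT, he'.initial hL₁ hL₂ hT, sub_self, norm_zero] at e
    have e2 : (∫ r in (0 : ℝ)..t, (driftForm 𝔭 (A₁ r) (A₂ r) (w r)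
        - driftForm 𝔭 (A₁ r) (A₂ r) (w' r)) (w r - w' r)).re =
        ∫ r in (0 : ℝ)..t, ((driftForm 𝔭 (A₁ r) (A₂ r) (w r)
        - driftForm 𝔭 (A₁ r) (A₂ r) (w' r)) (w r - w' r)).re :=
      (intervalIntegral.intervalIntegral_re hFi.intervalIntegrable).symm
    have e3 : ∫ r in (0 : ℝ)..t, ((driftForm 𝔭 (A₁ r) (A₂ r) (w r)
        - driftForm 𝔭 (A₁ r) (A₂ r) (w' r)) (w r - w' r)).re ≤
        ∫ s in (0 : ℝ)..t, K * (1 + (R ^ 2) ^ 2) * ‖v s - v' s‖ ^ 2 := by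
      refine intervalIntegral.integral_mono_ae_restrict ht.1 hFi.re.intervalIntegrable
        (((hvsq.mono (Icc_subset_Icc_right ht.2)).intervalIntegrable_of_Icc ht.1).const_mul _) ?_
      have hver' : ∀ᵐ s ∂volume.restrict (Icc 0 t), toH (w s - w' s) = v s - v' s :=
        (ae_restrict_iff' measurableSet_Icc).2 (hver.mono fun s hs h => hs ⟨h.1, h.2.trans ht.2⟩)
      filter_upwards [hver'] with s hs
      have k1 := hmon _ _ (hA.lower s) (hA.upper₂ s) (w s) (w' s)
      have k2 := gradSq_nonneg (w s - w' s)
      have k3 := mul_nonneg hκ.le (wtSq_nonneg (2 * 𝔭.σ) (w s) (w' s))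
      have k5 : gradSq (w' s) ^ 2 ≤ (R ^ 2) ^ 2 := by
        have := (gradSq_le _).trans (pow_le_pow_left₀ (norm_nonneg _) (h'.norm_le s) 2)
        exact pow_le_pow_left₀ (gradSq_nonneg _) this 2
      have k6 : K * (1 + gradSq (w' s) ^ 2) * ‖toH (w s - w' s)‖ ^ 2 ≤
          K * (1 + (R ^ 2) ^ 2) * ‖toH (w s - w' s)‖ ^ 2 := by gcongr
      rw [← hs]
      change (G 𝔭 (A₁ s) (A₂ s) (w s) (w s - w' s)
        - G 𝔭 (A₁ s) (A₂ s) (w' s) (w s - w' s)).re ≤ _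
      linarith
    rw [intervalIntegral.integral_const_mul] at e3
    rw [e2] at e
    rw [hKt]
    linarith
  intro t ht
  have := le_mul_exp_of_le_add_integral hKt0 hvsq key ht
  rw [zero_mul] at this
  have h0 : ‖v t - v' t‖ = 0 := by
    have h1 := sq_nonneg ‖v t - v' t‖
    exact pow_eq_zero_iff (two_ne_zero) |>.1 (le_antisymm this h1)
  exact sub_eq_zero.1 (norm_eq_zero.1 h0)

end IsEnergySolution

variable (𝔭) in
/-- The energy bound, with a constant that depends on the coefficients through `m` and `M`. -/
theorem exists_energy_bound (hL₁ : 0 < L₁) (hL₂ : 0 < L₂) (hT : 0 ≤ T) (hm : 0 < m) (M : ℝ)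
    (u₀ : V L₁ L₂) : ∃ C : ℝ, 0 ≤ C ∧ ∀ A₁ A₂ : ℝ → ℝ, Coeffs m M A₁ A₂ → ∀ v w,
      IsEnergySolution 𝔭 T A₁ A₂ u₀ v w →
      (∀ t ∈ Icc 0 T, ‖v t‖ ^ 2 ≤ C) ∧ (∫ t in (0 : ℝ)..T, gradSq (w t)) ≤ C ∧
      ∫ t in (0 : ℝ)..T, ∫ x in rect L₁ L₂, ‖toH (w t) x‖ ^ 𝔭.p ≤ C := by
  obtain ⟨κ, K, hκ, hK, hco⟩ := exists_coercive 𝔭 L₁ L₂ (M := M) hm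
  set ρ : ℝ := ‖toH u₀‖ ^ 2
  set Q : ℝ := ρ * (1 + 2 * K * T * Real.exp (2 * K * T)) with hQ
  have hρ : 0 ≤ ρ := sq_nonneg _
  have hQ0 : 0 ≤ Q := by positivity
  -- One summand for each of the three quantities: Grönwall's bound for the norm, the bound `Q` for
  -- the dissipated gradient, and `Q` divided by the coefficient `2κ` of the `L^p` term in the
  -- energy inequality.
  refine ⟨ρ * Real.exp (2 * K * T) + Q + Q / (2 * κ), by positivity, fun A₁ A₂ hA v w h => ?_⟩
  have hF := h.dominated hA
  have hFi := hF.integrable_comp h.stronglyMeasurable h.integrable_bulk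
  have hvsq : ContinuousOn (fun t => ‖v t‖ ^ 2) (Icc 0 T) := h.continuousOn.norm.pow 2
  have hgi := h.integrable_gradSq
  have hpi := h.integrable_integral_rpow
  have hp0 : ∀ t, 0 ≤ ∫ x in rect L₁ L₂, ‖toH (w t) x‖ ^ 𝔭.p := fun t =>
    integral_nonneg fun _ => by positivity
  have key : ∀ t ∈ Icc 0 T, ‖v t‖ ^ 2 + (∫ s in (0 : ℝ)..t, gradSq (w s)) +
      2 * κ * (∫ s in (0 : ℝ)..t, ∫ x in rect L₁ L₂, ‖toH (w s) x‖ ^ 𝔭.p) ≤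
      ρ + 2 * K * ∫ s in (0 : ℝ)..t, ‖v s‖ ^ 2 := by
    intro t ht
    have e := hF.energy_identity h.stronglyMeasurable h.memLp_two h.memLp_p h.continuousOn
      h.version (fun a b ha hab hb ψ => h.increment hA ha hab hb ψ) le_rfl ht.1 ht.2
    rw [h.initial hL₁ hL₂ hT] at e
    have e2 : (∫ r in (0 : ℝ)..t, driftForm 𝔭 (A₁ r) (A₂ r) (w r) (w r)).re =
        ∫ r in (0 : ℝ)..t, (driftForm 𝔭 (A₁ r) (A₂ r) (w r) (w r)).re :=
      (intervalIntegral.intervalIntegral_re hFi.intervalIntegrable).symm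
    have iv := (hvsq.mono (Icc_subset_Icc_right ht.2)).intervalIntegrable_of_Icc (μ := volume) ht.1
    have ig : IntervalIntegrable (fun t => gradSq (w t)) volume 0 t := hgi.intervalIntegrable
    have ip : IntervalIntegrable (fun t => ∫ x in rect L₁ L₂, ‖toH (w t) x‖ ^ 𝔭.p) volume 0 t :=
      hpi.intervalIntegrable
    have e3 : ∫ r in (0 : ℝ)..t, (driftForm 𝔭 (A₁ r) (A₂ r) (w r) (w r)).re ≤
        ∫ s in (0 : ℝ)..t, (-(1 / 2) * gradSq (w s)
          - κ * (∫ x in rect L₁ L₂, ‖toH (w s) x‖ ^ 𝔭.p) + K * ‖v s‖ ^ 2) := by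
      refine intervalIntegral.integral_mono_ae_restrict ht.1 hFi.re.intervalIntegrable
        (((ig.const_mul _).sub (ip.const_mul _)).add (iv.const_mul _)) ?_
      have hver' : ∀ᵐ s ∂volume.restrict (Icc 0 t), toH (w s) = v s :=
        (ae_restrict_iff' measurableSet_Icc).2
          (h.version.mono fun s hs h => hs ⟨h.1, h.2.trans ht.2⟩)
      filter_upwards [hver'] with s hs
      rw [← hs]
      exact hco _ _ (hA.lower s) (hA.upper₂ s) (w s)
    rw [intervalIntegral.integral_add ((ig.const_mul _).sub (ip.const_mul _)) (iv.const_mul _),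
      intervalIntegral.integral_sub (ig.const_mul _) (ip.const_mul _),
      intervalIntegral.integral_const_mul, intervalIntegral.integral_const_mul,
      intervalIntegral.integral_const_mul] at e3
    rw [e2] at e
    linarith
  have nng : ∀ t ∈ Icc 0 T, 0 ≤ ∫ s in (0 : ℝ)..t, gradSq (w s) := fun t ht =>
    intervalIntegral.integral_nonneg ht.1 fun s _ => gradSq_nonneg _
  have nnp : ∀ t ∈ Icc 0 T, 0 ≤ ∫ s in (0 : ℝ)..t, ∫ x in rect L₁ L₂, ‖toH (w s) x‖ ^ 𝔭.p :=
    fun t ht => intervalIntegral.integral_nonneg ht.1 fun s _ => hp0 s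
  have hsup : ∀ t ∈ Icc 0 T, ‖v t‖ ^ 2 ≤ ρ * Real.exp (2 * K * T) := fun t ht => by
    have := le_mul_exp_of_le_add_integral (T := T) (c := ρ) (by positivity : 0 ≤ 2 * K) hvsq
      (fun t ht => by
        have := mul_nonneg (by positivity : 0 ≤ 2 * κ) (nnp t ht)
        linarith [key t ht, nng t ht]) ht
    refine this.trans ?_
    gcongr
    exact ht.2
  have hT' : T ∈ Icc 0 T := ⟨hT, le_rfl⟩
  have hfin : (∫ s in (0 : ℝ)..T, gradSq (w s)) +
      2 * κ * (∫ s in (0 : ℝ)..T, ∫ x in rect L₁ L₂, ‖toH (w s) x‖ ^ 𝔭.p) ≤ Q := by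
    have h1 : ∫ s in (0 : ℝ)..T, ‖v s‖ ^ 2 ≤ ∫ _ in (0 : ℝ)..T, ρ * Real.exp (2 * K * T) :=
      intervalIntegral.integral_mono_on hT (hvsq.intervalIntegrable_of_Icc hT) (by simp) hsup
    rw [intervalIntegral.integral_const, smul_eq_mul, sub_zero] at h1
    have h2 := mul_le_mul_of_nonneg_left h1 (by positivity : 0 ≤ 2 * K)
    have h3 := key T hT'
    have h4 : Q = ρ + 2 * K * (T * (ρ * Real.exp (2 * K * T))) := by rw [hQ]; ring
    linarith [sq_nonneg ‖v T‖]
  have hQκ : 0 ≤ Q / (2 * κ) := by positivity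
  have hρe : 0 ≤ ρ * Real.exp (2 * K * T) := by positivity
  refine ⟨fun t ht => (hsup t ht).trans (by linarith), ?_, ?_⟩
  · have := mul_nonneg (by positivity : 0 ≤ 2 * κ) (nnp T hT')
    linarith
  · have : ∫ t in (0 : ℝ)..T, ∫ x in rect L₁ L₂, ‖toH (w t) x‖ ^ 𝔭.p ≤ Q / (2 * κ) := by
      rw [le_div_iff₀ (by positivity)]
      linarith [nng T hT']
    linarith

end SGGLE

namespace SGGLE

open Filter Topology
open scoped InnerProductSpace

/-! ### Controls -/

/-- Young's inequality for the cost function. -/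
lemma mul_le_ell_add_exp (r : ℝ≥0) (y : ℝ) : y * r ≤ ell r + (Real.exp y - 1) := by
  rw [ell]
  rcases eq_or_ne r 0 with rfl | hr
  · simp [(Real.exp_pos y).le]
  · have hr' : (0 : ℝ) < r := by positivity
    have h := Real.add_one_le_exp (y - Real.log r)
    rw [Real.exp_sub, Real.exp_log hr', le_div_iff₀ hr'] at h
    linarith

/-- The part of the cost estimate that does not depend on the control. -/
def jumpWeight (x : ℝ) : ℝ := if x ≤ 1 then x ^ 2 else 2 * Real.exp x

lemma jumpWeight_nonneg (x : ℝ) : 0 ≤ jumpWeight x := by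
  unfold jumpWeight; split_ifs <;> positivity

lemma measurable_jumpWeight : Measurable jumpWeight :=
  Measurable.ite measurableSet_Iic (measurable_id.pow_const 2) (Real.measurable_exp.const_mul 2)

lemma ell_nonneg (r : ℝ≥0) : 0 ≤ ell r := by
  have := mul_le_ell_add_exp r 0
  simpa using this

/-- Young's inequality is used with `y = x` and `y = -x`. For `x ≤ 1` the linear terms cancel and
the remainder of the exponential is at most `x²`, so square integrability of `g` suffices there. For
`x > 1` the crude bound `|r - 1| ≤ r + 1` is enough. -/
lemma mul_abs_le {x : ℝ} (hx : 0 ≤ x) (r : ℝ≥0) : x * |(r : ℝ) - 1| ≤ ell r + jumpWeight x := by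
  have h1 := mul_le_ell_add_exp r x
  have h2 := mul_le_ell_add_exp r (-x)
  have h0 := ell_nonneg r
  unfold jumpWeight
  split_ifs with h
  · have e1 := abs_le.1 (Real.abs_exp_sub_one_sub_id_le (x := x) (by rwa [abs_of_nonneg hx]))
    have e2 := abs_le.1 (Real.abs_exp_sub_one_sub_id_le (x := -x)
      (by rwa [abs_neg, abs_of_nonneg hx]))
    rcases abs_cases ((r : ℝ) - 1) with ⟨h3, -⟩ | ⟨h3, -⟩ <;> rw [h3] <;> nlinarith
  · have e1 := Real.add_one_le_exp x
    have e2 : |(r : ℝ) - 1| ≤ r + 1 := by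
      rw [abs_le]; constructor <;> linarith [r.coe_nonneg]
    nlinarith [mul_le_mul_of_nonneg_left e2 hx]

variable {Z : Type*} [MeasurableSpace Z] {ν : Measure Z} {g : Z → ℂ}

/-- Where `|g| ≤ 1` the weight is `|g|²`. The set where `|g| ≥ 1` has finite measure by Chebyshev's
inequality, and there `|g| ≤ δ |g|² + 1/δ` reduces the exponential to the assumed condition. -/
lemma lintegral_jumpWeight_lt_top (hg : Measurable g) (hg2 : MemLp g 2 ν)
    (hexp : ExpIntegrable ν g) : ∫⁻ z, ENNReal.ofReal (jumpWeight ‖g z‖) ∂ν < ∞ := by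
  obtain ⟨δ, hδ, h⟩ := hexp
  have hsq : ∫⁻ z, ENNReal.ofReal (‖g z‖ ^ 2) ∂ν < ∞ := by
    have := hg2.norm.integrable_sq.2
    rwa [hasFiniteIntegral_iff_ofReal (Eventually.of_forall fun z => sq_nonneg _)] at this
  set E : Set Z := {z | 1 ≤ ‖g z‖} with hE
  have hEm : MeasurableSet E := measurableSet_le measurable_const hg.norm
  have hEν : ν E < ∞ := by
    refine lt_of_le_of_lt ?_ hsq
    rw [← lintegral_indicator_one hEm]
    refine lintegral_mono fun z => ?_
    by_cases hz : z ∈ E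
    · rw [indicator_of_mem hz, Pi.one_apply, ← ENNReal.ofReal_one]
      exact ENNReal.ofReal_le_ofReal (one_le_pow₀ hz)
    · rw [indicator_of_notMem hz]; exact zero_le
  have hle : ∀ z, ENNReal.ofReal (jumpWeight ‖g z‖) ≤ ENNReal.ofReal (‖g z‖ ^ 2) +
      E.indicator (fun z => ENNReal.ofReal (2 * Real.exp δ⁻¹) *
        ENNReal.ofReal (Real.exp (δ * ‖g z‖ ^ 2))) z := by
    intro z
    unfold jumpWeight
    split_ifs with hz
    · exact le_self_add
    · rw [indicator_of_mem (show z ∈ E from (not_le.1 hz).le)]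
      refine le_add_left ?_
      rw [← ENNReal.ofReal_mul (by positivity), mul_assoc, ← Real.exp_add]
      refine ENNReal.ofReal_le_ofReal ?_
      gcongr
      have h1 := mul_le_mul_sq_add hδ ‖g z‖ 1
      linarith
  refine lt_of_le_of_lt (lintegral_mono hle) ?_
  rw [lintegral_add_left (by fun_prop), lintegral_indicator hEm, lintegral_const_mul _ (by fun_prop)]
  exact ENNReal.add_lt_top.2 ⟨hsq, ENNReal.mul_lt_top ENNReal.ofReal_lt_top (h E hEm hEν)⟩

/-- The jump coefficient times the deviation of the control from one. -/
def jumpKernel (g : Z → ℂ) (φ : ℝ → Z → ℝ≥0) (p : ℝ × Z) : ℂ :=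
  g p.2 * (((φ p.1 p.2 : ℝ) - 1 : ℝ) : ℂ)

lemma measurable_jumpKernel (hg : Measurable g) {φ : ℝ → Z → ℝ≥0}
    (hφ : Measurable (Function.uncurry φ)) : Measurable (jumpKernel g φ) := by
  have h1 : Measurable fun p : ℝ × Z => φ p.1 p.2 := hφ
  unfold jumpKernel
  fun_prop

/-- Integrating `mul_abs_le`, the control contributes only its cost, at most `N`, and the rest is
the integral of `jumpWeight` times the length of the time interval. The bound is therefore uniform
over `S ν T N`. -/
theorem exists_jumpKernel_bound [SigmaFinite ν] (hg : Measurable g) (hg2 : MemLp g 2 ν)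
    (hexp : ExpIntegrable ν g) (T : ℝ) (N : ℕ) : ∃ M : ℝ, 0 ≤ M ∧ ∀ φ ∈ S ν T N,
      Integrable (jumpKernel g φ) ((volume.restrict (Icc 0 T)).prod ν) ∧
      ∫ p, ‖jumpKernel g φ p‖ ∂((volume.restrict (Icc 0 T)).prod ν) ≤ M := by
  have hκ := lintegral_jumpWeight_lt_top hg hg2 hexp
  set κ := ∫⁻ z, ENNReal.ofReal (jumpWeight ‖g z‖) ∂ν with hκd
  set M : ℝ≥0∞ := N + κ * ENNReal.ofReal T with hM
  have hMt : M < ∞ := ENNReal.add_lt_top.2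
    ⟨ENNReal.natCast_lt_top N, ENNReal.mul_lt_top hκ ENNReal.ofReal_lt_top⟩
  refine ⟨M.toReal, ENNReal.toReal_nonneg, fun φ hφ => ?_⟩
  have hm := measurable_jumpKernel hg hφ.1
  have hφ1 : Measurable fun p : ℝ × Z => φ p.1 p.2 := hφ.1
  have hJ : Measurable fun p : ℝ × Z => ENNReal.ofReal (jumpWeight ‖g p.2‖) :=
    (measurable_jumpWeight.comp (hg.comp measurable_snd).norm).ennreal_ofReal
  have hle : ∫⁻ p, ‖jumpKernel g φ p‖ₑ ∂((volume.restrict (Icc 0 T)).prod ν) ≤ M := by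
    calc ∫⁻ p, ‖jumpKernel g φ p‖ₑ ∂((volume.restrict (Icc 0 T)).prod ν)
        ≤ ∫⁻ p, (ENNReal.ofReal (ell (φ p.1 p.2)) + ENNReal.ofReal (jumpWeight ‖g p.2‖))
            ∂((volume.restrict (Icc 0 T)).prod ν) := by
          refine lintegral_mono fun p => ?_
          rw [← ENNReal.ofReal_add (ell_nonneg _) (jumpWeight_nonneg _), ← ofReal_norm]
          refine ENNReal.ofReal_le_ofReal ?_
          rw [jumpKernel, norm_mul, Complex.norm_real, Real.norm_eq_abs]
          exact mul_abs_le (norm_nonneg _) _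
      _ = cost ν T φ + ∫⁻ p : ℝ × Z, ENNReal.ofReal (jumpWeight ‖g p.2‖)
            ∂((volume.restrict (Icc 0 T)).prod ν) := by
          rw [lintegral_add_right _ hJ]
          rfl
      _ ≤ M := by
          refine add_le_add hφ.2 ?_
          rw [lintegral_prod _ hJ.aemeasurable]
          simp only [lintegral_const, Measure.restrict_apply_univ, Real.volume_Icc, sub_zero]
          exact le_rfl
  have hi : Integrable (jumpKernel g φ) ((volume.restrict (Icc 0 T)).prod ν) :=
    ⟨hm.aestronglyMeasurable, lt_of_le_of_lt hle hMt⟩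
  refine ⟨hi, ?_⟩
  rw [integral_norm_eq_lintegral_enorm hm.aestronglyMeasurable]
  exact ENNReal.toReal_mono hMt.ne hle

/-- The rate of the linear term which comes from the jumps. -/
def jumpRate (ν : Measure Z) (g : Z → ℂ) (T : ℝ) (φ : ℝ → Z → ℝ≥0) : ℝ → ℂ :=
  (Icc 0 T).indicator fun s => ∫ z, jumpKernel g φ (s, z) ∂ν

/-- The primitive of the jump rate. -/
def jumpPhase (ν : Measure Z) (g : Z → ℂ) (T : ℝ) (φ : ℝ → Z → ℝ≥0) (t : ℝ) : ℂ :=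
  ∫ s in (0 : ℝ)..t, jumpRate ν g T φ s

section

variable [SigmaFinite ν] {T : ℝ} {φ : ℝ → Z → ℝ≥0}

lemma integrable_jumpRate
    (hi : Integrable (jumpKernel g φ) ((volume.restrict (Icc 0 T)).prod ν)) :
    Integrable (jumpRate ν g T φ) volume :=
  (integrable_indicator_iff measurableSet_Icc).2 hi.integral_prod_left

lemma continuous_jumpPhase
    (hi : Integrable (jumpKernel g φ) ((volume.restrict (Icc 0 T)).prod ν)) :
    Continuous (jumpPhase ν g T φ) :=
  intervalIntegral.continuous_primitive
    (fun _ _ => (integrable_jumpRate hi).intervalIntegrable) 0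

lemma norm_jumpPhase_le
    (hi : Integrable (jumpKernel g φ) ((volume.restrict (Icc 0 T)).prod ν)) (t : ℝ) :
    ‖jumpPhase ν g T φ t‖ ≤ ∫ p, ‖jumpKernel g φ p‖ ∂((volume.restrict (Icc 0 T)).prod ν) := by
  have h := integrable_jumpRate hi
  calc ‖jumpPhase ν g T φ t‖ ≤ ∫ s in uIoc 0 t, ‖jumpRate ν g T φ s‖ :=
        intervalIntegral.norm_integral_le_integral_norm_uIoc
    _ ≤ ∫ s, ‖jumpRate ν g T φ s‖ :=
        setIntegral_le_integral h.norm (Eventually.of_forall fun _ => norm_nonneg _)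
    _ = ∫ s in Icc 0 T, ‖∫ z, jumpKernel g φ (s, z) ∂ν‖ := by
        rw [← integral_indicator measurableSet_Icc]
        congr 1
        ext s
        rw [jumpRate, norm_indicator_eq_indicator_norm]
    _ ≤ ∫ s in Icc 0 T, ∫ z, ‖jumpKernel g φ (s, z)‖ ∂ν :=
        integral_mono hi.integral_prod_left.norm hi.norm.integral_prod_left fun s =>
          norm_integral_le_integral_norm _
    _ = _ := (integral_prod _ hi.norm).symm

end

end SGGLE

namespace SGGLE

open Filter Topology
open scoped InnerProductSpace

variable {L₁ L₂ : ℝ}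

/-! ### Removal of the jump term by an integrating factor -/

lemma ae_toH_smul (c : ℂ) (w : V L₁ L₂) :
    ∀ᵐ x ∂rectMeasure L₁ L₂, toH (c • w) x = c * toH w x := Lp.coeFn_smul c (toH w)
lemma ae_d₁_smul (c : ℂ) (w : V L₁ L₂) :
    ∀ᵐ x ∂rectMeasure L₁ L₂, d₁ (c • w) x = c * d₁ w x := Lp.coeFn_smul c (d₁ w)
lemma ae_d₂_smul (c : ℂ) (w : V L₁ L₂) :
    ∀ᵐ x ∂rectMeasure L₁ L₂, d₂ (c • w) x = c * d₂ w x := Lp.coeFn_smul c (d₂ w)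

lemma pairA_smul_left (α : ℝ) (c : ℂ) (w ψ : V L₁ L₂) :
    pairA α (c • w) ψ = c * pairA α w ψ := by
  simp only [pairA_eq, d₁_smul, d₂_smul, inner_smul_right]; ring

lemma pairP_smul_left (σ : ℝ) (c : ℂ) (w ψ : V L₁ L₂) :
    pairP σ (c • w) ψ = ((‖c‖ ^ (2 * σ) : ℝ) : ℂ) * c * pairP σ w ψ := by
  rw [pairP, pairP, ← integral_const_mul]
  refine integral_congr_ae ?_
  filter_upwards [ae_toH_smul c w] with x hx
  rw [hx, powMul, powMul, norm_mul, Real.mul_rpow (norm_nonneg _) (norm_nonneg _)]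
  push_cast; ring

lemma pairF₁_smul_left (l : ℂ × ℂ) (c : ℂ) (w ψ : V L₁ L₂) :
    pairF₁ l (c • w) ψ = (‖c‖ : ℂ) ^ 2 * c * pairF₁ l w ψ := by
  rw [pairF₁, pairF₁, ← integral_const_mul]
  refine integral_congr_ae ?_
  filter_upwards [ae_toH_smul c w] with x hx
  rw [hx, norm_mul]
  push_cast; ring

lemma pairF₂_smul_left (l : ℂ × ℂ) (c : ℂ) (w ψ : V L₁ L₂) :
    pairF₂ l (c • w) ψ = (‖c‖ : ℂ) ^ 2 * c * pairF₂ l w ψ := by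
  rw [pairF₂, pairF₂, ← integral_const_mul]
  refine integral_congr_ae ?_
  filter_upwards [ae_toH_smul c w, ae_d₁_smul c w, ae_d₂_smul c w] with x hx h1 h2
  rw [hx, h1, h2, norm_mul]
  push_cast; ring

variable (𝔭 : Params)

/-- The drift of the skeleton equation. -/
def drift (w ψ : V L₁ L₂) : ℂ := pairA 𝔭.α w ψ + pairB 𝔭.σ 𝔭.β 𝔭.γ 𝔭.l₁ 𝔭.l₂ w ψ

/-- Phases pass through every term, and moduli by homogeneity: a factor `c` in front of `w` produces
an extra `|c|^{2σ}` in the power term and `|c|²` in the convective term. The two real coefficients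
of `G` are chosen to cancel these. -/
lemma G_exp_smul (z : ℂ) (w ψ : V L₁ L₂) :
    G 𝔭 (Real.exp (2 * 𝔭.σ * z.re)) (Real.exp (2 * z.re)) (Complex.exp (-z) • w) ψ =
      Complex.exp (-z) * drift 𝔭 w ψ := by
  have h1 : ((Real.exp (2 * 𝔭.σ * z.re) : ℝ) : ℂ) *
      ((‖Complex.exp (-z)‖ ^ (2 * 𝔭.σ) : ℝ) : ℂ) = 1 := by
    rw [← Complex.ofReal_mul, Complex.norm_exp, ← Real.exp_mul, ← Real.exp_add, Complex.neg_re,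
      show 2 * 𝔭.σ * z.re + -z.re * (2 * 𝔭.σ) = 0 by ring, Real.exp_zero, Complex.ofReal_one]
  have h2 : ((Real.exp (2 * z.re) : ℝ) : ℂ) * (‖Complex.exp (-z)‖ : ℂ) ^ 2 = 1 := by
    rw [← Complex.ofReal_pow, ← Complex.ofReal_mul, Complex.norm_exp, ← Real.exp_nat_mul,
      ← Real.exp_add, Complex.neg_re, show 2 * z.re + ((2 : ℕ) : ℝ) * -z.re = 0 by push_cast; ring,
      Real.exp_zero, Complex.ofReal_one]
  rw [G, drift, pairB_eq, pairA_smul_left, pairP_smul_left, pairF₁_smul_left, pairF₂_smul_left,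
    toH_smul, inner_smul_right]
  linear_combination (-(1 - Complex.I * 𝔭.β) * Complex.exp (-z) * pairP 𝔭.σ w ψ) * h1 +
    (Complex.exp (-z) * (pairF₂ 𝔭.l₂ w ψ - pairF₁ 𝔭.l₁ w ψ)) * h2

lemma drift_exp_smul (z : ℂ) (w ψ : V L₁ L₂) :
    drift 𝔭 (Complex.exp z • w) ψ = Complex.exp z *
      G 𝔭 (Real.exp (2 * 𝔭.σ * z.re)) (Real.exp (2 * z.re)) w ψ := by
  have h := G_exp_smul 𝔭 z (Complex.exp z • w) ψ
  have e : Complex.exp (-z) * Complex.exp z = 1 := by rw [← Complex.exp_add]; simp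
  rw [smul_smul, e, one_smul] at h
  rw [h, ← mul_assoc, mul_comm (Complex.exp z), e, one_mul]

/-- Since `2 ≤ 2σ`, the bound `exp(2σM)` for the first coefficient serves the second one too. -/
lemma coeffs_exp {Θ : ℝ → ℂ} (hΘ : Continuous Θ) {M : ℝ} (hM : ∀ t, ‖Θ t‖ ≤ M) :
    Coeffs (Real.exp (-(2 * 𝔭.σ * M))) (Real.exp (2 * 𝔭.σ * M))
      (fun t => Real.exp (2 * 𝔭.σ * (Θ t).re)) (fun t => Real.exp (2 * (Θ t).re)) := by
  have hσ := 𝔭.hσ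
  have h1 : ∀ t, -M ≤ (Θ t).re ∧ (Θ t).re ≤ M := fun t =>
    abs_le.1 ((Complex.abs_re_le_norm _).trans (hM t))
  have hM0 : 0 ≤ M := (norm_nonneg _).trans (hM 0)
  refine ⟨Real.exp_pos _, by fun_prop, by fun_prop, fun t => ?_, fun t => ?_, fun t => ?_⟩
  · refine Real.exp_le_exp.2 ?_
    nlinarith [(h1 t).1]
  · rw [abs_of_pos (Real.exp_pos _)]
    exact Real.exp_le_exp.2 (by nlinarith [(h1 t).2])
  · rw [abs_of_pos (Real.exp_pos _)]
    exact Real.exp_le_exp.2 (by nlinarith [(h1 t).2])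

variable {T : ℝ}

lemma memLp_indicator_Icc {E : Type*} [NormedAddCommGroup E] {f : ℝ → E} {p : ℝ≥0∞}
    (h : MemLp f p (volume.restrict (Icc 0 T))) : MemLp ((Icc 0 T).indicator f) p volume :=
  (memLp_indicator_iff_restrict measurableSet_Icc).2 h

lemma lpEnergy_eq {u : ℝ → H L₁ L₂} {w : ℝ → V L₁ L₂}
    (h : ∀ᵐ s ∂(volume.restrict (Icc 0 T)), toH (w s) = u s) :
    lpEnergy 𝔭.σ T u = ∫⁻ s in Icc 0 T, ‖embed 𝔭 (w s)‖ₑ ^ 𝔭.p := by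
  refine lintegral_congr_ae ?_
  filter_upwards [h] with s hs
  have e : ‖embed 𝔭 (w s)‖ₑ = eLpNorm (toH (w s)) 𝔭.pE (rectMeasure L₁ L₂) :=
    Lp.enorm_toLp (hf := memLp_toH 𝔭 (w s))
  rw [e, hs]
  rfl

lemma memLp_embed_iff {w : ℝ → V L₁ L₂}
    (hw : AEStronglyMeasurable w (volume.restrict (Icc 0 T))) :
    MemLp (fun s => embed 𝔭 (w s)) 𝔭.pE (volume.restrict (Icc 0 T)) ↔
      ∫⁻ s in Icc 0 T, ‖embed 𝔭 (w s)‖ₑ ^ 𝔭.p < ∞ := by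
  have hm := (embed 𝔭).continuous.comp_aestronglyMeasurable hw
  rw [← 𝔭.pE_toReal, ← eLpNorm_lt_top_iff_lintegral_rpow_enorm_lt_top 𝔭.pE_ne_zero 𝔭.pE_ne_top]
  exact ⟨fun h => h.2, fun h => ⟨hm, h⟩⟩

section

variable {Z : Type*} [MeasurableSpace Z] {ν : Measure Z} {g : Z → ℂ}
  {φ : ℝ → Z → ℝ≥0}

lemma integral_jump_eq {u : ℝ → H L₁ L₂} (ψ : V L₁ L₂) {t : ℝ} (ht : t ∈ Icc 0 T) :
    ∫ s in (0 : ℝ)..t, ∫ z, (∫ x in rect L₁ L₂, u s x * conj (toH ψ x)) *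
      (g z * (((φ s z : ℝ) - 1 : ℝ) : ℂ)) ∂ν =
    ∫ s in (0 : ℝ)..t, jumpRate ν g T φ s * ⟪toH ψ, u s⟫_ℂ := by
  refine intervalIntegral.integral_congr fun s hs => ?_
  rw [uIcc_of_le ht.1] at hs
  have hs' : s ∈ Icc 0 T := ⟨hs.1, hs.2.trans ht.2⟩
  rw [integral_const_mul, ← inner_H, mul_comm, jumpRate, indicator_of_mem hs']
  rfl

variable [SigmaFinite ν]

lemma continuousOn_inner_toH {u : ℝ → H L₁ L₂} (hu : ContinuousOn u (Icc 0 T)) (ψ : V L₁ L₂) :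
    ContinuousOn (fun s => ⟪toH ψ, u s⟫_ℂ) (Icc 0 T) :=
  continuousOn_const.inner hu

lemma intervalIntegrable_jumpRate_mul
    (hi : Integrable (jumpKernel g φ) ((volume.restrict (Icc 0 T)).prod ν))
    {u : ℝ → H L₁ L₂} (hu : ContinuousOn u (Icc 0 T)) (ψ : V L₁ L₂) {t : ℝ} (ht : t ∈ Icc 0 T) :
    IntervalIntegrable (fun s => jumpRate ν g T φ s * ⟪toH ψ, u s⟫_ℂ) volume 0 t := by
  refine (integrable_jumpRate hi).intervalIntegrable.mul_continuousOn ?_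
  rw [uIcc_of_le ht.1]
  exact (continuousOn_inner_toH hu ψ).mono (Icc_subset_Icc_right ht.2)

/-- The coefficients of the transformed equation. -/
def coeffOne (ν : Measure Z) (g : Z → ℂ) (T : ℝ) (φ : ℝ → Z → ℝ≥0) (t : ℝ) : ℝ :=
  Real.exp (2 * 𝔭.σ * (jumpPhase ν g T φ t).re)

/-- The coefficients of the transformed equation. -/
def coeffTwo (ν : Measure Z) (g : Z → ℂ) (T : ℝ) (φ : ℝ → Z → ℝ≥0) (t : ℝ) : ℝ :=
  Real.exp (2 * (jumpPhase ν g T φ t).re)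

variable {u₀ : V L₁ L₂} {u : ℝ → H L₁ L₂} {w : ℝ → V L₁ L₂}

lemma norm_exp_le {z : ℂ} {M : ℝ} (h : ‖z‖ ≤ M) : ‖Complex.exp z‖ ≤ Real.exp M := by
  rw [Complex.norm_exp]
  exact Real.exp_le_exp.2 ((Complex.re_le_norm z).trans h)

variable {𝔭}

/-- Against a fixed test function the jump term is a scalar rate times the pairing itself, so
variation of constants with the negative rate removes it exactly. The rate is merely integrable in
time. -/
lemma inner_eq_of_isSolution (hT : 0 ≤ T)
    (hi : Integrable (jumpKernel g φ) ((volume.restrict (Icc 0 T)).prod ν))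
    (h : IsSolution ν g T 𝔭.σ 𝔭.α 𝔭.β 𝔭.γ 𝔭.l₁ 𝔭.l₂ u₀ φ u w) (ψ : V L₁ L₂) {t : ℝ}
    (ht : t ∈ Icc 0 T) : Complex.exp (-jumpPhase ν g T φ t) * ⟪toH ψ, u t⟫_ℂ =
      ⟪toH ψ, toH u₀⟫_ℂ +
        ∫ s in (0 : ℝ)..t, Complex.exp (-jumpPhase ν g T φ s) * drift 𝔭 (w s) ψ := by
  have hT' : T ∈ Icc 0 T := ⟨hT, le_rfl⟩
  have hr := fun {t} (ht : t ∈ Icc 0 T) =>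
    intervalIntegrable_jumpRate_mul hi h.continuousOn ψ ht
  have hd : ∀ {t}, t ∈ Icc 0 T → IntervalIntegrable (fun s => drift 𝔭 (w s) ψ) volume 0 t :=
    fun {t} ht => (h.integrable_drift ψ).mono_set (by
      rw [uIcc_of_le ht.1, uIcc_of_le hT]; exact Icc_subset_Icc_right ht.2)
  have hY : ∀ t ∈ Icc 0 T, ⟪toH ψ, u t⟫_ℂ = ⟪toH ψ, toH u₀⟫_ℂ +
      ∫ s in (0 : ℝ)..t, (drift 𝔭 (w s) ψ + jumpRate ν g T φ s * ⟪toH ψ, u s⟫_ℂ) := by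
    intro t ht
    have := h.equation t ht ψ
    rw [← inner_H, ← inner_H, integral_jump_eq ψ ht] at this
    rw [this, intervalIntegral.integral_add (hd ht) (hr ht), add_assoc]
    rfl
  have hn : IntervalIntegrable (fun s => -jumpRate ν g T φ s) volume 0 T :=
    (integrable_jumpRate hi).neg.intervalIntegrable
  have := exp_integral_mul_eq hT hn ((hd hT').add (hr hT')) hY ht
  simp only [intervalIntegral.integral_neg] at this
  refine this.trans ?_
  congr 1
  refine intervalIntegral.integral_congr fun s _ => ?_
  simp only [jumpPhase]
  ring

/-- A solution of the skeleton equation gives a solution of the transformed equation. -/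
theorem exists_isEnergySolution (hT : 0 ≤ T)
    (hi : Integrable (jumpKernel g φ) ((volume.restrict (Icc 0 T)).prod ν))
    (h : IsSolution ν g T 𝔭.σ 𝔭.α 𝔭.β 𝔭.γ 𝔭.l₁ 𝔭.l₂ u₀ φ u w) :
    ∃ w' : ℝ → V L₁ L₂, (∀ᵐ s ∂(volume.restrict (Icc 0 T)),
        w' s = Complex.exp (-jumpPhase ν g T φ s) • w s) ∧
      IsEnergySolution 𝔭 T (coeffOne 𝔭 ν g T φ) (coeffTwo ν g T φ) u₀
        (fun s => Complex.exp (-jumpPhase ν g T φ s) • u s) w' := by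
  set Θ := jumpPhase ν g T φ with hΘd
  have hΘ : Continuous Θ := continuous_jumpPhase hi
  have hE : Continuous fun s => Complex.exp (-Θ s) := by fun_prop
  set M := ∫ p, ‖jumpKernel g φ p‖ ∂((volume.restrict (Icc 0 T)).prod ν)
  have hM : ∀ s, ‖Complex.exp (-Θ s)‖ ≤ Real.exp M := fun s =>
    norm_exp_le (by rw [norm_neg]; exact norm_jumpPhase_le hi s)
  -- A strongly measurable representative, afterwards extended by zero outside `[0,T]`, so that
  -- translations in time on the whole line make sense in the energy identity.
  set w₁ : ℝ → V L₁ L₂ := h.memLp_V.1.mk w with hw₁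
  have hw₁m : StronglyMeasurable w₁ := h.memLp_V.1.stronglyMeasurable_mk
  have hw₁e : ∀ᵐ s ∂(volume.restrict (Icc 0 T)), w s = w₁ s := h.memLp_V.1.ae_eq_mk
  have hEw : StronglyMeasurable fun s => Complex.exp (-Θ s) • w₁ s :=
    hE.stronglyMeasurable.smul hw₁m
  have hw' : ∀ᵐ s ∂(volume.restrict (Icc 0 T)),
      (Icc 0 T).indicator (fun s => Complex.exp (-Θ s) • w₁ s) s = Complex.exp (-Θ s) • w s := by
    filter_upwards [hw₁e, ae_restrict_mem measurableSet_Icc] with s h1 h2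
    rw [indicator_of_mem h2, h1]
  refine ⟨(Icc 0 T).indicator fun s => Complex.exp (-Θ s) • w₁ s, hw', ?_, ?_, ?_, ?_, ?_, ?_⟩
  · exact hE.continuousOn.smul h.continuousOn
  · exact hEw.indicator measurableSet_Icc
  · refine memLp_indicator_Icc ?_
    refine MemLp.of_le_mul (c := Real.exp M) (h.memLp_V.ae_eq hw₁e) hEw.aestronglyMeasurable
      (Eventually.of_forall fun s => ?_)
    rw [norm_smul]
    gcongr
    exact hM s
  · have e : (fun s => embed 𝔭 ((Icc 0 T).indicator (fun s => Complex.exp (-Θ s) • w₁ s) s)) =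
        (Icc 0 T).indicator fun s => Complex.exp (-Θ s) • embed 𝔭 (w₁ s) := by
      ext1 s
      by_cases hs : s ∈ Icc 0 T
      · rw [indicator_of_mem hs, indicator_of_mem hs, map_smul]
      · rw [indicator_of_notMem hs, indicator_of_notMem hs, map_zero]
    rw [e]
    refine memLp_indicator_Icc ?_
    have h1 : MemLp (fun s => embed 𝔭 (w₁ s)) 𝔭.pE (volume.restrict (Icc 0 T)) := by
      rw [memLp_embed_iff 𝔭 hw₁m.aestronglyMeasurable, ← lpEnergy_eq 𝔭 (u := u)]
      · exact h.lpEnergy_lt_top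
      · filter_upwards [hw₁e, h.version] with s h1 h2
        rw [← h1, h2]
    have hm : StronglyMeasurable fun s => Complex.exp (-Θ s) • embed 𝔭 (w₁ s) :=
      hE.stronglyMeasurable.smul ((embed 𝔭).continuous.comp_stronglyMeasurable hw₁m)
    refine MemLp.of_le_mul (c := Real.exp M) h1 hm.aestronglyMeasurable
      (Eventually.of_forall fun s => ?_)
    rw [norm_smul]
    gcongr
    exact hM s
  · refine (ae_restrict_iff' measurableSet_Icc).1 ?_
    filter_upwards [hw', h.version] with s h1 h2
    rw [h1, toH_smul, h2]
  · intro t ht ψ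
    rw [inner_smul_right, inner_eq_of_isSolution hT hi h ψ ht]
    congr 1
    refine intervalIntegral.integral_congr_ae ?_
    filter_upwards [(ae_restrict_iff' measurableSet_Icc).1 hw'] with s h1 hs
    rw [uIoc_of_le ht.1] at hs
    rw [h1 ⟨hs.1.le, hs.2.trans ht.2⟩]
    exact (G_exp_smul 𝔭 (Θ s) (w s) ψ).symm

/-- A solution of the transformed equation gives a solution of the skeleton equation. -/
theorem isSolution_of_isEnergySolution (hT : 0 ≤ T)
    (hi : Integrable (jumpKernel g φ) ((volume.restrict (Icc 0 T)).prod ν))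
    {m M : ℝ} (hA : Coeffs m M (coeffOne 𝔭 ν g T φ) (coeffTwo ν g T φ))
    (h : IsEnergySolution 𝔭 T (coeffOne 𝔭 ν g T φ) (coeffTwo ν g T φ) u₀ u w) :
    IsSolution ν g T 𝔭.σ 𝔭.α 𝔭.β 𝔭.γ 𝔭.l₁ 𝔭.l₂ u₀ φ
      (fun s => Complex.exp (jumpPhase ν g T φ s) • u s)
      (fun s => Complex.exp (jumpPhase ν g T φ s) • w s) := by
  set Θ := jumpPhase ν g T φ with hΘd
  have hΘ : Continuous Θ := continuous_jumpPhase hi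
  have hE : Continuous fun s => Complex.exp (Θ s) := by fun_prop
  set M := ∫ p, ‖jumpKernel g φ p‖ ∂((volume.restrict (Icc 0 T)).prod ν)
  have hM : ∀ s, ‖Complex.exp (Θ s)‖ ≤ Real.exp M := fun s =>
    norm_exp_le (norm_jumpPhase_le hi s)
  have hcu : ContinuousOn (fun s => Complex.exp (Θ s) • u s) (Icc 0 T) :=
    hE.continuousOn.smul h.continuousOn
  have hwm : StronglyMeasurable fun s => Complex.exp (Θ s) • w s :=
    hE.stronglyMeasurable.smul h.stronglyMeasurable
  have hver : ∀ᵐ s ∂(volume.restrict (Icc 0 T)),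
      toH (Complex.exp (Θ s) • w s) = Complex.exp (Θ s) • u s := by
    refine (ae_restrict_iff' measurableSet_Icc).2 ?_
    filter_upwards [h.version] with s h1 hs
    rw [toH_smul, h1 hs]
  have hGi : ∀ (ψ : V L₁ L₂) (t : ℝ), IntervalIntegrable
      (fun s => G 𝔭 (coeffOne 𝔭 ν g T φ s) (coeffTwo ν g T φ s) (w s) ψ) volume 0 t :=
    fun ψ t => (h.dominated hA).intervalIntegrable_test ψ 0 t
  have hdi : ∀ (ψ : V L₁ L₂) (t : ℝ), IntervalIntegrable
      (fun s => drift 𝔭 (Complex.exp (Θ s) • w s) ψ) volume 0 t := fun ψ t => by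
    simp only [drift_exp_smul]
    exact (hGi ψ t).continuousOn_mul hE.continuousOn
  refine ⟨hcu, ?_, hver, ?_, fun ψ => hdi ψ T, fun ψ => ?_, fun t ht ψ => ?_⟩
  · refine MemLp.of_le_mul (c := Real.exp M) (h.memLp_two.restrict _) hwm.aestronglyMeasurable
      (Eventually.of_forall fun s => ?_)
    rw [norm_smul]
    gcongr
    exact hM s
  · rw [lpEnergy_eq 𝔭 hver, ← memLp_embed_iff 𝔭 hwm.aestronglyMeasurable]
    refine MemLp.of_le_mul (c := Real.exp M) (h.memLp_p.restrict _)
      ((embed 𝔭).continuous.comp_stronglyMeasurable hwm).aestronglyMeasurable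
      (Eventually.of_forall fun s => ?_)
    rw [map_smul, norm_smul]
    gcongr
    exact hM s
  · obtain ⟨C, hC⟩ := isCompact_Icc.exists_bound_of_continuousOn (continuousOn_inner_toH hcu ψ)
    have hm := ((continuousOn_inner_toH hcu ψ).aestronglyMeasurable
      (μ := volume) measurableSet_Icc).comp_fst (ν := ν)
    have hb : ∀ᵐ p ∂((volume.restrict (Icc 0 T)).prod ν),
        ‖⟪toH ψ, Complex.exp (Θ p.1) • u p.1⟫_ℂ‖ ≤ C :=
      Measure.quasiMeasurePreserving_fst.ae
        ((ae_restrict_iff' measurableSet_Icc).2 (Eventually.of_forall hC))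
    simp only [← inner_H]
    exact hi.bdd_mul hm hb
  · have hY := exp_integral_mul_eq hT (integrable_jumpRate hi).intervalIntegrable (hGi ψ T)
      (fun t ht => h.equation t ht ψ) ht
    have hr := intervalIntegrable_jumpRate_mul hi hcu ψ ht
    rw [← inner_H, ← inner_H, integral_jump_eq ψ ht, add_assoc]
    refine Eq.trans (inner_smul_right _ _ _) (hY.trans ?_)
    congr 1
    refine Eq.trans ?_ (intervalIntegral.integral_add (hdi ψ t) hr)
    refine intervalIntegral.integral_congr fun s _ => ?_
    have e1 : pairA 𝔭.α (Complex.exp (Θ s) • w s) ψ +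
        pairB 𝔭.σ 𝔭.β 𝔭.γ 𝔭.l₁ 𝔭.l₂ (Complex.exp (Θ s) • w s) ψ = Complex.exp (Θ s) *
        G 𝔭 (coeffOne 𝔭 ν g T φ s) (coeffTwo ν g T φ s) (w s) ψ :=
      drift_exp_smul 𝔭 (Θ s) (w s) ψ
    rw [e1, inner_smul_right]
    simp only [hΘd, jumpPhase]
    ring

end

end SGGLE

/-! ### Transport of the energy bound back to the skeleton equation. -/

namespace SGGLE

open Filter Topology
open scoped InnerProductSpace

variable {L₁ L₂ : ℝ} {𝔭 : Params} {T M : ℝ} {Θ : ℝ → ℂ} {u : ℝ → H L₁ L₂} {w w' : ℝ → V L₁ L₂}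

lemma lintegral_Icc_ofReal (hT : 0 ≤ T) {f : ℝ → ℝ} (hf : Integrable f volume)
    (h0 : ∀ t, 0 ≤ f t) :
    ∫⁻ s in Icc 0 T, ENNReal.ofReal (f s) = ENNReal.ofReal (∫ s in (0 : ℝ)..T, f s) := by
  rw [← ofReal_integral_eq_lintegral_ofReal hf.restrict (Eventually.of_forall h0),
    integral_Icc_eq_integral_Ioc, ← intervalIntegral.integral_of_le hT]

lemma gradSq_smul (c : ℂ) (z : V L₁ L₂) : gradSq (c • z) = ‖c‖ ^ 2 * gradSq z := by
  simp only [gradSq, d₁_smul, d₂_smul, norm_smul]; ring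

/-- The energy is controlled by that of the transformed function. -/
lemma energy_le (hT : 0 ≤ T) (hM : ∀ t, ‖Θ t‖ ≤ M) {C : ℝ} (hC : 0 ≤ C)
    (hver : ∀ᵐ s ∂(volume.restrict (Icc 0 T)), toH (w s) = u s)
    (hw : ∀ᵐ s ∂(volume.restrict (Icc 0 T)), w s = Complex.exp (Θ s) • w' s)
    (hg : Integrable (fun t => gradSq (w' t)) volume)
    (hp : Integrable (fun t => ∫ x in rect L₁ L₂, ‖toH (w' t) x‖ ^ 𝔭.p) volume)
    (h₁ : ∀ t ∈ Icc 0 T, ‖Complex.exp (-Θ t) • u t‖ ^ 2 ≤ C)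
    (h₂ : ∫ t in (0 : ℝ)..T, gradSq (w' t) ≤ C)
    (h₃ : ∫ t in (0 : ℝ)..T, ∫ x in rect L₁ L₂, ‖toH (w' t) x‖ ^ 𝔭.p ≤ C) :
    energy 𝔭.σ T u w ≤ ENNReal.ofReal
      (Real.exp M ^ 2 * C + Real.exp M ^ 2 * C + Real.exp M ^ 𝔭.p * C) := by
  have hp6 := 𝔭.six_lt_p
  have hE : ∀ t, ‖Complex.exp (Θ t)‖ ≤ Real.exp M := fun t => norm_exp_le (hM t)
  have e1 : (⨆ s ∈ Icc 0 T, ‖u s‖ₑ ^ 2) ≤ ENNReal.ofReal (Real.exp M ^ 2 * C) := by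
    refine iSup₂_le fun s hs => ?_
    rw [← ofReal_norm, ← ENNReal.ofReal_pow (norm_nonneg _)]
    refine ENNReal.ofReal_le_ofReal ?_
    have : u s = Complex.exp (Θ s) • (Complex.exp (-Θ s) • u s) := by
      rw [smul_smul, ← Complex.exp_add, add_neg_cancel, Complex.exp_zero, one_smul]
    rw [this, norm_smul, mul_pow]
    gcongr
    · exact hE s
    · exact h₁ s hs
  have e2 : ∫⁻ s in Icc 0 T, (‖d₁ (w s)‖ₑ ^ 2 + ‖d₂ (w s)‖ₑ ^ 2) ≤
      ENNReal.ofReal (Real.exp M ^ 2 * C) := by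
    calc _ ≤ ∫⁻ s in Icc 0 T, ENNReal.ofReal (Real.exp M ^ 2 * gradSq (w' s)) := by
          refine lintegral_mono_ae ?_
          filter_upwards [hw] with s hs
          rw [← ofReal_norm, ← ofReal_norm, ← ENNReal.ofReal_pow (norm_nonneg _),
            ← ENNReal.ofReal_pow (norm_nonneg _),
            ← ENNReal.ofReal_add (sq_nonneg _) (sq_nonneg _)]
          refine ENNReal.ofReal_le_ofReal ?_
          change gradSq (w s) ≤ _
          rw [hs, gradSq_smul]
          have := gradSq_nonneg (w' s)
          gcongr
          exact hE s
      _ ≤ _ := by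
          rw [lintegral_Icc_ofReal hT (hg.const_mul _) fun t =>
            mul_nonneg (sq_nonneg _) (gradSq_nonneg _), intervalIntegral.integral_const_mul]
          gcongr
  have e3 : lpEnergy 𝔭.σ T u ≤ ENNReal.ofReal (Real.exp M ^ 𝔭.p * C) := by
    rw [lpEnergy_eq 𝔭 hver]
    calc _ ≤ ∫⁻ s in Icc 0 T, ENNReal.ofReal (Real.exp M ^ 𝔭.p *
            ∫ x in rect L₁ L₂, ‖toH (w' s) x‖ ^ 𝔭.p) := by
          refine lintegral_mono_ae ?_
          filter_upwards [hw] with s hs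
          rw [← ofReal_norm, ENNReal.ofReal_rpow_of_nonneg (norm_nonneg _) (by linarith)]
          refine ENNReal.ofReal_le_ofReal ?_
          rw [hs, map_smul, norm_smul, Real.mul_rpow (norm_nonneg _) (norm_nonneg _),
            norm_embed_rpow]
          refine mul_le_mul_of_nonneg_right ?_ (integral_nonneg fun _ => by positivity)
          exact Real.rpow_le_rpow (norm_nonneg _) (hE s) (by linarith)
      _ ≤ _ := by
          rw [lintegral_Icc_ofReal hT (hp.const_mul _) fun t =>
            mul_nonneg (by positivity) (integral_nonneg fun _ => by positivity),
            intervalIntegral.integral_const_mul]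
          gcongr
  rw [ENNReal.ofReal_add (by positivity) (by positivity),
    ENNReal.ofReal_add (by positivity) (by positivity)]
  exact add_le_add (add_le_add e1 e2) e3

end SGGLE

end

/-! ### Proof of the proposition. -/

theorem proposition3p1
    {Z : Type*} [TopologicalSpace Z] [PolishSpace Z] [LocallyCompactSpace Z]
    [MeasurableSpace Z] [BorelSpace Z]
    (ν : Measure Z) [SigmaFinite ν] [IsFiniteMeasureOnCompacts ν]
    (g : Z → ℂ) (hg : Measurable g) (hg2 : MemLp g 2 ν) (hexp : SGGLE.ExpIntegrable ν g)
    (L₁ L₂ T σ α β γ : ℝ) (lam₁ lam₂ : ℂ × ℂ)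
    (hL₁ : 0 < L₁) (hL₂ : 0 < L₂) (hT : 0 < T) (hγ : 0 < γ) (hσ : 2 < σ)
    (hβ0 : 0 < |β|) (hβ : |β| < Real.sqrt (2 * σ + 1) / σ)
    (u₀ : SGGLE.V L₁ L₂) :
    (∀ φ ∈ SGGLE.Controls ν T,
      (∃ u w, SGGLE.IsSolution ν g T σ α β γ lam₁ lam₂ u₀ φ u w) ∧
      (∀ u w u' w', SGGLE.IsSolution ν g T σ α β γ lam₁ lam₂ u₀ φ u w →
        SGGLE.IsSolution ν g T σ α β γ lam₁ lam₂ u₀ φ u' w' → EqOn u u' (Icc 0 T))) ∧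
    (∀ N : ℕ, ∃ C : ℝ, 0 < C ∧ ∀ φ ∈ SGGLE.S ν T N, ∀ u w,
      SGGLE.IsSolution ν g T σ α β γ lam₁ lam₂ u₀ φ u w →
        SGGLE.energy σ T u w ≤ ENNReal.ofReal C) := by
  set 𝔭 : SGGLE.Params := ⟨σ, α, β, γ, lam₁, lam₂, hσ, SGGLE.ellip_pos (by linarith) hβ⟩ with h𝔭
  refine ⟨fun φ hφ => ?_, fun N => ?_⟩
  · simp only [SGGLE.Controls, mem_iUnion] at hφ
    obtain ⟨N, -, hφ⟩ := hφ
    obtain ⟨M, -, hM⟩ := SGGLE.exists_jumpKernel_bound hg hg2 hexp T N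
    obtain ⟨hi, hiM⟩ := hM φ hφ
    have hA := SGGLE.coeffs_exp 𝔭 (SGGLE.continuous_jumpPhase hi)
      fun t => (SGGLE.norm_jumpPhase_le hi t).trans hiM
    -- The strong solution serves twice: transformed back it gives existence, and every transformed
    -- solution is compared with it for uniqueness.
    obtain ⟨R, v, w, hs⟩ := SGGLE.exists_strongSolution 𝔭 hL₁ hL₂ hT.le hA u₀
    refine ⟨⟨_, _, SGGLE.isSolution_of_isEnergySolution hT.le hi hA hs.isEnergySolution⟩,
      fun u w u' w' h h' => ?_⟩
    obtain ⟨z, -, hz⟩ := SGGLE.exists_isEnergySolution (𝔭 := 𝔭) hT.le hi h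
    obtain ⟨z', -, hz'⟩ := SGGLE.exists_isEnergySolution (𝔭 := 𝔭) hT.le hi h'
    intro t ht
    have e := (hz.eq_strong hL₁ hL₂ hT.le hA hs ht).trans
      (hz'.eq_strong hL₁ hL₂ hT.le hA hs ht).symm
    exact smul_right_injective _ (Complex.exp_ne_zero _) e
  · obtain ⟨M, -, hM⟩ := SGGLE.exists_jumpKernel_bound hg hg2 hexp T N
    obtain ⟨C, hC, hb⟩ := SGGLE.exists_energy_bound 𝔭 hL₁ hL₂ hT.le
      (Real.exp_pos (-(2 * σ * M))) (Real.exp (2 * σ * M)) u₀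
    -- Undoing the integrating factor costs at most `exp M` in modulus, raised to the homogeneity of
    -- each part of the energy. The summand `1` makes the constant positive even if `C = 0`.
    refine ⟨Real.exp M ^ 2 * C + Real.exp M ^ 2 * C + Real.exp M ^ 𝔭.p * C + 1, by positivity,
      fun φ hφ u w h => ?_⟩
    obtain ⟨hi, hiM⟩ := hM φ hφ
    have hΘ : ∀ t, ‖SGGLE.jumpPhase ν g T φ t‖ ≤ M :=
      fun t => (SGGLE.norm_jumpPhase_le hi t).trans hiM
    have hA := SGGLE.coeffs_exp 𝔭 (SGGLE.continuous_jumpPhase hi) hΘ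
    obtain ⟨z, hzw, hz⟩ := SGGLE.exists_isEnergySolution (𝔭 := 𝔭) hT.le hi h
    obtain ⟨h₁, h₂, h₃⟩ := hb _ _ hA _ _ hz
    refine (SGGLE.energy_le (𝔭 := 𝔭) hT.le hΘ hC h.version ?_ hz.integrable_gradSq
      hz.integrable_integral_rpow h₁ h₂ h₃).trans (ENNReal.ofReal_le_ofReal (by linarith))
    filter_upwards [hzw] with s hs
    rw [hs, smul_smul, ← Complex.exp_add, add_neg_cancel, Complex.exp_zero, one_smul]
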